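/- **Setting.** A *graded category* is a category $\mathcal A$ with functors $\dim:\mathcal A\to\mathbb Z$ and $\emptyset:\mathbb Z\to\mathcal A$ ($\mathbb Z$ a poset) with $\dim\emptyset_n=n$ and an involution $i$ preserving $\dim$ and $\emptyset$. It is *balanced* if for $\dim X<\dim Y$ there are natural, involutive, $i$-compatible bijections $\mathcal A(X,Y)\cong\mathcal A(X,iY)$. A *$k$-morphism* is a functor lowering dimensions by $k$ and strictly commuting with $i$, $\emptyset$ and the balancing. Throughout, each $\emptyset_n$ has at most one morphism to each object of $\mathcal A$. Further $\mathcal A$ is symmetric monoidal in the graded sense: $\otimes$ adds dimensions, is strictly compatible in each variable with $i$, with $\emptyset$ ($X\otimes\emptyset_n=\emptyset_{\dim X+n}$) and with the balancing, and the symmetry is a coherent isomorphism $\gamma:X\otimes Y\cong i^{\dim X\dim Y}(Y\otimes X)$, natural up to the balancing and compatible with $i$. For a ball complex $K$ (a finite collection of PL balls with disjoint interiors, such that the boundary of each ball is a union of balls of the collection) let $\mathrm{Cell}(K)$ be the graded category of oriented cells of $K$ and empty cells $\emptyset_n$; within one dimension there are only identities, besides these the morphisms are the inclusions, irrespective of orientations.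 A *$K$-pread of degree $k$* is a $k$-morphism $\mathrm{Cell}(K)\to\mathcal A$. Fix a *multiplicative ad theory*: $i$-invariant sets $\mathrm{ad}^k(K)$ of $K$-preads of degree $k$, closed under restriction along morphisms of ball complexes (isomorphisms onto subcomplexes), such that: (pointed) the pread with all values $\emptyset$ is an ad; (full) preads isomorphic to ads are ads; (local) a pread whose restriction to each closed cell is an ad is an ad; (gluing) for a subdivision $K'$ of $K$ and a $K'$-ad $M$ there is a $K$-ad which agrees with $M$ on each common subcomplex; (cylinder) there is a natural map $J:\mathrm{ad}^k(K)\to\mathrm{ad}^k(K\times I)$ such that $J(M)$ restricts to $M$ on both ends and $J$ takes trivial ads to trivial ads; (stable) if $\theta:\mathrm{Cell}(K_0,L_0)\to\mathrm{Cell}(K_1,L_1)$ is a $k$-isomorphism preserving all incidence numbers, then $\theta^*$ takes $(K_1,L_1)$-ads of degree $l$ to $(K_0,L_0)$-ads of degree $k+l$ (here cells of $L$ are identified with empty cells in $\mathrm{Cell}(K,L)$, and a $(K,L)$-pread is an ad if it is one as a $K$-pread). Moreover for $F\in\mathrm{ad}^k(K)$, $G\in\mathrm{ad}^l(L)$ the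 pread $(\sigma\times\tau)\mapsto i^{k\dim\tau}\bigl(F(\sigma)\otimes G(\tau)\bigr)$ lies in $\mathrm{ad}^{k+l}(K\times L)$, and the unit object gives an element of $\mathrm{ad}^0(*)$. Let $P=(P_1,\dots,P_n)$ be a finite sequence of $*$-ads $P_j$, of dimension $p_j$. The category $\mathcal A(P)$ has as objects the following data: for each face $\sigma\subset\{0,\dots,n\}$ of $\Delta^n$ a $\sigma$-pread $M_\sigma$ which is $\emptyset$ on all cells not containing the vertex $0$ (so $M_\sigma=\emptyset$ if $0\notin\sigma$, and $\partial_0M_\sigma=\emptyset$), and for $j\notin\sigma$ an isomorphism of preads $f_{\sigma,j}:\partial_jM_{\sigma\cup j}\cong M_\sigma\otimes P_j$ (here $P_j$ carries the orientation $i^{p_j\sum p_h}$, the sum over all $h>j$ with $h\notin\sigma$), such that for distinct $j,h\notin\sigma$ the two isomorphisms from $\partial_h\partial_jM_{\sigma\cup\{j,h\}}$ to $M_\sigma\otimes P_j\otimes P_h$ and to $M_\sigma\otimes P_h\otimes P_j$ correspond under $1\otimes\gamma$. Morphisms are morphisms of preads commuting with the $f_{\sigma,j}$. $\mathcal A(P)$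 is a balanced graded category, the dimension of an object being the dimension (that is, minus the degree) of $M_{\Delta^n}$. An element of $\mathrm{ad}^k/P(K)$ is a $k$-morphism $M:\mathrm{Cell}(K)\to\mathcal A(P)$ such that for each face $\sigma$ of $\Delta^n$ its adjoint $\kappa\times\tau\mapsto M(\kappa)_\sigma(\tau)$ is a $(K\times\sigma)$-ad. **Proposition.** For all finite sequences $P=(P_1,\dots,P_n)$, $Q=(Q_1,\dots,Q_m)$ of $*$-ads, all ball complexes $K,L$ and all degrees $k,l$ there is an external product $$\times:\ \mathrm{ad}^k/P(K)\times\mathrm{ad}^l/Q(L)\longrightarrow\mathrm{ad}^{k+l}/(P,Q)(K\times L),\qquad (P,Q)=(P_1,\dots,P_n,Q_1,\dots,Q_m),$$ with the following properties. 1. (Formula) For $\rho\subset\{0,\dots,n+m\}$ put $\rho_0=\rho\cap\{0,\dots,n\}$ and $\rho_1=((\rho\cap\{n+1,\dots,n+m\})-n)\cup(\rho\cap\{0\})$. Then $(M\times N)_\rho=M_{\rho_0}\times N_{\rho_1}$. Explicitly, for oriented cells $\kappa$ of $K$ and $\lambda$ of $L$ and an oriented face $\tau$ of $\rho$ with $0\in\tau$,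 $$(M\times N)(\kappa\times\lambda)_\rho(\tau)=i^{s}\bigl(M(\kappa)_{\rho_0}(\tau_0)\otimes N(\lambda)_{\rho_1}(\tau_1)\bigr),$$ $$s=(k+p)(\dim\lambda+\dim\tau_1)+\dim\lambda\,\dim\tau_0+l\,p,\qquad p=\sum_{1\le j\le n,\ j\notin\rho_0}\dim P_j,$$ where the orientation of $\tau$ corresponds to that of $\tau_0\times\tau_1$; the same formula holds for the maps induced by inclusions of cells. The values on the $\tau$ with $0\notin\tau$ are empty. The isomorphisms $f_{\rho,j}$ of $M\times N$ are induced by those of $M$ for $j\le n$ (after interchanging $P_j$ and $N$ by $\gamma$) and by those of $N$ for $j>n$. 2. (Naturality) $f^*M\times g^*N=(f\times g)^*(M\times N)$ for all morphisms $f:K\to K'$, $g:L\to L'$ of ball complexes (isomorphisms onto subcomplexes), $M\in\mathrm{ad}^k/P(K')$ and $N\in\mathrm{ad}^l/Q(L')$. 3. (Associativity) For every further finite sequence $R$ of $*$-ads, every ball complex $J$ and $O\in\mathrm{ad}^j/R(J)$, under the identifications $((P,Q),R)=(P,(Q,R))$ and $(K\times L)\times J=K\times(L\times J)$, the associativity isomorphisms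 of $\otimes$ induce an isomorphism $(M\times N)\times O\cong M\times(N\times O)$ of preads in $\mathcal A(P,Q,R)$, natural in the cells of $K\times L\times J$, compatible with $i$ and with all $f_{\rho,j}$. (It is an equality if $\otimes$ is strictly associative.) -/

import Mathlib

open CategoryTheory MonoidalCategory

universe v u v' u' v'' u''

set_option linter.unusedSectionVars false

noncomputable section

namespace QuinnAd

/- ### Polyhedra -/

section Polyhedra

variable {E F G : Type} [AddCommGroup E] [Module ℝ E] [AddCommGroup F] [Module ℝ F]
  [AddCommGroup G] [Module ℝ G]

/-- A convex polytope: the convex hull of a finite set. -/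
def IsPolytope (Q : Set E) : Prop := ∃ V : Set E, V.Finite ∧ Q = convexHull ℝ V

/-- A compact polyhedron: a finite union of convex polytopes. -/
def IsPolyhedron (X : Set E) : Prop :=
  ∃ C : Set (Set E), C.Finite ∧ (∀ Q ∈ C, IsPolytope Q) ∧ X = ⋃₀ C

/-- The relative interior of a convex set: the points of `Q` such that every segment of `Q`
with this end point can be prolonged inside `Q`. -/
def relInterior (Q : Set E) : Set E :=
  {x | x ∈ Q ∧ ∀ y ∈ Q, ∃ t : ℝ, 1 < t ∧ AffineMap.lineMap y x t ∈ Q}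

/-- `f` restricts to a piecewise linear embedding of the compact polyhedron `X`: it is injective
on `X` and its graph over `X` is a compact polyhedron. -/
structure IsPLEmbedding (f : E → F) (X : Set E) : Prop where
  injOn : Set.InjOn f X
  graph : IsPolyhedron {p : E × F | p.1 ∈ X ∧ p.2 = f p.1}

/-- `X` is a PL ball of dimension `n` with boundary `B`: it is PL homeomorphic to an
`n`-dimensional convex polytope, in such a way that `B` corresponds to the relative boundary. -/
def IsPLBall (n : ℕ) (X B : Set E) : Prop :=
  ∃ (F : Type) (_ : AddCommGroup F) (_ : Module ℝ F) (Q : Set F) (h : F → E),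
    IsPolytope Q ∧ Q.Nonempty ∧ Module.finrank ℝ (vectorSpan ℝ Q) = n ∧
      IsPLEmbedding h Q ∧ h '' Q = X ∧ h '' (Q \ relInterior Q) = B

lemma IsPolytope.image {Q : Set E} (hQ : IsPolytope Q) (f : E →ᵃ[ℝ] F) : IsPolytope (f '' Q) := by
  obtain ⟨V, hV, rfl⟩ := hQ
  exact ⟨f '' V, hV.image _, f.image_convexHull V⟩

lemma IsPolytope.prod {Q : Set E} {R : Set F} (hQ : IsPolytope Q) (hR : IsPolytope R) :
    IsPolytope (Q ×ˢ R) := by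
  obtain ⟨V, hV, rfl⟩ := hQ
  obtain ⟨W, hW, rfl⟩ := hR
  exact ⟨V ×ˢ W, hV.prod hW, (convexHull_prod V W).symm⟩

lemma IsPolytope.isPolyhedron {Q : Set E} (hQ : IsPolytope Q) : IsPolyhedron Q :=
  ⟨{Q}, Set.finite_singleton _, by simpa using hQ, by simp⟩

lemma IsPolyhedron.image {X : Set E} (hX : IsPolyhedron X) (f : E →ᵃ[ℝ] F) :
    IsPolyhedron (f '' X) := by
  obtain ⟨C, hC, hQ, rfl⟩ := hX
  refine ⟨(fun Q => f '' Q) '' C, hC.image _, ?_, ?_⟩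
  · rintro _ ⟨Q, h, rfl⟩
    exact (hQ Q h).image f
  · rw [Set.sUnion_image, Set.sUnion_eq_biUnion, Set.image_iUnion₂]

lemma IsPolyhedron.prod {X : Set E} {Y : Set F} (hX : IsPolyhedron X) (hY : IsPolyhedron Y) :
    IsPolyhedron (X ×ˢ Y) := by
  obtain ⟨C, hC, hQ, rfl⟩ := hX
  obtain ⟨D, hD, hR, rfl⟩ := hY
  refine ⟨(fun p : Set E × Set F => p.1 ×ˢ p.2) '' (C ×ˢ D), (hC.prod hD).image _, ?_, ?_⟩
  · rintro _ ⟨⟨Q, R⟩, ⟨h, h'⟩, rfl⟩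
    exact (hQ Q h).prod (hR R h')
  · ext ⟨x, y⟩
    simp only [Set.mem_prod, Set.mem_sUnion, Set.sUnion_image, Set.mem_iUnion, Prod.exists]
    constructor
    · rintro ⟨⟨Q, h, hx⟩, ⟨R, h', hy⟩⟩
      exact ⟨Q, R, ⟨h, h'⟩, hx, hy⟩
    · rintro ⟨Q, R, ⟨h, h'⟩, hx, hy⟩
      exact ⟨⟨Q, h, hx⟩, ⟨R, h', hy⟩⟩

lemma IsPolyhedron.iUnion {ι : Type} [Finite ι] {X : ι → Set E} (h : ∀ i, IsPolyhedron (X i)) :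
    IsPolyhedron (⋃ i, X i) := by
  choose C hC hQ hX using h
  refine ⟨⋃ i, C i, Set.finite_iUnion hC, ?_, ?_⟩
  · intro Q hQ'
    obtain ⟨i, hi⟩ := Set.mem_iUnion.1 hQ'
    exact hQ i Q hi
  · rw [Set.sUnion_iUnion]
    exact Set.iUnion_congr hX

lemma isPLEmbedding_affine {X : Set E} (hX : IsPolyhedron X) (f : E →ᵃ[ℝ] F)
    (hf : Set.InjOn f X) : IsPLEmbedding f X := by
  refine ⟨hf, ?_⟩
  convert hX.image ((AffineMap.id ℝ E).prod f)
  ext ⟨x, y⟩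
  simp only [Set.mem_ofPred_eq, Set.mem_image, AffineMap.prod_apply, AffineMap.id_apply,
    Prod.mk.injEq]
  constructor
  · rintro ⟨h, rfl⟩
    exact ⟨x, h, rfl, rfl⟩
  · rintro ⟨x', h, rfl, rfl⟩
    exact ⟨h, rfl⟩

lemma IsPLEmbedding.prod {E' F' : Type} [AddCommGroup E'] [Module ℝ E'] [AddCommGroup F']
    [Module ℝ F'] {f : E → F} {g : E' → F'} {X : Set E} {Y : Set E'}
    (hf : IsPLEmbedding f X) (hg : IsPLEmbedding g Y) :
    IsPLEmbedding (Prod.map f g) (X ×ˢ Y) := by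
  refine ⟨hf.injOn.prodMap hg.injOn, ?_⟩
  convert (hf.graph.prod hg.graph).image
    (LinearEquiv.prodProdProdComm ℝ E F E' F').toLinearMap.toAffineMap
  ext ⟨⟨a, b⟩, ⟨c, d⟩⟩
  simp only [Set.mem_ofPred_eq, Set.mem_prod, Set.mem_image, Prod.exists, Prod.map,
    LinearMap.coe_toAffineMap, LinearEquiv.coe_coe, LinearEquiv.prodProdProdComm_apply,
    Prod.mk.injEq]
  constructor
  · rintro ⟨⟨ha, hb⟩, rfl, rfl⟩
    exact ⟨a, _, b, _, ⟨⟨ha, rfl⟩, hb, rfl⟩, ⟨rfl, rfl⟩, rfl, rfl⟩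
  · rintro ⟨_, _, _, _, ⟨⟨ha, rfl⟩, hb, rfl⟩, ⟨rfl, rfl⟩, rfl, rfl⟩
    exact ⟨⟨ha, hb⟩, rfl, rfl⟩

lemma IsPLBall.isPolyhedron {n : ℕ} {X B : Set E} (h : IsPLBall n X B) : IsPolyhedron X := by
  obtain ⟨F, _, _, Q, f, -, -, -, hf, rfl, -⟩ := h
  convert hf.graph.image (LinearMap.snd ℝ F E).toAffineMap
  ext y
  simp only [Set.mem_image, Set.mem_ofPred_eq, Prod.exists, LinearMap.coe_toAffineMap,
    LinearMap.snd_apply, exists_eq_right]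
  constructor
  · rintro ⟨x, h, rfl⟩
    exact ⟨x, h, rfl⟩
  · rintro ⟨x, h, rfl⟩
    exact ⟨x, h, rfl⟩

lemma IsPLBall.nonempty {n : ℕ} {X B : Set E} (h : IsPLBall n X B) : X.Nonempty := by
  obtain ⟨F, _, _, Q, f, -, hQ, -, hf, rfl, -⟩ := h
  exact hQ.image f

lemma IsPLBall.boundary_subset {n : ℕ} {X B : Set E} (h : IsPLBall n X B) : B ⊆ X := by
  obtain ⟨F, _, _, Q, f, -, hQ, -, hf, rfl, rfl⟩ := h
  exact Set.image_mono Set.sdiff_subset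

lemma relInterior_prod {Q : Set E} {R : Set F} (hQ : Convex ℝ Q) (hR : Convex ℝ R) :
    relInterior (Q ×ˢ R) = relInterior Q ×ˢ relInterior R := by
  have key : ∀ {E : Type} [AddCommGroup E] [Module ℝ E] {Q : Set E} (_ : Convex ℝ Q) {x y : E}
      (_ : x ∈ Q) {s t : ℝ}, 1 < s → s ≤ t → AffineMap.lineMap y x t ∈ Q →
      AffineMap.lineMap y x s ∈ Q := by
    intro E _ _ Q hQ x y hx s t hs hst ht
    have h1 : (0 : ℝ) < t - 1 := by linarith
    have := hQ hx ht (a := (t - s) / (t - 1)) (b := (s - 1) / (t - 1))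
      (div_nonneg (by linarith) h1.le) (div_nonneg (by linarith) h1.le)
      (by field_simp; ring)
    convert this using 1
    rw [AffineMap.lineMap_apply_module', AffineMap.lineMap_apply_module']
    have e1 : (t - s) / (t - 1) = 1 - (s - 1) / (t - 1) := by field_simp; ring
    have e2 : s = (s - 1) / (t - 1) * (t - 1) + 1 := by field_simp; ring
    rw [e1]
    generalize (s - 1) / (t - 1) = r at *
    rw [e2]
    module
  ext ⟨x, y⟩
  constructor
  · rintro ⟨⟨hx, hy⟩, h⟩
    refine ⟨⟨hx, fun x' hx' => ?_⟩, ⟨hy, fun y' hy' => ?_⟩⟩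
    · obtain ⟨t, ht, h1⟩ := h (x', y) ⟨hx', hy⟩
      refine ⟨t, ht, ?_⟩
      have := h1.1
      simpa [AffineMap.lineMap_apply_module'] using this
    · obtain ⟨t, ht, h1⟩ := h (x, y') ⟨hx, hy'⟩
      refine ⟨t, ht, ?_⟩
      have := h1.2
      simpa [AffineMap.lineMap_apply_module'] using this
  · rintro ⟨⟨hx, h⟩, ⟨hy, h'⟩⟩
    refine ⟨⟨hx, hy⟩, ?_⟩
    rintro ⟨x', y'⟩ ⟨hx', hy'⟩
    obtain ⟨s, hs, h1⟩ := h x' hx'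
    obtain ⟨t, ht, h2⟩ := h' y' hy'
    refine ⟨min s t, lt_min hs ht, ?_, ?_⟩
    · have := key hQ hx (lt_min hs ht) (min_le_left _ _) h1
      simpa [AffineMap.lineMap_apply_module'] using this
    · have := key hR hy (lt_min hs ht) (min_le_right _ _) h2
      simpa [AffineMap.lineMap_apply_module'] using this

lemma IsPolytope.convex {Q : Set E} (hQ : IsPolytope Q) : Convex ℝ Q := by
  obtain ⟨V, -, rfl⟩ := hQ
  exact convex_convexHull ℝ V

lemma IsPolytope.finite_vectorSpan {Q : Set E} (hQ : IsPolytope Q) :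
    FiniteDimensional ℝ (vectorSpan ℝ Q) := by
  obtain ⟨V, hV, rfl⟩ := hQ
  rw [← direction_affineSpan, affineSpan_convexHull, direction_affineSpan]
  exact finiteDimensional_vectorSpan_of_finite ℝ hV

lemma IsPLBall.prod {m n : ℕ} {X B : Set E} {Y C : Set F} (hX : IsPLBall m X B)
    (hY : IsPLBall n Y C) : IsPLBall (m + n) (X ×ˢ Y) (B ×ˢ Y ∪ X ×ˢ C) := by
  obtain ⟨E', _, _, Q, f, hQ, hQ0, rfl, hf, rfl, rfl⟩ := hX
  obtain ⟨F', _, _, R, g, hR, hR0, rfl, hg, rfl, rfl⟩ := hY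
  refine ⟨E' × F', inferInstance, inferInstance, Q ×ˢ R, Prod.map f g, hQ.prod hR, hQ0.prod hR0,
    ?_, hf.prod hg, Set.prodMap_image_prod .., ?_⟩
  · have := hQ.finite_vectorSpan
    have := hR.finite_vectorSpan
    rw [vectorSpan_prod_eq hQ0 hR0]
    let e : ((vectorSpan ℝ Q).prod (vectorSpan ℝ R)) ≃ₗ[ℝ] (vectorSpan ℝ Q) × (vectorSpan ℝ R) :=
      { toFun := fun p => (⟨p.1.1, p.2.1⟩, ⟨p.1.2, p.2.2⟩)
        invFun := fun p => ⟨(p.1.1, p.2.1), p.1.2, p.2.2⟩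
        map_add' := fun _ _ => rfl
        map_smul' := fun _ _ => rfl
        left_inv := fun _ => rfl
        right_inv := fun _ => rfl }
    rw [e.finrank_eq, Module.finrank_prod]
  · rw [relInterior_prod hQ.convex hR.convex, ← Set.prodMap_image_prod, ← Set.prodMap_image_prod,
      ← Set.image_union]
    congr 1
    ext ⟨x, y⟩
    simp only [Set.mem_sdiff, Set.mem_prod, Set.mem_union]
    tauto

end Polyhedra

/- ### Simplices -/

section Simplex

variable {V : Type} [Fintype V] [DecidableEq V]

/-- The face of the standard simplex in `ℝ^V` with vertex set `T`. -/
def simplexFace (T : Finset V) : Set (V → ℝ) :=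
  {x | (∀ v, 0 ≤ x v) ∧ (∀ v, v ∉ T → x v = 0) ∧ ∑ v, x v = 1}

lemma single_mem_simplexFace {T : Finset V} {v : V} (hv : v ∈ T) :
    (Pi.single v 1 : V → ℝ) ∈ simplexFace T := by
  refine ⟨fun w => ?_, fun w hw => ?_, by simp⟩
  · by_cases h : w = v
    · subst h; simp
    · simp [h]
  · have : w ≠ v := fun h => hw (h ▸ hv)
    simp [this]

lemma simplexFace_subset_iff {T U : Finset V} : simplexFace T ⊆ simplexFace U ↔ T ⊆ U := by
  constructor
  · intro h v hv
    by_contra hv'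
    have := (h (single_mem_simplexFace hv)).2.1 v hv'
    simp at this
  · intro h x hx
    exact ⟨hx.1, fun v hv => hx.2.1 v fun h' => hv (h h'), hx.2.2⟩

lemma simplexFace_injective : Function.Injective (simplexFace : Finset V → Set (V → ℝ)) := by
  intro T U h
  exact (simplexFace_subset_iff.1 h.subset).antisymm (simplexFace_subset_iff.1 h.superset)

lemma simplexFace_ssubset_iff {T U : Finset V} : simplexFace T ⊂ simplexFace U ↔ T ⊂ U := by
  rw [ssubset_iff_subset_not_subset, ssubset_iff_subset_not_subset, simplexFace_subset_iff,
    simplexFace_subset_iff]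

lemma simplexFace_eq_convexHull (T : Finset V) :
    simplexFace T = convexHull ℝ (Set.range fun v : T => (Pi.single v.1 1 : V → ℝ)) := by
  let f : (T → ℝ) →ₗ[ℝ] (V → ℝ) :=
    { toFun := fun x v => if h : v ∈ T then x ⟨v, h⟩ else 0
      map_add' := fun x y => by
        ext v
        by_cases h : v ∈ T <;> simp [h]
      map_smul' := fun c x => by
        ext v
        by_cases h : v ∈ T <;> simp [h] }
  have h1 : (fun v : T => (Pi.single v.1 1 : V → ℝ)) = f ∘ fun v : T => Pi.single v 1 := by
    funext v w
    by_cases h : w ∈ T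
    · by_cases h' : w = v.1
      · subst h'; simp [f]
      · have : (⟨w, h⟩ : T) ≠ v := fun h'' => h' (by rw [← h''])
        simp [f, h, h', this]
    · have : w ≠ v.1 := fun h' => h (h' ▸ v.2)
      simp [f, h, this]
  rw [h1, Set.range_comp, ← LinearMap.image_convexHull,
    convexHull_rangle_single_eq_stdSimplex]
  ext x
  constructor
  · rintro ⟨h0, hT, hs⟩
    refine ⟨fun v => x v.1, ⟨fun v => h0 _, ?_⟩, ?_⟩
    · rw [Finset.sum_coe_sort T x, ← hs]
      exact Finset.sum_subset (Finset.subset_univ _) fun v _ hv => hT v hv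
    · funext v
      by_cases h : v ∈ T
      · simp [f, h]
      · simp [f, h, hT v h]
  · rintro ⟨y, ⟨h0, hs⟩, rfl⟩
    refine ⟨fun v => ?_, fun v hv => by simp [f, hv], ?_⟩
    · by_cases h : v ∈ T
      · simpa [f, h] using h0 _
      · simp [f, h]
    · rw [← hs, ← Finset.sum_subset (Finset.subset_univ T) (fun v _ hv => by simp [f, hv]),
        ← Finset.sum_coe_sort T]
      exact Finset.sum_congr rfl fun v _ => by simp [f]

lemma isPolytope_simplexFace (T : Finset V) : IsPolytope (simplexFace T) :=
  ⟨_, Set.finite_range _, simplexFace_eq_convexHull T⟩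

lemma finrank_vectorSpan_simplexFace {T : Finset V} (hT : T.Nonempty) :
    Module.finrank ℝ (vectorSpan ℝ (simplexFace T)) = T.card - 1 := by
  have h : AffineIndependent ℝ (fun v : T => (Pi.single v.1 1 : V → ℝ)) := by
    have h1 : LinearIndependent ℝ (fun v : T => (Pi.single v.1 1 : V → ℝ)) := by
      convert (Pi.basisFun ℝ V).linearIndependent.comp (fun v : T => v.1)
        Subtype.val_injective using 1
      funext v
      simp
    exact h1.affineIndependent
  rw [simplexFace_eq_convexHull, ← direction_affineSpan, affineSpan_convexHull,
    direction_affineSpan]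
  refine h.finrank_vectorSpan ?_
  rw [Fintype.card_coe, Nat.sub_add_cancel hT.card_pos]

lemma mem_relInterior_simplexFace {T : Finset V} (hT : T.Nonempty) {x : V → ℝ} :
    x ∈ relInterior (simplexFace T) ↔ x ∈ simplexFace T ∧ ∀ v ∈ T, 0 < x v := by
  constructor
  · rintro ⟨hx, h⟩
    refine ⟨hx, fun v hv => ?_⟩
    obtain ⟨t, ht, h'⟩ := h _ (single_mem_simplexFace hv)
    have h1 := h'.1 v
    have h2 := hx.1 v
    simp only [AffineMap.lineMap_apply_module', Pi.add_apply, Pi.smul_apply, Pi.sub_apply,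
      Pi.single_eq_same, smul_eq_mul] at h1
    rcases h2.lt_or_eq with h3 | h3
    · exact h3
    · rw [← h3] at h1
      linarith
  · rintro ⟨hx, h⟩
    refine ⟨hx, fun y hy => ?_⟩
    obtain ⟨v, hv, hmin⟩ := T.exists_min_image x hT
    have hle : ∀ w, y w ≤ 1 := fun w => by
      rw [← hy.2.2]
      exact Finset.single_le_sum (fun w _ => hy.1 w) (Finset.mem_univ w)
    refine ⟨1 + x v, by linarith [h v hv], ?_, ?_, ?_⟩
    · intro w
      simp only [AffineMap.lineMap_apply_module', Pi.add_apply, Pi.smul_apply, Pi.sub_apply,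
        smul_eq_mul]
      by_cases hw : w ∈ T
      · nlinarith [hmin w hw, hle w, hx.1 w, h v hv, mul_nonneg (hx.1 v) (hx.1 w),
          mul_le_mul_of_nonneg_left (hle w) (hx.1 v)]
      · rw [hx.2.1 w hw, hy.2.1 w hw]; simp
    · intro w hw
      simp [AffineMap.lineMap_apply_module', hx.2.1 w hw, hy.2.1 w hw]
    · simp only [AffineMap.lineMap_apply_module', Pi.add_apply, Pi.smul_apply, Pi.sub_apply,
        smul_eq_mul]
      rw [Finset.sum_add_distrib, ← Finset.mul_sum, Finset.sum_sub_distrib, hx.2.2, hy.2.2]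
      ring

lemma simplexFace_diff_relInterior {T : Finset V} (hT : T.Nonempty) :
    simplexFace T \ relInterior (simplexFace T) =
      ⋃ U ∈ {U : Finset V | U.Nonempty ∧ U ⊂ T}, simplexFace U := by
  ext x
  simp only [Set.mem_sdiff, mem_relInterior_simplexFace hT, Set.mem_iUnion, Set.mem_ofPred_eq,
    exists_prop]
  constructor
  · rintro ⟨hx, h⟩
    push Not at h
    obtain ⟨v, hv, hv'⟩ := h hx
    have hv0 : x v = 0 := le_antisymm hv' (hx.1 v)
    have hx' : x ∈ simplexFace (T.erase v) := by
      refine ⟨hx.1, fun w hw => ?_, hx.2.2⟩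
      by_cases hwv : w = v
      · rw [hwv, hv0]
      · exact hx.2.1 w fun h' => hw (Finset.mem_erase.2 ⟨hwv, h'⟩)
    refine ⟨T.erase v, ⟨?_, Finset.erase_ssubset hv⟩, hx'⟩
    rw [Finset.nonempty_iff_ne_empty]
    intro he
    rw [he] at hx'
    have : ∑ v, x v = 0 := Finset.sum_eq_zero fun w _ => hx'.2.1 w (Finset.notMem_empty w)
    linarith [hx'.2.2]
  · rintro ⟨U, ⟨-, hU⟩, hx⟩
    refine ⟨simplexFace_subset_iff.2 hU.subset hx, fun h => ?_⟩
    obtain ⟨v, hv, hv'⟩ := Finset.exists_of_ssubset hU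
    have := h.2 v hv
    rw [hx.2.1 v hv'] at this
    exact lt_irrefl _ this

lemma isPLBall_simplexFace {T : Finset V} (hT : T.Nonempty) :
    IsPLBall (T.card - 1) (simplexFace T)
      (⋃ U ∈ {U : Finset V | U.Nonempty ∧ U ⊂ T}, simplexFace U) := by
  obtain ⟨v, hv⟩ := hT
  refine ⟨V → ℝ, inferInstance, inferInstance, simplexFace T, AffineMap.id ℝ _,
    isPolytope_simplexFace T, ⟨_, single_mem_simplexFace hv⟩,
    finrank_vectorSpan_simplexFace ⟨v, hv⟩,
    isPLEmbedding_affine (isPolytope_simplexFace T).isPolyhedron _ (by simp [Set.injOn_id]), ?_, ?_⟩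
  · simp
  · rw [simplexFace_diff_relInterior ⟨v, hv⟩]
    simp

variable {W : Type} [LinearOrder W]

/-- The incidence number of two finite subsets of an ordered set. -/
def simplexInc (T U : Finset W) : ℤ :=
  ∑ v ∈ T, if U = T.erase v then (-1) ^ (T.filter (· < v)).card else 0

lemma simplexInc_erase {T : Finset W} {v : W} (hv : v ∈ T) :
    simplexInc T (T.erase v) = (-1) ^ (T.filter (· < v)).card := by
  rw [simplexInc, Finset.sum_eq_single v]
  · simp
  · intro w hw hwv
    rw [if_neg]
    intro h
    have : w ∈ T.erase v := Finset.mem_erase.2 ⟨hwv, hw⟩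
    rw [h] at this
    simp at this
  · exact fun h => absurd hv h

lemma simplexInc_eq_zero {T U : Finset W} (h : ¬ (U ⊆ T ∧ T.card = U.card + 1)) :
    simplexInc T U = 0 := by
  refine Finset.sum_eq_zero fun v hv => if_neg ?_
  rintro rfl
  exact h ⟨Finset.erase_subset _ _, (Finset.card_erase_add_one hv).symm⟩

lemma exists_erase_of_card {T U : Finset W} (h : U ⊆ T) (h' : T.card = U.card + 1) :
    ∃ v ∈ T, U = T.erase v := by
  have h1 : (T \ U).card = 1 := by rw [Finset.card_sdiff_of_subset h]; omega
  obtain ⟨v, hv⟩ := Finset.card_eq_one.1 h1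
  have hvT : v ∈ T \ U := by rw [hv]; simp
  refine ⟨v, (Finset.mem_sdiff.1 hvT).1, ?_⟩
  rw [Finset.erase_eq, ← hv, Finset.sdiff_sdiff_eq_self h]

lemma simplexInc_eq_one_or {T U : Finset W} (h : U ⊆ T) (h' : T.card = U.card + 1) :
    simplexInc T U = 1 ∨ simplexInc T U = -1 := by
  obtain ⟨v, hv, rfl⟩ := exists_erase_of_card h h'
  rw [simplexInc_erase hv]
  exact neg_one_pow_eq_or ℤ _

lemma simplexInc_square_aux {T : Finset W} {v w : W} (hv : v ∈ T) (hw : w ∈ T) (h : v < w) :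
    (-1 : ℤ) ^ (T.filter (· < v)).card * (-1) ^ ((T.erase v).filter (· < w)).card =
      -((-1) ^ (T.filter (· < w)).card * (-1) ^ ((T.erase w).filter (· < v)).card) := by
  have h1 : (T.erase w).filter (· < v) = T.filter (· < v) := by
    ext x
    simp only [Finset.mem_filter, Finset.mem_erase]
    constructor
    · rintro ⟨⟨-, h1⟩, h2⟩; exact ⟨h1, h2⟩
    · rintro ⟨h1, h2⟩; exact ⟨⟨(h2.trans h).ne, h1⟩, h2⟩
  have h2 : (T.filter (· < w)).card = ((T.erase v).filter (· < w)).card + 1 := by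
    rw [Finset.filter_erase, Finset.card_erase_add_one]
    exact Finset.mem_filter.2 ⟨hv, h⟩
  rw [h1, h2, pow_succ]
  ring

lemma simplexInc_square (T Y : Finset W) :
    ∑ v ∈ T, simplexInc T (T.erase v) * simplexInc (T.erase v) Y = 0 := by
  let f : W → W → ℤ := fun v w => if w ≠ v then
    (if Y = (T.erase v).erase w then
      (-1) ^ (T.filter (· < v)).card * (-1) ^ ((T.erase v).filter (· < w)).card else 0) else 0
  have h1 : ∑ v ∈ T, simplexInc T (T.erase v) * simplexInc (T.erase v) Y =
      ∑ v ∈ T, ∑ w ∈ T, f v w := by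
    refine Finset.sum_congr rfl fun v hv => ?_
    rw [simplexInc_erase hv, simplexInc, Finset.mul_sum, ← Finset.filter_ne' T v,
      Finset.sum_filter]
    refine Finset.sum_congr rfl fun w _ => ?_
    simp only [f, Finset.filter_ne', mul_ite, mul_zero]
  have h2 : ∀ v ∈ T, ∀ w ∈ T, f v w = - f w v := by
    intro v hv w hw
    simp only [f]
    rcases lt_trichotomy v w with h | h | h
    · rw [if_pos h.ne', if_pos h.ne, Finset.erase_right_comm, simplexInc_square_aux hv hw h]
      split_ifs <;> simp
    · subst h; simp
    · rw [if_pos h.ne, if_pos h.ne', Finset.erase_right_comm, simplexInc_square_aux hw hv h]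
      split_ifs <;> simp
  have h3 : ∑ v ∈ T, ∑ w ∈ T, f v w = - ∑ v ∈ T, ∑ w ∈ T, f v w := by
    conv_rhs => rw [Finset.sum_comm]
    rw [← Finset.sum_neg_distrib]
    refine Finset.sum_congr rfl fun v hv => ?_
    rw [← Finset.sum_neg_distrib]
    exact Finset.sum_congr rfl fun w hw => h2 v hv w hw
  rw [h1]
  linarith

lemma sum_simplexInc_mul [Fintype W] {S T : Finset W} (hT : T ⊆ S) (g : Finset W → ℤ)
    (hg : g ∅ = 0 ∨ 2 ≤ T.card) :
    ∑ U : {U : Finset W // U.Nonempty ∧ U ⊆ S}, simplexInc T U.1 * g U.1 =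
      ∑ v ∈ T, simplexInc T (T.erase v) * g (T.erase v) := by
  have h1 : ∀ v ∈ T, simplexInc T (T.erase v) * g (T.erase v) =
      ∑ U : {U : Finset W // U.Nonempty ∧ U ⊆ S},
        (if U.1 = T.erase v then (-1) ^ (T.filter (· < v)).card else 0) * g U.1 := by
    intro v hv
    rcases (T.erase v).eq_empty_or_nonempty with h | h
    · have h0 : g ∅ = 0 := by
        rcases hg with h' | h'
        · exact h'
        · have := Finset.card_erase_add_one hv
          rw [h] at this
          simp only [Finset.card_empty] at this
          omega
      rw [h, h0, mul_zero, Finset.sum_eq_zero]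
      rintro U -
      rw [if_neg U.2.1.ne_empty, zero_mul]
    · rw [Finset.sum_eq_single ⟨T.erase v, h, (Finset.erase_subset _ _).trans hT⟩, if_pos rfl,
        simplexInc_erase hv]
      · rintro U - hU
        rw [if_neg fun h' => hU (Subtype.ext h'), zero_mul]
      · intro h'
        exact absurd (Finset.mem_univ _) h'
  rw [Finset.sum_congr rfl h1, Finset.sum_comm]
  refine Finset.sum_congr rfl fun U _ => ?_
  rw [simplexInc, Finset.sum_mul]

end Simplex

/- ### Ball complexes -/

open Classical in
/-- A ball complex: a finite collection of PL balls in a finite-dimensional real vector space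
whose interiors are disjoint and such that the boundary of each ball is a union of balls of the
collection. -/
structure BallComplex : Type 1 where
  E : Type
  [instAddCommGroup : AddCommGroup E]
  [instModule : Module ℝ E]
  [instFinite : FiniteDimensional ℝ E]
  Cell : Type
  [instFintype : Fintype Cell]
  carrier : Cell → Set E
  carrier_injective : Function.Injective carrier
  dim : Cell → ℕ
  dim_lt : ∀ σ τ, carrier σ ⊂ carrier τ → dim σ < dim τ
  isPLBall : ∀ σ, IsPLBall (dim σ) (carrier σ) (⋃ τ ∈ {τ | carrier τ ⊂ carrier σ}, carrier τ)
  disjoint : ∀ σ τ, σ ≠ τ →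
    Disjoint (carrier σ \ ⋃ υ ∈ {υ | carrier υ ⊂ carrier σ}, carrier υ)
      (carrier τ \ ⋃ υ ∈ {υ | carrier υ ⊂ carrier τ}, carrier υ)

attribute [instance] BallComplex.instAddCommGroup BallComplex.instModule BallComplex.instFinite
  BallComplex.instFintype

/-- A ball complex with a chosen reference orientation of each cell.  On a regular cell complex a
choice of orientations of the cells of positive dimension is the same as a system of incidence
numbers: `inc σ τ` is `±1` if `τ` is a codimension one face of `σ` and `0` otherwise, the two ends
of an edge have opposite incidence numbers, and the square of the cellular boundary vanishes. -/
structure OrientedBallComplex extends BallComplex where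
  inc : Cell → Cell → ℤ
  inc_eq_zero : ∀ σ τ, ¬ (carrier τ ⊆ carrier σ ∧ dim σ = dim τ + 1) → inc σ τ = 0
  inc_eq_one_or : ∀ σ τ, carrier τ ⊆ carrier σ → dim σ = dim τ + 1 → inc σ τ = 1 ∨ inc σ τ = -1
  inc_edge : ∀ σ, dim σ = 1 → ∑ τ, inc σ τ = 0
  inc_square : ∀ σ υ, ∑ τ, inc σ τ * inc τ υ = 0

namespace OrientedBallComplex

/-- The underlying polyhedron `|K|`. -/
def space (K : OrientedBallComplex) : Set K.E := ⋃ σ, K.carrier σ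

lemma isPolyhedron_space (K : OrientedBallComplex) : IsPolyhedron K.space :=
  IsPolyhedron.iUnion fun σ => (K.isPLBall σ).isPolyhedron

lemma carrier_subset_space (K : OrientedBallComplex) (σ : K.Cell) : K.carrier σ ⊆ K.space :=
  Set.subset_iUnion _ σ

lemma carrier_nonempty (K : OrientedBallComplex) (σ : K.Cell) : (K.carrier σ).Nonempty :=
  (K.isPLBall σ).nonempty

/-- A morphism of ball complexes, that is, an isomorphism onto a subcomplex: a map of cells that is
induced by a PL embedding of the underlying polyhedra and whose image is a subcomplex.  `sign σ`
compares the reference orientations of `σ` and of its image; it is determined by the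
compatibility with incidence numbers. -/
@[ext]
structure Hom (K L : OrientedBallComplex) where
  toFun : K.Cell → L.Cell
  sign : K.Cell → ℤˣ
  exists_pl : ∃ φ : K.E → L.E, IsPLEmbedding φ K.space ∧
    ∀ σ, φ '' K.carrier σ = L.carrier (toFun σ)
  dim_toFun : ∀ σ, L.dim (toFun σ) = K.dim σ
  exists_face : ∀ σ τ, L.carrier τ ⊆ L.carrier (toFun σ) → ∃ τ', toFun τ' = τ
  sign_vertex : ∀ σ, K.dim σ = 0 → sign σ = 1
  inc_toFun : ∀ σ τ, L.inc (toFun σ) (toFun τ) = sign σ * sign τ * K.inc σ τ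

lemma Hom.carrier_subset_iff {K L : OrientedBallComplex} (f : Hom K L) (σ τ : K.Cell) :
    L.carrier (f.toFun σ) ⊆ L.carrier (f.toFun τ) ↔ K.carrier σ ⊆ K.carrier τ := by
  obtain ⟨φ, hφ, h⟩ := f.exists_pl
  rw [← h, ← h]
  exact hφ.injOn.image_subset_image_iff (K.carrier_subset_space σ) (K.carrier_subset_space τ)

lemma Hom.carrier_ssubset_iff {K L : OrientedBallComplex} (f : Hom K L) (σ τ : K.Cell) :
    L.carrier (f.toFun σ) ⊂ L.carrier (f.toFun τ) ↔ K.carrier σ ⊂ K.carrier τ := by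
  rw [ssubset_iff_subset_not_subset, ssubset_iff_subset_not_subset, f.carrier_subset_iff,
    f.carrier_subset_iff]

lemma closedCell_boundary (K : OrientedBallComplex) (σ : K.Cell)
    (τ : {τ : K.Cell // K.carrier τ ⊆ K.carrier σ}) :
    (⋃ υ ∈ {υ : {υ : K.Cell // K.carrier υ ⊆ K.carrier σ} | K.carrier υ.1 ⊂ K.carrier τ.1},
      K.carrier υ.1) = ⋃ υ ∈ {υ | K.carrier υ ⊂ K.carrier τ.1}, K.carrier υ := by
  ext x
  simp only [Set.mem_iUnion, Set.mem_ofPred_eq, exists_prop, Subtype.exists]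
  constructor
  · rintro ⟨υ, -, h, hx⟩
    exact ⟨υ, h, hx⟩
  · rintro ⟨υ, h, hx⟩
    exact ⟨υ, h.subset.trans τ.2, h, hx⟩

open Classical in
lemma closedCell_sum (K : OrientedBallComplex) (σ : K.Cell)
    (τ : {τ : K.Cell // K.carrier τ ⊆ K.carrier σ}) (g : K.Cell → ℤ) :
    ∑ υ : {υ : K.Cell // K.carrier υ ⊆ K.carrier σ}, K.inc τ.1 υ.1 * g υ.1 =
      ∑ υ, K.inc τ.1 υ * g υ := by
  rw [← Finset.sum_subtype (Finset.univ.filter fun υ => K.carrier υ ⊆ K.carrier σ) (by simp)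
    (fun υ => K.inc τ.1 υ * g υ)]
  refine Finset.sum_subset (Finset.filter_subset _ _) fun υ _ h => ?_
  rw [K.inc_eq_zero, zero_mul]
  rintro ⟨h', -⟩
  exact h (Finset.mem_filter.2 ⟨Finset.mem_univ _, h'.trans τ.2⟩)

open Classical in
/-- The subcomplex of `K` consisting of the closed cell `σ`. -/
def closedCell (K : OrientedBallComplex) (σ : K.Cell) : OrientedBallComplex where
  E := K.E
  Cell := {τ : K.Cell // K.carrier τ ⊆ K.carrier σ}
  carrier τ := K.carrier τ.1
  carrier_injective := K.carrier_injective.comp Subtype.val_injective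
  dim τ := K.dim τ.1
  dim_lt τ υ h := K.dim_lt _ _ h
  isPLBall τ := by
    rw [K.closedCell_boundary σ τ]
    exact K.isPLBall τ.1
  disjoint τ υ h := by
    rw [K.closedCell_boundary σ τ, K.closedCell_boundary σ υ]
    exact K.disjoint _ _ fun h' => h (Subtype.ext h')
  inc τ υ := K.inc τ.1 υ.1
  inc_eq_zero τ υ h := K.inc_eq_zero _ _ h
  inc_eq_one_or τ υ h h' := K.inc_eq_one_or _ _ h h'
  inc_edge τ h := by
    have := K.closedCell_sum σ τ (fun _ => 1)
    simp only [mul_one] at this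
    rw [this, K.inc_edge _ h]
  inc_square τ υ := by
    rw [K.closedCell_sum σ τ fun x => K.inc x υ.1, K.inc_square]

lemma isPLEmbedding_id {E : Type} [AddCommGroup E] [Module ℝ E] {X : Set E}
    (hX : IsPolyhedron X) : IsPLEmbedding (fun x : E => x) X :=
  isPLEmbedding_affine hX (AffineMap.id ℝ E) (Set.injOn_id X)

/-- The inclusion of a closed cell. -/
def closedCellHom (K : OrientedBallComplex) (σ : K.Cell) : Hom (K.closedCell σ) K where
  toFun τ := τ.1
  sign _ := 1
  exists_pl := ⟨fun x => x, isPLEmbedding_id (isPolyhedron_space _), fun _ => Set.image_id' _⟩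
  dim_toFun _ := rfl
  exists_face τ υ h := ⟨⟨υ, h.trans τ.2⟩, rfl⟩
  sign_vertex _ _ := rfl
  inc_toFun τ υ := by simp [closedCell]

lemma prod_subset_iff (K L : OrientedBallComplex) (p q : K.Cell × L.Cell) :
    K.carrier p.1 ×ˢ L.carrier p.2 ⊆ K.carrier q.1 ×ˢ L.carrier q.2 ↔
      K.carrier p.1 ⊆ K.carrier q.1 ∧ L.carrier p.2 ⊆ L.carrier q.2 := by
  rw [Set.prod_subset_prod_iff]
  have h1 := (K.carrier_nonempty p.1).ne_empty
  have h2 := (L.carrier_nonempty p.2).ne_empty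
  tauto

lemma prod_carrier_injective (K L : OrientedBallComplex) :
    Function.Injective fun p : K.Cell × L.Cell => K.carrier p.1 ×ˢ L.carrier p.2 := by
  intro p q h
  have h1 := (prod_subset_iff K L p q).1 h.subset
  have h2 := (prod_subset_iff K L q p).1 h.superset
  exact Prod.ext (K.carrier_injective (h1.1.antisymm h2.1))
    (L.carrier_injective (h1.2.antisymm h2.2))

lemma carrier_eq_or_ssubset (K : OrientedBallComplex) {σ τ : K.Cell}
    (h : K.carrier σ ⊆ K.carrier τ) : σ = τ ∨ K.carrier σ ⊂ K.carrier τ := by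
  rcases h.eq_or_ssubset with h' | h'
  · exact Or.inl (K.carrier_injective h')
  · exact Or.inr h'

lemma dim_le (K : OrientedBallComplex) {σ τ : K.Cell} (h : K.carrier σ ⊆ K.carrier τ) :
    K.dim σ ≤ K.dim τ := by
  rcases K.carrier_eq_or_ssubset h with rfl | h'
  · exact le_rfl
  · exact (K.dim_lt _ _ h').le

lemma prod_ssubset_iff (K L : OrientedBallComplex) (p q : K.Cell × L.Cell) :
    K.carrier p.1 ×ˢ L.carrier p.2 ⊂ K.carrier q.1 ×ˢ L.carrier q.2 ↔
      K.carrier p.1 ⊂ K.carrier q.1 ∧ L.carrier p.2 ⊆ L.carrier q.2 ∨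
      K.carrier p.1 ⊆ K.carrier q.1 ∧ L.carrier p.2 ⊂ L.carrier q.2 := by
  simp only [ssubset_iff_subset_not_subset, prod_subset_iff]
  tauto

lemma prod_boundary (K L : OrientedBallComplex) (p : K.Cell × L.Cell) :
    (⋃ q ∈ {q : K.Cell × L.Cell | K.carrier q.1 ×ˢ L.carrier q.2 ⊂
        K.carrier p.1 ×ˢ L.carrier p.2}, K.carrier q.1 ×ˢ L.carrier q.2) =
      (⋃ τ ∈ {τ | K.carrier τ ⊂ K.carrier p.1}, K.carrier τ) ×ˢ L.carrier p.2 ∪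
      K.carrier p.1 ×ˢ (⋃ τ ∈ {τ | L.carrier τ ⊂ L.carrier p.2}, L.carrier τ) := by
  ext ⟨x, y⟩
  simp only [Set.mem_iUnion, Set.mem_ofPred_eq, exists_prop, Set.mem_union, Set.mem_prod,
    prod_ssubset_iff, Prod.exists]
  constructor
  · rintro ⟨σ, τ, ⟨h1, h2⟩ | ⟨h1, h2⟩, hx, hy⟩
    · exact Or.inl ⟨⟨σ, h1, hx⟩, h2 hy⟩
    · exact Or.inr ⟨h1 hx, ⟨τ, h2, hy⟩⟩
  · rintro (⟨⟨σ, h1, hx⟩, hy⟩ | ⟨hx, ⟨τ, h2, hy⟩⟩)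
    · exact ⟨σ, p.2, Or.inl ⟨h1, subset_rfl⟩, hx, hy⟩
    · exact ⟨p.1, τ, Or.inr ⟨subset_rfl, h2⟩, hx, hy⟩

lemma inc_self (K : OrientedBallComplex) (σ : K.Cell) : K.inc σ σ = 0 :=
  K.inc_eq_zero _ _ fun h => by omega

lemma inc_mul_pow (K : OrientedBallComplex) (σ τ : K.Cell) :
    (-1) ^ K.dim σ * K.inc σ τ = - ((-1) ^ K.dim τ * K.inc σ τ) := by
  by_cases h : K.carrier τ ⊆ K.carrier σ ∧ K.dim σ = K.dim τ + 1
  · rw [h.2, pow_succ]; ring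
  · rw [K.inc_eq_zero _ _ h]; simp

open Classical in
lemma prod_inc_square (K L : OrientedBallComplex) (p r : K.Cell × L.Cell) :
    ∑ q : K.Cell × L.Cell,
      ((if p.2 = q.2 then K.inc p.1 q.1 else 0) +
        (if p.1 = q.1 then (-1) ^ K.dim p.1 * L.inc p.2 q.2 else 0)) *
      ((if q.2 = r.2 then K.inc q.1 r.1 else 0) +
        (if q.1 = r.1 then (-1) ^ K.dim q.1 * L.inc q.2 r.2 else 0)) = 0 := by
  obtain ⟨a, b⟩ := p
  obtain ⟨c, d⟩ := r
  simp only
  rw [Fintype.sum_prod_type]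
  have h1 : ∀ x y, ((if b = y then K.inc a x else 0) +
        (if a = x then (-1) ^ K.dim a * L.inc b y else 0)) *
      ((if y = d then K.inc x c else 0) + (if x = c then (-1) ^ K.dim x * L.inc y d else 0)) =
      (if b = y then (if b = d then K.inc a x * K.inc x c else 0) else 0) +
      (if a = x then (if a = c then L.inc b y * L.inc y d else 0) else 0) +
      (if b = y then (if x = c then (-1) ^ K.dim c * K.inc a c * L.inc b d else 0) else 0) +
      (if a = x then (if y = d then (-1) ^ K.dim a * K.inc a c * L.inc b d else 0) else 0) := by
    intro x y
    have h2 : ((-1 : ℤ) ^ K.dim a) * (-1) ^ K.dim a = 1 := by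
      rw [← mul_pow]; simp
    by_cases hb : b = y <;> by_cases ha : a = x <;> by_cases hd : y = d <;> by_cases hc : x = c <;>
      subst_vars <;> simp_all [inc_self] <;>
      first
      | ring1
      | linear_combination (L.inc b y * L.inc y d) * h2
  have h3 := K.inc_square a c
  have h4 := L.inc_square b d
  have h5 := K.inc_mul_pow a c
  simp only [h1, Finset.sum_add_distrib]
  have s1 : ∑ x, ∑ y, (if b = y then (if b = d then K.inc a x * K.inc x c else 0) else 0) = 0 := by
    simp only [Finset.sum_ite_eq, Finset.mem_univ, if_true]
    split_ifs
    · exact h3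
    · simp
  have s2 : ∑ x, ∑ y, (if a = x then (if a = c then L.inc b y * L.inc y d else 0) else 0) = 0 := by
    rw [Finset.sum_comm]
    simp only [Finset.sum_ite_eq, Finset.mem_univ, if_true]
    split_ifs
    · exact h4
    · simp
  have s3 : ∑ x, ∑ y, (if b = y then
      (if x = c then (-1) ^ K.dim c * K.inc a c * L.inc b d else 0) else 0) =
      (-1) ^ K.dim c * K.inc a c * L.inc b d := by
    simp
  have s4 : ∑ x, ∑ y, (if a = x then
      (if y = d then (-1) ^ K.dim a * K.inc a c * L.inc b d else 0) else 0) =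
      (-1) ^ K.dim a * K.inc a c * L.inc b d := by
    rw [Finset.sum_comm]
    simp
  rw [s1, s2, s3, s4]
  linear_combination L.inc b d * h5

open Classical in
/-- The product of ball complexes, with the product orientations. -/
def prod (K L : OrientedBallComplex) : OrientedBallComplex where
  E := K.E × L.E
  Cell := K.Cell × L.Cell
  carrier p := K.carrier p.1 ×ˢ L.carrier p.2
  carrier_injective := prod_carrier_injective K L
  dim p := K.dim p.1 + L.dim p.2
  dim_lt p q h := by
    rcases (prod_ssubset_iff K L p q).1 h with ⟨h1, h2⟩ | ⟨h1, h2⟩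
    · exact add_lt_add_of_lt_of_le (K.dim_lt _ _ h1) (L.dim_le h2)
    · exact add_lt_add_of_le_of_lt (K.dim_le h1) (L.dim_lt _ _ h2)
  isPLBall p := by
    rw [prod_boundary]
    exact (K.isPLBall p.1).prod (L.isPLBall p.2)
  disjoint p q h := by
    rw [prod_boundary, prod_boundary, Set.disjoint_left]
    rintro ⟨x, y⟩ ⟨⟨hx, hy⟩, h1⟩ ⟨⟨hx', hy'⟩, h2⟩
    simp only [Set.mem_union, Set.mem_prod, not_or, not_and] at h1 h2
    by_cases hpq : p.1 = q.1
    · have hpq' : p.2 ≠ q.2 := fun h' => h (Prod.ext hpq h')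
      exact Set.disjoint_left.1 (L.disjoint _ _ hpq') ⟨hy, h1.2 hx⟩ ⟨hy', h2.2 hx'⟩
    · exact Set.disjoint_left.1 (K.disjoint _ _ hpq) ⟨hx, fun h' => h1.1 h' hy⟩
        ⟨hx', fun h' => h2.1 h' hy'⟩
  inc p q := (if p.2 = q.2 then K.inc p.1 q.1 else 0) +
    (if p.1 = q.1 then (-1) ^ K.dim p.1 * L.inc p.2 q.2 else 0)
  inc_eq_zero p q h := by
    rw [prod_subset_iff] at h
    by_cases h2 : p.2 = q.2
    · by_cases h1 : p.1 = q.1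
      · simp [h1, h2, inc_self]
      · rw [if_neg h1, if_pos h2, K.inc_eq_zero, add_zero]
        rintro ⟨h3, h4⟩
        exact h ⟨⟨h3, h2 ▸ subset_rfl⟩, by rw [h2]; omega⟩
    · by_cases h1 : p.1 = q.1
      · rw [if_pos h1, if_neg h2, L.inc_eq_zero, mul_zero, add_zero]
        rintro ⟨h3, h4⟩
        exact h ⟨⟨h1 ▸ subset_rfl, h3⟩, by rw [h1]; omega⟩
      · rw [if_neg h1, if_neg h2, add_zero]
  inc_eq_one_or p q h h' := by
    rw [prod_subset_iff] at h
    rcases K.carrier_eq_or_ssubset h.1 with h1 | h1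
    · have h4 : L.dim p.2 = L.dim q.2 + 1 := by rw [h1] at h'; omega
      have h2 : ¬ p.2 = q.2 := fun h2 => by rw [h2] at h4; omega
      rw [if_pos h1.symm, if_neg h2, zero_add]
      rcases L.inc_eq_one_or _ _ h.2 h4 with h5 | h5 <;>
        rcases neg_one_pow_eq_or ℤ (K.dim p.1) with h6 | h6 <;> simp [h5, h6]
    · have h3 := K.dim_lt _ _ h1
      rcases L.carrier_eq_or_ssubset h.2 with h2 | h2
      · have h4 : K.dim p.1 = K.dim q.1 + 1 := by rw [h2] at h'; omega
        rw [if_pos h2.symm, if_neg fun h5 => by rw [h5] at h4; omega, add_zero]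
        exact K.inc_eq_one_or _ _ h.1 h4
      · have := L.dim_lt _ _ h2
        omega
  inc_edge p h := by
    rw [Finset.sum_add_distrib, Fintype.sum_prod_type_right, Fintype.sum_prod_type]
    simp only [Finset.sum_const_zero, Finset.sum_ite_irrel, Finset.sum_ite_eq, Finset.mem_univ,
      if_true, ← Finset.mul_sum]
    have h0 : ∀ (M : OrientedBallComplex) (σ : M.Cell), M.dim σ = 0 → ∑ τ, M.inc σ τ = 0 :=
      fun M σ h => Finset.sum_eq_zero fun τ _ => M.inc_eq_zero _ _ fun h' => by omega
    rcases Nat.add_eq_one_iff.1 h with ⟨h1, h2⟩ | ⟨h1, h2⟩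
    · rw [h0 K _ h1, L.inc_edge _ h2]; simp
    · rw [K.inc_edge _ h1, h0 L _ h2]; simp
  inc_square p r := prod_inc_square K L p r

lemma space_prod (K L : OrientedBallComplex) : (K.prod L).space = K.space ×ˢ L.space := by
  refine Set.Subset.antisymm (fun p hp => ?_) fun p hp => ?_
  · obtain ⟨⟨σ, τ⟩, hx, hy⟩ := Set.mem_iUnion.1 hp
    exact ⟨Set.mem_iUnion.2 ⟨σ, hx⟩, Set.mem_iUnion.2 ⟨τ, hy⟩⟩
  · obtain ⟨σ, hx⟩ := Set.mem_iUnion.1 hp.1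
    obtain ⟨τ, hy⟩ := Set.mem_iUnion.1 hp.2
    exact Set.mem_iUnion.2 ⟨(σ, τ), hx, hy⟩

lemma Hom.injective {K L : OrientedBallComplex} (f : Hom K L) : Function.Injective f.toFun := by
  intro σ τ h
  refine K.carrier_injective (((f.carrier_subset_iff σ τ).1 ?_).antisymm
    ((f.carrier_subset_iff τ σ).1 ?_)) <;> rw [h]

/-- The product of two morphisms. -/
def Hom.prod {K L K' L' : OrientedBallComplex} (f : Hom K K') (g : Hom L L') :
    Hom (K.prod L) (K'.prod L') where
  toFun p := (f.toFun p.1, g.toFun p.2)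
  sign p := f.sign p.1 * g.sign p.2
  exists_pl := by
    obtain ⟨φ, hφ, h⟩ := f.exists_pl
    obtain ⟨ψ, hψ, h'⟩ := g.exists_pl
    refine ⟨Prod.map φ ψ, ?_, fun p => ?_⟩
    · rw [space_prod]
      exact hφ.prod hψ
    · exact (Set.prodMap_image_prod ..).trans (by rw [h, h']; rfl)
  dim_toFun p := congrArg₂ (· + ·) (f.dim_toFun p.1) (g.dim_toFun p.2)
  exists_face p q h := by
    obtain ⟨h1, h2⟩ := (prod_subset_iff K' L' q (f.toFun p.1, g.toFun p.2)).1 h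
    obtain ⟨σ, hσ⟩ := f.exists_face _ _ h1
    obtain ⟨τ, hτ⟩ := g.exists_face _ _ h2
    exact ⟨(σ, τ), Prod.ext hσ hτ⟩
  sign_vertex p h := by
    obtain ⟨h1, h2⟩ := Nat.add_eq_zero_iff.1 h
    rw [f.sign_vertex _ h1, g.sign_vertex _ h2, mul_one]
  inc_toFun p q := by
    have hs : ∀ ε : ℤˣ, (ε : ℤ) * ε = 1 := fun ε => by
      rw [← Units.val_mul, Int.units_mul_self, Units.val_one]
    have e1 : f.toFun p.1 = f.toFun q.1 ↔ p.1 = q.1 := f.injective.eq_iff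
    have e2 : g.toFun p.2 = g.toFun q.2 ↔ p.2 = q.2 := g.injective.eq_iff
    simp only [OrientedBallComplex.prod, f.inc_toFun, g.inc_toFun, f.dim_toFun, Units.val_mul]
    by_cases h1 : p.1 = q.1 <;> by_cases h2 : p.2 = q.2
    · simp [h1, h2, inc_self]
    · rw [if_neg (e2.not.2 h2), if_pos (e1.2 h1), if_neg h2, if_pos h1]
      simp only [h1]
      linear_combination (-(g.sign p.2 : ℤ) * g.sign q.2 * (-1) ^ K.dim q.1 * L.inc p.2 q.2) *
        hs (f.sign q.1)
    · rw [if_pos (e2.2 h2), if_neg (e1.not.2 h1), if_pos h2, if_neg h1]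
      simp only [h2]
      linear_combination (-(f.sign p.1 : ℤ) * f.sign q.1 * K.inc p.1 q.1) * hs (g.sign q.2)
    · rw [if_neg (e2.not.2 h2), if_neg (e1.not.2 h1), if_neg h2, if_neg h1]
      simp

/-- The identity morphism. -/
def Hom.id (K : OrientedBallComplex) : Hom K K where
  toFun σ := σ
  sign _ := 1
  exists_pl := ⟨fun x => x, isPLEmbedding_id (isPolyhedron_space _), fun _ => Set.image_id' _⟩
  dim_toFun _ := rfl
  exists_face _ τ _ := ⟨τ, rfl⟩
  sign_vertex _ _ := rfl
  inc_toFun _ _ := by simp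

lemma simplex_boundary {V : Type} [Fintype V] [DecidableEq V] {S : Finset V}
    (T : {T : Finset V // T.Nonempty ∧ T ⊆ S}) :
    (⋃ U ∈ {U : {U : Finset V // U.Nonempty ∧ U ⊆ S} | simplexFace U.1 ⊂ simplexFace T.1},
      simplexFace U.1) = ⋃ U ∈ {U : Finset V | U.Nonempty ∧ U ⊂ T.1}, simplexFace U := by
  ext x
  simp only [Set.mem_iUnion, Set.mem_ofPred_eq, exists_prop, Subtype.exists,
    simplexFace_ssubset_iff]
  constructor
  · rintro ⟨U, h, h', hx⟩
    exact ⟨U, ⟨h.1, h'⟩, hx⟩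
  · rintro ⟨U, h, hx⟩
    exact ⟨U, ⟨h.1, h.2.subset.trans T.2.2⟩, h.2, hx⟩

/-- The simplex spanned by a finite subset `S` of a finite ordered set `V` of vertices, realized in
`ℝ^V`.  Its cells are the nonempty subsets of `S`, oriented by the order of `V`. -/
def simplex {V : Type} [Fintype V] [LinearOrder V] (S : Finset V) : OrientedBallComplex where
  E := V → ℝ
  Cell := {T : Finset V // T.Nonempty ∧ T ⊆ S}
  carrier T := simplexFace T.1
  carrier_injective := simplexFace_injective.comp Subtype.val_injective
  dim T := T.1.card - 1
  dim_lt T U h := by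
    have h1 := Finset.card_lt_card (simplexFace_ssubset_iff.1 h)
    have := T.2.1.card_pos
    omega
  isPLBall T := by
    rw [simplex_boundary]
    exact isPLBall_simplexFace T.2.1
  disjoint T U h := by
    rw [simplex_boundary, simplex_boundary, ← simplexFace_diff_relInterior T.2.1,
      ← simplexFace_diff_relInterior U.2.1, Set.disjoint_left]
    rintro x ⟨hx, hx1⟩ ⟨hy, hy1⟩
    rw [Set.mem_sdiff, not_and_not_right] at hx1 hy1
    have hx2 := ((mem_relInterior_simplexFace T.2.1).1 (hx1 hx)).2
    have hy2 := ((mem_relInterior_simplexFace U.2.1).1 (hy1 hy)).2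
    refine h (Subtype.ext (Finset.Subset.antisymm (fun v hv => ?_) fun v hv => ?_))
    · by_contra h'
      exact (hx2 v hv).ne' (hy.2.1 v h')
    · by_contra h'
      exact (hy2 v hv).ne' (hx.2.1 v h')
  inc T U := simplexInc T.1 U.1
  inc_eq_zero T U h := simplexInc_eq_zero fun h' => h ⟨simplexFace_subset_iff.2 h'.1, by
    have := U.2.1.card_pos
    omega⟩
  inc_eq_one_or T U h h' := simplexInc_eq_one_or (simplexFace_subset_iff.1 h) (by
    have := U.2.1.card_pos
    have := T.2.1.card_pos
    omega)
  inc_edge T h := by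
    have h2 : T.1.card = 2 := by omega
    have h3 := sum_simplexInc_mul T.2.2 (fun U => if U.card = 1 then 1 else 0) (Or.inr h2.ge)
    have h4 : ∀ v ∈ T.1, ((fun U : Finset V => if U.card = 1 then (1 : ℤ) else 0) (T.1.erase v)) =
        simplexInc (T.1.erase v) ∅ := by
      intro v hv
      have h5 : (T.1.erase v).card = 1 := by rw [Finset.card_erase_of_mem hv, h2]
      obtain ⟨w, hw⟩ := Finset.card_eq_one.1 h5
      have h6 := simplexInc_erase (Finset.mem_singleton_self w)
      rw [Finset.erase_singleton] at h6
      simp [hw, h6, Finset.filter_singleton]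
    have h5 := simplexInc_square T.1 ∅
    rw [← Finset.sum_congr rfl fun v hv => congrArg (simplexInc T.1 (T.1.erase v) * ·) (h4 v hv),
      ← h3] at h5
    rw [← h5]
    refine Finset.sum_congr rfl fun U _ => ?_
    by_cases hU : U.1.card = 1
    · simp [hU]
    · rw [simplexInc_eq_zero fun h' => hU (by omega), zero_mul]
  inc_square T Y := by
    rw [sum_simplexInc_mul T.2.2 (fun U => simplexInc U Y.1) (Or.inl (by simp [simplexInc])),
      simplexInc_square]

/-- The inclusion of a face of a simplex. -/
def simplexHom {V : Type} [Fintype V] [LinearOrder V] {S S' : Finset V} (h : S ⊆ S') :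
    Hom (simplex S) (simplex S') where
  toFun T := ⟨T.1, T.2.1, T.2.2.trans h⟩
  sign _ := 1
  exists_pl := ⟨fun x => x, isPLEmbedding_id (isPolyhedron_space _), fun _ => Set.image_id' _⟩
  dim_toFun _ := rfl
  exists_face T U h := ⟨⟨U.1, U.2.1, (simplexFace_subset_iff.1 h).trans T.2.2⟩, rfl⟩
  sign_vertex _ _ := rfl
  inc_toFun T U := by simp [simplex]

/-- The one-point complex. -/
def point : OrientedBallComplex := simplex (Finset.univ : Finset (Fin 1))

/-- The unit interval, with cells its two ends and itself. -/
def interval : OrientedBallComplex := simplex (Finset.univ : Finset (Fin 2))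

/-- The end `{v}` of the unit interval. -/
def intervalEnd (v : Fin 2) : interval.Cell :=
  ⟨{v}, Finset.singleton_nonempty v, Finset.subset_univ _⟩

lemma carrier_intervalEnd (v : Fin 2) :
    interval.carrier (intervalEnd v) = {(Pi.single v 1 : Fin 2 → ℝ)} := by
  change simplexFace {v} = _
  rw [simplexFace_eq_convexHull]
  have h : (Set.range fun v' : ({v} : Finset (Fin 2)) => (Pi.single v'.1 1 : Fin 2 → ℝ)) =
      {Pi.single v 1} := by
    ext x
    simp [eq_comm]
  rw [h, convexHull_singleton]
  rfl

/-- The inclusion of `K` as the end `K × v` of the cylinder `K × I`. -/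
def endHom (K : OrientedBallComplex) (v : Fin 2) : Hom K (K.prod interval) where
  toFun σ := (σ, intervalEnd v)
  sign _ := 1
  exists_pl := by
    refine ⟨fun x => (x, Pi.single v 1), isPLEmbedding_affine (isPolyhedron_space _)
      ((AffineMap.id ℝ K.E).prod (AffineMap.const ℝ K.E (Pi.single v 1 : Fin 2 → ℝ)))
      (fun x _ y _ h => congrArg Prod.fst h), fun σ => ?_⟩
    refine Eq.trans ?_ (congrArg (fun s => K.carrier σ ×ˢ s) (carrier_intervalEnd v)).symm
    exact Set.prod_singleton.symm
  dim_toFun _ := by simp [prod, interval, intervalEnd, simplex]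
  exists_face σ p h := by
    have h1 := (prod_subset_iff K interval p (σ, intervalEnd v)).1 h
    refine ⟨p.1, Prod.ext rfl (interval.carrier_injective (Set.Subset.antisymm ?_ h1.2))⟩
    have h2 := h1.2
    intro x hx
    obtain ⟨y, hy⟩ := interval.carrier_nonempty p.2
    have h3 : x = y := ((carrier_intervalEnd v).subset hx).trans
      ((carrier_intervalEnd v).subset (h2 hy)).symm
    exact h3 ▸ hy
  sign_vertex _ _ := rfl
  inc_toFun σ τ := by
    simp [prod, inc_self]

end OrientedBallComplex

/- ### Graded categories and categories of cells -/

/-- A graded category: a category over the poset `ℤ` with a section `∅` and an involution. -/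
class GradedCategory (A : Type u) [Category.{v} A] where
  dim : A ⥤ ℤ
  inv : A ⥤ A
  empty : ℤ ⥤ A
  inv_comp_inv : inv ⋙ inv = 𝟭 A
  inv_comp_dim : inv ⋙ dim = dim
  empty_comp_inv : empty ⋙ inv = empty
  empty_comp_dim : empty ⋙ dim = 𝟭 ℤ

section

variable {A : Type u} [Category.{v} A] [GradedCategory A]

/-- The dimension of an object. -/
def gdim (X : A) : ℤ := (GradedCategory.dim : A ⥤ ℤ).obj X

variable (A) in
/-- The involution. -/
def ginv : A ⥤ A := GradedCategory.inv

variable (A) in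
/-- The empty objects `∅_n`. -/
def gempty : ℤ ⥤ A := GradedCategory.empty

lemma gdim_le {X Y : A} (f : X ⟶ Y) : gdim X ≤ gdim Y :=
  leOfHom ((GradedCategory.dim : A ⥤ ℤ).map f)

@[simp] lemma gdim_inv (X : A) : gdim ((ginv A).obj X) = gdim X :=
  Functor.congr_obj (GradedCategory.inv_comp_dim (A := A)) X

@[simp] lemma inv_obj_inv_obj (X : A) : (ginv A).obj ((ginv A).obj X) = X :=
  Functor.congr_obj (GradedCategory.inv_comp_inv (A := A)) X

lemma heq_inv_map_inv_map {X Y : A} (f : X ⟶ Y) :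
    HEq ((ginv A).map ((ginv A).map f)) f := by
  have h := Functor.congr_hom (GradedCategory.inv_comp_inv (A := A)) f
  refine (heq_of_eq h).trans ?_
  simp

@[simp] lemma inv_obj_empty (n : ℤ) : (ginv A).obj ((gempty A).obj n) = (gempty A).obj n :=
  Functor.congr_obj (GradedCategory.empty_comp_inv (A := A)) n

@[simp] lemma gdim_empty (n : ℤ) : gdim ((gempty A).obj n) = n :=
  Functor.congr_obj (GradedCategory.empty_comp_dim (A := A)) n

variable (A) in
/-- The identity for `ε = 1` and the involution for `ε = -1`. -/
def sgn (ε : ℤˣ) : A ⥤ A := if ε = 1 then 𝟭 A else ginv A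

@[simp] lemma sgn_one : sgn A 1 = 𝟭 A := if_pos rfl

@[simp] lemma sgn_neg_one : sgn A (-1) = ginv A := if_neg (by decide)

@[simp] lemma gdim_sgn (ε : ℤˣ) (X : A) : gdim ((sgn A ε).obj X) = gdim X := by
  rcases Int.units_eq_one_or ε with rfl | rfl <;> simp

end

/-- A balanced graded category: morphisms `X ⟶ Y` which raise the dimension do not see
orientations, that is, they are identified with the morphisms `X ⟶ i Y`. -/
class BalancedCategory (A : Type u) [Category.{v} A] extends GradedCategory A where
  bal : ∀ {X Y : A}, gdim X < gdim Y → (X ⟶ Y) → (X ⟶ (ginv A).obj Y)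
  comp_bal : ∀ {X Y Z : A} (f : X ⟶ Y) (g : Y ⟶ Z) (h : gdim Y < gdim Z)
    (h' : gdim X < gdim Z), bal h' (f ≫ g) = f ≫ bal h g
  bal_comp : ∀ {X Y Z : A} (f : X ⟶ Y) (g : Y ⟶ Z) (h : gdim X < gdim Y)
    (h' : gdim X < gdim Z), bal h' (f ≫ g) = bal h f ≫ (ginv A).map g
  bal_inv : ∀ {X Y : A} (f : X ⟶ Y) (h : gdim X < gdim Y)
    (h' : gdim ((ginv A).obj X) < gdim ((ginv A).obj Y)),
    bal h' ((ginv A).map f) = (ginv A).map (bal h f)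
  bal_bal : ∀ {X Y : A} (f : X ⟶ Y) (h : gdim X < gdim Y)
    (h' : gdim X < gdim ((ginv A).obj Y)), HEq (bal h' (bal h f)) f

/-- There is at most one morphism from each empty object to each object. -/
class EmptyInitial (A : Type u) [Category.{v} A] [GradedCategory A] : Prop where
  subsingleton : ∀ (n : ℤ) (X : A), Subsingleton ((gempty A).obj n ⟶ X)

/-- The functor `n ↦ n - k` on the poset `ℤ`. -/
def shift (k : ℤ) : ℤ ⥤ ℤ :=
  Monotone.functor (f := fun n => n - k) fun _ _ h => sub_le_sub_right h k

/-- A `k`-morphism of balanced graded categories: a functor which decreases the dimension by `k`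
and strictly commutes with the involution, with the empty objects and with the balancing. -/
structure GradedHom (k : ℤ) (A : Type u) [Category.{v} A] [BalancedCategory A] (B : Type u')
    [Category.{v'} B] [BalancedCategory B] where
  F : A ⥤ B
  gdim_obj : ∀ X, gdim (F.obj X) = gdim X - k
  inv_comp : ginv A ⋙ F = F ⋙ ginv B
  empty_comp : gempty A ⋙ F = shift k ⋙ gempty B
  map_bal : ∀ {X Y : A} (f : X ⟶ Y) (h : gdim X < gdim Y) (h' : gdim (F.obj X) < gdim (F.obj Y)),
    HEq (F.map (BalancedCategory.bal h f)) (BalancedCategory.bal h' (F.map f))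

namespace GradedHom

variable {A : Type u} [Category.{v} A] [BalancedCategory A] {B : Type u'} [Category.{v'} B]
  [BalancedCategory B] {C : Type u''} [Category.{v''} C] [BalancedCategory C] {k l m : ℤ}

lemma ext_F {M N : GradedHom k A B} (h : M.F = N.F) : M = N := by
  cases M; cases N; cases h; rfl

lemma obj_inv (M : GradedHom k A B) (X : A) :
    M.F.obj ((ginv A).obj X) = (ginv B).obj (M.F.obj X) :=
  Functor.congr_obj M.inv_comp X

lemma map_inv (M : GradedHom k A B) {X Y : A} (f : X ⟶ Y) :
    HEq (M.F.map ((ginv A).map f)) ((ginv B).map (M.F.map f)) := by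
  have h := Functor.congr_hom M.inv_comp f
  refine (heq_of_eq h).trans ?_
  simp

lemma obj_empty (M : GradedHom k A B) (n : ℤ) :
    M.F.obj ((gempty A).obj n) = (gempty B).obj (n - k) :=
  Functor.congr_obj M.empty_comp n

/-- The composite of a `k`-morphism and an `l`-morphism. -/
def comp (M : GradedHom k A B) (N : GradedHom l B C) (h : m = k + l) : GradedHom m A C where
  F := M.F ⋙ N.F
  gdim_obj X := by
    rw [Functor.comp_obj, N.gdim_obj, M.gdim_obj]
    omega
  inv_comp := by
    rw [← Functor.assoc, M.inv_comp, Functor.assoc, N.inv_comp, Functor.assoc]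
  empty_comp := by
    rw [← Functor.assoc, M.empty_comp, Functor.assoc, N.empty_comp, ← Functor.assoc]
    congr 1
    refine _root_.CategoryTheory.Functor.ext (fun n => ?_) fun _ _ _ => rfl
    change n - k - l = n - m
    omega
  map_bal f h1 h2 := by
    have h3 := M.map_bal f h1 (by rw [M.gdim_obj, M.gdim_obj]; omega)
    have h4 := N.map_bal (M.F.map f) (by rw [M.gdim_obj, M.gdim_obj]; omega) h2
    refine HEq.trans ?_ h4
    rw [Functor.comp_map]
    have h5 := M.obj_inv
    congr 1
    · exact h5 _

/-- The involution as a `0`-morphism. -/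
def inv (A : Type u) [Category.{v} A] [BalancedCategory A] : GradedHom 0 A A where
  F := ginv A
  gdim_obj X := by simp
  inv_comp := rfl
  empty_comp := by
    refine (GradedCategory.empty_comp_inv (A := A)).trans ?_
    conv_lhs => rw [← Functor.id_comp (GradedCategory.empty : ℤ ⥤ A)]
    change _ = _ ⋙ (GradedCategory.empty : ℤ ⥤ A)
    congr 1
    refine _root_.CategoryTheory.Functor.ext (fun n => ?_) fun _ _ _ => rfl
    change n = n - 0
    omega
  map_bal f h h' := heq_of_eq (BalancedCategory.bal_inv f h h').symm

end GradedHom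

/-- A subcomplex of a ball complex. -/
structure Subcomplex (K : OrientedBallComplex) where
  cells : Set K.Cell
  mem_of_subset : ∀ σ τ, K.carrier σ ⊆ K.carrier τ → τ ∈ cells → σ ∈ cells

/-- The empty subcomplex. -/
def Subcomplex.empty (K : OrientedBallComplex) : Subcomplex K := ⟨∅, fun _ _ _ h => h⟩

/-- The objects of the category of cells of the pair `(K, L)`: the oriented cells of `K` which do
not belong to `L`, and the empty cells `∅_n`. -/
inductive RelCell (K : OrientedBallComplex) (L : Subcomplex K) : Type
  | cell (σ : K.Cell) (h : σ ∉ L.cells) (ε : ℤˣ)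
  | empty (n : ℤ)

namespace RelCell

variable {K : OrientedBallComplex} {L : Subcomplex K}

/-- The relation underlying the category of cells. -/
protected def le : RelCell K L → RelCell K L → Prop
  | cell σ _ ε, cell τ _ δ => (σ = τ ∧ ε = δ) ∨ K.carrier σ ⊂ K.carrier τ
  | cell _ _ _, empty _ => False
  | empty m, cell τ _ _ => m < K.dim τ
  | empty m, empty n => m ≤ n

/-- The only morphisms within a dimension are identities, and the morphisms which raise the
dimension are the inclusions, irrespective of the orientations. -/
instance : Preorder (RelCell K L) where
  le := RelCell.le
  le_refl x := match x with
    | cell _ _ _ => Or.inl ⟨rfl, rfl⟩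
    | empty n => le_refl n
  le_trans x y z := match x, y, z with
    | cell σ _ ε, cell τ _ δ, cell υ _ ζ => by
      rintro (⟨rfl, rfl⟩ | h) (⟨rfl, rfl⟩ | h')
      · exact Or.inl ⟨rfl, rfl⟩
      · exact Or.inr h'
      · exact Or.inr h
      · exact Or.inr (h.trans h')
    | cell _ _ _, cell _ _ _, empty _ => fun _ h => h
    | cell _ _ _, empty _, _ => fun h => h.elim
    | empty m, cell τ _ _, cell υ _ _ => by
      rintro (h : m < _) (⟨rfl, rfl⟩ | h')
      · exact h
      · have := K.dim_lt _ _ h'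
        change m < _
        omega
    | empty _, cell _ _ _, empty _ => fun _ h => h.elim
    | empty m, empty n, cell τ _ _ => fun (h : m ≤ n) (h' : n < _) => h.trans_lt h'
    | empty m, empty n, empty o => fun (h : m ≤ n) (h' : n ≤ o) => h.trans h'

/-- The dimension of a cell. -/
def dim : RelCell K L → ℤ
  | cell σ _ _ => K.dim σ
  | empty n => n

/-- The cell with the opposite orientation. -/
def neg : RelCell K L → RelCell K L
  | cell σ h ε => cell σ h (-ε)
  | empty n => empty n

lemma dim_mono : Monotone (dim : RelCell K L → ℤ) := by
  rintro (⟨σ, hσ, ε⟩ | m) (⟨τ, hτ, δ⟩ | n) h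
  · rcases h with ⟨rfl, rfl⟩ | h
    · exact le_rfl
    · exact Int.ofNat_le.2 (K.dim_lt _ _ h).le
  · exact h.elim
  · exact (show m < _ from h).le
  · exact h

lemma neg_mono : Monotone (neg : RelCell K L → RelCell K L) := by
  rintro (⟨σ, hσ, ε⟩ | m) (⟨τ, hτ, δ⟩ | n) h
  · rcases h with ⟨rfl, rfl⟩ | h
    · exact Or.inl ⟨rfl, rfl⟩
    · exact Or.inr h
  · exact h.elim
  · exact h
  · exact h

lemma le_neg {x y : RelCell K L} (h : x ≤ y) (h' : dim x < dim y) : x ≤ neg y := by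
  rcases x with ⟨σ, hσ, ε⟩ | m <;> rcases y with ⟨τ, hτ, δ⟩ | n
  · rcases h with ⟨rfl, rfl⟩ | h
    · exact absurd h' (lt_irrefl _)
    · exact Or.inr h
  · exact h.elim
  · exact h
  · exact h

lemma neg_neg (x : RelCell K L) : neg (neg x) = x := by
  rcases x with ⟨σ, hσ, ε⟩ | m
  · simp [neg]
  · rfl

lemma thin_heq {X Y X' Y' : RelCell K L} (h : X = X') (h' : Y = Y') (f : X ⟶ Y)
    (g : X' ⟶ Y') : HEq f g := by
  subst h
  subst h'
  exact heq_of_eq (Subsingleton.elim _ _)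

lemma functor_ext {C : Type u} [Category.{v} C] [Quiver.IsThin C] {F G : C ⥤ RelCell K L}
    (h : ∀ X, F.obj X = G.obj X) : F = G :=
  _root_.CategoryTheory.Functor.ext h fun _ _ _ => Subsingleton.elim _ _

instance : GradedCategory (RelCell K L) where
  dim := dim_mono.functor
  inv := neg_mono.functor
  empty := Monotone.functor (f := RelCell.empty) fun _ _ h => h
  inv_comp_inv := functor_ext neg_neg
  inv_comp_dim := _root_.CategoryTheory.Functor.ext (fun x => by cases x <;> rfl)
    fun _ _ _ => Subsingleton.elim _ _
  empty_comp_inv := functor_ext fun _ => rfl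
  empty_comp_dim := rfl

instance : BalancedCategory (RelCell K L) where
  bal h f := homOfLE (le_neg (leOfHom f) h)
  comp_bal _ _ _ _ := Subsingleton.elim _ _
  bal_comp _ _ _ _ := Subsingleton.elim _ _
  bal_inv _ _ _ := Subsingleton.elim _ _
  bal_bal {X Y} f h h' :=
     thin_heq rfl (inv_obj_inv_obj Y) _ _

end RelCell

/-- The category of cells of `K`. -/
abbrev OrCell (K : OrientedBallComplex) : Type := RelCell K (Subcomplex.empty K)

/-- The oriented cell `(σ, ε)` of `K`. -/
abbrev OrCell.mk {K : OrientedBallComplex} (σ : K.Cell) (ε : ℤˣ) : OrCell K :=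
  RelCell.cell σ (Set.notMem_empty σ) ε

/-- The `k`-morphisms between categories of cells are determined by their values on objects. -/
def RelCell.gradedHom {K K' : OrientedBallComplex} {L : Subcomplex K} {L' : Subcomplex K'} (k : ℤ)
    (f : RelCell K L → RelCell K' L') (h : Monotone f) (h1 : ∀ x, (f x).dim = x.dim - k)
    (h2 : ∀ x, f x.neg = (f x).neg) (h3 : ∀ n, f (.empty n) = .empty (n - k)) :
    GradedHom k (RelCell K L) (RelCell K' L') where
  F := h.functor
  gdim_obj := h1
  inv_comp := RelCell.functor_ext h2
  empty_comp := RelCell.functor_ext h3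
  map_bal {X Y} g _ _ :=
     RelCell.thin_heq rfl (h2 Y) _ _

/- ### Ad theories -/

section

/-- The `K`-preads of degree `k` in `A`. -/
abbrev Pre (A : Type u) [Category.{v} A] [BalancedCategory A] (K : OrientedBallComplex) (k : ℤ) :
    Type (max u v) :=
  GradedHom k (OrCell K) A

/-- The `0`-morphism of categories of cells induced by a morphism of ball complexes. -/
def OrientedBallComplex.Hom.cellHom {K L : OrientedBallComplex}
    (f : OrientedBallComplex.Hom K L) : GradedHom 0 (OrCell K) (OrCell L) :=
  RelCell.gradedHom 0
    (fun x => match x with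
      | .cell σ _ ε => OrCell.mk (f.toFun σ) (f.sign σ * ε)
      | .empty n => .empty n)
    (by
      rintro (⟨σ, _, ε⟩ | m) (⟨τ, _, δ⟩ | n) h
      · rcases h with ⟨rfl, rfl⟩ | h
        · exact Or.inl ⟨rfl, rfl⟩
        · exact Or.inr ((f.carrier_ssubset_iff σ τ).2 h)
      · exact h.elim
      · change m < (L.dim (f.toFun τ) : ℤ)
        rw [f.dim_toFun]
        exact h
      · exact h)
    (by
      rintro (⟨σ, _, ε⟩ | n)
      · change (L.dim (f.toFun σ) : ℤ) = K.dim σ - 0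
        rw [f.dim_toFun, sub_zero]
      · exact (sub_zero n).symm)
    (by
      rintro (⟨σ, _, ε⟩ | n)
      · change OrCell.mk (f.toFun σ) (f.sign σ * -ε) = OrCell.mk (f.toFun σ) (-(f.sign σ * ε))
        rw [mul_neg]
      · rfl)
    (fun n => by rw [sub_zero])

open Classical in
/-- The projection to the quotient category, which identifies the cells of `L` with the empty
cells. -/
def quotientHom (K : OrientedBallComplex) (L : Subcomplex K) :
    GradedHom 0 (OrCell K) (RelCell K L) :=
  RelCell.gradedHom 0
    (fun x => match x with
      | .cell σ _ ε => if h : σ ∈ L.cells then .empty (K.dim σ) else .cell σ h ε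
      | .empty n => .empty n)
    (by
      rintro (⟨σ, _, ε⟩ | m) (⟨τ, _, δ⟩ | n) h
      · rcases h with ⟨rfl, rfl⟩ | h
        · exact le_rfl
        · dsimp only
          have h1 := K.dim_lt _ _ h
          split_ifs with h2 h3 h3
          · exact Int.ofNat_le.2 h1.le
          · exact Int.ofNat_lt.2 h1
          · exact absurd (L.mem_of_subset _ _ h.subset h3) h2
          · exact Or.inr h
      · exact h.elim
      · dsimp only
        split_ifs with h2
        · exact (show m < _ from h).le
        · exact h
      · exact h)
    (by
      rintro (⟨σ, _, ε⟩ | n)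
      · dsimp only
        split_ifs with h2 <;> exact (sub_zero _).symm
      · exact (sub_zero n).symm)
    (by
      rintro (⟨σ, _, ε⟩ | n)
      · dsimp only [RelCell.neg]
        split_ifs with h2 <;> rfl
      · rfl)
    (fun n => by rw [sub_zero])

/-- The incidence numbers of oriented cells. -/
def RelCell.inc {K : OrientedBallComplex} {L : Subcomplex K} : RelCell K L → RelCell K L → ℤ
  | .cell σ _ ε, .cell τ _ δ => ε * δ * K.inc σ τ
  | _, _ => 0

section

variable {A : Type u} [Category.{v} A] [BalancedCategory A]

namespace Pre

/-- The restriction of a pread along a morphism of ball complexes. -/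
def pull {K L : OrientedBallComplex} {k : ℤ} (M : Pre A L k) (f : OrientedBallComplex.Hom K L) :
    Pre A K k :=
  f.cellHom.comp M (zero_add k).symm

/-- The pread with the opposite orientation. -/
def neg {K : OrientedBallComplex} {k : ℤ} (M : Pre A K k) : Pre A K k :=
  M.comp (GradedHom.inv A) (add_zero k).symm

lemma heq_of_empty [EmptyInitial A] {m n : ℤ} {X Y : A} (h : m = n) (h' : X = Y)
    (f : (gempty A).obj m ⟶ X) (g : (gempty A).obj n ⟶ Y) : HEq f g := by
  subst h
  subst h'
  have := EmptyInitial.subsingleton m X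
  exact heq_of_eq (Subsingleton.elim _ _)

variable (A) in
/-- The pread which takes every oriented cell to `∅`. -/
def trivial [EmptyInitial A] (K : OrientedBallComplex) (k : ℤ) : Pre A K k where
  F := GradedCategory.dim ⋙ shift k ⋙ gempty A
  gdim_obj X := gdim_empty _
  inv_comp := by
    have h1 : ginv (OrCell K) ⋙ GradedCategory.dim = GradedCategory.dim :=
      GradedCategory.inv_comp_dim
    have h2 : gempty A ⋙ ginv A = gempty A := GradedCategory.empty_comp_inv
    rw [← Functor.assoc, h1, Functor.assoc, Functor.assoc, h2]
  empty_comp := by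
    have h1 : gempty (OrCell K) ⋙ GradedCategory.dim = 𝟭 ℤ := GradedCategory.empty_comp_dim
    rw [← Functor.assoc, h1, Functor.id_comp]
  map_bal {_ Y} _ _ _ := by
    have h1 : gdim ((ginv (OrCell K)).obj Y) = gdim Y := gdim_inv Y
    refine heq_of_empty rfl ?_ _ _
    refine Eq.trans ?_ (inv_obj_empty (A := A) (gdim Y - k)).symm
    exact congrArg (fun n => (gempty A).obj (n - k)) h1

end Pre

/-- A graded monoidal category: the tensor product adds dimensions, and it is strictly compatible
with the involution, with the empty objects and with the balancing in each variable. -/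
class GradedMonoidalCategory (A : Type u) [Category.{v} A] [BalancedCategory A]
    [MonoidalCategory A] : Prop where
  gdim_tensor : ∀ X Y : A, gdim (X ⊗ Y) = gdim X + gdim Y
  gdim_unit : gdim (𝟙_ A) = 0
  inv_tensor : ∀ X Y : A, (ginv A).obj X ⊗ Y = (ginv A).obj (X ⊗ Y)
  tensor_inv : ∀ X Y : A, X ⊗ (ginv A).obj Y = (ginv A).obj (X ⊗ Y)
  empty_tensor : ∀ (n : ℤ) (X : A), (gempty A).obj n ⊗ X = (gempty A).obj (n + gdim X)
  tensor_empty : ∀ (X : A) (n : ℤ), X ⊗ (gempty A).obj n = (gempty A).obj (gdim X + n)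
  inv_whiskerRight : ∀ {X Y : A} (f : X ⟶ Y) (Z : A),
    HEq ((ginv A).map f ▷ Z) ((ginv A).map (f ▷ Z))
  whiskerRight_inv : ∀ {X Y : A} (f : X ⟶ Y) (Z : A),
    HEq (f ▷ (ginv A).obj Z) ((ginv A).map (f ▷ Z))
  whiskerLeft_inv : ∀ {X Y : A} (Z : A) (f : X ⟶ Y),
    HEq (Z ◁ (ginv A).map f) ((ginv A).map (Z ◁ f))
  inv_whiskerLeft : ∀ {X Y : A} (Z : A) (f : X ⟶ Y),
    HEq ((ginv A).obj Z ◁ f) ((ginv A).map (Z ◁ f))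
  bal_whiskerRight : ∀ {X Y : A} (f : X ⟶ Y) (Z : A) (h : gdim X < gdim Y)
    (h' : gdim (X ⊗ Z) < gdim (Y ⊗ Z)),
    HEq (BalancedCategory.bal h f ▷ Z) (BalancedCategory.bal h' (f ▷ Z))
  whiskerLeft_bal : ∀ {X Y : A} (Z : A) (f : X ⟶ Y) (h : gdim X < gdim Y)
    (h' : gdim (Z ⊗ X) < gdim (Z ⊗ Y)),
    HEq (Z ◁ BalancedCategory.bal h f) (BalancedCategory.bal h' (Z ◁ f))
  inv_associator : ∀ X Y Z : A, HEq (α_ ((ginv A).obj X) Y Z).hom ((ginv A).map (α_ X Y Z).hom)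
  associator_inv : ∀ X Y Z : A, HEq (α_ X ((ginv A).obj Y) Z).hom ((ginv A).map (α_ X Y Z).hom)
  associator_inv' : ∀ X Y Z : A, HEq (α_ X Y ((ginv A).obj Z)).hom ((ginv A).map (α_ X Y Z).hom)
  leftUnitor_inv : ∀ X : A, HEq (λ_ ((ginv A).obj X)).hom ((ginv A).map (λ_ X).hom)
  rightUnitor_inv : ∀ X : A, HEq (ρ_ ((ginv A).obj X)).hom ((ginv A).map (ρ_ X).hom)

/-- The sign `(-1)^n`. -/
abbrev psign (n : ℤ) : ℤˣ := n.negOnePow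

lemma sgn_tensor [MonoidalCategory A] [GradedMonoidalCategory A] (ε : ℤˣ) (X Y : A) :
    (sgn A ε).obj X ⊗ Y = (sgn A ε).obj (X ⊗ Y) := by
  rcases Int.units_eq_one_or ε with rfl | rfl
  · simp
  · simpa using GradedMonoidalCategory.inv_tensor X Y

end

/-- A graded symmetric monoidal category: the commutativity isomorphism is natural, symmetric and
coherent up to the usual signs, the sign `(-1)^{dim X dim Y}` being realized by the involution. -/
class GradedSymmetricCategory (A : Type u) [Category.{v} A] [BalancedCategory A]
    [MonoidalCategory A] extends GradedMonoidalCategory A where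
  braid : ∀ X Y : A, X ⊗ Y ≅ (sgn A (psign (gdim X * gdim Y))).obj (Y ⊗ X)
  inv_braid : ∀ X Y : A,
    HEq (braid ((ginv A).obj X) Y).hom ((ginv A).map (braid X Y).hom)
  braid_inv : ∀ X Y : A,
    HEq (braid X ((ginv A).obj Y)).hom ((ginv A).map (braid X Y).hom)
  braid_natural : ∀ {X X' : A} (f : X ⟶ X') (Y : A),
    psign (gdim X * gdim Y) = psign (gdim X' * gdim Y) →
    HEq (f ▷ Y ≫ (braid X' Y).hom)
      ((braid X Y).hom ≫ (sgn A (psign (gdim X * gdim Y))).map (Y ◁ f))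
  braid_natural' : ∀ {X X' : A} (f : X ⟶ X') (Y : A),
    psign (gdim X * gdim Y) ≠ psign (gdim X' * gdim Y) →
    ∀ h : gdim (X ⊗ Y) < gdim ((sgn A (psign (gdim X * gdim Y))).obj (Y ⊗ X')),
    HEq (f ▷ Y ≫ (braid X' Y).hom)
      (BalancedCategory.bal h
        ((braid X Y).hom ≫ (sgn A (psign (gdim X * gdim Y))).map (Y ◁ f)))
  symmetry : ∀ X Y : A,
    HEq ((braid X Y).hom ≫ (sgn A (psign (gdim X * gdim Y))).map (braid Y X).hom) (𝟙 (X ⊗ Y))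
  hexagon : ∀ X Y Z : A,
    HEq ((α_ X Y Z).hom ≫ (braid X (Y ⊗ Z)).hom ≫
        (sgn A (psign (gdim X * gdim (Y ⊗ Z)))).map (α_ Y Z X).hom)
      ((braid X Y).hom ▷ Z ≫ eqToHom (sgn_tensor (psign (gdim X * gdim Y)) (Y ⊗ X) Z) ≫
        (sgn A (psign (gdim X * gdim Y))).map ((α_ Y X Z).hom ≫ Y ◁ (braid X Z).hom))

variable {A : Type u} [Category.{v} A] [BalancedCategory A]

/-- An ad theory: a distinguished set of preads for each ball complex and each degree. -/
structure AdTheory (A : Type u) [Category.{v} A] [BalancedCategory A] [EmptyInitial A] where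
  ad : ∀ (K : OrientedBallComplex) (k : ℤ), Set (Pre A K k)
  pull_mem : ∀ {K L : OrientedBallComplex} (f : OrientedBallComplex.Hom K L) {k : ℤ}
    {M : Pre A L k}, M ∈ ad L k → M.pull f ∈ ad K k
  neg_mem : ∀ {K : OrientedBallComplex} {k : ℤ} {M : Pre A K k}, M ∈ ad K k → M.neg ∈ ad K k
  pointed : ∀ (K : OrientedBallComplex) (k : ℤ), Pre.trivial A K k ∈ ad K k
  full : ∀ {K : OrientedBallComplex} {k : ℤ} {M N : Pre A K k}, M ∈ ad K k →
    (∃ α : M.F ≅ N.F, ∀ x, HEq (α.hom.app ((ginv (OrCell K)).obj x)) ((ginv A).map (α.hom.app x))) →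
    N ∈ ad K k
  isLocal : ∀ {K : OrientedBallComplex} {k : ℤ} (M : Pre A K k),
    (∀ σ : K.Cell, M.pull (K.closedCellHom σ) ∈ ad (K.closedCell σ) k) → M ∈ ad K k
  gluing : ∀ {K K' : OrientedBallComplex} (φ : K'.E ≃ₗ[ℝ] K.E), φ '' K'.space = K.space →
    (∀ σ' : K'.Cell, ∃ σ : K.Cell, φ '' K'.carrier σ' ⊆ K.carrier σ) →
    ∀ {k : ℤ} {M : Pre A K' k}, M ∈ ad K' k → ∃ N ∈ ad K k,
      ∀ {L : OrientedBallComplex} (a : OrientedBallComplex.Hom L K)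
        (b : OrientedBallComplex.Hom L K'),
        (∀ σ, K.carrier (a.toFun σ) = φ '' K'.carrier (b.toFun σ)) → N.pull a = M.pull b
  cylinder : ∃ J : ∀ (K : OrientedBallComplex) (k : ℤ),
      ad K k → ad (K.prod OrientedBallComplex.interval) k,
    (∀ {K L : OrientedBallComplex} (f : OrientedBallComplex.Hom K L) (k : ℤ) (M : ad L k),
      (J K k ⟨M.1.pull f, pull_mem f M.2⟩).1 =
        (J L k M).1.pull (f.prod (.id OrientedBallComplex.interval))) ∧
    (∀ (K : OrientedBallComplex) (k : ℤ) (M : ad K k) (v : Fin 2),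
      (J K k M).1.pull (K.endHom v) = M.1) ∧
    (∀ (K : OrientedBallComplex) (k : ℤ),
      (J K k ⟨Pre.trivial A K k, pointed K k⟩).1 = Pre.trivial A _ k)
  stable : ∀ {K₀ K₁ : OrientedBallComplex} {L₀ : Subcomplex K₀} {L₁ : Subcomplex K₁} {k : ℤ}
    (θ : GradedHom k (RelCell K₀ L₀) (RelCell K₁ L₁)),
    (∃ θ' : RelCell K₁ L₁ ⥤ RelCell K₀ L₀, θ.F ⋙ θ' = 𝟭 _ ∧ θ' ⋙ θ.F = 𝟭 _) →
    (∀ x y, (θ.F.obj x).inc (θ.F.obj y) = x.inc y) →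
    ∀ {l : ℤ} (M : GradedHom l (RelCell K₁ L₁) A),
      (quotientHom K₁ L₁).comp M (zero_add l).symm ∈ ad K₁ l →
      (quotientHom K₀ L₀).comp (θ.comp M (m := k + l) rfl) (zero_add _).symm ∈ ad K₀ (k + l)

/-- The pread `H` is the external product of the preads `F` and `G`.  The product of the oriented
cells `(σ, ε₁)` and `(τ, ε₂)` is `(σ × τ, ε₁ ε₂)`; as `G` has to pass the degree of `F` there is a
sign. -/
structure IsProd [MonoidalCategory A] {K L : OrientedBallComplex} {k l : ℤ} (F : Pre A K k)
    (G : Pre A L l) (H : Pre A (K.prod L) (k + l)) : Prop where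
  obj : ∀ (σ : K.Cell) (τ : L.Cell) (ε₁ ε₂ : ℤˣ),
    H.F.obj (OrCell.mk (K := K.prod L) (σ, τ) (ε₁ * ε₂ * psign (k * L.dim τ))) =
      F.F.obj (OrCell.mk σ ε₁) ⊗ G.F.obj (OrCell.mk τ ε₂)
  map : ∀ (σ σ' : K.Cell) (τ τ' : L.Cell) (ε₁ ε₂ ε₁' ε₂' : ℤˣ)
    (f : OrCell.mk σ ε₁ ⟶ OrCell.mk σ' ε₁') (g : OrCell.mk τ ε₂ ⟶ OrCell.mk τ' ε₂')
    (h : OrCell.mk (K := K.prod L) (σ, τ) (ε₁ * ε₂ * psign (k * L.dim τ)) ⟶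
      OrCell.mk (K := K.prod L) (σ', τ') (ε₁' * ε₂' * psign (k * L.dim τ'))),
    HEq (H.F.map h) (F.F.map f ⊗ₘ G.F.map g)

/-- A multiplicative ad theory: external products of ads are ads, and the unit object gives an ad
on the point. -/
structure MultiplicativeAdTheory (A : Type u) [Category.{v} A] [BalancedCategory A]
    [EmptyInitial A] [MonoidalCategory A] [GradedSymmetricCategory A] extends AdTheory A where
  unit_mem : ∃ e ∈ ad OrientedBallComplex.point 0,
    ∀ σ, e.F.obj (OrCell.mk σ 1) = 𝟙_ A
  prod_mem : ∀ {K L : OrientedBallComplex} {k l : ℤ} {F : Pre A K k} {G : Pre A L l},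
    F ∈ ad K k → G ∈ ad L l → ∃ H ∈ ad (K.prod L) (k + l), IsProd F G H

/-- A `*`-ad, of arbitrary dimension. -/
structure StarAd [EmptyInitial A] (T : AdTheory A) where
  dim : ℤ
  pread : Pre A OrientedBallComplex.point (-dim)
  mem : pread ∈ T.ad _ _

end

/- ### Objects with singularities -/

section

open OrientedBallComplex (simplex)

/-- The inclusion of a face of a simplex, on the level of oriented cells. -/
def faceHom {V : Type} [Fintype V] [LinearOrder V] {S S' : Finset V} (h : S ⊆ S') :
    GradedHom 0 (OrCell (simplex S)) (OrCell (simplex S')) :=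
  RelCell.gradedHom 0
    (fun x => match x with
      | .cell τ _ ε => OrCell.mk (K := simplex S') ⟨τ.1, τ.2.1, τ.2.2.trans h⟩ ε
      | .empty n => .empty n)
    (by
      rintro (⟨σ, _, ε⟩ | m) (⟨τ, _, δ⟩ | n) h
      · rcases h with ⟨rfl, rfl⟩ | h
        · exact Or.inl ⟨rfl, rfl⟩
        · exact Or.inr h
      · exact h.elim
      · exact h
      · exact h)
    (by
      rintro (⟨σ, _, ε⟩ | n)
      · exact (sub_zero _).symm
      · exact (sub_zero n).symm)
    (by
      rintro (⟨σ, _, ε⟩ | n)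
      · rfl
      · rfl)
    (fun n => by rw [sub_zero])

variable {A : Type u} [Category.{v} A] [BalancedCategory A] [EmptyInitial A] [MonoidalCategory A]
  [GradedSymmetricCategory A] {T : AdTheory A}

/-- The object of `A` given by a `*`-ad and an orientation of the point. -/
def StarAd.obj (p : StarAd T) (ε : ℤˣ) : A :=
  p.pread.F.obj (OrCell.mk (K := OrientedBallComplex.point) ⟨Finset.univ, ⟨0, by simp⟩, subset_rfl⟩ ε)

lemma StarAd.gdim_obj (p : StarAd T) (ε : ℤˣ) : gdim (p.obj ε) = p.dim := by
  refine (p.pread.gdim_obj _).trans ?_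
  change ((Finset.univ : Finset (Fin 1)).card - 1 : ℕ) - -p.dim = p.dim
  simp

section

variable {n : ℕ} (P : Fin n → StarAd T)

/-- The sum of the dimensions of the singularities `P_i` with `i` not in `σ`. -/
def miss (σ : Finset (Fin (n + 1))) : ℤ := ∑ a with a.succ ∉ σ, (P a).dim

/-- The sign which arises when `P_i` is moved past those later singularities which already belong
to `M_σ`. -/
def orSign (σ : Finset (Fin (n + 1))) (a : Fin n) : ℤˣ :=
  psign ((P a).dim * ∑ b with a < b ∧ b.succ ∉ σ, (P b).dim)

/-- `σ' = (σ, i)` for the vertex `i` belonging to the index `a`. -/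
structure IsFace (a : Fin n) (σ σ' : Finset (Fin (n + 1))) : Prop where
  notMem : a.succ ∉ σ
  eq : σ' = insert a.succ σ

lemma IsFace.subset {a : Fin n} {σ σ' : Finset (Fin (n + 1))} (h : IsFace a σ σ') : σ ⊆ σ' :=
  h.eq ▸ Finset.subset_insert _ _

lemma IsFace.miss_eq {a : Fin n} {σ σ' : Finset (Fin (n + 1))} (h : IsFace a σ σ') :
    miss P σ = miss P σ' + (P a).dim := by
  have h1 : (Finset.univ.filter fun b : Fin n => b.succ ∉ σ) =
      insert a (Finset.univ.filter fun b : Fin n => b.succ ∉ σ') := by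
    ext b
    have := h.notMem
    by_cases hb : b = a <;> simp [h.eq, hb, this]
  rw [miss, miss, h1, Finset.sum_insert, add_comm]
  simp [h.eq]

/-- The passage from oriented cells of `σ` to oriented cells of `(σ, i)`. -/
abbrev IsFace.cell {a : Fin n} {σ σ' : Finset (Fin (n + 1))} (h : IsFace a σ σ')
    (x : OrCell (simplex σ)) : OrCell (simplex σ') :=
  (faceHom h.subset).F.obj x

/-- The objects of the category of objects with singularities: preads `M_σ` on the faces `σ` of
`Δ^n` which are empty on the cells not containing the vertex `0`, together with isomorphisms
`f_{σ,i} : ∂_i M_{(σ,i)} ≅ M_σ ⊗ P_i` of preads.  The number `dim` is the dimension of the pread on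
the top face `Δ^n`, that is, the negative of its degree. -/
structure SingObj : Type (max u v) where
  dim : ℤ
  pre : ∀ σ : Finset (Fin (n + 1)), Pre A (simplex σ) (miss P σ - dim)
  pre_eq_empty : ∀ (σ : Finset (Fin (n + 1))) (τ : (simplex σ).Cell) (ε : ℤˣ), 0 ∉ τ.1 →
    (pre σ).F.obj (OrCell.mk τ ε) = (gempty A).obj ((simplex σ).dim τ - (miss P σ - dim))
  glue : ∀ {a : Fin n} {σ σ' : Finset (Fin (n + 1))} (h : IsFace a σ σ') (x : OrCell (simplex σ)),
    (pre σ').F.obj (h.cell x) ≅ (pre σ).F.obj x ⊗ (P a).obj (orSign P σ a)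
  glue_natural : ∀ {a : Fin n} {σ σ' : Finset (Fin (n + 1))} (h : IsFace a σ σ')
    {x y : OrCell (simplex σ)} (f : x ⟶ y),
    (pre σ').F.map ((faceHom h.subset).F.map f) ≫ (glue h y).hom =
      (glue h x).hom ≫ (pre σ).F.map f ▷ (P a).obj (orSign P σ a)
  glue_neg : ∀ {a : Fin n} {σ σ' : Finset (Fin (n + 1))} (h : IsFace a σ σ')
    (x : OrCell (simplex σ)), HEq (glue h x.neg).hom ((ginv A).map (glue h x).hom)
  glue_square : ∀ {a b : Fin n} {σ σa σb ρ : Finset (Fin (n + 1))} (ha : IsFace a σ σa)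
    (hb : IsFace b σ σb) (hab : IsFace b σa ρ) (hba : IsFace a σb ρ) (x : OrCell (simplex σ)),
    HEq ((glue hab (ha.cell x)).hom ≫ (glue ha x).hom ▷ (P b).obj (orSign P σa b) ≫
        (α_ _ _ _).hom ≫ (pre σ).F.obj x ◁
          (GradedSymmetricCategory.braid ((P a).obj (orSign P σ a)) ((P b).obj (orSign P σa b))).hom)
      ((glue hba (hb.cell x)).hom ≫ (glue hb x).hom ▷ (P a).obj (orSign P σb a) ≫ (α_ _ _ _).hom)

variable {P}

namespace SingObj

/-- The morphisms of the category of objects with singularities: morphisms of preads which commute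
with the given isomorphisms. -/
@[ext]
structure Hom (M N : SingObj P) : Type v where
  app : ∀ (σ : Finset (Fin (n + 1))) (x : OrCell (simplex σ)),
    (M.pre σ).F.obj x ⟶ (N.pre σ).F.obj x
  natural : ∀ (σ : Finset (Fin (n + 1))) {x y : OrCell (simplex σ)} (f : x ⟶ y),
    (M.pre σ).F.map f ≫ app σ y = app σ x ≫ (N.pre σ).F.map f
  app_neg : ∀ (σ : Finset (Fin (n + 1))) (x : OrCell (simplex σ)),
    HEq (app σ x.neg) ((ginv A).map (app σ x))
  comm : ∀ {a : Fin n} {σ σ' : Finset (Fin (n + 1))} (h : IsFace a σ σ') (x : OrCell (simplex σ)),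
    (M.glue h x).hom ≫ app σ x ▷ (P a).obj (orSign P σ a) = app σ' (h.cell x) ≫ (N.glue h x).hom

lemma map_comp_heq {X Y Z X' Y' Z' : A} {f : X ⟶ Y} {g : Y ⟶ Z} {f' : X' ⟶ Y'} {g' : Y' ⟶ Z'}
    (h : X = X') (h1 : Y = Y') (h2 : Z = Z') (h3 : HEq f f') (h4 : HEq g g') :
    HEq (f ≫ g) (f' ≫ g') := by
  subst h
  subst h1
  subst h2
  cases h3
  cases h4
  rfl

lemma pre_obj_neg (M : SingObj P) (σ : Finset (Fin (n + 1))) (x : OrCell (simplex σ)) :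
    (M.pre σ).F.obj x.neg = (ginv A).obj ((M.pre σ).F.obj x) :=
  (M.pre σ).obj_inv x

instance : Category (SingObj P) where
  Hom := Hom
  id M :=
    { app := fun σ x => 𝟙 _
      natural := fun σ x y f => by simp
      app_neg := fun σ x => by
        rw [_root_.CategoryTheory.Functor.map_id, M.pre_obj_neg]
      comm := fun h x => by simp }
  comp {M N O} f g :=
    { app := fun σ x => f.app σ x ≫ g.app σ x
      natural := fun σ x y φ => by
        rw [← Category.assoc, f.natural, Category.assoc, g.natural, Category.assoc]
      app_neg := fun σ x => by
        rw [Functor.map_comp]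
        exact map_comp_heq (M.pre_obj_neg σ x) (N.pre_obj_neg σ x) (O.pre_obj_neg σ x)
          (f.app_neg σ x) (g.app_neg σ x)
      comm := fun h x => by
        rw [comp_whiskerRight, ← Category.assoc, f.comm, Category.assoc, g.comm, Category.assoc] }
  id_comp f := Hom.ext (funext₂ fun σ x => Category.id_comp _)
  comp_id f := Hom.ext (funext₂ fun σ x => Category.comp_id _)
  assoc f g h := Hom.ext (funext₂ fun σ x => Category.assoc _ _ _)

lemma dim_le {M N : SingObj P} (f : M ⟶ N) : M.dim ≤ N.dim := by
  have h := gdim_le (f.app Finset.univ (.empty 0))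
  rw [(M.pre _).gdim_obj, (N.pre _).gdim_obj] at h
  omega

lemma gdim_lt {M N : SingObj P} (h : M.dim < N.dim) (σ : Finset (Fin (n + 1)))
    (x : OrCell (simplex σ)) : gdim ((M.pre σ).F.obj x) < gdim ((N.pre σ).F.obj x) := by
  rw [(M.pre _).gdim_obj, (N.pre _).gdim_obj]
  omega

lemma trivial_obj_neg {K : OrientedBallComplex} (k : ℤ) (x : OrCell K) :
    (Pre.trivial A K k).F.obj x.neg = (Pre.trivial A K k).F.obj x :=
  congrArg (fun n => (gempty A).obj (n - k)) (gdim_inv x)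

lemma heq_of_empty_eq {K : OrientedBallComplex} {k : ℤ} (x : OrCell K) {X Y X' Y' : A}
    (h : X = (Pre.trivial A K k).F.obj x) (h' : X' = X) (h2 : Y = Y') (f : X ⟶ Y) (g : X' ⟶ Y') :
    HEq f g := by
  subst h'
  subst h
  exact Pre.heq_of_empty rfl h2 f g

lemma functor_map_heq {K : OrientedBallComplex} {k : ℤ} (M : Pre A K k) {x y x' y' : OrCell K}
    (h : x = x') (h' : y = y') (f : x ⟶ y) (g : x' ⟶ y') : HEq (M.F.map f) (M.F.map g) := by
  subst h
  subst h'
  rw [Subsingleton.elim f g]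

lemma ext_heq {M N : SingObj P} (h : M.dim = N.dim)
    (h1 : ∀ σ x, (M.pre σ).F.obj x = (N.pre σ).F.obj x)
    (h2 : ∀ σ {x y : OrCell (simplex σ)} (f : x ⟶ y), HEq ((M.pre σ).F.map f) ((N.pre σ).F.map f))
    (h3 : ∀ {a : Fin n} {σ σ' : Finset (Fin (n + 1))} (h : IsFace a σ σ') (x : OrCell (simplex σ)),
      HEq (M.glue h x).hom (N.glue h x).hom) : M = N := by
  obtain ⟨d, p, p1, g, g1, g2, g3⟩ := M
  obtain ⟨d', p', p1', g', g1', g2', g3'⟩ := N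
  obtain rfl : d = d' := h
  obtain rfl : p = p' := funext fun σ =>
    GradedHom.ext_F (_root_.CategoryTheory.Functor.hext (h1 σ) fun _ _ f => h2 σ f)
  have e : @g = @g' := by
    funext a σ σ' h x
    exact Iso.ext (eq_of_heq (h3 h x))
  subst e
  rfl

lemma hom_heq {M N M' N' : SingObj P} (h : M = M') (h' : N = N') (f : M ⟶ N) (g : M' ⟶ N')
    (h1 : ∀ σ x, HEq (f.app σ x) (g.app σ x)) : HEq f g := by
  subst h
  subst h'
  exact heq_of_eq (Hom.ext (funext₂ fun σ x => eq_of_heq (h1 σ x)))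

/-- The object with the opposite orientation. -/
def neg (M : SingObj P) : SingObj P where
  dim := M.dim
  pre σ := (GradedHom.inv (OrCell (simplex σ))).comp (M.pre σ) (zero_add _).symm
  pre_eq_empty σ τ ε h := M.pre_eq_empty σ τ (-ε) h
  glue h x := match x with
    | .cell τ h' ε => M.glue h (.cell τ h' (-ε))
    | .empty n => M.glue h (.empty n)
  glue_natural h x y f := by
    rcases x with ⟨σ, _, ε⟩ | m <;> rcases y with ⟨τ, _, δ⟩ | n <;>
      exact M.glue_natural h ((ginv (OrCell (simplex _))).map f)
  glue_neg h x := match x with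
    | .cell τ h' ε => M.glue_neg h (.cell τ h' (-ε))
    | .empty n => M.glue_neg h (.empty n)
  glue_square ha hb hab hba x := match x with
    | .cell τ h' ε => M.glue_square ha hb hab hba (.cell τ h' (-ε))
    | .empty n => M.glue_square ha hb hab hba (.empty n)

/-- The empty object. -/
def emptyObj (P : Fin n → StarAd T) (m : ℤ) : SingObj P where
  dim := m
  pre σ := Pre.trivial A (simplex σ) (miss P σ - m)
  pre_eq_empty σ τ ε h := rfl
  glue {a σ σ'} h x := eqToIso (by
    change (gempty A).obj (gdim (h.cell x) - _) = (gempty A).obj (gdim x - _) ⊗ _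
    rw [GradedMonoidalCategory.empty_tensor, StarAd.gdim_obj, (faceHom h.subset).gdim_obj,
      h.miss_eq]
    congr 1
    omega)
  glue_natural h x y f := eq_of_heq (Pre.heq_of_empty rfl rfl _ _)
  glue_neg h x := by
    refine heq_of_empty_eq (h.cell x.neg) rfl ?_ ?_ _ _
    · refine (inv_obj_empty _).trans ?_
      exact (trivial_obj_neg _ (h.cell x)).symm.trans
        (congrArg (Pre.trivial A _ _).F.obj ((faceHom h.subset).obj_inv x).symm)
    · refine Eq.trans ?_ (GradedMonoidalCategory.inv_tensor _ _)
      exact congrArg (· ⊗ _) ((Pre.trivial A _ _).obj_inv x)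
  glue_square {a b σ σa σb ρ} ha hb hab hba x := by
    refine heq_of_empty_eq (hab.cell (ha.cell x)) rfl ?_ ?_ _ _
    · change (gempty A).obj (gdim _ - _) = (gempty A).obj (gdim _ - _)
      rw [(faceHom hab.subset).gdim_obj, (faceHom ha.subset).gdim_obj,
        (faceHom hba.subset).gdim_obj, (faceHom hb.subset).gdim_obj]
    · change (gempty A).obj (gdim _ - _) ⊗ _ = (gempty A).obj (gdim _ - _) ⊗ _
      rw [GradedMonoidalCategory.empty_tensor, GradedMonoidalCategory.empty_tensor, gdim_sgn,
        GradedMonoidalCategory.gdim_tensor, GradedMonoidalCategory.gdim_tensor,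
        StarAd.gdim_obj, StarAd.gdim_obj, StarAd.gdim_obj, StarAd.gdim_obj]

/-- The morphism of empty objects. -/
def emptyMap (P : Fin n → StarAd T) {m m' : ℤ} (h : m ≤ m') : emptyObj P m ⟶ emptyObj P m' where
  app σ x := (gempty A).map (homOfLE (by
    change gdim x - _ ≤ gdim x - _
    omega))
  natural σ x y f := eq_of_heq (Pre.heq_of_empty rfl rfl _ _)
  app_neg σ x := by
    refine heq_of_empty_eq x.neg rfl ?_ ?_ _ _
    · exact ((Pre.trivial A _ _).obj_inv x).symm
    · exact (Pre.trivial A _ _).obj_inv x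
  comm h x := eq_of_heq (Pre.heq_of_empty rfl rfl _ _)

/-- The morphism with the opposite orientation. -/
def negMap {M N : SingObj P} (f : M ⟶ N) : neg M ⟶ neg N where
  app σ x := f.app σ x.neg
  natural σ _ _ φ := f.natural σ ((ginv (OrCell (simplex σ))).map φ)
  app_neg σ x := f.app_neg σ x.neg
  comm h x := match x with
    | .cell τ h' ε => f.comm h (.cell τ h' (-ε))
    | .empty n => f.comm h (.empty n)

lemma glue_heq (M : SingObj P) {a : Fin n} {σ σ' : Finset (Fin (n + 1))} (h : IsFace a σ σ')
    {x y : OrCell (simplex σ)} (e : x = y) : HEq (M.glue h x).hom (M.glue h y).hom := by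
  subst e
  rfl

lemma neg_glue_heq (M : SingObj P) {a : Fin n} {σ σ' : Finset (Fin (n + 1))} (h : IsFace a σ σ')
    (x : OrCell (simplex σ)) : HEq ((neg M).glue h x).hom (M.glue h x.neg).hom := by
  cases x <;> rfl

lemma app_heq {M N : SingObj P} (f : M ⟶ N) (σ : Finset (Fin (n + 1)))
    {x y : OrCell (simplex σ)} (e : x = y) : HEq (f.app σ x) (f.app σ y) := by
  subst e
  rfl

lemma neg_neg (M : SingObj P) : neg (neg M) = M := by
  refine ext_heq rfl (fun σ x => ?_) (fun σ x y f => ?_) fun h x => ?_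
  · exact congrArg (M.pre σ).F.obj (RelCell.neg_neg x)
  · exact functor_map_heq _ (RelCell.neg_neg x) (RelCell.neg_neg y) _ _
  · exact ((neg_glue_heq _ h x).trans (neg_glue_heq _ h x.neg)).trans
      (glue_heq M h (RelCell.neg_neg x))

lemma neg_emptyObj (m : ℤ) : neg (emptyObj P m) = emptyObj P m := by
  have e : ∀ {σ : Finset (Fin (n + 1))} (x : OrCell (simplex σ)),
      ((emptyObj P m).pre σ).F.obj x.neg = ((emptyObj P m).pre σ).F.obj x := fun x =>
    trivial_obj_neg _ x
  refine ext_heq rfl (fun σ x => e x) (fun σ x y f => ?_) fun {a σ σ'} h x => ?_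
  · exact heq_of_empty_eq x.neg rfl (e x).symm (e y) _ _
  · refine (neg_glue_heq _ h x).trans (heq_of_empty_eq (h.cell x.neg) rfl ?_ ?_ _ _)
    · exact (e (h.cell x)).symm.trans
        (congrArg (Pre.trivial A _ _).F.obj ((faceHom h.subset).obj_inv x).symm)
    · exact congrArg (· ⊗ _) (e x)

instance : GradedCategory (SingObj P) where
  dim :=
    { obj := fun M => M.dim
      map := fun f => homOfLE (dim_le f) }
  inv :=
    { obj := neg
      map := negMap
      map_id := fun M => rfl
      map_comp := fun f g => rfl }
  empty :=
    { obj := emptyObj P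
      map := fun f => emptyMap P (leOfHom f)
      map_id := fun m => Hom.ext (funext₂ fun σ x => eq_of_heq (Pre.heq_of_empty rfl rfl _ _))
      map_comp := fun f g =>
        Hom.ext (funext₂ fun σ x => eq_of_heq (Pre.heq_of_empty rfl rfl _ _)) }
  inv_comp_inv := _root_.CategoryTheory.Functor.hext neg_neg fun M N f =>
    hom_heq (neg_neg M) (neg_neg N) _ _ fun σ x => app_heq f σ (RelCell.neg_neg x)
  inv_comp_dim := rfl
  empty_comp_inv := _root_.CategoryTheory.Functor.hext neg_emptyObj fun m m' f =>
    hom_heq (neg_emptyObj m) (neg_emptyObj m') _ _ fun σ x =>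
      heq_of_empty_eq x.neg rfl (trivial_obj_neg _ x).symm (trivial_obj_neg _ x) _ _
  empty_comp_dim := rfl

lemma bal_heq {X Y X' Y' : A} (e : X = X') (e' : Y = Y') {f : X ⟶ Y} {g : X' ⟶ Y'} (h : HEq f g)
    (h1 : gdim X < gdim Y) (h2 : gdim X' < gdim Y') :
    HEq (BalancedCategory.bal h1 f) (BalancedCategory.bal h2 g) := by
  subst e
  subst e'
  cases h
  rfl

lemma map_comp_eqToHom_heq {X Y Z : A} (F : A ⥤ A) (f : X ⟶ Y) (e : Y = Z) :
    HEq (F.map (f ≫ eqToHom e)) (F.map f) := by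
  subst e
  simp

lemma whiskerRight_comp_eqToHom_heq {X Y Z : A} (f : X ⟶ Y) (e : Y = Z) (W : A) :
    HEq ((f ≫ eqToHom e) ▷ W) (f ▷ W) := by
  subst e
  simp

/-- The morphism to the object with the opposite orientation which is given by the balancing. -/
def balMap {M N : SingObj P} (h : M.dim < N.dim) (f : M ⟶ N) : M ⟶ neg N where
  app σ x := BalancedCategory.bal (gdim_lt h σ x) (f.app σ x) ≫ eqToHom (N.pre_obj_neg σ x).symm
  natural σ x y φ := by
    refine eq_of_heq ?_
    have h1 : gdim ((M.pre σ).F.obj x) < gdim ((N.pre σ).F.obj y) :=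
      (gdim_le ((M.pre σ).F.map φ)).trans_lt (gdim_lt h σ y)
    have h2 : (M.pre σ).F.map φ ≫ BalancedCategory.bal (gdim_lt h σ y) (f.app σ y) =
        BalancedCategory.bal (gdim_lt h σ x) (f.app σ x) ≫ (ginv A).map ((N.pre σ).F.map φ) := by
      rw [← BalancedCategory.comp_bal _ _ _ h1, ← BalancedCategory.bal_comp _ _ _ h1, f.natural]
    refine HEq.trans (b := (M.pre σ).F.map φ ≫
      BalancedCategory.bal (gdim_lt h σ y) (f.app σ y)) ?_ ((heq_of_eq h2).trans ?_)
    · exact map_comp_heq rfl rfl (N.pre_obj_neg σ y) HEq.rfl (comp_eqToHom_heq _ _)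
    · exact map_comp_heq rfl (N.pre_obj_neg σ x).symm (N.pre_obj_neg σ y).symm
        (comp_eqToHom_heq _ _).symm ((N.pre σ).map_inv φ).symm
  app_neg σ x := by
    have h1 := gdim_lt h σ x.neg
    have h2 : gdim ((ginv A).obj ((M.pre σ).F.obj x)) < gdim ((ginv A).obj ((N.pre σ).F.obj x)) := by
      rw [gdim_inv, gdim_inv]
      exact gdim_lt h σ x
    refine (comp_eqToHom_heq _ _).trans
      ((bal_heq (M.pre_obj_neg σ x) (N.pre_obj_neg σ x) (f.app_neg σ x) h1 h2).trans ?_)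
    rw [BalancedCategory.bal_inv _ (gdim_lt h σ x)]
    exact (map_comp_eqToHom_heq _ _ (N.pre_obj_neg σ x).symm).symm
  comm {a σ σ'} h' x := by
    refine eq_of_heq ?_
    have h1 := gdim_lt h σ' (h'.cell x)
    have h2 : gdim ((M.pre σ).F.obj x ⊗ (P a).obj (orSign P σ a)) <
        gdim ((N.pre σ).F.obj x ⊗ (P a).obj (orSign P σ a)) := by
      rw [GradedMonoidalCategory.gdim_tensor, GradedMonoidalCategory.gdim_tensor]
      exact add_lt_add_left (gdim_lt h σ x) _
    have h3 : gdim ((M.pre σ').F.obj (h'.cell x)) <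
        gdim ((N.pre σ).F.obj x ⊗ (P a).obj (orSign P σ a)) :=
      (gdim_le (M.glue h' x).hom).trans_lt h2
    have h4 : (M.glue h' x).hom ≫ BalancedCategory.bal h2 (f.app σ x ▷ _) =
        BalancedCategory.bal h1 (f.app σ' (h'.cell x)) ≫ (ginv A).map (N.glue h' x).hom := by
      rw [← BalancedCategory.comp_bal _ _ _ h3, ← BalancedCategory.bal_comp _ _ _ h3, f.comm]
    refine HEq.trans (b := (M.glue h' x).hom ≫ BalancedCategory.bal h2 (f.app σ x ▷ _)) ?_
      ((heq_of_eq h4).trans ?_)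
    · refine map_comp_heq rfl rfl ?_ HEq.rfl ?_
      · exact (congrArg (· ⊗ _) (N.pre_obj_neg σ x)).trans (GradedMonoidalCategory.inv_tensor _ _)
      · refine HEq.trans ?_ (GradedMonoidalCategory.bal_whiskerRight _ _ (gdim_lt h σ x) h2)
        exact whiskerRight_comp_eqToHom_heq _ (N.pre_obj_neg σ x).symm _
    · refine map_comp_heq rfl ?_ ?_ (comp_eqToHom_heq _ _).symm ?_
      · exact (N.pre_obj_neg σ' _).symm
      · exact ((congrArg (· ⊗ _) (N.pre_obj_neg σ x)).trans
          (GradedMonoidalCategory.inv_tensor _ _)).symm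
      · exact ((neg_glue_heq N h' x).trans (N.glue_neg h' x)).symm

instance : BalancedCategory (SingObj P) where
  bal h f := balMap h f
  comp_bal f g h h' := Hom.ext (funext₂ fun σ x =>
    (congrArg (· ≫ _) (BalancedCategory.comp_bal (f.app σ x) (g.app σ x) (gdim_lt h σ x)
      (gdim_lt h' σ x))).trans (Category.assoc _ _ _))
  bal_comp {M N O} f g h h' := Hom.ext (funext₂ fun σ x => by
    refine eq_of_heq ((comp_eqToHom_heq _ _).trans ((heq_of_eq
      (BalancedCategory.bal_comp (f.app σ x) (g.app σ x) (gdim_lt h σ x)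
        (gdim_lt h' σ x))).trans ?_))
    exact map_comp_heq rfl (N.pre_obj_neg σ x).symm (O.pre_obj_neg σ x).symm
      (comp_eqToHom_heq _ _).symm (g.app_neg σ x).symm)
  bal_inv f h h' := rfl
  bal_bal {M N} f h h' := hom_heq rfl (neg_neg N) _ _ fun σ x => by
    refine (comp_eqToHom_heq _ _).trans ?_
    have h1 : gdim ((M.pre σ).F.obj x) < gdim ((ginv A).obj ((N.pre σ).F.obj x)) := by
      rw [gdim_inv]
      exact gdim_lt h σ x
    refine HEq.trans ?_ (BalancedCategory.bal_bal (f.app σ x) (gdim_lt h σ x) h1)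
    exact bal_heq rfl (N.pre_obj_neg σ x) (comp_eqToHom_heq _ _) _ _

end SingObj

end

end

/- ### Ads with singularities and their products -/

section

open OrientedBallComplex (simplex)

/-- The associativity isomorphism of products of ball complexes. -/
def OrientedBallComplex.prodAssoc (K L J : OrientedBallComplex) :
    OrientedBallComplex.Hom ((K.prod L).prod J) (K.prod (L.prod J)) where
  toFun p := (p.1.1, (p.1.2, p.2))
  sign _ := 1
  exists_pl := by
    refine ⟨fun x => (x.1.1, (x.1.2, x.2)),
      isPLEmbedding_affine (OrientedBallComplex.isPolyhedron_space ((K.prod L).prod J))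
      (LinearEquiv.prodAssoc ℝ K.E L.E J.E).toLinearMap.toAffineMap
      ((LinearEquiv.prodAssoc ℝ K.E L.E J.E).injective.injOn), fun p => ?_⟩
    ext ⟨x, y, z⟩
    constructor
    · rintro ⟨⟨⟨x', y'⟩, z'⟩, ⟨⟨h1, h2⟩, h3⟩, h⟩
      obtain ⟨rfl, h⟩ := Prod.ext_iff.1 h
      obtain ⟨rfl, rfl⟩ := Prod.ext_iff.1 h
      exact ⟨h1, h2, h3⟩
    · rintro ⟨h1, h2, h3⟩
      exact ⟨((x, y), z), ⟨⟨h1, h2⟩, h3⟩, rfl⟩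
  dim_toFun p := (add_assoc _ _ _).symm
  exists_face p q _ := ⟨((q.1, q.2.1), q.2.2), rfl⟩
  sign_vertex _ _ := rfl
  inc_toFun p q := by
    obtain ⟨⟨a, b⟩, c⟩ := p
    obtain ⟨⟨a', b'⟩, c'⟩ := q
    simp only [OrientedBallComplex.prod, Units.val_one, one_mul, pow_add]
    by_cases h1 : a = a' <;> by_cases h2 : b = b' <;> by_cases h3 : c = c' <;>
      simp [h1, h2, h3, mul_assoc, OrientedBallComplex.inc_self]

variable {A : Type u} [Category.{v} A] [BalancedCategory A] [EmptyInitial A] [MonoidalCategory A]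
  [GradedSymmetricCategory A]

section

variable {T : AdTheory A} {n m r : ℕ}

/-- The pread `H` on `K × σ` is adjoint to the pread which is given by the `σ`-preads `M(κ)_σ` for
the cells `κ` of `K`. -/
structure IsAdjoint {P : Fin n → StarAd T} {K : OrientedBallComplex} {k : ℤ}
    (M : GradedHom k (OrCell K) (SingObj P)) (σ : Finset (Fin (n + 1)))
    (H : Pre A (K.prod (simplex σ)) (k + miss P σ)) : Prop where
  obj : ∀ (κ : K.Cell) (τ : (simplex σ).Cell) (ε δ : ℤˣ),
    H.F.obj (OrCell.mk (K := K.prod (simplex σ)) (κ, τ) (ε * δ)) =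
      ((M.F.obj (OrCell.mk κ ε)).pre σ).F.obj (OrCell.mk τ δ)
  map : ∀ (κ κ' : K.Cell) (τ τ' : (simplex σ).Cell) (ε δ ε' δ' : ℤˣ)
    (f : OrCell.mk κ ε ⟶ OrCell.mk κ' ε') (g : OrCell.mk τ δ ⟶ OrCell.mk τ' δ')
    (h : OrCell.mk (K := K.prod (simplex σ)) (κ, τ) (ε * δ) ⟶
      OrCell.mk (K := K.prod (simplex σ)) (κ', τ') (ε' * δ')),
    HEq (H.F.map h)
      ((M.F.map f).app σ (OrCell.mk τ δ) ≫ ((M.F.obj (OrCell.mk κ' ε')).pre σ).F.map g)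

variable (T) in
/-- The `K`-ads of degree `k` with singularities `P`: the `K`-preads in the category of objects with
singularities whose adjoints are `(K × σ)`-ads for all faces `σ` of `Δ^n`. -/
def AdSing (P : Fin n → StarAd T) (K : OrientedBallComplex) (k : ℤ) : Type (max u v) :=
  {M : GradedHom k (OrCell K) (SingObj P) //
    ∀ σ, ∃ H ∈ T.ad (K.prod (simplex σ)) (k + miss P σ), IsAdjoint M σ H}

/-- The restriction of ads with singularities along a morphism of ball complexes. -/
def AdSing.pull {P : Fin n → StarAd T} {K L : OrientedBallComplex} {k : ℤ} (M : AdSing T P L k)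
    (f : OrientedBallComplex.Hom K L) : AdSing T P K k :=
  ⟨f.cellHom.comp M.1 (zero_add k).symm, fun σ => by
    obtain ⟨H, hH, h⟩ := M.2 σ
    have e : ∀ (κ : K.Cell) (τ : (simplex σ).Cell) (ε δ : ℤˣ),
        (f.prod (.id (simplex σ))).cellHom.F.obj
          (OrCell.mk (K := K.prod (simplex σ)) (κ, τ) (ε * δ)) =
        OrCell.mk (K := L.prod (simplex σ)) (f.toFun κ, τ) (f.sign κ * ε * δ) := by
      intro κ τ ε δ
      change OrCell.mk (K := L.prod (simplex σ)) (f.toFun κ, τ) (f.sign κ * 1 * (ε * δ)) = _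
      rw [mul_one, mul_assoc]
    refine ⟨H.pull (f.prod (.id (simplex σ))), T.pull_mem _ hH, ⟨fun κ τ ε δ => ?_,
      fun κ κ' τ τ' ε δ ε' δ' φ g h' => ?_⟩⟩
    · exact (congrArg H.F.obj (e κ τ ε δ)).trans (h.obj _ _ _ _)
    · have h1 := (f.prod (.id (simplex σ))).cellHom.F.map h'
      rw [e, e] at h1
      exact (SingObj.functor_map_heq H (e κ τ ε δ) (e κ' τ' ε' δ') _ h1).trans
        (h.map _ _ _ _ _ _ _ _ (f.cellHom.F.map φ) g h1)⟩

/-- Relabelling of the singularities, and of the degree. -/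
def AdSing.relabel {P : Fin n → StarAd T} {P' : Fin m → StarAd T} {K : OrientedBallComplex}
    {k l : ℤ} (h : n = m) (h' : P = P' ∘ Fin.cast h) (h'' : k = l) (M : AdSing T P K k) :
    AdSing T P' K l :=
  cast (by subst h; subst h''; obtain rfl : P = P' := h'; rfl) M

/-- The inclusion of `{0, …, n}` in `{0, …, n + m}`. -/
def leftVertex (n m : ℕ) : Fin (n + 1) → Fin (n + m + 1) :=
  Fin.cases 0 fun a => (Fin.castAdd m a).succ

/-- The map from `{0, …, m}` to `{0, …, n + m}` which takes `0` to `0` and `j` to `n + j` for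
positive `j`. -/
def rightVertex (n m : ℕ) : Fin (m + 1) → Fin (n + m + 1) :=
  Fin.cases 0 fun b => (Fin.natAdd n b).succ

/-- The set `ρ_0 = ρ ∩ {0, …, n}`. -/
def leftPart (n m : ℕ) (ρ : Finset (Fin (n + m + 1))) : Finset (Fin (n + 1)) :=
  Finset.univ.filter fun i => leftVertex n m i ∈ ρ

/-- The set `ρ_1 = ((ρ ∩ {n + 1, …, n + m}) - n) ∪ (ρ ∩ {0})`. -/
def rightPart (n m : ℕ) (ρ : Finset (Fin (n + m + 1))) : Finset (Fin (m + 1)) :=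
  Finset.univ.filter fun i => rightVertex n m i ∈ ρ

lemma mem_leftPart {ρ : Finset (Fin (n + m + 1))} {i : Fin (n + 1)} :
    i ∈ leftPart n m ρ ↔ leftVertex n m i ∈ ρ :=
  Finset.mem_filter.trans (and_iff_right (Finset.mem_univ _))

lemma mem_rightPart {ρ : Finset (Fin (n + m + 1))} {i : Fin (m + 1)} :
    i ∈ rightPart n m ρ ↔ rightVertex n m i ∈ ρ :=
  Finset.mem_filter.trans (and_iff_right (Finset.mem_univ _))

lemma zero_mem_leftPart {ρ : Finset (Fin (n + m + 1))} (h : 0 ∈ ρ) : 0 ∈ leftPart n m ρ :=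
  mem_leftPart.2 h

lemma zero_mem_rightPart {ρ : Finset (Fin (n + m + 1))} (h : 0 ∈ ρ) : 0 ∈ rightPart n m ρ :=
  mem_rightPart.2 h

/-- The face `τ_0` of `ρ_0` for a face `τ` of `ρ` which contains the vertex `0`. -/
def leftFace {ρ : Finset (Fin (n + m + 1))} (τ : (simplex ρ).Cell) (h : 0 ∈ τ.1) :
    (simplex (leftPart n m ρ)).Cell :=
  ⟨leftPart n m τ.1, ⟨0, zero_mem_leftPart h⟩,
    Finset.monotone_filter_right _ fun _ _ h' => τ.2.2 h'⟩

/-- The face `τ_1` of `ρ_1` for a face `τ` of `ρ` which contains the vertex `0`. -/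
def rightFace {ρ : Finset (Fin (n + m + 1))} (τ : (simplex ρ).Cell) (h : 0 ∈ τ.1) :
    (simplex (rightPart n m ρ)).Cell :=
  ⟨rightPart n m τ.1, ⟨0, zero_mem_rightPart h⟩,
    Finset.monotone_filter_right _ fun _ _ h' => τ.2.2 h'⟩

lemma IsFace.left {a : Fin n} {ρ ρ' : Finset (Fin (n + m + 1))}
    (h : IsFace (Fin.castAdd m a) ρ ρ') : IsFace a (leftPart n m ρ) (leftPart n m ρ') where
  notMem := by
    exact fun h' => h.notMem (mem_leftPart.1 h')
  eq := by
    rw [h.eq]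
    ext i
    cases i using Fin.cases with
    | zero => simp [mem_leftPart, leftVertex, (Fin.succ_ne_zero _).symm]
    | succ i => simp [mem_leftPart, leftVertex]

lemma IsFace.right {b : Fin m} {ρ ρ' : Finset (Fin (n + m + 1))}
    (h : IsFace (Fin.natAdd n b) ρ ρ') : IsFace b (rightPart n m ρ) (rightPart n m ρ') where
  notMem := by
    exact fun h' => h.notMem (mem_rightPart.1 h')
  eq := by
    rw [h.eq]
    ext i
    cases i using Fin.cases with
    | zero => simp [mem_rightPart, rightVertex, (Fin.succ_ne_zero _).symm]
    | succ i => simp [mem_rightPart, rightVertex]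

/-- The sign which relates the orientation of the cell `κ × λ × τ` to the orientation of
`(κ × τ_0) × (λ × τ_1)` in the product of a `(K × ρ_0)`-pread of degree `k + miss P ρ_0` with an
`(L × ρ_1)`-pread; `d`, `t₀`, `t₁` are the dimensions of `λ`, `τ_0`, `τ_1`. -/
def extSign (P : Fin n → StarAd T) (k l : ℤ) (ρ₀ : Finset (Fin (n + 1))) (d t₀ t₁ : ℕ) : ℤˣ :=
  psign ((k + miss P ρ₀) * (d + t₁) + d * t₀ + l * miss P ρ₀)

/-- The value `M(κ, ε)_σ(τ, δ)`. -/
abbrev AdSing.val {P : Fin n → StarAd T} {K : OrientedBallComplex} {k : ℤ} (M : AdSing T P K k)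
    (κ : K.Cell) (ε : ℤˣ) (σ : Finset (Fin (n + 1))) (τ : (simplex σ).Cell) (δ : ℤˣ) : A :=
  ((M.1.F.obj (OrCell.mk κ ε)).pre σ).F.obj (OrCell.mk τ δ)

/-- The morphism `M(κ, ε)_σ(τ, δ) ⟶ M(κ', ε')_σ(τ', δ')` for inclusions of cells. -/
abbrev AdSing.valMap {P : Fin n → StarAd T} {K : OrientedBallComplex} {k : ℤ} (M : AdSing T P K k)
    {κ κ' : K.Cell} {ε ε' : ℤˣ} (f : OrCell.mk κ ε ⟶ OrCell.mk κ' ε') {σ : Finset (Fin (n + 1))}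
    {τ τ' : (simplex σ).Cell} {δ δ' : ℤˣ} (g : OrCell.mk τ δ ⟶ OrCell.mk τ' δ') :
    M.val κ ε σ τ δ ⟶ M.val κ' ε' σ τ' δ' :=
  (M.1.F.map f).app σ (OrCell.mk τ δ) ≫ ((M.1.F.obj (OrCell.mk κ' ε')).pre σ).F.map g

/-- The isomorphism `f_{σ,i}` of `M(κ, ε)`, evaluated on the cell `(τ, δ)` of `σ`. -/
abbrev AdSing.valGlue {P : Fin n → StarAd T} {K : OrientedBallComplex} {k : ℤ}
    (M : AdSing T P K k) (κ : K.Cell) (ε : ℤˣ) {a : Fin n} {σ σ' : Finset (Fin (n + 1))}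
    (h : IsFace a σ σ') (τ : (simplex σ).Cell) (δ : ℤˣ) :
    M.val κ ε σ' ⟨τ.1, τ.2.1, τ.2.2.trans h.subset⟩ δ ≅
      M.val κ ε σ τ δ ⊗ (P a).obj (orSign P σ a) :=
  (M.1.F.obj (OrCell.mk κ ε)).glue h (OrCell.mk τ δ)

/-- The ad `Z` with singularities `(P, Q)` is the external product of `M` and `N`, that is,
`Z(κ × κ')_ρ = M(κ)_{ρ_0} × N(κ')_{ρ_1}`: on a cell `τ` of `ρ` which contains the vertex `0` its
value is the tensor product of the values on `τ_0` and `τ_1`, and the isomorphisms `f_{ρ,i}` are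
induced by those of `M` and `N`.  On the cells which do not contain the vertex `0` all values are
empty. -/
structure IsExtProd {P : Fin n → StarAd T} {Q : Fin m → StarAd T} {K L : OrientedBallComplex}
    {k l : ℤ} (M : AdSing T P K k) (N : AdSing T Q L l)
    (Z : AdSing T (Fin.append P Q) (K.prod L) (k + l)) : Prop where
  obj : ∀ (ρ : Finset (Fin (n + m + 1))) (κ : K.Cell) (κ' : L.Cell) (τ : (simplex ρ).Cell)
    (h : 0 ∈ τ.1) (ε ε₁ ε₂ δ δ₁ δ₂ : ℤˣ),
    ε * δ = ε₁ * ε₂ * (δ₁ * δ₂) * extSign P k l (leftPart n m ρ) (L.dim κ')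
      ((simplex _).dim (leftFace τ h)) ((simplex _).dim (rightFace τ h)) →
    Z.val (κ, κ') ε ρ τ δ =
      M.val κ ε₁ (leftPart n m ρ) (leftFace τ h) δ₁ ⊗
        N.val κ' ε₂ (rightPart n m ρ) (rightFace τ h) δ₂
  map : ∀ (ρ : Finset (Fin (n + m + 1))) (κ ν : K.Cell) (κ' ν' : L.Cell)
    (τ υ : (simplex ρ).Cell) (h : 0 ∈ τ.1) (h' : 0 ∈ υ.1)
    (ε ε₁ ε₂ δ δ₁ δ₂ ζ ζ₁ ζ₂ θ θ₁ θ₂ : ℤˣ),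
    ε * δ = ε₁ * ε₂ * (δ₁ * δ₂) * extSign P k l (leftPart n m ρ) (L.dim κ')
      ((simplex _).dim (leftFace τ h)) ((simplex _).dim (rightFace τ h)) →
    ζ * θ = ζ₁ * ζ₂ * (θ₁ * θ₂) * extSign P k l (leftPart n m ρ) (L.dim ν')
      ((simplex _).dim (leftFace υ h')) ((simplex _).dim (rightFace υ h')) →
    ∀ (f : OrCell.mk (K := K.prod L) (κ, κ') ε ⟶ OrCell.mk (K := K.prod L) (ν, ν') ζ)
      (f₁ : OrCell.mk κ ε₁ ⟶ OrCell.mk ν ζ₁) (f₂ : OrCell.mk κ' ε₂ ⟶ OrCell.mk ν' ζ₂)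
      (g : OrCell.mk τ δ ⟶ OrCell.mk υ θ)
      (g₁ : OrCell.mk (leftFace τ h) δ₁ ⟶ OrCell.mk (leftFace υ h') θ₁)
      (g₂ : OrCell.mk (rightFace τ h) δ₂ ⟶ OrCell.mk (rightFace υ h') θ₂),
    HEq (Z.valMap f g) (M.valMap f₁ g₁ ⊗ₘ N.valMap f₂ g₂)
  glue_left : ∀ (a : Fin n) (ρ ρ' : Finset (Fin (n + m + 1))) (hρ : IsFace (Fin.castAdd m a) ρ ρ')
    (κ : K.Cell) (κ' : L.Cell) (τ : (simplex ρ).Cell) (h : 0 ∈ τ.1)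
    (ε ε₁ ε₂ δ δ₁ δ₂ δ₂' : ℤˣ),
    ε * δ = ε₁ * ε₂ * (δ₁ * δ₂) * extSign P k l (leftPart n m ρ') (L.dim κ')
      ((simplex _).dim (leftFace τ h)) ((simplex _).dim (rightFace τ h)) →
    ∀ hδ : ε * δ = ε₁ * ε₂ * (δ₁ * δ₂') * extSign P k l (leftPart n m ρ) (L.dim κ')
      ((simplex _).dim (leftFace τ h)) ((simplex _).dim (rightFace τ h)),
    HEq ((Z.valGlue (κ, κ') ε hρ τ δ).hom ≫
        eqToHom (congrArg (· ⊗ _) (obj ρ κ κ' τ h ε ε₁ ε₂ δ δ₁ δ₂' hδ)) ≫ (α_ _ _ _).hom)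
      ((M.valGlue κ ε₁ hρ.left (leftFace τ h) δ₁).hom ▷
          N.val κ' ε₂ (rightPart n m ρ) (rightFace τ h) δ₂ ≫
        (α_ _ _ _).hom ≫ _ ◁ (GradedSymmetricCategory.braid _ _).hom)
  glue_right : ∀ (b : Fin m) (ρ ρ' : Finset (Fin (n + m + 1)))
    (hρ : IsFace (Fin.natAdd n b) ρ ρ') (κ : K.Cell) (κ' : L.Cell)
    (τ : (simplex ρ).Cell) (h : 0 ∈ τ.1) (ε ε₁ ε₂ δ δ₁ δ₂ : ℤˣ)
    (hδ : ε * δ = ε₁ * ε₂ * (δ₁ * δ₂) * extSign P k l (leftPart n m ρ) (L.dim κ')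
      ((simplex _).dim (leftFace τ h)) ((simplex _).dim (rightFace τ h))),
    HEq ((Z.valGlue (κ, κ') ε hρ τ δ).hom ≫
        eqToHom (congrArg (· ⊗ _) (obj ρ κ κ' τ h ε ε₁ ε₂ δ δ₁ δ₂ hδ)) ≫ (α_ _ _ _).hom)
      (M.val κ ε₁ (leftPart n m ρ) (leftFace τ h) δ₁ ◁
        (N.valGlue κ' ε₂ hρ.right (rightFace τ h) δ₂).hom)

/-- The isomorphism `Φ` is induced by the associativity isomorphisms
`(M × N) × O ≅ M × (N × O)` of the values of `M`, `N` and `O`. -/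
def IsInducedByAssociators {P : Fin n → StarAd T} {Q : Fin m → StarAd T} {R : Fin r → StarAd T}
    {K L J : OrientedBallComplex} {k l j : ℤ} (M : AdSing T P K k) (N : AdSing T Q L l)
    (O : AdSing T R J j)
    {Z Z' : AdSing T (Fin.append P (Fin.append Q R)) ((K.prod L).prod J) (k + (l + j))}
    (Φ : Z.1.F ≅ Z'.1.F) : Prop :=
  ∀ (ρ : Finset (Fin (n + (m + r) + 1))) (κ : K.Cell) (κ' : L.Cell) (κ'' : J.Cell)
    (τ : (simplex ρ).Cell) (h : 0 ∈ τ.1) (ε ε₁ ε₂ ε₃ δ δ₁ δ₂ δ₃ : ℤˣ),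
    ε * δ = ε₁ * ε₂ * ε₃ * (δ₁ * δ₂ * δ₃) *
      extSign Q l j (leftPart m r (rightPart n (m + r) ρ)) (J.dim κ'')
        ((simplex _).dim (leftFace (rightFace τ h) (zero_mem_rightPart h)))
        ((simplex _).dim (rightFace (rightFace τ h) (zero_mem_rightPart h))) *
      extSign P k (l + j) (leftPart n (m + r) ρ) (L.dim κ' + J.dim κ'')
        ((simplex _).dim (leftFace τ h)) ((simplex _).dim (rightFace τ h)) →
    HEq ((Φ.hom.app (OrCell.mk (K := (K.prod L).prod J) ((κ, κ'), κ'') ε)).app ρ (OrCell.mk τ δ))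
      (α_ (M.val κ ε₁ (leftPart n (m + r) ρ) (leftFace τ h) δ₁)
        (N.val κ' ε₂ (leftPart m r (rightPart n (m + r) ρ))
          (leftFace (rightFace τ h) (zero_mem_rightPart h)) δ₂)
        (O.val κ'' ε₃ (rightPart m r (rightPart n (m + r) ρ))
          (rightFace (rightFace τ h) (zero_mem_rightPart h)) δ₃)).hom

end

end

end QuinnAd

end

open QuinnAd

noncomputable section

namespace QuinnAd

open QuinnAd.OrientedBallComplex (simplex)

section

section Comp

variable {A : Type u} [Category.{v} A]

lemma comp_eqToHom_heq' {X Y Z W : A} (f : X ⟶ Y) (g : Y ⟶ Z) (h : Z = W) :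
    HEq (f ≫ g ≫ eqToHom h) (f ≫ g) := by
  subst h
  simp

lemma comp_heq_comp {X Y Z X' Y' Z' : A} {f : X ⟶ Y} {g : Y ⟶ Z} {f' : X' ⟶ Y'} {g' : Y' ⟶ Z'}
    (h : X = X') (h1 : Y = Y') (h2 : Z = Z') (h3 : HEq f f') (h4 : HEq g g') :
    HEq (f ≫ g) (f' ≫ g') := by
  subst h
  subst h1
  subst h2
  cases h3
  cases h4
  rfl

end Comp

section Sign

variable {A : Type u} [Category.{v} A] [GradedCategory A]

lemma sgn_obj_sgn_obj (s t : ℤˣ) (X : A) :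
    (sgn A s).obj ((sgn A t).obj X) = (sgn A (s * t)).obj X := by
  rcases Int.units_eq_one_or s with rfl | rfl <;> rcases Int.units_eq_one_or t with rfl | rfl <;>
    simp

lemma sgn_map_heq {X Y X' Y' : A} (s : ℤˣ) {f : X ⟶ Y} {g : X' ⟶ Y'} (h : X = X') (h' : Y = Y')
    (e : HEq f g) : HEq ((sgn A s).map f) ((sgn A s).map g) := by
  subst h
  subst h'
  cases e
  rfl

lemma sgn_one_map_heq {X Y : A} (f : X ⟶ Y) : HEq ((sgn A 1).map f) f := by
  rw [sgn_one]
  rfl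

lemma sgn_neg_one_map_heq {X Y : A} (f : X ⟶ Y) : HEq ((sgn A (-1)).map f) ((ginv A).map f) := by
  rw [sgn_neg_one]

lemma sgn_map_sgn_map (s t : ℤˣ) {X Y : A} (f : X ⟶ Y) :
    HEq ((sgn A s).map ((sgn A t).map f)) ((sgn A (s * t)).map f) := by
  rcases Int.units_eq_one_or s with rfl | rfl
  · rw [one_mul]
    exact sgn_one_map_heq _
  · rcases Int.units_eq_one_or t with rfl | rfl
    · rw [mul_one]
      exact sgn_map_heq _ (by simp) (by simp) (sgn_one_map_heq _)
    · refine (sgn_map_heq _ (by simp) (by simp) (sgn_neg_one_map_heq f)).trans ?_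
      refine (sgn_neg_one_map_heq _).trans ((heq_inv_map_inv_map f).trans ?_)
      rw [neg_one_mul, neg_neg]
      exact (sgn_one_map_heq f).symm

lemma eq_sgn_symm {s : ℤˣ} {X X' : A} (h : X' = (sgn A s).obj X) : X = (sgn A s).obj X' := by
  rw [h, sgn_obj_sgn_obj, Int.units_mul_self, sgn_one]
  rfl

lemma eq_sgn_trans {s t : ℤˣ} {X X' X'' : A} (h : X'' = (sgn A s).obj X')
    (h' : X' = (sgn A t).obj X) : X'' = (sgn A (s * t)).obj X := by
  rw [h, h', sgn_obj_sgn_obj]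

lemma eq_sgn_one {X X' : A} (h : X' = X) : X' = (sgn A 1).obj X := by
  rw [h, sgn_one]
  rfl

lemma sgn_obj_empty (s : ℤˣ) (n : ℤ) : (sgn A s).obj ((gempty A).obj n) = (gempty A).obj n := by
  rcases Int.units_eq_one_or s with rfl | rfl <;> simp

end Sign

section Unoriented

/-- The category `A` with orientations disregarded: the morphisms from `X` to `Y` are the morphisms
from `X` to `Y` with one of its two orientations, modulo the balancing. -/
structure Unor (A : Type u) : Type u where
  as : A

variable {A : Type u} [Category.{v} A] [BalancedCategory A]

lemma bal_heq_bal {X Y X' Y' : A} (e : X = X') (e' : Y = Y') {f : X ⟶ Y} {g : X' ⟶ Y'}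
    (h : HEq f g) (h1 : gdim X < gdim Y) (h2 : gdim X' < gdim Y') :
    HEq (BalancedCategory.bal h1 f) (BalancedCategory.bal h2 g) := by
  subst e
  subst e'
  cases h
  rfl

/-- A morphism to one of the two orientations. -/
abbrev Unor.PreHom (X Y : A) : Type v := Σ s : ℤˣ, (X ⟶ (sgn A s).obj Y)

lemma Unor.PreHom.ext {X Y : A} {p q : Unor.PreHom X Y} (h : p.1 = q.1) (h' : HEq p.2 q.2) :
    p = q := Sigma.ext h h'

/-- Identification of the two morphisms that correspond under the balancing. -/
def Unor.Rel {X Y : A} (p q : Unor.PreHom X Y) : Prop :=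
  p = q ∨ p.1 = - q.1 ∧ ∃ h : gdim X < gdim ((sgn A p.1).obj Y),
    HEq (BalancedCategory.bal h p.2) q.2

lemma ginv_sgn_obj (s : ℤˣ) (X : A) : (ginv A).obj ((sgn A s).obj X) = (sgn A (-s)).obj X := by
  have := sgn_obj_sgn_obj (-1) s X
  rwa [sgn_neg_one, neg_one_mul] at this

lemma Unor.Rel.symm {X Y : A} {p q : Unor.PreHom X Y} (h : Unor.Rel p q) : Unor.Rel q p := by
  rcases h with rfl | ⟨h, h', e⟩
  · exact Or.inl rfl
  · have h1 : gdim X < gdim ((sgn A q.1).obj Y) := by rw [gdim_sgn] at h' ⊢; exact h'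
    refine Or.inr ⟨by rw [h, neg_neg], h1, ?_⟩
    have h2 : gdim X < gdim ((ginv A).obj ((sgn A p.1).obj Y)) := by rwa [gdim_inv]
    have h3 : (ginv A).obj ((sgn A p.1).obj Y) = (sgn A q.1).obj Y := by
      rw [ginv_sgn_obj, h, neg_neg]
    exact (bal_heq_bal rfl h3 e h2 h1).symm.trans (BalancedCategory.bal_bal p.2 h' h2)

lemma Unor.Rel.trans {X Y : A} {p q r : Unor.PreHom X Y} (h : Unor.Rel p q) (h' : Unor.Rel q r) :
    Unor.Rel p r := by
  rcases h with rfl | ⟨h, h1, e⟩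
  · exact h'
  rcases h' with rfl | ⟨h', h1', e'⟩
  · exact Or.inr ⟨h, h1, e⟩
  have h2 : gdim X < gdim ((ginv A).obj ((sgn A p.1).obj Y)) := by rwa [gdim_inv]
  have h3 : (ginv A).obj ((sgn A p.1).obj Y) = (sgn A q.1).obj Y := by
    rw [ginv_sgn_obj, h, neg_neg]
  refine Or.inl (Unor.PreHom.ext (by rw [h, h', neg_neg]) ?_)
  exact (BalancedCategory.bal_bal p.2 h1 h2).symm.trans
    ((bal_heq_bal rfl h3 e h2 h1').trans e')

/-- The relation as a setoid. -/
instance Unor.setoid (X Y : A) : Setoid (Unor.PreHom X Y) where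
  r := Unor.Rel
  iseqv := ⟨fun _ => Or.inl rfl, Unor.Rel.symm, Unor.Rel.trans⟩

/-- Composition before the identification. -/
def Unor.PreHom.comp {X Y Z : A} (p : Unor.PreHom X Y) (q : Unor.PreHom Y Z) : Unor.PreHom X Z :=
  ⟨p.1 * q.1, p.2 ≫ (sgn A p.1).map q.2 ≫ eqToHom (sgn_obj_sgn_obj _ _ _)⟩

lemma sgn_map_bal {s : ℤˣ} {X Y : A} (f : X ⟶ Y) (h : gdim X < gdim Y)
    (h' : gdim ((sgn A s).obj X) < gdim ((sgn A s).obj Y)) :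
    HEq ((sgn A s).map (BalancedCategory.bal h f))
      (BalancedCategory.bal h' ((sgn A s).map f)) := by
  rcases Int.units_eq_one_or s with rfl | rfl
  · exact (sgn_one_map_heq _).trans
      (bal_heq_bal (by simp) (by simp) (sgn_one_map_heq f).symm _ _)
  · refine (sgn_neg_one_map_heq _).trans (HEq.trans ?_ (bal_heq_bal (by simp) (by simp)
      (sgn_neg_one_map_heq f).symm (by rwa [gdim_inv, gdim_inv]) _))
    exact heq_of_eq (BalancedCategory.bal_inv f h _).symm

lemma ginv_map_sgn_map (s : ℤˣ) {X Y : A} (f : X ⟶ Y) :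
    HEq ((ginv A).map ((sgn A s).map f)) ((sgn A (-s)).map f) := by
  refine (sgn_neg_one_map_heq _).symm.trans ((sgn_map_sgn_map _ _ f).trans ?_)
  rw [neg_one_mul]

lemma Unor.comp_rel {X Y Z : A} {p p' : Unor.PreHom X Y} {q q' : Unor.PreHom Y Z}
    (hp : Unor.Rel p p') (hq : Unor.Rel q q') : Unor.Rel (p.comp q) (p'.comp q') := by
  refine Unor.Rel.trans (q := p'.comp q) ?_ ?_
  · rcases hp with rfl | ⟨h, h', e⟩
    · exact Or.inl rfl
    obtain ⟨s, f⟩ := p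
    obtain ⟨t, f'⟩ := p'
    obtain ⟨r, g⟩ := q
    dsimp only at h h' e
    obtain rfl : t = -s := by rw [h, neg_neg]
    have h1 := gdim_le ((sgn A s).map g)
    refine Or.inr ⟨?_, ?_, ?_⟩
    · simp [Unor.PreHom.comp]
    · simp only [gdim_sgn, Unor.PreHom.comp] at h1 h' ⊢
      exact h'.trans_le h1
    · have h2 : gdim X < gdim ((sgn A s).obj ((sgn A r).obj Z)) := h'.trans_le h1
      refine (bal_heq_bal rfl (sgn_obj_sgn_obj _ _ _).symm (comp_eqToHom_heq' _ _ _) _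
        h2).trans ?_
      rw [BalancedCategory.bal_comp f _ h']
      refine HEq.trans ?_ (comp_eqToHom_heq' _ _ _).symm
      exact comp_heq_comp rfl (ginv_sgn_obj _ _) (ginv_sgn_obj _ _) e
        (ginv_map_sgn_map _ _)
  · rcases hq with rfl | ⟨h, h', e⟩
    · exact Or.inl rfl
    obtain ⟨s, f⟩ := p'
    obtain ⟨r, g⟩ := q
    obtain ⟨t, g'⟩ := q'
    dsimp only at h h' e
    obtain rfl : t = -r := by rw [h, neg_neg]
    have h1 := gdim_le f
    have h2 : gdim X < gdim ((sgn A s).obj ((sgn A r).obj Z)) := by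
      simp only [gdim_sgn] at h1 h' ⊢
      exact h1.trans_lt h'
    refine Or.inr ⟨?_, ?_, ?_⟩
    · simp [Unor.PreHom.comp]
    · simpa [Unor.PreHom.comp] using h2
    · refine (bal_heq_bal rfl (sgn_obj_sgn_obj _ _ _).symm (comp_eqToHom_heq' _ _ _) _
        h2).trans ?_
      have h3 : gdim ((sgn A s).obj Y) < gdim ((sgn A s).obj ((sgn A r).obj Z)) := by
        simpa using h'
      rw [BalancedCategory.comp_bal f _ h3]
      refine HEq.trans ?_ (comp_eqToHom_heq' _ _ _).symm
      refine comp_heq_comp rfl rfl ?_ HEq.rfl ?_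
      · rw [ginv_sgn_obj, sgn_obj_sgn_obj, sgn_obj_sgn_obj]; simp
      · exact (sgn_map_bal g h' h3).symm.trans (sgn_map_heq _ rfl (ginv_sgn_obj _ _) e)

instance : Category.{v} (Unor A) where
  Hom X Y := Quotient (Unor.setoid X.as Y.as)
  id X := Quotient.mk _ ⟨1, eqToHom (by simp)⟩
  comp f g := Quotient.map₂ Unor.PreHom.comp (fun _ _ h _ _ h' => Unor.comp_rel h h') f g
  id_comp f := by
    induction f using Quotient.inductionOn with | _ p => ?_
    refine congrArg (Quotient.mk _) (Unor.PreHom.ext (one_mul _) ?_)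
    refine (comp_eqToHom_heq' _ _ _).trans ?_
    exact HEq.trans (eqToHom_comp_heq _ (by simp)) (sgn_one_map_heq p.2)
  comp_id f := by
    induction f using Quotient.inductionOn with | _ p => ?_
    refine congrArg (Quotient.mk _) (Unor.PreHom.ext (mul_one _) ?_)
    refine (comp_eqToHom_heq' _ _ _).trans ?_
    rw [eqToHom_map]
    exact comp_eqToHom_heq _ _
  assoc f g h := by
    induction f using Quotient.inductionOn with | _ p => ?_
    induction g using Quotient.inductionOn with | _ q => ?_
    induction h using Quotient.inductionOn with | _ r => ?_
    refine congrArg (Quotient.mk _) (Unor.PreHom.ext (mul_assoc _ _ _) ?_)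
    refine (comp_eqToHom_heq' _ _ _).trans (HEq.trans ?_ (comp_eqToHom_heq' _ _ _).symm)
    refine HEq.trans (b := (p.2 ≫ (sgn A p.1).map q.2) ≫ (sgn A p.1).map ((sgn A q.1).map r.2)) ?_
      ?_
    · exact comp_heq_comp rfl (sgn_obj_sgn_obj _ _ _).symm (sgn_obj_sgn_obj _ _ _).symm
        (comp_eqToHom_heq' _ _ _) (sgn_map_sgn_map _ _ _).symm
    · rw [Category.assoc, ← Functor.map_comp]
      exact comp_heq_comp rfl rfl (by rw [sgn_obj_sgn_obj q.1]; rfl) HEq.rfl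
        (sgn_map_heq _ rfl (by rw [sgn_obj_sgn_obj q.1]; rfl) (comp_eqToHom_heq' _ _ _).symm)

namespace Unor

/-- The morphism given by a morphism of `A`. -/
def of {X Y : A} (f : X ⟶ Y) : Unor.mk X ⟶ Unor.mk Y :=
  Quotient.mk (setoid X Y) ⟨1, f ≫ eqToHom (by simp)⟩

/-- The canonical morphism to an object from one of its orientations. -/
def can (s : ℤˣ) {X X' : A} (h : X' = (sgn A s).obj X) : Unor.mk X' ⟶ Unor.mk X :=
  Quotient.mk (setoid X' X) ⟨s, eqToHom h⟩

lemma mk_eq {X Y : A} (s : ℤˣ) (f : X ⟶ (sgn A s).obj Y) :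
    (Quotient.mk (setoid X Y) ⟨s, f⟩ : Unor.mk X ⟶ Unor.mk Y) = of f ≫ can s rfl := by
  refine congrArg (Quotient.mk _) (PreHom.ext (one_mul _).symm ?_)
  refine HEq.trans ?_ (comp_eqToHom_heq' _ _ _).symm
  rw [eqToHom_map]
  exact ((comp_eqToHom_heq _ _).trans (comp_eqToHom_heq _ _)).symm

lemma exists_eq {X Y : A} (φ : Unor.mk X ⟶ Unor.mk Y) :
    ∃ (s : ℤˣ) (f : X ⟶ (sgn A s).obj Y), φ = of f ≫ can s rfl := by
  induction φ using Quotient.inductionOn with | _ p => ?_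
  exact ⟨p.1, p.2, mk_eq p.1 p.2⟩

@[simp] lemma of_id (X : A) : of (𝟙 X) = 𝟙 (Unor.mk X) :=
  congrArg (Quotient.mk _) (PreHom.ext rfl (heq_of_eq (Category.id_comp _)))

lemma of_comp {X Y Z : A} (f : X ⟶ Y) (g : Y ⟶ Z) : of (f ≫ g) = of f ≫ of g := by
  refine congrArg (Quotient.mk _) (PreHom.ext (one_mul _).symm ?_)
  refine (comp_eqToHom_heq _ _).trans (HEq.trans ?_ (comp_eqToHom_heq' _ _ _).symm)
  exact comp_heq_comp rfl (by simp) (by simp) (comp_eqToHom_heq _ _).symm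
    ((comp_eqToHom_heq _ _).symm.trans (sgn_one_map_heq _).symm)

lemma of_injective {X Y : A} {f g : X ⟶ Y} (h : of f = of g) : f = g := by
  rcases Quotient.exact h with h | ⟨h, -⟩
  · exact (cancel_mono _).1 (eq_of_heq (Sigma.mk.inj h).2)
  · exact absurd (show (1 : ℤˣ) = -1 from h) (by decide)

lemma can_comp_can {s t : ℤˣ} {X X' X'' : A} (h : X'' = (sgn A s).obj X')
    (h' : X' = (sgn A t).obj X) : can s h ≫ can t h' = can (s * t) (eq_sgn_trans h h') := by
  refine congrArg (Quotient.mk _) (PreHom.ext rfl ?_)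
  dsimp only [PreHom.comp]
  rw [eqToHom_map, eqToHom_trans, eqToHom_trans]

lemma of_eqToHom {X X' : A} (h : X' = X) : of (eqToHom h) = can 1 (eq_sgn_one h) := by
  refine congrArg (Quotient.mk _) (PreHom.ext rfl ?_)
  dsimp only
  rw [eqToHom_trans]

lemma can_congr {s t : ℤˣ} {X X' : A} (h : X' = (sgn A s).obj X) (e : s = t) :
    can s h = can t (e ▸ h) := by
  subst e
  rfl

lemma can_one (X : A) (h : X = (sgn A 1).obj X) : can 1 h = 𝟙 (Unor.mk X) := rfl

lemma can_self {s : ℤˣ} {X : A} (h : X = (sgn A s).obj X) (e : s = 1) :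
    can s h = 𝟙 (Unor.mk X) := by
  subst e
  rfl

/-- The canonical isomorphism to an object from one of its orientations. -/
@[simps] def canIso (s : ℤˣ) {X X' : A} (h : X' = (sgn A s).obj X) : Unor.mk X' ≅ Unor.mk X where
  hom := can s h
  inv := can s (eq_sgn_symm h)
  hom_inv_id := by rw [can_comp_can]; exact can_self _ (Int.units_mul_self s)
  inv_hom_id := by rw [can_comp_can]; exact can_self _ (Int.units_mul_self s)

instance {s : ℤˣ} {X X' : A} (h : X' = (sgn A s).obj X) : IsIso (can s h) :=
  (canIso s h).isIso_hom

lemma of_comp_can {s : ℤˣ} {X X' Y Y' : A} (h : X' = (sgn A s).obj X) (h' : Y' = (sgn A s).obj Y)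
    {f : X ⟶ Y} {f' : X' ⟶ Y'} (e : HEq f' ((sgn A s).map f)) :
    of f' ≫ can s h' = can s h ≫ of f := by
  refine congrArg (Quotient.mk _) (PreHom.ext ((one_mul _).trans (mul_one _).symm) ?_)
  refine (comp_eqToHom_heq' _ _ _).trans (HEq.trans ?_ (comp_eqToHom_heq' _ _ _).symm)
  rw [eqToHom_map]
  refine ((comp_eqToHom_heq _ _).trans ((comp_eqToHom_heq _ _).trans e)).trans ?_
  refine HEq.trans ?_ (eqToHom_comp_heq _ h).symm
  exact sgn_map_heq _ rfl (by simp) (comp_eqToHom_heq _ _).symm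

lemma of_bal_comp_can {X Y : A} (f : X ⟶ Y) (h : gdim X < gdim Y)
    (h' : (ginv A).obj Y = (sgn A (-1)).obj Y) :
    of (BalancedCategory.bal h f) ≫ can (-1) h' = of f := by
  have h0 : gdim X < gdim ((sgn A (1 * -1)).obj Y) := by rwa [gdim_sgn]
  refine Quotient.sound (Or.inr ⟨?_, h0, ?_⟩)
  · rfl
  · have h1 : gdim X < gdim ((ginv A).obj Y) := by rwa [gdim_inv]
    refine HEq.trans (bal_heq_bal rfl ?_ ?_ _ h1)
      ((BalancedCategory.bal_bal f h h1).trans (comp_eqToHom_heq _ _).symm)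
    · simp [PreHom.comp]
    · refine (comp_eqToHom_heq' _ _ _).trans ?_
      rw [eqToHom_map]
      exact (comp_eqToHom_heq _ _).trans (comp_eqToHom_heq _ _)

lemma of_heq {X Y X' Y' : A} {f : X ⟶ Y} {f' : X' ⟶ Y'} (h : X' = X) (h' : Y' = Y)
    (e : HEq f' f) : of f' ≫ can 1 (eq_sgn_one h') = can 1 (eq_sgn_one h) ≫ of f := by
  subst h
  subst h'
  cases e
  rw [can_one, can_one, Category.comp_id, Category.id_comp]

end Unor

end Unoriented

end

section

section Monoidal

variable {A : Type u} [Category.{v} A] [BalancedCategory A] [MonoidalCategory A]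

section

variable [GradedMonoidalCategory A]

lemma tensor_sgn (s : ℤˣ) (X Y : A) : X ⊗ (sgn A s).obj Y = (sgn A s).obj (X ⊗ Y) := by
  rcases Int.units_eq_one_or s with rfl | rfl
  · simp
  · simpa using GradedMonoidalCategory.tensor_inv X Y

lemma whiskerRight_heq_whiskerRight {X Y X' Y' : A} (h : X = X') (h' : Y = Y') {f : X ⟶ Y}
    {f' : X' ⟶ Y'} (e : HEq f f') {Z Z' : A} (hZ : Z = Z') : HEq (f ▷ Z) (f' ▷ Z') := by
  subst h
  subst h'
  subst hZ
  cases e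
  rfl

lemma whiskerLeft_heq_whiskerLeft {X Y X' Y' : A} (h : X = X') (h' : Y = Y') {f : X ⟶ Y}
    {f' : X' ⟶ Y'} (e : HEq f f') {Z Z' : A} (hZ : Z = Z') : HEq (Z ◁ f) (Z' ◁ f') := by
  subst h
  subst h'
  subst hZ
  cases e
  rfl

lemma sgn_map_whiskerRight (s : ℤˣ) {X Y : A} (f : X ⟶ Y) (Z : A) :
    HEq ((sgn A s).map f ▷ Z) ((sgn A s).map (f ▷ Z)) := by
  rcases Int.units_eq_one_or s with rfl | rfl
  · exact (whiskerRight_heq_whiskerRight (by simp) (by simp) (sgn_one_map_heq f) rfl).trans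
      (sgn_one_map_heq _).symm
  · exact (whiskerRight_heq_whiskerRight (by simp) (by simp) (sgn_neg_one_map_heq f) rfl).trans
      ((GradedMonoidalCategory.inv_whiskerRight f Z).trans (sgn_neg_one_map_heq _).symm)

lemma sgn_map_whiskerLeft (s : ℤˣ) {X Y : A} (f : X ⟶ Y) (Z : A) :
    HEq (Z ◁ (sgn A s).map f) ((sgn A s).map (Z ◁ f)) := by
  rcases Int.units_eq_one_or s with rfl | rfl
  · exact (whiskerLeft_heq_whiskerLeft (by simp) (by simp) (sgn_one_map_heq f) rfl).trans
      (sgn_one_map_heq _).symm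
  · exact (whiskerLeft_heq_whiskerLeft (by simp) (by simp) (sgn_neg_one_map_heq f) rfl).trans
      ((GradedMonoidalCategory.whiskerLeft_inv Z f).trans (sgn_neg_one_map_heq _).symm)

lemma whiskerRight_sgn_obj (s : ℤˣ) {X Y : A} (f : X ⟶ Y) (Z : A) :
    HEq (f ▷ (sgn A s).obj Z) ((sgn A s).map (f ▷ Z)) := by
  rcases Int.units_eq_one_or s with rfl | rfl
  · exact (whiskerRight_heq_whiskerRight rfl rfl HEq.rfl (by simp)).trans
      (sgn_one_map_heq _).symm
  · exact (whiskerRight_heq_whiskerRight rfl rfl HEq.rfl (by simp)).trans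
      ((GradedMonoidalCategory.whiskerRight_inv f Z).trans (sgn_neg_one_map_heq _).symm)

lemma sgn_obj_whiskerLeft (s : ℤˣ) {X Y : A} (f : X ⟶ Y) (Z : A) :
    HEq ((sgn A s).obj Z ◁ f) ((sgn A s).map (Z ◁ f)) := by
  rcases Int.units_eq_one_or s with rfl | rfl
  · exact (whiskerLeft_heq_whiskerLeft rfl rfl HEq.rfl (by simp)).trans
      (sgn_one_map_heq _).symm
  · exact (whiskerLeft_heq_whiskerLeft rfl rfl HEq.rfl (by simp)).trans
      ((GradedMonoidalCategory.inv_whiskerLeft Z f).trans (sgn_neg_one_map_heq _).symm)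

lemma eq_sgn_tensor_right {s : ℤˣ} {X X' : A} (h : X' = (sgn A s).obj X) (Z : A) :
    X' ⊗ Z = (sgn A s).obj (X ⊗ Z) := by
  rw [h, sgn_tensor]

lemma eq_sgn_tensor_left {s : ℤˣ} {X X' : A} (h : X' = (sgn A s).obj X) (Z : A) :
    Z ⊗ X' = (sgn A s).obj (Z ⊗ X) := by
  rw [h, tensor_sgn]

lemma eq_sgn_tensor {s t : ℤˣ} {X X' Y Y' : A} (h : X' = (sgn A s).obj X)
    (h' : Y' = (sgn A t).obj Y) : X' ⊗ Y' = (sgn A (s * t)).obj (X ⊗ Y) := by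
  rw [h, h', sgn_tensor, tensor_sgn, sgn_obj_sgn_obj]

/-- Whiskering before the identification. -/
def Unor.PreHom.whiskerRight {X Y : A} (p : Unor.PreHom X Y) (Z : A) :
    Unor.PreHom (X ⊗ Z) (Y ⊗ Z) :=
  ⟨p.1, p.2 ▷ Z ≫ eqToHom (sgn_tensor _ _ _)⟩

/-- Whiskering before the identification. -/
def Unor.PreHom.whiskerLeft (Z : A) {X Y : A} (p : Unor.PreHom X Y) :
    Unor.PreHom (Z ⊗ X) (Z ⊗ Y) :=
  ⟨p.1, Z ◁ p.2 ≫ eqToHom (tensor_sgn _ _ _)⟩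

lemma Unor.whiskerRight_rel {X Y : A} {p q : Unor.PreHom X Y} (h : Unor.Rel p q) (Z : A) :
    Unor.Rel (p.whiskerRight Z) (q.whiskerRight Z) := by
  rcases h with rfl | ⟨h, h', e⟩
  · exact Or.inl rfl
  · have h1 : gdim (X ⊗ Z) < gdim ((sgn A p.1).obj Y ⊗ Z) := by
      rw [GradedMonoidalCategory.gdim_tensor, GradedMonoidalCategory.gdim_tensor]
      exact add_lt_add_left h' _
    refine Or.inr ⟨h, ?_, ?_⟩
    · rwa [sgn_tensor] at h1
    · refine HEq.trans (bal_heq_bal rfl (sgn_tensor _ _ _).symm (comp_eqToHom_heq _ _) _ h1) ?_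
      refine (GradedMonoidalCategory.bal_whiskerRight p.2 Z h' h1).symm.trans ?_
      refine HEq.trans ?_ (comp_eqToHom_heq _ _).symm
      exact whiskerRight_heq_whiskerRight rfl (by rw [ginv_sgn_obj, h, neg_neg]) e rfl

lemma Unor.whiskerLeft_rel {X Y : A} {p q : Unor.PreHom X Y} (h : Unor.Rel p q) (Z : A) :
    Unor.Rel (p.whiskerLeft Z) (q.whiskerLeft Z) := by
  rcases h with rfl | ⟨h, h', e⟩
  · exact Or.inl rfl
  · have h1 : gdim (Z ⊗ X) < gdim (Z ⊗ (sgn A p.1).obj Y) := by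
      rw [GradedMonoidalCategory.gdim_tensor, GradedMonoidalCategory.gdim_tensor]
      exact add_lt_add_right h' _
    refine Or.inr ⟨h, ?_, ?_⟩
    · rwa [tensor_sgn] at h1
    · refine HEq.trans (bal_heq_bal rfl (tensor_sgn _ _ _).symm (comp_eqToHom_heq _ _) _ h1) ?_
      refine (GradedMonoidalCategory.whiskerLeft_bal Z p.2 h' h1).symm.trans ?_
      refine HEq.trans ?_ (comp_eqToHom_heq _ _).symm
      exact whiskerLeft_heq_whiskerLeft rfl (by rw [ginv_sgn_obj, h, neg_neg]) e rfl

namespace Unor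

instance : MonoidalCategoryStruct (Unor A) where
  tensorObj X Y := ⟨X.as ⊗ Y.as⟩
  tensorUnit := ⟨𝟙_ A⟩
  whiskerLeft X _ _ f := Quotient.map (PreHom.whiskerLeft X.as) (fun _ _ h => whiskerLeft_rel h _) f
  whiskerRight f X := Quotient.map (·.whiskerRight X.as) (fun _ _ h => whiskerRight_rel h _) f
  associator X Y Z := ⟨of (α_ X.as Y.as Z.as).hom, of (α_ X.as Y.as Z.as).inv,
    by rw [← of_comp, Iso.hom_inv_id, of_id], by rw [← of_comp, Iso.inv_hom_id, of_id]⟩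
  leftUnitor X := ⟨of (λ_ X.as).hom, of (λ_ X.as).inv,
    by rw [← of_comp, Iso.hom_inv_id, of_id], by rw [← of_comp, Iso.inv_hom_id, of_id]⟩
  rightUnitor X := ⟨of (ρ_ X.as).hom, of (ρ_ X.as).inv,
    by rw [← of_comp, Iso.hom_inv_id, of_id], by rw [← of_comp, Iso.inv_hom_id, of_id]⟩

lemma of_whiskerRight {X Y : A} (f : X ⟶ Y) (Z : A) : of (f ▷ Z) = of f ▷ mk Z := by
  refine congrArg (Quotient.mk _) (PreHom.ext rfl ?_)
  refine (comp_eqToHom_heq _ _).trans (HEq.trans ?_ (comp_eqToHom_heq _ _).symm)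
  exact whiskerRight_heq_whiskerRight rfl (by simp) (comp_eqToHom_heq _ _).symm rfl

lemma of_whiskerLeft {X Y : A} (f : X ⟶ Y) (Z : A) : of (Z ◁ f) = mk Z ◁ of f := by
  refine congrArg (Quotient.mk _) (PreHom.ext rfl ?_)
  refine (comp_eqToHom_heq _ _).trans (HEq.trans ?_ (comp_eqToHom_heq _ _).symm)
  exact whiskerLeft_heq_whiskerLeft rfl (by simp) (comp_eqToHom_heq _ _).symm rfl

lemma can_whiskerRight {s : ℤˣ} {X X' : A} (h : X' = (sgn A s).obj X) (Z : A) :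
    can s h ▷ mk Z = can s (eq_sgn_tensor_right h Z) := by
  refine congrArg (Quotient.mk _) (PreHom.ext rfl ?_)
  subst h
  dsimp only [PreHom.whiskerRight]
  simp

lemma whiskerLeft_can {s : ℤˣ} {X X' : A} (h : X' = (sgn A s).obj X) (Z : A) :
    mk Z ◁ can s h = can s (eq_sgn_tensor_left h Z) := by
  refine congrArg (Quotient.mk _) (PreHom.ext rfl ?_)
  subst h
  dsimp only [PreHom.whiskerLeft]
  simp

lemma comp_whiskerRight_aux {X Y Z : Unor A} (f : X ⟶ Y) (g : Y ⟶ Z) (W : Unor A) :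
    (f ≫ g) ▷ W = f ▷ W ≫ g ▷ W := by
  induction f using Quotient.inductionOn with | _ p => ?_
  induction g using Quotient.inductionOn with | _ q => ?_
  refine congrArg (Quotient.mk _) (PreHom.ext rfl ?_)
  dsimp only [PreHom.whiskerRight, PreHom.comp]
  refine (comp_eqToHom_heq _ _).trans (HEq.trans ?_ (comp_eqToHom_heq' _ _ _).symm)
  rw [comp_whiskerRight]
  refine comp_heq_comp rfl (sgn_tensor _ _ _) ?_ (comp_eqToHom_heq _ _).symm ?_
  · rw [← sgn_obj_sgn_obj, sgn_tensor, sgn_tensor]; rfl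
  · refine HEq.trans (whiskerRight_heq_whiskerRight rfl (sgn_obj_sgn_obj _ _ _).symm
      (comp_eqToHom_heq _ _) rfl) ((sgn_map_whiskerRight _ _ _).trans ?_)
    exact sgn_map_heq _ rfl (sgn_tensor _ _ _) (comp_eqToHom_heq _ _).symm

lemma whiskerLeft_comp_aux (W : Unor A) {X Y Z : Unor A} (f : X ⟶ Y) (g : Y ⟶ Z) :
    W ◁ (f ≫ g) = W ◁ f ≫ W ◁ g := by
  induction f using Quotient.inductionOn with | _ p => ?_
  induction g using Quotient.inductionOn with | _ q => ?_
  refine congrArg (Quotient.mk _) (PreHom.ext rfl ?_)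
  dsimp only [PreHom.whiskerLeft, PreHom.comp]
  refine (comp_eqToHom_heq _ _).trans (HEq.trans ?_ (comp_eqToHom_heq' _ _ _).symm)
  rw [MonoidalCategory.whiskerLeft_comp]
  refine comp_heq_comp rfl (tensor_sgn _ _ _) ?_ (comp_eqToHom_heq _ _).symm ?_
  · rw [← sgn_obj_sgn_obj, tensor_sgn, tensor_sgn]; rfl
  · refine HEq.trans (whiskerLeft_heq_whiskerLeft rfl (sgn_obj_sgn_obj _ _ _).symm
      (comp_eqToHom_heq _ _) rfl) ((sgn_map_whiskerLeft _ _ _).trans ?_)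
    exact sgn_map_heq _ rfl (tensor_sgn _ _ _) (comp_eqToHom_heq _ _).symm

/-- A property of morphisms which is stable under composition holds for all morphisms as soon as it
holds for the morphisms of `A` and for the canonical ones. -/
lemma induction_hom {p : ∀ {X Y : Unor A}, (X ⟶ Y) → Prop}
    (h1 : ∀ {X Y : A} (f : X ⟶ Y), p (of f))
    (h2 : ∀ {X X' : A} (s : ℤˣ) (h : X' = (sgn A s).obj X), p (can s h))
    (h3 : ∀ {X Y Z : Unor A} (f : X ⟶ Y) (g : Y ⟶ Z), p f → p g → p (f ≫ g))
    {X Y : Unor A} (f : X ⟶ Y) : p f := by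
  obtain ⟨s, f', rfl⟩ := exists_eq f
  exact h3 _ _ (h1 _) (h2 _ _)

lemma whisker_exchange_aux {W X Y Z : Unor A} (f : W ⟶ X) (g : Y ⟶ Z) :
    W ◁ g ≫ f ▷ Z = f ▷ Y ≫ X ◁ g := by
  refine induction_hom (p := fun {W X} f => ∀ {Y Z : Unor A} (g : Y ⟶ Z),
    W ◁ g ≫ f ▷ Z = f ▷ Y ≫ X ◁ g) (fun {W X} f Y Z g => ?_) (fun {W X} s h Y Z g => ?_)
    (fun f f' h h' Y Z g => ?_) f g
  · refine induction_hom (p := fun {Y Z} g => mk W ◁ g ≫ of f ▷ Z = of f ▷ Y ≫ mk X ◁ g)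
      (fun {Y Z} g => ?_) (fun {Y Z} s h => ?_) (fun g g' h h' => ?_) g
    · rw [← of_whiskerRight, ← of_whiskerRight, ← of_whiskerLeft, ← of_whiskerLeft]
      exact (of_comp _ _).symm.trans ((congrArg of (whisker_exchange f g)).trans (of_comp _ _))
    · rw [whiskerLeft_can, whiskerLeft_can, ← of_whiskerRight, ← of_whiskerRight]
      refine (of_comp_can _ _ ?_).symm
      subst h
      exact whiskerRight_sgn_obj _ _ _
    · rw [whiskerLeft_comp_aux, whiskerLeft_comp_aux, Category.assoc, h', ← Category.assoc, h,
        Category.assoc]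
  · refine induction_hom (p := fun {Y Z} g => mk X ◁ g ≫ can s h ▷ Z = can s h ▷ Y ≫ mk W ◁ g)
      (fun {Y Z} g => ?_) (fun {Y Z} s h => ?_) (fun g g' h h' => ?_) g
    · rw [can_whiskerRight, can_whiskerRight, ← of_whiskerLeft, ← of_whiskerLeft]
      refine of_comp_can _ _ ?_
      subst h
      exact sgn_obj_whiskerLeft _ _ _
    · rw [can_whiskerRight, can_whiskerRight, whiskerLeft_can, whiskerLeft_can]
      refine (can_comp_can _ _).trans (Eq.trans ?_ (can_comp_can _ _).symm)
      exact can_congr _ (mul_comm _ _)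
    · rw [whiskerLeft_comp_aux, whiskerLeft_comp_aux, Category.assoc, h', ← Category.assoc, h,
        Category.assoc]
  · rw [comp_whiskerRight_aux, comp_whiskerRight_aux, ← Category.assoc, h, Category.assoc, h',
      Category.assoc]

lemma id_whiskerRight_aux (X Y : Unor A) : 𝟙 X ▷ Y = 𝟙 (X ⊗ Y) :=
  (congrArg (· ▷ Y) (of_id X.as).symm).trans ((of_whiskerRight _ _).symm.trans
    ((congrArg of (id_whiskerRight _ _)).trans (of_id _)))

lemma whiskerLeft_id_aux (X Y : Unor A) : X ◁ 𝟙 Y = 𝟙 (X ⊗ Y) :=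
  (congrArg (X ◁ ·) (of_id Y.as).symm).trans ((of_whiskerLeft _ _).symm.trans
    ((congrArg of (MonoidalCategory.whiskerLeft_id _ _)).trans (of_id _)))

lemma sgn_associator (s : ℤˣ) (X Y Z : A) :
    HEq (α_ ((sgn A s).obj X) Y Z).hom ((sgn A s).map (α_ X Y Z).hom) := by
  rcases Int.units_eq_one_or s with rfl | rfl
  · rw [sgn_one]; rfl
  · rw [sgn_neg_one]; exact GradedMonoidalCategory.inv_associator X Y Z

lemma associator_sgn (s : ℤˣ) (X Y Z : A) :
    HEq (α_ X ((sgn A s).obj Y) Z).hom ((sgn A s).map (α_ X Y Z).hom) := by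
  rcases Int.units_eq_one_or s with rfl | rfl
  · rw [sgn_one]; rfl
  · rw [sgn_neg_one]; exact GradedMonoidalCategory.associator_inv X Y Z

lemma associator_sgn' (s : ℤˣ) (X Y Z : A) :
    HEq (α_ X Y ((sgn A s).obj Z)).hom ((sgn A s).map (α_ X Y Z).hom) := by
  rcases Int.units_eq_one_or s with rfl | rfl
  · rw [sgn_one]; rfl
  · rw [sgn_neg_one]; exact GradedMonoidalCategory.associator_inv' X Y Z

lemma associator_naturality_left_aux {X X' : Unor A} (f : X ⟶ X') (Y Z : Unor A) :
    (f ▷ Y) ▷ Z ≫ (α_ X' Y Z).hom = (α_ X Y Z).hom ≫ f ▷ (Y ⊗ Z) := by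
  refine induction_hom (p := fun {X X'} f => (f ▷ Y) ▷ Z ≫ (α_ X' Y Z).hom =
    (α_ X Y Z).hom ≫ f ▷ (Y ⊗ Z)) (fun {X X'} f => ?_) (fun {X X'} s h => ?_)
    (fun g g' h h' => ?_) f
  · change (of f ▷ mk Y.as) ▷ mk Z.as ≫ of (α_ X' Y.as Z.as).hom = of (α_ X Y.as Z.as).hom ≫
        of f ▷ mk (Y.as ⊗ Z.as)
    rw [← of_whiskerRight, ← of_whiskerRight, ← of_whiskerRight]
    refine (of_comp _ _).symm.trans ((congrArg of ?_).trans (of_comp _ _))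
    exact associator_naturality_left f Y.as Z.as
  · change (can s h ▷ mk Y.as) ▷ mk Z.as ≫ of (α_ X Y.as Z.as).hom =
      of (α_ X' Y.as Z.as).hom ≫ can s h ▷ mk (Y.as ⊗ Z.as)
    rw [can_whiskerRight, can_whiskerRight, can_whiskerRight]
    refine (of_comp_can _ _ ?_).symm
    subst h
    exact sgn_associator _ _ _ _
  · simp only [comp_whiskerRight_aux]
    rw [Category.assoc, h', ← Category.assoc, h, Category.assoc]

lemma associator_naturality_middle_aux (X : Unor A) {Y Y' : Unor A} (f : Y ⟶ Y') (Z : Unor A) :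
    (X ◁ f) ▷ Z ≫ (α_ X Y' Z).hom = (α_ X Y Z).hom ≫ X ◁ f ▷ Z := by
  refine induction_hom (p := fun {Y Y'} f => (X ◁ f) ▷ Z ≫ (α_ X Y' Z).hom =
    (α_ X Y Z).hom ≫ X ◁ f ▷ Z) (fun {Y Y'} f => ?_) (fun {Y Y'} s h => ?_)
    (fun g g' h h' => ?_) f
  · change (mk X.as ◁ of f) ▷ mk Z.as ≫ of (α_ X.as Y' Z.as).hom = of (α_ X.as Y Z.as).hom ≫
        mk X.as ◁ of f ▷ mk Z.as
    rw [← of_whiskerLeft, ← of_whiskerRight, ← of_whiskerRight, ← of_whiskerLeft]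
    refine (of_comp _ _).symm.trans ((congrArg of ?_).trans (of_comp _ _))
    exact associator_naturality_middle X.as f Z.as
  · change (mk X.as ◁ can s h) ▷ mk Z.as ≫ of (α_ X.as Y Z.as).hom =
      of (α_ X.as Y' Z.as).hom ≫ mk X.as ◁ can s h ▷ mk Z.as
    rw [whiskerLeft_can, can_whiskerRight, can_whiskerRight, whiskerLeft_can]
    refine (of_comp_can _ _ ?_).symm
    subst h
    exact associator_sgn _ _ _ _
  · simp only [comp_whiskerRight_aux, whiskerLeft_comp_aux]
    rw [Category.assoc, h', ← Category.assoc, h, Category.assoc]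

lemma associator_naturality_right_aux (X Y : Unor A) {Z Z' : Unor A} (f : Z ⟶ Z') :
    (X ⊗ Y) ◁ f ≫ (α_ X Y Z').hom = (α_ X Y Z).hom ≫ X ◁ Y ◁ f := by
  refine induction_hom (p := fun {Z Z'} f => (X ⊗ Y) ◁ f ≫ (α_ X Y Z').hom =
    (α_ X Y Z).hom ≫ X ◁ Y ◁ f) (fun {Z Z'} f => ?_) (fun {Z Z'} s h => ?_)
    (fun g g' h h' => ?_) f
  · change mk (X.as ⊗ Y.as) ◁ of f ≫ of (α_ X.as Y.as Z').hom = of (α_ X.as Y.as Z).hom ≫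
        mk X.as ◁ mk Y.as ◁ of f
    rw [← of_whiskerLeft, ← of_whiskerLeft, ← of_whiskerLeft]
    refine (of_comp _ _).symm.trans ((congrArg of ?_).trans (of_comp _ _))
    exact associator_naturality_right X.as Y.as f
  · change mk (X.as ⊗ Y.as) ◁ can s h ≫ of (α_ X.as Y.as Z).hom =
      of (α_ X.as Y.as Z').hom ≫ mk X.as ◁ mk Y.as ◁ can s h
    rw [whiskerLeft_can, whiskerLeft_can, whiskerLeft_can]
    refine (of_comp_can _ _ ?_).symm
    subst h
    exact associator_sgn' _ _ _ _
  · simp only [whiskerLeft_comp_aux]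
    rw [Category.assoc, h', ← Category.assoc, h, Category.assoc]

lemma leftUnitor_naturality_aux {X Y : Unor A} (f : X ⟶ Y) :
    𝟙_ (Unor A) ◁ f ≫ (λ_ Y).hom = (λ_ X).hom ≫ f := by
  refine induction_hom (p := fun {X Y} f => 𝟙_ (Unor A) ◁ f ≫ (λ_ Y).hom = (λ_ X).hom ≫ f)
    (fun {X Y} f => ?_) (fun {X X'} s h => ?_) (fun g g' h h' => ?_) f
  · change mk (𝟙_ A) ◁ of f ≫ of (λ_ Y).hom = of (λ_ X).hom ≫ of f
    rw [← of_whiskerLeft]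
    exact (of_comp _ _).symm.trans ((congrArg of (leftUnitor_naturality f)).trans (of_comp _ _))
  · change mk (𝟙_ A) ◁ can s h ≫ of (λ_ X).hom = of (λ_ X').hom ≫ can s h
    rw [whiskerLeft_can]
    refine (of_comp_can _ _ ?_).symm
    subst h
    rcases Int.units_eq_one_or s with rfl | rfl
    · rw [sgn_one]; rfl
    · rw [sgn_neg_one]; exact GradedMonoidalCategory.leftUnitor_inv X
  · simp only [whiskerLeft_comp_aux]
    rw [Category.assoc, h', ← Category.assoc, h, Category.assoc]

lemma rightUnitor_naturality_aux {X Y : Unor A} (f : X ⟶ Y) :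
    f ▷ 𝟙_ (Unor A) ≫ (ρ_ Y).hom = (ρ_ X).hom ≫ f := by
  refine induction_hom (p := fun {X Y} f => f ▷ 𝟙_ (Unor A) ≫ (ρ_ Y).hom = (ρ_ X).hom ≫ f)
    (fun {X Y} f => ?_) (fun {X X'} s h => ?_) (fun g g' h h' => ?_) f
  · change of f ▷ mk (𝟙_ A) ≫ of (ρ_ Y).hom = of (ρ_ X).hom ≫ of f
    rw [← of_whiskerRight]
    exact (of_comp _ _).symm.trans ((congrArg of (rightUnitor_naturality f)).trans (of_comp _ _))
  · change can s h ▷ mk (𝟙_ A) ≫ of (ρ_ X).hom = of (ρ_ X').hom ≫ can s h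
    rw [can_whiskerRight]
    refine (of_comp_can _ _ ?_).symm
    subst h
    rcases Int.units_eq_one_or s with rfl | rfl
    · rw [sgn_one]; rfl
    · rw [sgn_neg_one]; exact GradedMonoidalCategory.rightUnitor_inv X
  · simp only [comp_whiskerRight_aux]
    rw [Category.assoc, h', ← Category.assoc, h, Category.assoc]

instance : MonoidalCategory (Unor A) where
  tensorHom_def _ _ := rfl
  id_tensorHom_id X Y := by
    change 𝟙 X ▷ Y ≫ X ◁ 𝟙 Y = _
    rw [id_whiskerRight_aux, whiskerLeft_id_aux]
    exact Category.id_comp _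
  tensorHom_comp_tensorHom f₁ f₂ g₁ g₂ := by
    change (f₁ ▷ _ ≫ _ ◁ f₂) ≫ (g₁ ▷ _ ≫ _ ◁ g₂) = (f₁ ≫ g₁) ▷ _ ≫ _ ◁ (f₂ ≫ g₂)
    rw [comp_whiskerRight_aux, whiskerLeft_comp_aux, Category.assoc, Category.assoc,
      ← Category.assoc (_ ◁ f₂), whisker_exchange_aux, Category.assoc]
  whiskerLeft_id := whiskerLeft_id_aux
  id_whiskerRight := id_whiskerRight_aux
  associator_naturality {X₁ X₂ X₃ Y₁ Y₂ Y₃} f₁ f₂ f₃ := by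
    change ((f₁ ▷ _ ≫ _ ◁ f₂) ▷ _ ≫ _ ◁ f₃) ≫ _ = _ ≫ (f₁ ▷ _ ≫ _ ◁ (f₂ ▷ _ ≫ _ ◁ f₃))
    rw [comp_whiskerRight_aux, whiskerLeft_comp_aux, Category.assoc,
      associator_naturality_right_aux, Category.assoc, ← Category.assoc ((Y₁ ◁ f₂) ▷ X₃),
      associator_naturality_middle_aux, Category.assoc,
      ← Category.assoc ((f₁ ▷ X₂) ▷ X₃), associator_naturality_left_aux, Category.assoc]
  leftUnitor_naturality := leftUnitor_naturality_aux
  rightUnitor_naturality := rightUnitor_naturality_aux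
  pentagon W X Y Z := by
    change of _ ▷ mk Z.as ≫ of _ ≫ mk W.as ◁ of _ = of _ ≫ of _
    rw [← of_whiskerRight, ← of_whiskerLeft]
    refine Eq.trans ?_ ((congrArg of (pentagon W.as X.as Y.as Z.as)).trans (of_comp _ _))
    exact (congrArg (of _ ≫ ·) (of_comp _ _).symm).trans (of_comp _ _).symm
  triangle X Y := by
    change of _ ≫ mk X.as ◁ of _ = of _ ▷ mk Y.as
    rw [← of_whiskerRight, ← of_whiskerLeft]
    exact (of_comp _ _).symm.trans (congrArg of (triangle X.as Y.as))

lemma of_tensorHom {X Y X' Y' : A} (f : X ⟶ Y) (g : X' ⟶ Y') : of (f ⊗ₘ g) = of f ⊗ₘ of g := by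
  rw [MonoidalCategory.tensorHom_def, MonoidalCategory.tensorHom_def, of_comp, of_whiskerRight,
    of_whiskerLeft]

lemma can_tensorHom_can {s t : ℤˣ} {X X' Y Y' : A} (h : X' = (sgn A s).obj X)
    (h' : Y' = (sgn A t).obj Y) : can s h ⊗ₘ can t h' = can (s * t) (eq_sgn_tensor h h') := by
  rw [MonoidalCategory.tensorHom_def, can_whiskerRight, whiskerLeft_can]
  exact can_comp_can _ _

end Unor

end

section

variable [GradedSymmetricCategory A]

lemma psign_add (a b : ℤ) : psign (a + b) = psign a * psign b := Int.negOnePow_add a b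

namespace Unor

/-- The commutativity isomorphism. -/
def braidIso (X Y : Unor A) : X ⊗ Y ≅ Y ⊗ X :=
  (⟨of (GradedSymmetricCategory.braid X.as Y.as).hom,
    of (GradedSymmetricCategory.braid X.as Y.as).inv,
    by rw [← of_comp, Iso.hom_inv_id, of_id]; rfl,
    by rw [← of_comp, Iso.inv_hom_id, of_id]⟩ : X ⊗ Y ≅ mk ((sgn A (psign (gdim X.as * gdim Y.as))).obj (Y.as ⊗ X.as))) ≪≫ canIso _ rfl

lemma braidIso_hom (X Y : A) : (braidIso (mk X) (mk Y)).hom =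
    of (GradedSymmetricCategory.braid X Y).hom ≫ can (psign (gdim X * gdim Y)) rfl := rfl

lemma can_comp_of (s : ℤˣ) {X Y : A} (f : X ⟶ Y) :
    can s rfl ≫ of f = of ((sgn A s).map f) ≫ can s rfl :=
  (of_comp_can rfl rfl HEq.rfl).symm

lemma braidIso_symmetry (X Y : Unor A) : (braidIso X Y).hom ≫ (braidIso Y X).hom = 𝟙 _ := by
  obtain ⟨X⟩ := X
  obtain ⟨Y⟩ := Y
  have h1 : (sgn A (psign (gdim X * gdim Y))).obj
      ((sgn A (psign (gdim Y * gdim X))).obj (X ⊗ Y)) = X ⊗ Y := by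
    rw [sgn_obj_sgn_obj, mul_comm (gdim Y), Int.units_mul_self, sgn_one]
    rfl
  have h2 := of_heq rfl h1 (GradedSymmetricCategory.symmetry X Y)
  rw [of_id, Category.comp_id, can_one, of_comp, Category.assoc] at h2
  rw [braidIso_hom, braidIso_hom, Category.assoc, ← Category.assoc (can _ _), can_comp_of,
    Category.assoc, can_comp_can]
  refine Eq.trans ?_ h2
  congr 2
  exact can_congr _ (by rw [mul_comm (gdim Y), Int.units_mul_self])

lemma sgn_braid (s : ℤˣ) (X Y : A) :
    HEq (GradedSymmetricCategory.braid ((sgn A s).obj X) Y).hom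
      ((sgn A s).map (GradedSymmetricCategory.braid X Y).hom) := by
  rcases Int.units_eq_one_or s with rfl | rfl
  · rw [sgn_one]; rfl
  · rw [sgn_neg_one]; exact GradedSymmetricCategory.inv_braid X Y

lemma braidIso_naturality_left {X Y : Unor A} (f : X ⟶ Y) (Z : Unor A) :
    f ▷ Z ≫ (braidIso Y Z).hom = (braidIso X Z).hom ≫ Z ◁ f := by
  obtain ⟨Z⟩ := Z
  refine induction_hom (p := fun {X Y} f => f ▷ mk Z ≫ (braidIso Y (mk Z)).hom =
    (braidIso X (mk Z)).hom ≫ mk Z ◁ f) (fun {X Y} f => ?_) (fun {X X'} s h => ?_)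
    (fun g g' h h' => ?_) f
  · rw [braidIso_hom, braidIso_hom, ← of_whiskerRight, ← of_whiskerLeft]
    refine (Category.assoc _ _ _).symm.trans (Eq.trans ?_ (Category.assoc _ _ _).symm)
    refine Eq.trans ?_ (congrArg (of _ ≫ ·) (can_comp_of _ _).symm)
    refine Eq.trans ?_ (Category.assoc _ _ _)
    refine (congrArg (· ≫ can _ _) (of_comp _ _)).symm.trans
      (Eq.trans ?_ (congrArg (· ≫ can _ _) (of_comp _ _)))
    by_cases hp : psign (gdim X * gdim Z) = psign (gdim Y * gdim Z)
    · have h2 := of_heq rfl (by rw [hp]) (GradedSymmetricCategory.braid_natural f Z hp)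
      rw [can_one, Category.id_comp] at h2
      rw [← h2, Category.assoc, can_comp_can]
      congr 1
      exact can_congr _ (by rw [hp, one_mul])
    · have h0 : gdim X < gdim Y := (gdim_le f).lt_of_ne fun h => hp (by rw [h])
      have h1 : gdim (X ⊗ Z) < gdim ((sgn A (psign (gdim X * gdim Z))).obj (Z ⊗ Y)) := by
        rw [gdim_sgn, GradedMonoidalCategory.gdim_tensor, GradedMonoidalCategory.gdim_tensor]
        omega
      have hs : psign (gdim Y * gdim Z) = -psign (gdim X * gdim Z) := by
        rcases Int.units_eq_one_or (psign (gdim X * gdim Z)) with h2 | h2 <;>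
          rcases Int.units_eq_one_or (psign (gdim Y * gdim Z)) with h3 | h3 <;>
          simp_all
      have h2 := of_heq rfl (by rw [ginv_sgn_obj, hs])
        (GradedSymmetricCategory.braid_natural' f Z hp h1)
      rw [can_one, Category.id_comp] at h2
      rw [← of_bal_comp_can _ h1 (by rw [sgn_neg_one]), ← h2, Category.assoc, Category.assoc,
        can_comp_can, can_comp_can]
      congr 1
      exact can_congr _ (by rw [hs]; simp)
  · rw [braidIso_hom, braidIso_hom, can_whiskerRight, whiskerLeft_can]
    have h1 := of_comp_can (f := (GradedSymmetricCategory.braid X Z).hom)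
      (f' := (GradedSymmetricCategory.braid X' Z).hom) (eq_sgn_tensor_right h Z) (s := s) (by
      rw [h, gdim_sgn, tensor_sgn, sgn_obj_sgn_obj, sgn_obj_sgn_obj, mul_comm]) (by
      subst h
      exact sgn_braid s X Z)
    refine (Category.assoc _ _ _).symm.trans (Eq.trans ?_ (Category.assoc _ _ _).symm)
    refine (congrArg (· ≫ can _ _) h1).symm.trans ((Category.assoc _ _ _).trans ?_)
    congr 1
    refine (can_comp_can _ _).trans (Eq.trans ?_ (can_comp_can _ _).symm)
    exact can_congr _ (by rw [h, gdim_sgn, mul_comm])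
  · rw [comp_whiskerRight, MonoidalCategory.whiskerLeft_comp, Category.assoc, h',
      ← Category.assoc, h, Category.assoc]

lemma braidIso_naturality_right (Z : Unor A) {X Y : Unor A} (f : X ⟶ Y) :
    Z ◁ f ≫ (braidIso Z Y).hom = (braidIso Z X).hom ≫ f ▷ Z := by
  rw [← cancel_mono (braidIso Y Z).hom, Category.assoc, braidIso_symmetry, Category.comp_id,
    Category.assoc, braidIso_naturality_left, ← Category.assoc, braidIso_symmetry,
    Category.id_comp]

lemma braidIso_hexagon (X Y Z : Unor A) :
    (α_ X Y Z).hom ≫ (braidIso X (Y ⊗ Z)).hom ≫ (α_ Y Z X).hom =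
      (braidIso X Y).hom ▷ Z ≫ (α_ Y X Z).hom ≫ Y ◁ (braidIso X Z).hom := by
  obtain ⟨X⟩ := X
  obtain ⟨Y⟩ := Y
  obtain ⟨Z⟩ := Z
  have h1 : (sgn A (psign (gdim X * gdim Y))).obj
      (Y ⊗ (sgn A (psign (gdim X * gdim Z))).obj (Z ⊗ X)) =
      (sgn A (psign (gdim X * gdim (Y ⊗ Z)))).obj (Y ⊗ Z ⊗ X) := by
    rw [tensor_sgn, sgn_obj_sgn_obj, GradedMonoidalCategory.gdim_tensor, mul_add,
      psign_add]
  have h2 := of_heq rfl h1 (GradedSymmetricCategory.hexagon X Y Z).symm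
  rw [can_one, Category.id_comp, of_comp, of_comp, of_comp, of_comp] at h2
  rw [braidIso_hom, braidIso_hom]
  have h3 : (braidIso (mk X) (mk (Y ⊗ Z))).hom ≫ of (α_ Y Z X).hom =
      (of (GradedSymmetricCategory.braid X (Y ⊗ Z)).hom ≫ of ((sgn A _).map (α_ Y Z X).hom)) ≫
        can _ rfl := by
    rw [braidIso_hom, Category.assoc, can_comp_of, Category.assoc]
  refine (congrArg (of (α_ X Y Z).hom ≫ ·) h3).trans ((Category.assoc _ _ _).symm.trans ?_)
  refine (congrArg (· ≫ can _ rfl) h2).symm.trans ?_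
  rw [comp_whiskerRight, can_whiskerRight, ← of_whiskerRight, of_eqToHom]
  have h4 : can (psign (gdim X * gdim Y)) (eq_sgn_tensor_right rfl Z) =
      can 1 (eq_sgn_one (sgn_tensor (psign (gdim X * gdim Y)) (Y ⊗ X) Z)) ≫ can _ rfl := by
    rw [can_comp_can]
    exact can_congr _ (one_mul _).symm
  have h5 : of (α_ Y X Z).hom ≫ mk Y ◁ (of (GradedSymmetricCategory.braid X Z).hom ≫ can _ rfl) =
      of ((α_ Y X Z).hom ≫ Y ◁ (GradedSymmetricCategory.braid X Z).hom) ≫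
        can (psign (gdim X * gdim Z)) (eq_sgn_tensor_left rfl Y) := by
    rw [MonoidalCategory.whiskerLeft_comp, whiskerLeft_can, ← of_whiskerLeft, of_comp]
    exact (Category.assoc _ _ _).symm
  have h6 : can (psign (gdim X * gdim Y)) rfl ≫
      of ((α_ Y X Z).hom ≫ Y ◁ (GradedSymmetricCategory.braid X Z).hom) =
      of ((sgn A _).map ((α_ Y X Z).hom ≫ Y ◁ (GradedSymmetricCategory.braid X Z).hom)) ≫
        can _ rfl := can_comp_of _ _
  refine Eq.trans ?_ (congrArg (_ ≫ ·) h5).symm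
  rw [h4]
  simp only [Category.assoc]
  congr 2
  refine Eq.trans ?_ ((Category.assoc _ _ _).symm.trans ((congrArg (· ≫ can _ _) h6).trans
    (Category.assoc _ _ _))).symm
  congr 1
  refine (can_comp_can _ _).trans (Eq.trans ?_ (can_comp_can _ _).symm)
  exact can_congr _ (by rw [one_mul, GradedMonoidalCategory.gdim_tensor, mul_add, psign_add])

instance : SymmetricCategory (Unor A) where
  braiding := braidIso
  braiding_naturality_right := braidIso_naturality_right
  braiding_naturality_left := braidIso_naturality_left
  hexagon_forward := braidIso_hexagon
  hexagon_reverse X Y Z := by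
    have h1 : ∀ X Y : Unor A, inv (braidIso X Y).hom = (braidIso Y X).hom := fun X Y =>
      IsIso.inv_eq_of_hom_inv_id (braidIso_symmetry X Y)
    have h := braidIso_hexagon Z X Y
    simpa [h1] using IsIso.inv_eq_inv.2 h
  symmetry := braidIso_symmetry

end Unor

end

end Monoidal

end

section

namespace Unor

variable {A : Type u} [Category.{v} A] [BalancedCategory A]

/-- Two morphisms of `A` which agree up to the same canonical isomorphisms are heterogeneously
equal. -/
lemma heq_of_can {X Y X' Y' W V : A} {s s' t t' : ℤˣ} {f : X ⟶ Y} {f' : X' ⟶ Y'}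
    (φ : mk W ⟶ mk V) (hs : s = s') (ht : t = t') (hX : X = (sgn A s).obj W)
    (hX' : X' = (sgn A s').obj W) (hY : Y = (sgn A t).obj V) (hY' : Y' = (sgn A t').obj V)
    (e : of f ≫ can t hY = can s hX ≫ φ) (e' : of f' ≫ can t' hY' = can s' hX' ≫ φ) :
    HEq f f' := by
  subst hs
  subst ht
  subst hX
  subst hY
  subst hX'
  subst hY'
  refine heq_of_eq (of_injective ?_)
  rw [← cancel_mono (can t rfl), e, e']

end Unor

/- ### The values of preads on cells without orientation -/

section

variable {A : Type u} [Category.{v} A] [BalancedCategory A]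

lemma OrCell.mk_le_mk {K : OrientedBallComplex} {σ τ : K.Cell} (h : K.carrier σ ⊆ K.carrier τ) :
    OrCell.mk σ 1 ≤ OrCell.mk τ 1 := by
  rcases K.carrier_eq_or_ssubset h with rfl | h
  · exact le_rfl
  · exact Or.inr h

lemma OrCell.carrier_subset {K : OrientedBallComplex} {σ τ : K.Cell} {ε δ : ℤˣ}
    (h : OrCell.mk σ ε ≤ OrCell.mk τ δ) : K.carrier σ ⊆ K.carrier τ := by
  rcases h with ⟨rfl, rfl⟩ | h
  · exact subset_rfl
  · exact h.subset

namespace Pre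

open Unor

variable {K : OrientedBallComplex} {k : ℤ} (M : Pre A K k)

lemma obj_mk (σ : K.Cell) (ε : ℤˣ) :
    M.F.obj (OrCell.mk σ ε) = (sgn A ε).obj (M.F.obj (OrCell.mk σ 1)) := by
  rcases Int.units_eq_one_or ε with rfl | rfl
  · rw [sgn_one]; rfl
  · rw [sgn_neg_one]; exact M.obj_inv (OrCell.mk σ 1)

lemma map_heq_map {x y x' y' : OrCell K} (h : x = x') (h' : y = y') (f : x ⟶ y) (g : x' ⟶ y') :
    HEq (M.F.map f) (M.F.map g) := by
  subst h
  subst h'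
  rw [Subsingleton.elim f g]

/-- The value of a pread on a cell. -/
abbrev bar (σ : K.Cell) : Unor A := ⟨M.F.obj (OrCell.mk σ 1)⟩

/-- The morphism of values of a pread on an inclusion of cells. -/
def barMap {σ τ : K.Cell} (h : K.carrier σ ⊆ K.carrier τ) : M.bar σ ⟶ M.bar τ :=
  of (M.F.map (homOfLE (OrCell.mk_le_mk h)))

lemma barMap_refl (σ : K.Cell) : M.barMap (subset_refl (K.carrier σ)) = 𝟙 _ :=
  (congrArg of (M.F.map_id _)).trans (of_id _)

lemma of_map {σ τ : K.Cell} {ε δ : ℤˣ} (f : OrCell.mk σ ε ⟶ OrCell.mk τ δ) :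
    of (M.F.map f) ≫ can δ (M.obj_mk τ δ) =
      can ε (M.obj_mk σ ε) ≫ M.barMap (OrCell.carrier_subset (leOfHom f)) := by
  rcases (leOfHom f : RelCell.le _ _) with ⟨rfl, rfl⟩ | h
  · obtain rfl : f = 𝟙 _ := Subsingleton.elim _ _
    refine (congrArg (· ≫ can ε _) ((congrArg of (M.F.map_id _)).trans (of_id _))).trans ?_
    exact (Category.id_comp _).trans ((congrArg (can ε _ ≫ ·) (M.barMap_refl σ)).trans
      (Category.comp_id _)).symm
  have key : ∀ {δ : ℤˣ} (f : OrCell.mk σ 1 ⟶ OrCell.mk τ δ),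
      of (M.F.map f) ≫ can δ (M.obj_mk τ δ) = M.barMap h.subset := by
    intro δ f
    rcases Int.units_eq_one_or δ with rfl | rfl
    · exact (Category.comp_id _).trans (congrArg (fun g => of (M.F.map g)) (Subsingleton.elim _ _))
    · have h0 : gdim (OrCell.mk σ 1) < gdim (OrCell.mk τ 1) := Int.ofNat_lt.2 (K.dim_lt _ _ h)
      have h1 : gdim (M.F.obj (OrCell.mk σ 1)) < gdim (M.F.obj (OrCell.mk τ 1)) := by
        rw [M.gdim_obj, M.gdim_obj]
        exact sub_lt_sub_right h0 k
      have h2 := M.map_bal (homOfLE (OrCell.mk_le_mk h.subset)) h0 h1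
      have h3 : M.F.obj (OrCell.mk τ (-1)) = (ginv A).obj (M.F.obj (OrCell.mk τ 1)) :=
        M.obj_inv (OrCell.mk τ 1)
      have h4 := of_heq (f' := M.F.map f) rfl h3 h2
      rw [can_one, Category.id_comp] at h4
      have h5 := of_bal_comp_can (M.F.map (homOfLE (OrCell.mk_le_mk h.subset))) h1
        (by rw [sgn_neg_one])
      rw [← h4, Category.assoc, can_comp_can] at h5
      exact h5
  rcases Int.units_eq_one_or ε with rfl | rfl
  · exact (key f).trans (Category.id_comp _).symm
  · let f' : OrCell.mk σ 1 ⟶ OrCell.mk τ (-δ) := homOfLE (Or.inr h)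
    have h1 := M.map_inv f'
    have h2 : HEq (M.F.map f) (M.F.map ((ginv _).map f')) :=
      M.map_heq_map rfl (congrArg (OrCell.mk τ) (neg_neg δ).symm) _ _
    have h3 : M.F.obj (OrCell.mk τ δ) = (sgn A (-1)).obj (M.F.obj (OrCell.mk τ (-δ))) := by
      rw [sgn_neg_one, M.obj_mk τ δ, M.obj_mk τ (-δ), ginv_sgn_obj, neg_neg]
    have h4 := of_comp_can (f' := M.F.map f) (f := M.F.map f') (M.obj_mk σ (-1)) h3
      ((h2.trans h1).trans (sgn_neg_one_map_heq _).symm)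
    rw [← key f', ← Category.assoc, ← h4, Category.assoc, can_comp_can]
    congr 1
    exact can_congr _ (by simp)

end Pre

end

end

section

variable {A : Type u} [Category.{v} A] [BalancedCategory A] [EmptyInitial A] [MonoidalCategory A]
  [GradedSymmetricCategory A] {T : AdTheory A}

namespace StarAd

/-- The object of `A` given by a `*`-ad, without orientation. -/
abbrev bar (p : StarAd T) : Unor A := ⟨p.obj 1⟩

lemma obj_eq (p : StarAd T) (ε : ℤˣ) : p.obj ε = (sgn A ε).obj (p.obj 1) := p.pread.obj_mk _ ε

end StarAd

/-- The cell of a larger simplex given by a cell of a face. -/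
abbrev IsFace.face {n : ℕ} {a : Fin n} {σ σ' : Finset (Fin (n + 1))} (h : IsFace a σ σ')
    (τ : (simplex σ).Cell) : (simplex σ').Cell := ⟨τ.1, τ.2.1, τ.2.2.trans h.subset⟩

lemma simplex_carrier_subset {n : ℕ} {σ : Finset (Fin (n + 1))} {τ τ' : (simplex σ).Cell} :
    (simplex σ).carrier τ ⊆ (simplex σ).carrier τ' ↔ τ.1 ⊆ τ'.1 := simplexFace_subset_iff

lemma psign_zero : psign 0 = 1 := Int.negOnePow_zero

lemma comp_eq_comp_of_squares {C : Type u} [Category.{v} C] {X X' X'' Y Y' Y'' : C} {f : X ⟶ Y}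
    {f' : X' ⟶ Y'} {f'' : X'' ⟶ Y''} {a : X ⟶ X'} {a' : X' ⟶ X''} {a'' : X ⟶ X''} {b : Y ⟶ Y'}
    {b' : Y' ⟶ Y''} {b'' : Y ⟶ Y''} (h : f ≫ b = a ≫ f') (h' : f' ≫ b' = a' ≫ f'')
    (ha : a'' = a ≫ a') (hb : b'' = b ≫ b') : f ≫ b'' = a'' ≫ f'' := by
  rw [ha, hb, ← Category.assoc, h, Category.assoc, h', Category.assoc]

section Coherence

variable {C : Type u} [Category.{v} C] [MonoidalCategory C]

lemma natural_of_squares {X X' F F' p X₀ X₀' F₀ F₀' p₀ : C} {m' : X ⟶ X'} {m : F ⟶ F'}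
    {g : X ⟶ F ⊗ p} {g' : X' ⟶ F' ⊗ p} {M' : X₀ ⟶ X₀'} {M : F₀ ⟶ F₀'} {G : X₀ ⟶ F₀ ⊗ p₀}
    {G' : X₀' ⟶ F₀' ⊗ p₀} {a : X ⟶ X₀} {a' : X' ⟶ X₀'} {b : F ⟶ F₀} {b' : F' ⟶ F₀'} {d : p ⟶ p₀}
    [Epi a] (h : m' ≫ g' = g ≫ m ▷ p) (e1 : m' ≫ a' = a ≫ M') (e2 : m ≫ b' = b ≫ M)
    (e3 : g ≫ (b ⊗ₘ d) = a ≫ G) (e4 : g' ≫ (b' ⊗ₘ d) = a' ≫ G') : M' ≫ G' = G ≫ M ▷ p₀ := by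
  rw [← cancel_epi a, ← Category.assoc, ← e1, Category.assoc, ← e4, ← Category.assoc, h,
    Category.assoc, ← Category.assoc a, ← e3, Category.assoc, whiskerRight_comp_tensorHom, e2,
    tensorHom_comp_whiskerRight]

lemma square_right_of_squares {X F F' p q X₀ F₀ F₀' p₀ q₀ : C} {f : X ⟶ F' ⊗ q} {f' : F' ⟶ F ⊗ p}
    {g : X₀ ⟶ F₀' ⊗ q₀} {g' : F₀' ⟶ F₀ ⊗ p₀} {x : X ⟶ X₀} {a' : F' ⟶ F₀'} {a : F ⟶ F₀} {c : p ⟶ p₀}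
    {d : q ⟶ q₀} (e : f ≫ (a' ⊗ₘ d) = x ≫ g) (e' : f' ≫ (a ⊗ₘ c) = a' ≫ g') :
    f ≫ f' ▷ q ≫ (α_ F p q).hom ≫ (a ⊗ₘ c ⊗ₘ d) = x ≫ g ≫ g' ▷ q₀ ≫ (α_ F₀ p₀ q₀).hom := by
  rw [← Category.assoc x, ← e, Category.assoc, ← Category.assoc (a' ⊗ₘ d),
    tensorHom_comp_whiskerRight, ← e', ← associator_naturality, ← Category.assoc (f' ▷ q),
    whiskerRight_comp_tensorHom]

lemma square_left_of_squares [BraidedCategory C] {X F F' p q X₀ F₀ F₀' p₀ q₀ : C} {f : X ⟶ F' ⊗ q}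
    {f' : F' ⟶ F ⊗ p} {g : X₀ ⟶ F₀' ⊗ q₀} {g' : F₀' ⟶ F₀ ⊗ p₀} {x : X ⟶ X₀} {a' : F' ⟶ F₀'}
    {a : F ⟶ F₀} {c : p ⟶ p₀} {d : q ⟶ q₀} (e : f ≫ (a' ⊗ₘ d) = x ≫ g)
    (e' : f' ≫ (a ⊗ₘ c) = a' ≫ g') :
    f ≫ f' ▷ q ≫ (α_ F p q).hom ≫ F ◁ (β_ p q).hom ≫ (a ⊗ₘ d ⊗ₘ c) =
      x ≫ g ≫ g' ▷ q₀ ≫ (α_ F₀ p₀ q₀).hom ≫ F₀ ◁ (β_ p₀ q₀).hom := by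
  have h := square_right_of_squares e e'
  have h1 : F ◁ (β_ p q).hom ≫ (a ⊗ₘ d ⊗ₘ c) = (a ⊗ₘ c ⊗ₘ d) ≫ F₀ ◁ (β_ p₀ q₀).hom := by
    rw [whiskerLeft_comp_tensorHom, tensorHom_comp_whiskerLeft, BraidedCategory.braiding_naturality]
  rw [h1]
  simpa only [Category.assoc] using congrArg (· ≫ F₀ ◁ (β_ p₀ q₀).hom) h

end Coherence

section OrSign

variable {n : ℕ} (P : Fin n → StarAd T)

lemma orSign_insert {a b : Fin n} {σ σb : Finset (Fin (n + 1))} (hb : IsFace b σ σb) :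
    orSign P σ a = orSign P σb a * psign (if a < b then (P a).dim * (P b).dim else 0) := by
  unfold orSign
  rw [← psign_add]
  congr 1
  by_cases h : a < b
  · have h1 : (Finset.univ.filter fun c : Fin n => a < c ∧ c.succ ∉ σ) =
        insert b (Finset.univ.filter fun c : Fin n => a < c ∧ c.succ ∉ σb) := by
      ext c
      have := hb.notMem
      by_cases hc : c = b <;> simp [hb.eq, hc, this, h]
    rw [h1, Finset.sum_insert (by simp [hb.eq]), if_pos h, mul_add, add_comm]
  · have h1 : (Finset.univ.filter fun c : Fin n => a < c ∧ c.succ ∉ σ) =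
        (Finset.univ.filter fun c : Fin n => a < c ∧ c.succ ∉ σb) := by
      ext c
      by_cases hc : c = b <;> simp [hb.eq, hc, h]
    rw [h1, if_neg h, add_zero]

lemma orSign_square {a b : Fin n} {σ σa σb ρ : Finset (Fin (n + 1))} (ha : IsFace a σ σa)
    (hb : IsFace b σ σb) (hab : IsFace b σa ρ) :
    psign ((P a).dim * (P b).dim) * (orSign P σa b * orSign P σ a) =
      orSign P σ b * orSign P σb a := by
  have hne : a ≠ b := by
    rintro rfl
    exact hab.notMem (ha.eq ▸ Finset.mem_insert_self _ _)
  rw [orSign_insert P hb, orSign_insert P ha (a := b)]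
  rcases lt_or_gt_of_ne hne with h | h
  · rw [if_pos h, if_neg h.not_gt, psign_zero]
    generalize orSign P σa b = x, orSign P σb a = y, psign _ = z
    revert x y z
    decide
  · rw [if_pos h, if_neg h.not_gt, psign_zero, mul_comm (P b).dim]
    generalize orSign P σa b = x, orSign P σb a = y, psign _ = z
    revert x y z
    decide

end OrSign

lemma OrCell.prod_le {K L : OrientedBallComplex} {κ κ' : K.Cell} {τ τ' : L.Cell}
    {ε ε' δ δ' : ℤˣ} (h : OrCell.mk κ ε ≤ OrCell.mk κ' ε') (h' : OrCell.mk τ δ ≤ OrCell.mk τ' δ') :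
    OrCell.mk (K := K.prod L) (κ, τ) (ε * δ) ≤ OrCell.mk (K := K.prod L) (κ', τ') (ε' * δ') := by
  rcases h with ⟨rfl, rfl⟩ | h <;> rcases h' with ⟨rfl, rfl⟩ | h'
  · exact Or.inl ⟨rfl, rfl⟩
  · exact Or.inr ((OrientedBallComplex.prod_ssubset_iff K L (κ, τ) (κ, τ')).2
      (Or.inr ⟨subset_rfl, h'⟩))
  · exact Or.inr ((OrientedBallComplex.prod_ssubset_iff K L (κ, τ) (κ', τ)).2
      (Or.inl ⟨h, subset_rfl⟩))
  · exact Or.inr ((OrientedBallComplex.prod_ssubset_iff K L (κ, τ) (κ', τ')).2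
      (Or.inl ⟨h, h'.subset⟩))

lemma prod_carrier_subset {K L : OrientedBallComplex} {κ κ' : K.Cell} {τ τ' : L.Cell}
    (h : K.carrier κ ⊆ K.carrier κ') (h' : L.carrier τ ⊆ L.carrier τ') :
    (K.prod L).carrier (κ, τ) ⊆ (K.prod L).carrier (κ', τ') :=
  (OrientedBallComplex.prod_subset_iff K L (κ, τ) (κ', τ')).2 ⟨h, h'⟩

namespace Unor

lemma of_braid_comp_can (X Y : A) : of (GradedSymmetricCategory.braid X Y).hom ≫
    can (psign (gdim X * gdim Y)) rfl = (β_ (mk X) (mk Y)).hom := rfl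

lemma of_square_right {X F F' p q : A} {X₀ F₀' F₀ p₀ q₀ : A} {f : X ⟶ F' ⊗ q} {f' : F' ⟶ F ⊗ p}
    {g : mk X₀ ⟶ mk F₀' ⊗ mk q₀} {g' : mk F₀' ⟶ mk F₀ ⊗ mk p₀} {r s s' t t' : ℤˣ}
    (hX : X = (sgn A r).obj X₀) (hF' : F' = (sgn A s').obj F₀') (hF : F = (sgn A s).obj F₀)
    (hp : p = (sgn A t).obj p₀) (hq : q = (sgn A t').obj q₀)
    (e : of f ≫ can (s' * t') (eq_sgn_tensor hF' hq) = can r hX ≫ g)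
    (e' : of f' ≫ can (s * t) (eq_sgn_tensor hF hp) = can s' hF' ≫ g') :
    of (f ≫ f' ▷ q ≫ (α_ F p q).hom) ≫
      can (s * (t * t')) (eq_sgn_tensor hF (eq_sgn_tensor hp hq)) =
      can r hX ≫ g ≫ g' ▷ mk q₀ ≫ (α_ (mk F₀) (mk p₀) (mk q₀)).hom := by
  rw [← can_tensorHom_can hF' hq] at e
  rw [← can_tensorHom_can hF hp] at e'
  rw [of_comp, of_comp, of_whiskerRight, Category.assoc, Category.assoc,
    ← can_tensorHom_can hF (eq_sgn_tensor hp hq), ← can_tensorHom_can hp hq]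
  exact square_right_of_squares e e'

lemma of_square_left {X F F' p q : A} {X₀ F₀' F₀ p₀ q₀ : A} {f : X ⟶ F' ⊗ q} {f' : F' ⟶ F ⊗ p}
    {g : mk X₀ ⟶ mk F₀' ⊗ mk q₀} {g' : mk F₀' ⟶ mk F₀ ⊗ mk p₀} {r s s' t t' : ℤˣ}
    (hX : X = (sgn A r).obj X₀) (hF' : F' = (sgn A s').obj F₀') (hF : F = (sgn A s).obj F₀)
    (hp : p = (sgn A t).obj p₀) (hq : q = (sgn A t').obj q₀)
    (e : of f ≫ can (s' * t') (eq_sgn_tensor hF' hq) = can r hX ≫ g)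
    (e' : of f' ≫ can (s * t) (eq_sgn_tensor hF hp) = can s' hF' ≫ g') :
    of (f ≫ f' ▷ q ≫ (α_ F p q).hom ≫ F ◁ (GradedSymmetricCategory.braid p q).hom) ≫
      can (s * (psign (gdim p * gdim q) * (t' * t)))
        (eq_sgn_tensor hF (eq_sgn_trans rfl (eq_sgn_tensor hq hp))) =
      can r hX ≫ g ≫ g' ▷ mk q₀ ≫ (α_ (mk F₀) (mk p₀) (mk q₀)).hom ≫
        mk F₀ ◁ (β_ (mk p₀) (mk q₀)).hom := by
  rw [← can_tensorHom_can hF' hq] at e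
  rw [← can_tensorHom_can hF hp] at e'
  rw [of_comp, of_comp, of_comp, of_whiskerRight, of_whiskerLeft, Category.assoc, Category.assoc,
    Category.assoc, ← can_tensorHom_can hF (eq_sgn_trans rfl (eq_sgn_tensor hq hp)),
    ← can_comp_can rfl (eq_sgn_tensor hq hp), ← can_tensorHom_can hq hp]
  refine Eq.trans ?_ (square_left_of_squares e e')
  refine congrArg (_ ≫ ·) (congrArg (_ ≫ ·) (congrArg (_ ≫ ·) ?_))
  rw [← of_braid_comp_can, MonoidalCategory.whiskerLeft_comp, Category.assoc]
  refine congrArg (_ ≫ ·) ?_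
  exact (whiskerLeft_comp_tensorHom _ _ _).symm

end Unor

namespace AdSing

open Unor

variable {n : ℕ} {P : Fin n → StarAd T} {K : OrientedBallComplex} {k : ℤ} (M : AdSing T P K k)

/-- The ad on `K × σ` which is adjoint to the preads `M(κ)_σ`. -/
def adj (σ : Finset (Fin (n + 1))) : Pre A (K.prod (simplex σ)) (k + miss P σ) :=
  (M.2 σ).choose

lemma adj_mem (σ : Finset (Fin (n + 1))) : M.adj σ ∈ T.ad _ _ := (M.2 σ).choose_spec.1

lemma isAdjoint (σ : Finset (Fin (n + 1))) : IsAdjoint M.1 σ (M.adj σ) := (M.2 σ).choose_spec.2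

/-- The value of `M(κ)_σ` on `τ`, without orientations. -/
abbrev bar (σ : Finset (Fin (n + 1))) (κ : K.Cell) (τ : (simplex σ).Cell) : Unor A :=
  (M.adj σ).bar (κ, τ)

/-- The morphism of values on inclusions of cells. -/
abbrev barMap {σ : Finset (Fin (n + 1))} {κ κ' : K.Cell} {τ τ' : (simplex σ).Cell}
    (h : K.carrier κ ⊆ K.carrier κ') (h' : τ.1 ⊆ τ'.1) : M.bar σ κ τ ⟶ M.bar σ κ' τ' :=
  (M.adj σ).barMap (prod_carrier_subset h (simplex_carrier_subset.2 h'))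

lemma val_eq (κ : K.Cell) (ε : ℤˣ) (σ : Finset (Fin (n + 1))) (τ : (simplex σ).Cell) (δ : ℤˣ) :
    M.val κ ε σ τ δ = (sgn A (ε * δ)).obj (M.bar σ κ τ).as :=
  ((M.isAdjoint σ).obj κ τ ε δ).symm.trans ((M.adj σ).obj_mk _ _)

lemma of_valMap {κ κ' : K.Cell} {ε ε' : ℤˣ} (f : OrCell.mk κ ε ⟶ OrCell.mk κ' ε')
    {σ : Finset (Fin (n + 1))} {τ τ' : (simplex σ).Cell} {δ δ' : ℤˣ}
    (g : OrCell.mk τ δ ⟶ OrCell.mk τ' δ') :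
    of (M.valMap f g) ≫ can (ε' * δ') (M.val_eq κ' ε' σ τ' δ') =
      can (ε * δ) (M.val_eq κ ε σ τ δ) ≫ M.barMap (OrCell.carrier_subset (leOfHom f))
        (simplex_carrier_subset.1 (OrCell.carrier_subset (leOfHom g))) := by
  have h1 := (M.isAdjoint σ).map κ κ' τ τ' ε δ ε' δ' f g
    (homOfLE (OrCell.prod_le (leOfHom f) (leOfHom g)))
  have h2 := of_heq (f' := M.valMap f g) ((M.isAdjoint σ).obj κ τ ε δ).symm
    ((M.isAdjoint σ).obj κ' τ' ε' δ').symm h1.symm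
  have h3 := (M.adj σ).of_map (homOfLE (OrCell.prod_le (leOfHom f) (leOfHom g)))
  exact comp_eq_comp_of_squares h2 h3 ((can_congr _ (one_mul _).symm).trans (can_comp_can _ _).symm)
    ((can_congr _ (one_mul _).symm).trans (can_comp_can _ _).symm)

lemma obj_neg (κ : K.Cell) (ε : ℤˣ) : M.1.F.obj (OrCell.mk κ (-ε)) =
    SingObj.neg (M.1.F.obj (OrCell.mk κ ε)) := M.1.obj_inv (OrCell.mk κ ε)

lemma SingObj.glue_heq_of_eq {X Y : SingObj P} (e : X = Y) {a : Fin n}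
    {σ σ' : Finset (Fin (n + 1))} (h : IsFace a σ σ') (x : OrCell (simplex σ)) :
    HEq (X.glue h x).hom (Y.glue h x).hom := by
  subst e
  rfl

lemma valGlue_neg (κ : K.Cell) (ε : ℤˣ) {a : Fin n} {σ σ' : Finset (Fin (n + 1))}
    (h : IsFace a σ σ') (τ : (simplex σ).Cell) (δ : ℤˣ) :
    HEq (M.valGlue κ ε h τ (-δ)).hom ((ginv A).map (M.valGlue κ ε h τ δ).hom) :=
  (M.1.F.obj (OrCell.mk κ ε)).glue_neg h (OrCell.mk τ δ)

lemma valGlue_neg' (κ : K.Cell) (ε : ℤˣ) {a : Fin n} {σ σ' : Finset (Fin (n + 1))}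
    (h : IsFace a σ σ') (τ : (simplex σ).Cell) (δ : ℤˣ) :
    HEq (M.valGlue κ (-ε) h τ δ).hom (M.valGlue κ ε h τ (-δ)).hom :=
  (SingObj.glue_heq_of_eq (M.obj_neg κ ε) h (OrCell.mk τ δ)).trans
    (SingObj.neg_glue_heq _ h (OrCell.mk τ δ))

/-- The value of the isomorphism `f_{σ,i}` of `M(κ)` on `τ`, without orientations. -/
def barGlue {a : Fin n} {σ σ' : Finset (Fin (n + 1))} (h : IsFace a σ σ') (κ : K.Cell)
    (τ : (simplex σ).Cell) : M.bar σ' κ (h.face τ) ≅ M.bar σ κ τ ⊗ (P a).bar :=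
  (canIso (1 * 1) (M.val_eq κ 1 σ' (h.face τ) 1)).symm ≪≫
    (⟨of (M.valGlue κ 1 h τ 1).hom, of (M.valGlue κ 1 h τ 1).inv,
      by rw [← of_comp, Iso.hom_inv_id, of_id], by rw [← of_comp, Iso.inv_hom_id, of_id]⟩ :
      Unor.mk (M.val κ 1 σ' (h.face τ) 1) ≅ Unor.mk (M.val κ 1 σ τ 1 ⊗ (P a).obj (orSign P σ a))) ≪≫
    (canIso (1 * 1 * orSign P σ a)
      (eq_sgn_tensor (M.val_eq κ 1 σ τ 1) ((P a).obj_eq (orSign P σ a))))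

lemma of_valGlue {a : Fin n} {σ σ' : Finset (Fin (n + 1))} (h : IsFace a σ σ') (κ : K.Cell)
    (τ : (simplex σ).Cell) (ε δ : ℤˣ) :
    of (M.valGlue κ ε h τ δ).hom ≫ can (ε * δ * orSign P σ a)
      (eq_sgn_tensor (M.val_eq κ ε σ τ δ) ((P a).obj_eq (orSign P σ a))) =
      can (ε * δ) (M.val_eq κ ε σ' (h.face τ) δ) ≫ (M.barGlue h κ τ).hom := by
  have h0 : of (M.valGlue κ 1 h τ 1).hom ≫ can (1 * 1 * orSign P σ a)
      (eq_sgn_tensor (M.val_eq κ 1 σ τ 1) ((P a).obj_eq (orSign P σ a))) =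
      can (1 * 1) (M.val_eq κ 1 σ' (h.face τ) 1) ≫ (M.barGlue h κ τ).hom :=
    ((canIso (1 * 1) (M.val_eq κ 1 σ' (h.face τ) 1)).hom_inv_id_assoc _).symm
  have key : ∀ (ε δ : ℤˣ), of (M.valGlue κ ε h τ δ).hom ≫ can (ε * δ * orSign P σ a)
      (eq_sgn_tensor (M.val_eq κ ε σ τ δ) ((P a).obj_eq (orSign P σ a))) =
      can (ε * δ) (M.val_eq κ ε σ' (h.face τ) δ) ≫ (M.barGlue h κ τ).hom →
      of (M.valGlue κ ε h τ (-δ)).hom ≫ can (ε * -δ * orSign P σ a)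
      (eq_sgn_tensor (M.val_eq κ ε σ τ (-δ)) ((P a).obj_eq (orSign P σ a))) =
      can (ε * -δ) (M.val_eq κ ε σ' (h.face τ) (-δ)) ≫ (M.barGlue h κ τ).hom := by
    intro ε δ ih
    have e : ∀ σ τ, M.val κ ε σ τ (-δ) = (sgn A (-1)).obj (M.val κ ε σ τ δ) := fun σ τ => by
      rw [M.val_eq, M.val_eq, sgn_obj_sgn_obj]; simp
    have h1 := of_comp_can (e σ' (h.face τ)) (eq_sgn_tensor_right (e σ τ) _)
      ((M.valGlue_neg κ ε h τ δ).trans (sgn_neg_one_map_heq _).symm)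
    exact comp_eq_comp_of_squares h1 ih
      ((can_congr _ (by simp)).trans (can_comp_can _ _).symm)
      ((can_congr _ (by simp)).trans (can_comp_can _ _).symm)
  have key' : ∀ δ : ℤˣ, of (M.valGlue κ 1 h τ δ).hom ≫ can (1 * δ * orSign P σ a)
      (eq_sgn_tensor (M.val_eq κ 1 σ τ δ) ((P a).obj_eq (orSign P σ a))) =
      can (1 * δ) (M.val_eq κ 1 σ' (h.face τ) δ) ≫ (M.barGlue h κ τ).hom := fun δ => by
    rcases Int.units_eq_one_or δ with rfl | rfl
    · exact h0
    · exact key 1 1 h0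
  rcases Int.units_eq_one_or ε with rfl | rfl
  · exact key' δ
  · have e : ∀ σ τ, M.val κ (-1) σ τ δ = M.val κ 1 σ τ (-δ) := fun σ τ => by
      rw [M.val_eq, M.val_eq]; simp
    have h1 := of_heq (e σ' (h.face τ)) (congrArg (· ⊗ _) (e σ τ)) (M.valGlue_neg' κ 1 h τ δ)
    exact comp_eq_comp_of_squares h1 (key' (-δ))
      ((can_congr _ (by simp)).trans (can_comp_can _ _).symm)
      ((can_congr _ (by simp)).trans (can_comp_can _ _).symm)

lemma barMap_comp_barGlue {a : Fin n} {σ σ' : Finset (Fin (n + 1))} (h : IsFace a σ σ')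
    {κ κ' : K.Cell} {τ τ' : (simplex σ).Cell} (hκ : K.carrier κ ⊆ K.carrier κ')
    (hτ : τ.1 ⊆ τ'.1) :
    M.barMap (σ := σ') (τ := h.face τ) (τ' := h.face τ') hκ hτ ≫ (M.barGlue h κ' τ').hom =
      (M.barGlue h κ τ).hom ≫ M.barMap hκ hτ ▷ (P a).bar := by
  let f : OrCell.mk κ 1 ⟶ OrCell.mk κ' 1 := homOfLE (OrCell.mk_le_mk hκ)
  let g : OrCell.mk τ 1 ⟶ OrCell.mk τ' 1 :=
    homOfLE (OrCell.mk_le_mk (simplex_carrier_subset.2 hτ))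
  let g' : OrCell.mk (h.face τ) 1 ⟶ OrCell.mk (h.face τ') 1 := (faceHom h.subset).F.map g
  have h1 : M.valMap f g' ≫ (M.valGlue κ' 1 h τ' 1).hom =
      (M.valGlue κ 1 h τ 1).hom ≫ M.valMap f g ▷ (P a).obj (orSign P σ a) := by
    have h2 := (M.1.F.obj (OrCell.mk κ' 1)).glue_natural h g
    have h3 := (M.1.F.map f).comm h (OrCell.mk τ 1)
    rw [comp_whiskerRight]
    refine (Category.assoc _ _ _).trans ((congrArg (_ ≫ ·) h2).trans ?_)
    refine (Category.assoc _ _ _).symm.trans ((congrArg (· ≫ _) h3).symm.trans ?_)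
    exact Category.assoc _ _ _
  have h2 : of (M.valMap f g') ≫ of (M.valGlue κ' 1 h τ' 1).hom =
      of (M.valGlue κ 1 h τ 1).hom ≫ of (M.valMap f g) ▷ Unor.mk ((P a).obj (orSign P σ a)) :=
    (of_comp _ _).symm.trans ((congrArg of h1).trans ((of_comp _ _).trans
      (congrArg (_ ≫ ·) (of_whiskerRight _ _))))
  exact natural_of_squares h2 (M.of_valMap f g') (M.of_valMap f g)
    ((congrArg (_ ≫ ·) (can_tensorHom_can (M.val_eq κ 1 σ τ 1)
      ((P a).obj_eq (orSign P σ a)))).trans (M.of_valGlue h κ τ 1 1))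
    ((congrArg (_ ≫ ·) (can_tensorHom_can (M.val_eq κ' 1 σ τ' 1)
      ((P a).obj_eq (orSign P σ a)))).trans (M.of_valGlue h κ' τ' 1 1))

/-- The two passages to the singularities `i` and `j` agree up to the commutativity isomorphism. -/
lemma barGlue_square {a b : Fin n} {σ σa σb ρ : Finset (Fin (n + 1))} (ha : IsFace a σ σa)
    (hb : IsFace b σ σb) (hab : IsFace b σa ρ) (hba : IsFace a σb ρ) (κ : K.Cell)
    (τ : (simplex σ).Cell) :
    (M.barGlue hab κ (ha.face τ)).hom ≫ (M.barGlue ha κ τ).hom ▷ (P b).bar ≫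
      (α_ _ _ _).hom ≫ M.bar σ κ τ ◁ (β_ (P a).bar (P b).bar).hom =
      (M.barGlue hba κ (hb.face τ)).hom ≫ (M.barGlue hb κ τ).hom ▷ (P a).bar ≫
        (α_ _ _ _).hom := by
  have h1 := of_square_left (M.val_eq κ 1 ρ (hab.face (ha.face τ)) 1)
    (M.val_eq κ 1 σa (ha.face τ) 1) (M.val_eq κ 1 σ τ 1) ((P a).obj_eq (orSign P σ a))
    ((P b).obj_eq (orSign P σa b)) (M.of_valGlue hab κ (ha.face τ) 1 1) (M.of_valGlue ha κ τ 1 1)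
  have h2 := of_square_right (M.val_eq κ 1 ρ (hba.face (hb.face τ)) 1)
    (M.val_eq κ 1 σb (hb.face τ) 1) (M.val_eq κ 1 σ τ 1) ((P b).obj_eq (orSign P σ b))
    ((P a).obj_eq (orSign P σb a)) (M.of_valGlue hba κ (hb.face τ) 1 1) (M.of_valGlue hb κ τ 1 1)
  rw [← cancel_epi (can (1 * 1) (M.val_eq κ 1 ρ (hab.face (ha.face τ)) 1))]
  refine h1.symm.trans (Eq.trans ?_ h2)
  have e := (M.1.F.obj (OrCell.mk κ 1)).glue_square ha hb hab hba (OrCell.mk τ 1)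
  have e2 : psign (gdim ((P a).obj (orSign P σ a)) * gdim ((P b).obj (orSign P σa b))) *
      (orSign P σa b * orSign P σ a) = orSign P σ b * orSign P σb a := by
    rw [StarAd.gdim_obj, StarAd.gdim_obj]
    exact orSign_square P ha hb hab
  have e3 : M.val κ 1 σ τ 1 ⊗ (sgn A (psign (gdim ((P a).obj (orSign P σ a)) *
      gdim ((P b).obj (orSign P σa b))))).obj
        ((P b).obj (orSign P σa b) ⊗ (P a).obj (orSign P σ a)) =
      M.val κ 1 σ τ 1 ⊗ ((P b).obj (orSign P σ b) ⊗ (P a).obj (orSign P σb a)) := by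
    refine congrArg (M.val κ 1 σ τ 1 ⊗ ·) ((eq_sgn_trans rfl (eq_sgn_tensor
      ((P b).obj_eq (orSign P σa b)) ((P a).obj_eq (orSign P σ a)))).trans ?_)
    rw [e2]
    exact (eq_sgn_tensor ((P b).obj_eq (orSign P σ b)) ((P a).obj_eq (orSign P σb a))).symm
  have h3 := of_heq rfl e3 e
  have e4 : (1 * 1 * (psign (gdim ((P a).obj (orSign P σ a)) * gdim ((P b).obj (orSign P σa b))) *
      (orSign P σa b * orSign P σ a)) : ℤˣ) = 1 * (1 * 1 * (orSign P σ b * orSign P σb a)) := by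
    simp only [e2, one_mul]
  refine (congrArg (_ ≫ ·) ((can_congr _ e4).trans (can_comp_can (eq_sgn_one e3)
    (eq_sgn_tensor (M.val_eq κ 1 σ τ 1) (eq_sgn_tensor ((P b).obj_eq (orSign P σ b))
      ((P a).obj_eq (orSign P σb a))))).symm)).trans ?_
  refine (Category.assoc _ _ _).symm.trans (congrArg (· ≫ _) (h3.trans ?_))
  exact (congrArg (· ≫ _) (can_self _ rfl)).trans (Category.id_comp _)

end AdSing

end

section

namespace Unor

section

variable {A : Type u} [Category.{v} A] [BalancedCategory A]

/-- The morphism `φ` is given by an isomorphism of `A` which changes the orientation by `s`. -/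
def IsSigned {X Y : Unor A} (s : ℤˣ) (φ : X ⟶ Y) : Prop :=
  ∃ (Y' : A) (h : Y' = (sgn A s).obj Y.as) (f : X.as ≅ Y'), of f.hom ≫ can s h = φ

lemma isSigned_can {s : ℤˣ} {X X' : A} (h : X' = (sgn A s).obj X) : IsSigned s (can s h) :=
  ⟨X', h, Iso.refl _, (congrArg (· ≫ can s h) (of_id X')).trans (Category.id_comp _)⟩

lemma isSigned_of {X Y : A} (f : X ≅ Y) : IsSigned 1 (of f.hom) :=
  ⟨Y, eq_sgn_one rfl, f, Category.comp_id _⟩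

lemma IsSigned.comp {X Y Z : Unor A} {s t : ℤˣ} {φ : X ⟶ Y} {ψ : Y ⟶ Z} (hφ : IsSigned s φ)
    (hψ : IsSigned t ψ) : IsSigned (s * t) (φ ≫ ψ) := by
  obtain ⟨Y', rfl, f, rfl⟩ := hφ
  obtain ⟨Z', h, g, rfl⟩ := hψ
  refine ⟨(sgn A s).obj Z', eq_sgn_trans rfl h, f ≪≫ (sgn A s).mapIso g, ?_⟩
  have h1 : can s rfl ≫ of g.hom = of ((sgn A s).map g.hom) ≫ can s rfl :=
    (of_comp_can rfl rfl HEq.rfl).symm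
  refine (congrArg (· ≫ _) (of_comp _ _)).trans ((Category.assoc _ _ _).trans
    (Eq.trans (congrArg (of f.hom ≫ ·) ?_) (Category.assoc _ _ _).symm))
  refine (congrArg (_ ≫ ·) (can_comp_can rfl h).symm).trans ?_
  refine (Category.assoc _ _ _).symm.trans ((congrArg (· ≫ _) h1.symm).trans ?_)
  exact Category.assoc _ _ _

lemma IsSigned.congr {X Y : Unor A} {s t : ℤˣ} {φ : X ⟶ Y} (h : IsSigned s φ) (e : s = t) :
    IsSigned t φ := e ▸ h

variable [MonoidalCategory A] [GradedSymmetricCategory A]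

lemma IsSigned.whiskerRight {X Y : Unor A} {s : ℤˣ} {φ : X ⟶ Y} (h : IsSigned s φ) (Z : Unor A) :
    IsSigned s (φ ▷ Z) := by
  obtain ⟨Y', h, f, rfl⟩ := h
  refine ⟨Y' ⊗ Z.as, eq_sgn_tensor_right h _, whiskerRightIso f Z.as, ?_⟩
  refine Eq.trans ?_ (comp_whiskerRight _ _ _).symm
  exact congrArg₂ (· ≫ ·) (of_whiskerRight _ _) (can_whiskerRight _ _).symm

lemma IsSigned.whiskerLeft {X Y : Unor A} {s : ℤˣ} {φ : X ⟶ Y} (Z : Unor A) (h : IsSigned s φ) :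
    IsSigned s (Z ◁ φ) := by
  obtain ⟨Y', h, f, rfl⟩ := h
  refine ⟨Z.as ⊗ Y', eq_sgn_tensor_left h _, whiskerLeftIso Z.as f, ?_⟩
  refine Eq.trans ?_ (MonoidalCategory.whiskerLeft_comp _ _ _).symm
  exact congrArg₂ (· ≫ ·) (of_whiskerLeft _ _) (whiskerLeft_can _ _).symm

lemma isSigned_associator (X Y Z : Unor A) : IsSigned 1 (α_ X Y Z).hom :=
  isSigned_of (α_ X.as Y.as Z.as)

lemma isSigned_associator_inv (X Y Z : Unor A) : IsSigned 1 (α_ X Y Z).inv :=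
  isSigned_of (α_ X.as Y.as Z.as).symm

lemma isSigned_braiding (X Y : Unor A) :
    IsSigned (psign (gdim X.as * gdim Y.as)) (β_ X Y).hom :=
  ⟨_, rfl, GradedSymmetricCategory.braid X.as Y.as, rfl⟩

end

end Unor

namespace RelCell

variable {K L : OrientedBallComplex}

/-- The product of two oriented cells. -/
def prod : OrCell K → OrCell L → OrCell (K.prod L)
  | .cell κ _ ε, .cell τ _ δ => OrCell.mk (K := K.prod L) (κ, τ) (ε * δ)
  | .cell κ _ _, .empty n => .empty (K.dim κ + n)
  | .empty m, x => .empty (m + x.dim)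

lemma prod_empty (x : OrCell K) (n : ℤ) :
    prod (L := L) x (.empty n) = .empty (x.dim + n) := by
  cases x <;> rfl

lemma dim_prod (x : OrCell K) (y : OrCell L) : (prod x y).dim = x.dim + y.dim := by
  rcases x with ⟨κ, _, ε⟩ | m <;> rcases y with ⟨τ, _, δ⟩ | n
  · exact Int.natCast_add _ _
  all_goals rfl

lemma prod_neg (x : OrCell K) (y : OrCell L) : prod x y.neg = (prod x y).neg := by
  rcases x with ⟨κ, _, ε⟩ | m <;> rcases y with ⟨τ, _, δ⟩ | n
  · exact congrArg (OrCell.mk _) (mul_neg _ _)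
  all_goals rfl

lemma neg_prod (x : OrCell K) (y : OrCell L) : prod x.neg y = (prod x y).neg := by
  rcases x with ⟨κ, _, ε⟩ | m <;> rcases y with ⟨τ, _, δ⟩ | n
  · exact congrArg (OrCell.mk _) (neg_mul _ _)
  all_goals rfl

lemma prod_le_prod {x x' : OrCell K} {y y' : OrCell L} (h : x ≤ x') (h' : y ≤ y') :
    prod x y ≤ prod x' y' := by
  have d := dim_mono h
  have d' := dim_mono h'
  rcases x with ⟨κ, _, ε⟩ | m <;> rcases x' with ⟨κ', _, ε'⟩ | m' <;>
    rcases y with ⟨τ, _, δ⟩ | n <;> rcases y' with ⟨τ', _, δ'⟩ | n'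
  · exact OrCell.prod_le h h'
  · exact h'.elim
  · have h1 : n < L.dim τ' := h'
    change (K.dim κ : ℤ) + n < ((K.dim κ' + L.dim τ' : ℕ) : ℤ)
    change (K.dim κ : ℤ) ≤ K.dim κ' at d
    push_cast
    omega
  · exact add_le_add d d'
  all_goals try exact h.elim
  · have h1 : m < K.dim κ' := h
    change m + (L.dim τ : ℤ) < ((K.dim κ' + L.dim τ' : ℕ) : ℤ)
    change (L.dim τ : ℤ) ≤ L.dim τ' at d'
    push_cast
    omega
  · exact h'.elim
  · have h1 : m < K.dim κ' := h
    have h2 : n < L.dim τ' := h'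
    change m + n < ((K.dim κ' + L.dim τ' : ℕ) : ℤ)
    push_cast
    omega
  · exact add_le_add d d'
  · exact add_le_add d d'
  · exact h'.elim
  · exact add_le_add d d'
  · exact add_le_add d d'

/-- The product with a fixed cell on the left. -/
def prodHom (x : OrCell K) : GradedHom (-x.dim) (OrCell L) (OrCell (K.prod L)) :=
  gradedHom _ (prod x) (fun _ _ h => prod_le_prod le_rfl h)
    (fun y => (dim_prod x y).trans (by omega)) (prod_neg x)
    (fun n => (prod_empty x n).trans (congrArg _ (by omega)))

end RelCell

lemma natural_of_squares_symm {C : Type u} [Category.{v} C] [MonoidalCategory C]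
    {X X' F F' p X₀ X₀' F₀ F₀' p₀ : C} {m' : X ⟶ X'} {m : F ⟶ F'}
    {g : X ⟶ F ⊗ p} {g' : X' ⟶ F' ⊗ p} {M' : X₀ ⟶ X₀'} {M : F₀ ⟶ F₀'} {G : X₀ ⟶ F₀ ⊗ p₀}
    {G' : X₀' ⟶ F₀' ⊗ p₀} {a : X ⟶ X₀} {a' : X' ⟶ X₀'} {b : F ⟶ F₀} {b' : F' ⟶ F₀'} {d : p ⟶ p₀}
    (_ : IsIso (b' ⊗ₘ d)) (h : M' ≫ G' = G ≫ M ▷ p₀) (e1 : m' ≫ a' = a ≫ M') (e2 : m ≫ b' = b ≫ M)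
    (e3 : g ≫ (b ⊗ₘ d) = a ≫ G) (e4 : g' ≫ (b' ⊗ₘ d) = a' ≫ G') : m' ≫ g' = g ≫ m ▷ p := by
  rw [← cancel_mono (b' ⊗ₘ d), Category.assoc, e4, ← Category.assoc, e1, Category.assoc, h,
    Category.assoc, whiskerRight_comp_tensorHom, e2, ← tensorHom_comp_whiskerRight,
    ← Category.assoc g, e3, Category.assoc]

section

variable {A : Type u} [Category.{v} A] [BalancedCategory A]

lemma heq_of_eq_empty [EmptyInitial A] {X Y X' Y' : A} {m : ℤ} (h : X = (gempty A).obj m) (h' : X = X')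
    (h2 : Y = Y') (f : X ⟶ Y) (g : X' ⟶ Y') : HEq f g := by
  subst h'
  subst h
  exact Pre.heq_of_empty rfl h2 f g

namespace Unor

lemma heq_ginv_map_of_can {X Y X' Y' W V : A} {s s' t t' : ℤˣ} {f : X ⟶ Y} {f' : X' ⟶ Y'}
    (φ : mk W ⟶ mk V) (hs : s' = -s) (ht : t' = -t) (hX : X = (sgn A s).obj W)
    (hX' : X' = (sgn A s').obj W) (hY : Y = (sgn A t).obj V) (hY' : Y' = (sgn A t').obj V)
    (e : of f ≫ can t hY = can s hX ≫ φ) (e' : of f' ≫ can t' hY' = can s' hX' ≫ φ) :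
    HEq f' ((ginv A).map f) := by
  rw [← sgn_neg_one]
  refine heq_of_can φ (hs.trans (neg_one_mul s).symm) (ht.trans (neg_one_mul t).symm) hX'
    (eq_sgn_trans rfl hX) hY' (eq_sgn_trans rfl hY) e' ?_
  exact comp_eq_comp_of_squares (of_comp_can rfl rfl HEq.rfl) e (can_comp_can _ _).symm
    (can_comp_can _ _).symm

end Unor

end

variable {A : Type u} [Category.{v} A] [BalancedCategory A] [EmptyInitial A] [MonoidalCategory A]
  [GradedSymmetricCategory A] {T : AdTheory A} {n : ℕ}

open Unor

/-- The data on the products `K × σ` which describe an ad with singularities. -/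
structure AdjointFamily (P : Fin n → StarAd T) (K : OrientedBallComplex) (k : ℤ) where
  pread : ∀ σ : Finset (Fin (n + 1)), Pre A (K.prod (simplex σ)) (k + miss P σ)
  mem : ∀ σ, pread σ ∈ T.ad _ _
  obj_eq_empty : ∀ (σ : Finset (Fin (n + 1))) (κ : K.Cell) (τ : (simplex σ).Cell) (ε : ℤˣ),
    0 ∉ τ.1 → (pread σ).F.obj (OrCell.mk (K := K.prod (simplex σ)) (κ, τ) ε) =
      (gempty A).obj ((K.prod (simplex σ)).dim (κ, τ) - (k + miss P σ))
  glue : ∀ {a : Fin n} {σ σ' : Finset (Fin (n + 1))} (h : IsFace a σ σ') (κ : K.Cell)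
    (τ : (simplex σ).Cell), 0 ∈ τ.1 →
      ((pread σ').bar (κ, h.face τ) ⟶ (pread σ).bar (κ, τ) ⊗ (P a).bar)
  isSigned_glue : ∀ {a : Fin n} {σ σ' : Finset (Fin (n + 1))} (h : IsFace a σ σ') (κ : K.Cell)
    (τ : (simplex σ).Cell) (h0 : 0 ∈ τ.1), IsSigned (orSign P σ a) (glue h κ τ h0)
  glue_natural : ∀ {a : Fin n} {σ σ' : Finset (Fin (n + 1))} (h : IsFace a σ σ') {κ κ' : K.Cell}
    {τ τ' : (simplex σ).Cell} (h0 : 0 ∈ τ.1) (hκ : K.carrier κ ⊆ K.carrier κ')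
    (hτ : τ.1 ⊆ τ'.1),
    (pread σ').barMap (prod_carrier_subset hκ
        (simplex_carrier_subset (τ := h.face τ) (τ' := h.face τ').2 hτ)) ≫ glue h κ' τ' (hτ h0) =
      glue h κ τ h0 ≫
        (pread σ).barMap (prod_carrier_subset hκ (simplex_carrier_subset.2 hτ)) ▷ (P a).bar
  glue_square : ∀ {a b : Fin n} {σ σa σb ρ : Finset (Fin (n + 1))} (ha : IsFace a σ σa)
    (hb : IsFace b σ σb) (hab : IsFace b σa ρ) (hba : IsFace a σb ρ) (κ : K.Cell)
    (τ : (simplex σ).Cell) (h0 : 0 ∈ τ.1),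
    glue hab κ (ha.face τ) h0 ≫ glue ha κ τ h0 ▷ (P b).bar ≫
      (α_ _ _ _).hom ≫ (pread σ).bar (κ, τ) ◁ (β_ (P a).bar (P b).bar).hom =
      glue hba κ (hb.face τ) h0 ≫ glue hb κ τ h0 ▷ (P a).bar ≫ (α_ _ _ _).hom

namespace AdjointFamily

variable {P : Fin n → StarAd T} {K : OrientedBallComplex} {k : ℤ} (D : AdjointFamily P K k)

/-- The passage from cells of `K × σ` to cells of `K × (σ, i)`. -/
def face {a : Fin n} {σ σ' : Finset (Fin (n + 1))} (h : IsFace a σ σ') :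
    OrCell (K.prod (simplex σ)) → OrCell (K.prod (simplex σ'))
  | .cell c _ ε => OrCell.mk (K := K.prod (simplex σ')) (c.1, h.face c.2) ε
  | .empty m => .empty m

lemma prod_cell {a : Fin n} {σ σ' : Finset (Fin (n + 1))} (h : IsFace a σ σ') (x : OrCell K)
    (z : OrCell (simplex σ)) : x.prod (h.cell z) = face h (x.prod z) := by
  rcases x with ⟨κ, _, ε⟩ | m <;> rcases z with ⟨τ, _, δ⟩ | n <;> rfl

/-- The cells on which the value has to be empty. -/
def IsEmpty {σ : Finset (Fin (n + 1))} : OrCell (K.prod (simplex σ)) → Prop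
  | .cell c _ _ => (0 : Fin (n + 1)) ∉ c.2.1
  | .empty _ => True

lemma obj_of_isEmpty {σ : Finset (Fin (n + 1))} {y : OrCell (K.prod (simplex σ))}
    (h : IsEmpty y) : (D.pread σ).F.obj y = (gempty A).obj (y.dim - (k + miss P σ)) := by
  rcases y with ⟨⟨κ, τ⟩, _, ε⟩ | m
  · exact D.obj_eq_empty σ κ τ ε h
  · exact (D.pread σ).obj_empty m

lemma dim_face {a : Fin n} {σ σ' : Finset (Fin (n + 1))} (h : IsFace a σ σ')
    (y : OrCell (K.prod (simplex σ))) : (face h y).dim = y.dim := by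
  cases y <;> rfl

lemma IsEmpty.face {a : Fin n} {σ σ' : Finset (Fin (n + 1))} (h : IsFace a σ σ')
    {y : OrCell (K.prod (simplex σ))} (hy : IsEmpty y) : IsEmpty (face h y) := by
  cases y
  · exact hy
  · trivial

lemma obj_face_of_isEmpty {a : Fin n} {σ σ' : Finset (Fin (n + 1))} (h : IsFace a σ σ')
    {y : OrCell (K.prod (simplex σ))} (hy : IsEmpty y) : (D.pread σ').F.obj (face h y) =
      (D.pread σ).F.obj y ⊗ (P a).obj (orSign P σ a) := by
  rw [D.obj_of_isEmpty hy, D.obj_of_isEmpty (hy.face h), GradedMonoidalCategory.empty_tensor,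
    StarAd.gdim_obj, dim_face, h.miss_eq]
  congr 1
  omega

lemma exists_glue {a : Fin n} {σ σ' : Finset (Fin (n + 1))} (h : IsFace a σ σ')
    (y : OrCell (K.prod (simplex σ))) :
    ∃ f : (D.pread σ').F.obj (face h y) ≅ (D.pread σ).F.obj y ⊗ (P a).obj (orSign P σ a),
      ∀ (κ : K.Cell) (τ : (simplex σ).Cell) (ε : ℤˣ)
        (hy : OrCell.mk (K := K.prod (simplex σ)) (κ, τ) ε = y) (h0 : 0 ∈ τ.1),
        of f.hom ≫ can (ε * orSign P σ a)
          (eq_sgn_tensor (hy ▸ (D.pread σ).obj_mk (κ, τ) ε) ((P a).obj_eq (orSign P σ a))) =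
        can ε (hy ▸ (D.pread σ').obj_mk (κ, h.face τ) ε) ≫ D.glue h κ τ h0 := by
  rcases y with ⟨⟨κ, τ⟩, _, ε⟩ | m
  · by_cases h0 : 0 ∈ τ.1
    · obtain ⟨Y', h1, f, h2⟩ := (isSigned_can ((D.pread σ').obj_mk (κ, h.face τ) ε)).comp
        (D.isSigned_glue h κ τ h0)
      have h3 : (D.pread σ).F.obj (OrCell.mk (K := K.prod (simplex σ)) (κ, τ) ε) ⊗
          (P a).obj (orSign P σ a) = Y' :=
        (eq_sgn_tensor ((D.pread σ).obj_mk (κ, τ) ε) ((P a).obj_eq (orSign P σ a))).trans h1.symm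
      subst h3
      refine ⟨f, fun κ₁ τ₁ ε₁ hy h0' => ?_⟩
      injection hy with e1 e2
      injection e1 with e1 e3
      subst e1 e2 e3
      exact h2
    · refine ⟨eqToIso (D.obj_face_of_isEmpty h h0), fun κ₁ τ₁ ε₁ hy h0' => ?_⟩
      injection hy with e1 e2
      injection e1 with e1 e3
      subst e1 e2 e3
      exact absurd h0' h0
  · exact ⟨eqToIso (D.obj_face_of_isEmpty h trivial), fun κ₁ τ₁ ε₁ hy => nomatch hy⟩

/-- The isomorphism on all cells of `K × σ`. -/
def glueIso {a : Fin n} {σ σ' : Finset (Fin (n + 1))} (h : IsFace a σ σ')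
    (y : OrCell (K.prod (simplex σ))) :
    (D.pread σ').F.obj (face h y) ≅ (D.pread σ).F.obj y ⊗ (P a).obj (orSign P σ a) :=
  (D.exists_glue h y).choose

lemma of_glueIso {a : Fin n} {σ σ' : Finset (Fin (n + 1))} (h : IsFace a σ σ') (κ : K.Cell)
    (τ : (simplex σ).Cell) (ε : ℤˣ) (h0 : 0 ∈ τ.1) :
    of (D.glueIso h (OrCell.mk (K := K.prod (simplex σ)) (κ, τ) ε)).hom ≫ can (ε * orSign P σ a)
      (eq_sgn_tensor ((D.pread σ).obj_mk (κ, τ) ε) ((P a).obj_eq (orSign P σ a))) =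
    can ε ((D.pread σ').obj_mk (κ, h.face τ) ε) ≫ D.glue h κ τ h0 :=
  (D.exists_glue h _).choose_spec κ τ ε rfl h0

lemma exists_eq_of_not_isEmpty {σ : Finset (Fin (n + 1))} {y : OrCell (K.prod (simplex σ))}
    (h : ¬ IsEmpty y) : ∃ (κ : K.Cell) (τ : (simplex σ).Cell) (ε : ℤˣ),
      0 ∈ τ.1 ∧ y = OrCell.mk (K := K.prod (simplex σ)) (κ, τ) ε := by
  rcases y with ⟨⟨κ, τ⟩, _, ε⟩ | m
  · exact ⟨κ, τ, ε, not_not.1 h, rfl⟩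
  · exact absurd trivial h

lemma glueIso_natural {a : Fin n} {σ σ' : Finset (Fin (n + 1))} (h : IsFace a σ σ')
    {y y' : OrCell (K.prod (simplex σ))} (f : y ⟶ y') (f' : face h y ⟶ face h y') :
    (D.pread σ').F.map f' ≫ (D.glueIso h y').hom =
      (D.glueIso h y).hom ≫ (D.pread σ).F.map f ▷ (P a).obj (orSign P σ a) := by
  by_cases hy : IsEmpty y
  · exact eq_of_heq (heq_of_eq_empty (D.obj_of_isEmpty (hy.face h)) rfl rfl _ _)
  obtain ⟨κ, τ, ε, h0, rfl⟩ := exists_eq_of_not_isEmpty hy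
  rcases y' with ⟨⟨κ', τ'⟩, _, ε'⟩ | m
  swap
  · exact (leOfHom f : RelCell.le _ _).elim
  have hs := (OrientedBallComplex.prod_subset_iff K (simplex σ) (κ, τ) (κ', τ')).1
    (OrCell.carrier_subset (leOfHom f))
  have hτ := simplex_carrier_subset.1 hs.2
  have h1 := (D.pread σ').of_map f'
  have h2 := (D.pread σ).of_map f
  have h3 := D.of_glueIso h κ τ ε h0
  have h4 := D.of_glueIso h κ' τ' ε' (hτ h0)
  have h5 := D.glue_natural h h0 hs.1 hτ
  refine of_injective ?_
  refine (of_comp _ _).trans (Eq.trans ?_ (of_comp _ _).symm)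
  refine Eq.trans ?_ (congrArg (_ ≫ ·) (of_whiskerRight _ _).symm)
  have h6 : IsIso (can ε' ((D.pread σ).obj_mk (κ', τ') ε') ⊗ₘ
      can (orSign P σ a) ((P a).obj_eq (orSign P σ a))) := inferInstance
  exact natural_of_squares_symm h6 h5 h1 h2
    ((congrArg (_ ≫ ·) (can_tensorHom_can ((D.pread σ).obj_mk (κ, τ) ε)
      ((P a).obj_eq (orSign P σ a)))).trans h3)
    ((congrArg (_ ≫ ·) (can_tensorHom_can ((D.pread σ).obj_mk (κ', τ') ε')
      ((P a).obj_eq (orSign P σ a)))).trans h4)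

lemma neg_mk_obj {σ : Finset (Fin (n + 1))} (y : OrCell (K.prod (simplex σ))) :
    (D.pread σ).F.obj y.neg = (ginv A).obj ((D.pread σ).F.obj y) := (D.pread σ).obj_inv y

lemma face_neg {a : Fin n} {σ σ' : Finset (Fin (n + 1))} (h : IsFace a σ σ')
    (y : OrCell (K.prod (simplex σ))) : face h y.neg = (face h y).neg := by
  cases y <;> rfl

lemma glueIso_neg {a : Fin n} {σ σ' : Finset (Fin (n + 1))} (h : IsFace a σ σ')
    (y : OrCell (K.prod (simplex σ))) :
    HEq (D.glueIso h y.neg).hom ((ginv A).map (D.glueIso h y).hom) := by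
  have e1 : (D.pread σ').F.obj (face h y.neg) =
      (ginv A).obj ((D.pread σ').F.obj (face h y)) :=
    (congrArg _ (face_neg h y)).trans (D.neg_mk_obj _)
  have e2 : (D.pread σ).F.obj y.neg ⊗ (P a).obj (orSign P σ a) =
      (ginv A).obj ((D.pread σ).F.obj y ⊗ (P a).obj (orSign P σ a)) :=
    (congrArg (· ⊗ _) (D.neg_mk_obj _)).trans (GradedMonoidalCategory.inv_tensor _ _)
  by_cases hy : IsEmpty y
  · refine heq_of_eq_empty (m := (face h y).dim - (k + miss P σ')) ?_ e1 e2 _ _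
    rw [e1, D.obj_of_isEmpty (hy.face h), inv_obj_empty]
  obtain ⟨κ, τ, ε, h0, rfl⟩ := exists_eq_of_not_isEmpty hy
  exact heq_ginv_map_of_can _ rfl (neg_mul _ _) _ _ _ _ (D.of_glueIso h κ τ ε h0)
    (D.of_glueIso h κ τ (-ε) h0)

lemma glueIso_square {a b : Fin n} {σ σa σb ρ : Finset (Fin (n + 1))} (ha : IsFace a σ σa)
    (hb : IsFace b σ σb) (hab : IsFace b σa ρ) (hba : IsFace a σb ρ)
    (y : OrCell (K.prod (simplex σ))) :
    HEq ((D.glueIso hab (face ha y)).hom ≫ (D.glueIso ha y).hom ▷ (P b).obj (orSign P σa b) ≫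
        (α_ _ _ _).hom ≫ (D.pread σ).F.obj y ◁
          (GradedSymmetricCategory.braid ((P a).obj (orSign P σ a)) ((P b).obj (orSign P σa b))).hom)
      ((D.glueIso hba (face hb y)).hom ≫ (D.glueIso hb y).hom ▷ (P a).obj (orSign P σb a) ≫
        (α_ _ _ _).hom) := by
  have e1 : face hab (face ha y) = face hba (face hb y) := by cases y <;> rfl
  have e2 : psign (gdim ((P a).obj (orSign P σ a)) * gdim ((P b).obj (orSign P σa b))) *
      (orSign P σa b * orSign P σ a) = orSign P σ b * orSign P σb a := by
    rw [StarAd.gdim_obj, StarAd.gdim_obj]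
    exact orSign_square P ha hb hab
  by_cases hy : IsEmpty y
  · refine heq_of_eq_empty (D.obj_of_isEmpty ((hy.face ha).face hab)) (congrArg _ e1)
      (congrArg (_ ⊗ ·) ((eq_sgn_trans rfl (eq_sgn_tensor
      ((P b).obj_eq (orSign P σa b)) ((P a).obj_eq (orSign P σ a)))).trans ?_)) _ _
    rw [e2]
    exact (eq_sgn_tensor ((P b).obj_eq (orSign P σ b)) ((P a).obj_eq (orSign P σb a))).symm
  obtain ⟨κ, τ, ε, h0, rfl⟩ := exists_eq_of_not_isEmpty hy
  have h1 := of_square_left ((D.pread ρ).obj_mk (κ, hab.face (ha.face τ)) ε)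
    ((D.pread σa).obj_mk (κ, ha.face τ) ε) ((D.pread σ).obj_mk (κ, τ) ε)
    ((P a).obj_eq (orSign P σ a)) ((P b).obj_eq (orSign P σa b))
    (D.of_glueIso hab κ (ha.face τ) ε h0) (D.of_glueIso ha κ τ ε h0)
  have h2 := of_square_right ((D.pread ρ).obj_mk (κ, hba.face (hb.face τ)) ε)
    ((D.pread σb).obj_mk (κ, hb.face τ) ε) ((D.pread σ).obj_mk (κ, τ) ε)
    ((P b).obj_eq (orSign P σ b)) ((P a).obj_eq (orSign P σb a))
    (D.of_glueIso hba κ (hb.face τ) ε h0) (D.of_glueIso hb κ τ ε h0)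
  refine heq_of_can _ rfl (congrArg _ e2) _ ((D.pread ρ).obj_mk (κ, hba.face (hb.face τ)) ε) _
    (eq_sgn_tensor ((D.pread σ).obj_mk (κ, τ) ε) (eq_sgn_tensor ((P b).obj_eq (orSign P σ b))
      ((P a).obj_eq (orSign P σb a)))) h1 ?_
  exact h2.trans (congrArg (_ ≫ ·) (D.glue_square ha hb hab hba κ τ h0).symm)

variable (x : OrCell K)

/-- The object with singularities belonging to an oriented cell of `K`. -/
def obj : SingObj P where
  dim := x.dim - k
  pre σ := (RelCell.prodHom x).comp (D.pread σ) (by omega)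
  pre_eq_empty σ τ ε h := by
    rcases x with ⟨κ, _, δ⟩ | m
    · refine (D.obj_eq_empty σ κ τ (δ * ε) h).trans (congrArg _ ?_)
      change ((K.dim κ + (simplex σ).dim τ : ℕ) : ℤ) - _ = _ - (_ - ((K.dim κ : ℤ) - k))
      push_cast
      omega
    · refine ((D.pread σ).obj_empty _).trans (congrArg _ ?_)
      change m + ((simplex σ).dim τ : ℤ) - _ = _ - (_ - (m - k))
      omega
  glue h z := eqToIso (congrArg (D.pread _).F.obj (prod_cell h x z)) ≪≫ D.glueIso h (x.prod z)
  glue_natural {a σ σ'} h z z' f := by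
    have e : ∀ {y y' : OrCell (K.prod (simplex σ))} {w w' : OrCell (K.prod (simplex σ'))}
        (hw : w = face h y) (hw' : w' = face h y') (φ : y ⟶ y') (φ' : w ⟶ w'),
        (D.pread σ').F.map φ' ≫ eqToHom (congrArg (D.pread σ').F.obj hw') ≫ (D.glueIso h y').hom =
        (eqToHom (congrArg (D.pread σ').F.obj hw) ≫ (D.glueIso h y).hom) ≫
          (D.pread σ).F.map φ ▷ (P a).obj (orSign P σ a) := by
      intro y y' w w' hw hw' φ φ'
      subst hw
      subst hw'
      simpa using D.glueIso_natural h φ φ'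
    exact e (prod_cell h x z) (prod_cell h x z') ((RelCell.prodHom x).F.map f)
      ((RelCell.prodHom x).F.map ((faceHom h.subset).F.map f))
  glue_neg {a σ σ'} h z := by
    have e : ∀ {y y' : OrCell (K.prod (simplex σ))} {w w' : OrCell (K.prod (simplex σ'))}
        (hw : w = face h y) (hw' : w' = face h y') (hy : y' = y.neg),
        HEq (eqToHom (congrArg (D.pread σ').F.obj hw') ≫ (D.glueIso h y').hom)
          ((ginv A).map (eqToHom (congrArg (D.pread σ').F.obj hw) ≫ (D.glueIso h y).hom)) := by
      intro y y' w w' hw hw' hy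
      subst hw
      subst hw'
      subst hy
      simpa using D.glueIso_neg h y
    exact e (prod_cell h x z) (prod_cell h x z.neg) (RelCell.prod_neg x z)
  glue_square {a b σ σa σb ρ} ha hb hab hba z := by
    have e : ∀ {y : OrCell (K.prod (simplex σ))} {ya : OrCell (K.prod (simplex σa))}
        {yb : OrCell (K.prod (simplex σb))} {w w' : OrCell (K.prod (simplex ρ))}
        (hya : ya = face ha y) (hyb : yb = face hb y) (hw : w = face hab ya)
        (hw' : w' = face hba yb),
        HEq ((eqToHom (congrArg (D.pread ρ).F.obj hw) ≫ (D.glueIso hab ya).hom) ≫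
          (eqToHom (congrArg (D.pread σa).F.obj hya) ≫ (D.glueIso ha y).hom) ▷
            (P b).obj (orSign P σa b) ≫ (α_ _ _ _).hom ≫ (D.pread σ).F.obj y ◁
          (GradedSymmetricCategory.braid ((P a).obj (orSign P σ a)) ((P b).obj (orSign P σa b))).hom)
        ((eqToHom (congrArg (D.pread ρ).F.obj hw') ≫ (D.glueIso hba yb).hom) ≫
          (eqToHom (congrArg (D.pread σb).F.obj hyb) ≫ (D.glueIso hb y).hom) ▷
            (P a).obj (orSign P σb a) ≫ (α_ _ _ _).hom) := by
      intro y ya yb w w' hya hyb hw hw'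
      subst hya
      subst hyb
      subst hw
      subst hw'
      simpa using D.glueIso_square ha hb hab hba y
    exact e (prod_cell ha x z) (prod_cell hb x z) (prod_cell hab x (ha.cell z))
      (prod_cell hba x (hb.cell z))

lemma obj_glue_heq {a : Fin n} {σ σ' : Finset (Fin (n + 1))} (h : IsFace a σ σ')
    (z : OrCell (simplex σ)) : HEq ((D.obj x).glue h z).hom (D.glueIso h (x.prod z)).hom :=
  eqToHom_comp_heq (D.glueIso h (x.prod z)).hom (congrArg _ (prod_cell h x z))

variable {x} {x' : OrCell K}

/-- The morphism of objects with singularities belonging to an inclusion of cells of `K`. -/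
def map (f : x ⟶ x') : D.obj x ⟶ D.obj x' where
  app σ z := (D.pread σ).F.map (homOfLE (RelCell.prod_le_prod (leOfHom f) le_rfl))
  natural σ z z' g := by
    refine ((D.pread σ).F.map_comp _ _).symm.trans (Eq.trans ?_ ((D.pread σ).F.map_comp _ _))
    exact congrArg _ (Subsingleton.elim _ _)
  app_neg σ z := by
    refine HEq.trans ?_ ((D.pread σ).map_inv _)
    exact SingObj.functor_map_heq _ (RelCell.prod_neg x z) (RelCell.prod_neg x' z) _ _
  comm {a σ σ'} h z := by
    have e : ∀ {y y' : OrCell (K.prod (simplex σ))} {w w' : OrCell (K.prod (simplex σ'))}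
        (hw : w = face h y) (hw' : w' = face h y') (φ : y ⟶ y') (φ' : w ⟶ w'),
        (eqToHom (congrArg (D.pread σ').F.obj hw) ≫ (D.glueIso h y).hom) ≫
          (D.pread σ).F.map φ ▷ (P a).obj (orSign P σ a) =
        (D.pread σ').F.map φ' ≫ eqToHom (congrArg (D.pread σ').F.obj hw') ≫
          (D.glueIso h y').hom := by
      intro y y' w w' hw hw' φ φ'
      subst hw
      subst hw'
      simpa using (D.glueIso_natural h φ φ').symm
    exact e (prod_cell h x z) (prod_cell h x' z) _ _

lemma obj_neg (x : OrCell K) : D.obj x.neg = SingObj.neg (D.obj x) := by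
  refine SingObj.ext_heq ?_ (fun σ z => ?_) (fun σ z z' f => ?_) fun {a σ σ'} h z => ?_
  · exact congrArg (· - k) (gdim_inv x)
  · exact congrArg _ ((RelCell.neg_prod x z).trans (RelCell.prod_neg x z).symm)
  · exact SingObj.functor_map_heq _ ((RelCell.neg_prod x z).trans (RelCell.prod_neg x z).symm)
      ((RelCell.neg_prod x z').trans (RelCell.prod_neg x z').symm) _ _
  · refine (D.obj_glue_heq _ h z).trans (HEq.trans ?_ ((SingObj.neg_glue_heq _ h z).trans
      (D.obj_glue_heq _ h z.neg)).symm)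
    rw [RelCell.neg_prod x z, RelCell.prod_neg x z]

lemma obj_empty (m : ℤ) : D.obj (.empty m) = SingObj.emptyObj P (m - k) := by
  have e : ∀ σ (z : OrCell (simplex σ)), ((D.obj (.empty m)).pre σ).F.obj z =
      ((SingObj.emptyObj P (m - k)).pre σ).F.obj z := fun σ z =>
    ((D.pread σ).obj_empty _).trans (congrArg (gempty A).obj (by
      change m + z.dim - _ = z.dim - _
      omega))
  refine SingObj.ext_heq rfl e (fun σ z z' f => ?_) fun {a σ σ'} h z => ?_
  · exact heq_of_eq_empty (e σ z) (e σ z) (e σ z') _ _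
  · exact heq_of_eq_empty (e σ' (h.cell z)) (e σ' (h.cell z)) (congrArg (· ⊗ _) (e σ z)) _ _

/-- The ad with singularities. -/
def toAdSing : AdSing T P K k where
  val :=
    { F :=
        { obj := fun x => D.obj x
          map := fun f => D.map f
          map_id := fun x => SingObj.Hom.ext (funext₂ fun σ z =>
            (congrArg _ (Subsingleton.elim _ _)).trans ((D.pread σ).F.map_id _))
          map_comp := fun f g => SingObj.Hom.ext (funext₂ fun σ z =>
            (congrArg _ (Subsingleton.elim _ _)).trans ((D.pread σ).F.map_comp _ _)) }
      gdim_obj := fun x => rfl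
      inv_comp := _root_.CategoryTheory.Functor.hext D.obj_neg fun x x' f =>
        SingObj.hom_heq (D.obj_neg x) (D.obj_neg x') _ _ fun σ z =>
          SingObj.functor_map_heq _ ((RelCell.neg_prod x z).trans (RelCell.prod_neg x z).symm)
            ((RelCell.neg_prod x' z).trans (RelCell.prod_neg x' z).symm) _ _
      empty_comp := _root_.CategoryTheory.Functor.hext D.obj_empty fun m m' f =>
        SingObj.hom_heq (D.obj_empty m) (D.obj_empty m') _ _ fun σ z => by
          have e : ∀ m, ((D.obj (.empty m)).pre σ).F.obj z =
              ((SingObj.emptyObj P (m - k)).pre σ).F.obj z := fun m => by rw [D.obj_empty]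
          exact heq_of_eq_empty (e m) (e m) (e m') _ _
      map_bal := fun {x x'} f h h' => SingObj.hom_heq rfl (D.obj_neg x') _ _ fun σ z => by
        have h1 : gdim (x.prod z) < gdim (x'.prod z) := by
          change (x.prod z).dim < (x'.prod z).dim
          rw [RelCell.dim_prod, RelCell.dim_prod]
          exact add_lt_add_left h _
        have h2 := (D.pread σ).map_bal
          (homOfLE (RelCell.prod_le_prod (leOfHom f) (le_refl z))) h1
          (SingObj.gdim_lt h' σ z)
        refine HEq.trans ?_ (h2.trans (comp_eqToHom_heq _ _).symm)
        exact SingObj.functor_map_heq _ rfl (RelCell.neg_prod x' z) _ _ }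
  property σ := ⟨D.pread σ, D.mem σ, ⟨fun κ τ ε δ => rfl, fun κ κ' τ τ' ε δ ε' δ' f g h =>
    heq_of_eq ((congrArg _ (Subsingleton.elim _ _)).trans ((D.pread σ).F.map_comp _ _))⟩⟩

lemma of_valGlue {a : Fin n} {σ σ' : Finset (Fin (n + 1))} (h : IsFace a σ σ') (κ : K.Cell)
    (τ : (simplex σ).Cell) (ε δ : ℤˣ) (h0 : 0 ∈ τ.1) :
    of (D.toAdSing.valGlue κ ε h τ δ).hom ≫ can (ε * δ * orSign P σ a)
      (eq_sgn_tensor ((D.pread σ).obj_mk (κ, τ) (ε * δ)) ((P a).obj_eq (orSign P σ a))) =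
    can (ε * δ) ((D.pread σ').obj_mk (κ, h.face τ) (ε * δ)) ≫ D.glue h κ τ h0 := by
  refine Eq.trans (congrArg (fun f => of f ≫ _) ?_) (D.of_glueIso h κ τ (ε * δ) h0)
  exact eq_of_heq (D.obj_glue_heq (OrCell.mk κ ε) h (OrCell.mk τ δ))

end AdjointFamily

end

section

section Parts

variable {n m : ℕ}

lemma vertex_cases {p : Fin (n + m + 1) → Prop} (h : ∀ i, p (leftVertex n m i))
    (h' : ∀ i, p (rightVertex n m i)) (v : Fin (n + m + 1)) : p v := by
  cases v using Fin.cases with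
  | zero => exact h 0
  | succ v =>
    cases v using Fin.addCases with
    | left a => exact h a.succ
    | right b => exact h' b.succ

lemma val_leftVertex (i : Fin (n + 1)) : (leftVertex n m i : ℕ) = i := by
  cases i using Fin.cases <;> simp [leftVertex]

lemma val_rightVertex_succ (j : Fin m) : (rightVertex n m j.succ : ℕ) = n + j + 1 := by
  simp [rightVertex]

lemma leftVertex_strictMono : StrictMono (leftVertex n m) := fun i j h => by
  rw [Fin.lt_def, val_leftVertex, val_leftVertex]
  exact h

lemma rightVertex_strictMono : StrictMono (rightVertex n m) := by
  intro i j h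
  cases j using Fin.cases with
  | zero => exact absurd h (Fin.not_lt_zero i)
  | succ j =>
    cases i using Fin.cases with
    | zero => exact Fin.succ_pos _
    | succ i =>
      have := Fin.succ_lt_succ_iff.1 h
      rw [Fin.lt_def] at this
      rw [Fin.lt_def, val_rightVertex_succ, val_rightVertex_succ]
      omega

lemma leftVertex_lt_rightVertex (i : Fin (n + 1)) (j : Fin m) :
    leftVertex n m i < rightVertex n m j.succ := by
  rw [Fin.lt_def, val_leftVertex, val_rightVertex_succ]
  omega

lemma leftVertex_eq_rightVertex {i : Fin (n + 1)} {j : Fin (m + 1)}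
    (h : leftVertex n m i = rightVertex n m j) : i = 0 ∧ j = 0 := by
  cases j using Fin.cases with
  | zero => exact ⟨leftVertex_strictMono.injective h, rfl⟩
  | succ j => exact absurd h (leftVertex_lt_rightVertex i j).ne

lemma subset_iff_parts {S U : Finset (Fin (n + m + 1))} :
    S ⊆ U ↔ leftPart n m S ⊆ leftPart n m U ∧ rightPart n m S ⊆ rightPart n m U := by
  refine ⟨fun h => ⟨fun i hi => mem_leftPart.2 (h (mem_leftPart.1 hi)),
    fun i hi => mem_rightPart.2 (h (mem_rightPart.1 hi))⟩, fun h v => ?_⟩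
  refine vertex_cases (p := fun v => v ∈ S → v ∈ U) (fun i hi => ?_) (fun i hi => ?_) v
  · exact mem_leftPart.1 (h.1 (mem_leftPart.2 hi))
  · exact mem_rightPart.1 (h.2 (mem_rightPart.2 hi))

lemma eq_iff_parts {S U : Finset (Fin (n + m + 1))} :
    S = U ↔ leftPart n m S = leftPart n m U ∧ rightPart n m S = rightPart n m U := by
  refine ⟨fun h => by rw [h]; exact ⟨rfl, rfl⟩, fun h => ?_⟩
  exact (subset_iff_parts.2 ⟨h.1.subset, h.2.subset⟩).antisymm
    (subset_iff_parts.2 ⟨h.1.superset, h.2.superset⟩)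

/-- The set of vertices with the given parts. -/
def joinParts (S : Finset (Fin (n + 1))) (U : Finset (Fin (m + 1))) : Finset (Fin (n + m + 1)) :=
  S.image (leftVertex n m) ∪ U.image (rightVertex n m)

lemma leftPart_joinParts {S : Finset (Fin (n + 1))} {U : Finset (Fin (m + 1))} (h : 0 ∈ S) :
    leftPart n m (joinParts S U) = S := by
  ext i
  simp only [mem_leftPart, joinParts, Finset.mem_union, Finset.mem_image]
  constructor
  · rintro (⟨j, hj, e⟩ | ⟨j, hj, e⟩)
    · exact leftVertex_strictMono.injective e ▸ hj
    · exact (leftVertex_eq_rightVertex e.symm).1 ▸ h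
  · exact fun hi => Or.inl ⟨i, hi, rfl⟩

lemma rightPart_joinParts {S : Finset (Fin (n + 1))} {U : Finset (Fin (m + 1))} (h : 0 ∈ U) :
    rightPart n m (joinParts S U) = U := by
  ext i
  simp only [mem_rightPart, joinParts, Finset.mem_union, Finset.mem_image]
  constructor
  · rintro (⟨j, hj, e⟩ | ⟨j, hj, e⟩)
    · exact (leftVertex_eq_rightVertex e).2 ▸ h
    · exact rightVertex_strictMono.injective e ▸ hj
  · exact fun hi => Or.inr ⟨i, hi, rfl⟩

lemma joinParts_parts {S : Finset (Fin (n + m + 1))} (h : 0 ∈ S) :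
    joinParts (leftPart n m S) (rightPart n m S) = S :=
  eq_iff_parts.2 ⟨leftPart_joinParts (zero_mem_leftPart h),
    rightPart_joinParts (zero_mem_rightPart h)⟩

lemma card_joinParts {S : Finset (Fin (n + 1))} {U : Finset (Fin (m + 1))} (h : 0 ∈ S)
    (h' : 0 ∈ U) : (joinParts S U).card + 1 = S.card + U.card := by
  have h1 : S.image (leftVertex n m) ∩ U.image (rightVertex n m) = {0} := by
    ext v
    simp only [Finset.mem_inter, Finset.mem_image, Finset.mem_singleton]
    constructor
    · rintro ⟨⟨i, -, rfl⟩, ⟨j, -, e⟩⟩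
      rw [(leftVertex_eq_rightVertex e.symm).1]
      rfl
    · rintro rfl
      exact ⟨⟨0, h, rfl⟩, ⟨0, h', rfl⟩⟩
  have h2 := Finset.card_union_add_card_inter (S.image (leftVertex n m))
    (U.image (rightVertex n m))
  rw [h1, Finset.card_singleton, Finset.card_image_of_injective _ leftVertex_strictMono.injective,
    Finset.card_image_of_injective _ rightVertex_strictMono.injective] at h2
  exact h2

lemma card_parts {S : Finset (Fin (n + m + 1))} (h : 0 ∈ S) :
    S.card + 1 = (leftPart n m S).card + (rightPart n m S).card := by
  conv_lhs => rw [← joinParts_parts h]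
  exact card_joinParts (zero_mem_leftPart h) (zero_mem_rightPart h)

lemma leftPart_erase_leftVertex (S : Finset (Fin (n + m + 1))) (i : Fin (n + 1)) :
    leftPart n m (S.erase (leftVertex n m i)) = (leftPart n m S).erase i := by
  ext j
  simp [mem_leftPart, leftVertex_strictMono.injective.eq_iff]

lemma rightPart_erase_leftVertex (S : Finset (Fin (n + m + 1))) {i : Fin (n + 1)} (hi : i ≠ 0) :
    rightPart n m (S.erase (leftVertex n m i)) = rightPart n m S := by
  ext j
  simp only [mem_rightPart, Finset.mem_erase, and_iff_right_iff_imp]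
  exact fun _ h => hi (leftVertex_eq_rightVertex h.symm).1

lemma rightPart_erase_rightVertex (S : Finset (Fin (n + m + 1))) (i : Fin (m + 1)) :
    rightPart n m (S.erase (rightVertex n m i)) = (rightPart n m S).erase i := by
  ext j
  simp [mem_rightPart, rightVertex_strictMono.injective.eq_iff]

lemma leftPart_erase_rightVertex (S : Finset (Fin (n + m + 1))) {i : Fin (m + 1)} (hi : i ≠ 0) :
    leftPart n m (S.erase (rightVertex n m i)) = leftPart n m S := by
  ext j
  simp only [mem_leftPart, Finset.mem_erase, and_iff_right_iff_imp]
  exact fun _ h => hi (leftVertex_eq_rightVertex h).2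

lemma filter_lt_leftVertex (S : Finset (Fin (n + m + 1))) (i : Fin (n + 1)) :
    (S.filter (· < leftVertex n m i)).card = ((leftPart n m S).filter (· < i)).card := by
  rw [← Finset.card_image_of_injective _ (leftVertex_strictMono (n := n) (m := m)).injective]
  congr 1
  ext v
  simp only [Finset.mem_filter, Finset.mem_image]
  constructor
  · revert v
    refine fun v => vertex_cases (p := fun v => v ∈ S ∧ v < leftVertex n m i →
      ∃ a, (a ∈ leftPart n m S ∧ a < i) ∧ leftVertex n m a = v) (fun j h => ?_)
      (fun j h => ?_) v
    · exact ⟨j, ⟨mem_leftPart.2 h.1, leftVertex_strictMono.lt_iff_lt.1 h.2⟩, rfl⟩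
    · cases j using Fin.cases with
      | zero => exact ⟨0, ⟨mem_leftPart.2 h.1, leftVertex_strictMono.lt_iff_lt.1 h.2⟩, rfl⟩
      | succ j => exact absurd h.2 (leftVertex_lt_rightVertex i j).not_gt
  · rintro ⟨j, ⟨h1, h2⟩, rfl⟩
    exact ⟨mem_leftPart.1 h1, leftVertex_strictMono h2⟩

lemma filter_lt_rightVertex {S : Finset (Fin (n + m + 1))} (h0 : 0 ∈ S) {i : Fin (m + 1)}
    (hi : i ≠ 0) : (S.filter (· < rightVertex n m i)).card + 1 =
      (leftPart n m S).card + ((rightPart n m S).filter (· < i)).card := by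
  have h1 : 0 ∈ S.filter (· < rightVertex n m i) :=
    Finset.mem_filter.2 ⟨h0, rightVertex_strictMono (Fin.pos_iff_ne_zero.2 hi)⟩
  rw [card_parts h1]
  congr 2
  · ext j
    simp only [mem_leftPart, Finset.mem_filter, and_iff_left_iff_imp]
    intro _
    obtain ⟨i, rfl⟩ := Fin.exists_succ_eq.2 hi
    exact leftVertex_lt_rightVertex j i
  · ext j
    simp [mem_rightPart, rightVertex_strictMono.lt_iff_lt]

lemma simplexInc_parts {S U : Finset (Fin (n + m + 1))} (hS : 0 ∈ S) (hU : 0 ∈ U) :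
    simplexInc S U = (if rightPart n m S = rightPart n m U then
        simplexInc (leftPart n m S) (leftPart n m U) else 0) +
      (if leftPart n m S = leftPart n m U then
        (-1) ^ ((leftPart n m S).card - 1) * simplexInc (rightPart n m S) (rightPart n m U)
        else 0) := by
  have hself : ∀ {k : ℕ} (V : Finset (Fin k)), simplexInc V V = 0 := fun V =>
    simplexInc_eq_zero fun h => by omega
  by_cases h : U ⊆ S ∧ S.card = U.card + 1
  · obtain ⟨v, hv, rfl⟩ := exists_erase_of_card h.1 h.2
    rw [simplexInc_erase hv]
    clear h
    revert v
    refine vertex_cases (fun i hv hU => ?_) (fun i hv hU => ?_)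
    · have hi : i ≠ 0 := by
        rintro rfl
        exact Finset.notMem_erase _ _ hU
      have hi' := mem_leftPart.2 hv
      rw [rightPart_erase_leftVertex S hi, if_pos rfl, leftPart_erase_leftVertex,
        simplexInc_erase hi', filter_lt_leftVertex, if_neg, add_zero]
      intro h
      exact Finset.notMem_erase i _ (h ▸ hi')
    · have hi : i ≠ 0 := by
        rintro rfl
        exact Finset.notMem_erase _ _ hU
      have hi' := mem_rightPart.2 hv
      rw [leftPart_erase_rightVertex S hi, if_pos rfl, rightPart_erase_rightVertex,
        simplexInc_erase hi', if_neg, zero_add, ← pow_add]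
      · congr 1
        have := filter_lt_rightVertex hS hi
        have := (Finset.card_pos.2 ⟨0, zero_mem_leftPart hS⟩ : 0 < (leftPart n m S).card)
        omega
      · intro h
        exact Finset.notMem_erase i _ (h ▸ hi')
  · rw [simplexInc_eq_zero h]
    have h1 := card_parts hS
    have h2 := card_parts hU
    rw [subset_iff_parts] at h
    split_ifs with h3 h4 h4
    · rw [h3, h4, hself, hself]; simp
    · rw [simplexInc_eq_zero, add_zero]
      rintro ⟨h5, h6⟩
      exact h ⟨⟨h5, h3.superset⟩, by rw [h3] at h1; omega⟩
    · rw [simplexInc_eq_zero (T := rightPart n m S), mul_zero, add_zero]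
      rintro ⟨h5, h6⟩
      exact h ⟨⟨h4.superset, h5⟩, by rw [h4] at h1; omega⟩
    · rfl

end Parts

end

section

section Rearrange

variable {n m : ℕ}

lemma dim_parts {ρ : Finset (Fin (n + m + 1))} (τ : (simplex ρ).Cell) (h : 0 ∈ τ.1) :
    (simplex ρ).dim τ = (simplex _).dim (leftFace τ h) + (simplex _).dim (rightFace τ h) := by
  have h1 := card_parts h
  have h2 := Finset.card_pos.2 ⟨0, zero_mem_leftPart h⟩
  have h3 := Finset.card_pos.2 ⟨0, zero_mem_rightPart h⟩
  change τ.1.card - 1 = ((leftPart n m τ.1).card - 1) + ((rightPart n m τ.1).card - 1)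
  omega

lemma leftFace_eq_iff {ρ : Finset (Fin (n + m + 1))} {τ υ : (simplex ρ).Cell} (h : 0 ∈ τ.1)
    (h' : 0 ∈ υ.1) : leftFace τ h = leftFace υ h' ↔ leftPart n m τ.1 = leftPart n m υ.1 :=
  Subtype.ext_iff

lemma rightFace_eq_iff {ρ : Finset (Fin (n + m + 1))} {τ υ : (simplex ρ).Cell} (h : 0 ∈ τ.1)
    (h' : 0 ∈ υ.1) : rightFace τ h = rightFace υ h' ↔ rightPart n m τ.1 = rightPart n m υ.1 :=
  Subtype.ext_iff

lemma face_eq_iff {ρ : Finset (Fin (n + m + 1))} {τ υ : (simplex ρ).Cell} (h : 0 ∈ τ.1)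
    (h' : 0 ∈ υ.1) :
    τ = υ ↔ leftFace τ h = leftFace υ h' ∧ rightFace τ h = rightFace υ h' := by
  rw [leftFace_eq_iff, rightFace_eq_iff, ← eq_iff_parts]
  exact Subtype.ext_iff

lemma inc_parts {ρ : Finset (Fin (n + m + 1))} {τ υ : (simplex ρ).Cell} (h : 0 ∈ τ.1)
    (h' : 0 ∈ υ.1) : (simplex ρ).inc τ υ = (open Classical in
      (if rightFace τ h = rightFace υ h' then
        (simplex _).inc (leftFace τ h) (leftFace υ h') else 0) +
      (if leftFace τ h = leftFace υ h' then (-1) ^ (simplex _).dim (leftFace τ h) *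
        (simplex _).inc (rightFace τ h) (rightFace υ h') else 0)) := by
  refine (simplexInc_parts h h').trans ?_
  simp only [rightFace_eq_iff, leftFace_eq_iff]
  congr

variable (K L : OrientedBallComplex) (ρ : Finset (Fin (n + m + 1)))

/-- The cell `(κ × τ₀) × (λ × τ₁)` for a cell `(κ × λ) × τ`. -/
def splitCell (c : ((K.prod L).prod (simplex ρ)).Cell) (h : 0 ∈ c.2.1) :
    ((K.prod (simplex (leftPart n m ρ))).prod (L.prod (simplex (rightPart n m ρ)))).Cell :=
  ((c.1.1, leftFace c.2 h), (c.1.2, rightFace c.2 h))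

/-- The sign of the interchange of `λ` and `τ₀`, up to a global sign. -/
def splitSign (e : ℤ) (c : ((K.prod L).prod (simplex ρ)).Cell) (h : 0 ∈ c.2.1) : ℤˣ :=
  psign (L.dim c.1.2 * (simplex _).dim (leftFace c.2 h) + e)

lemma psign_add_mul_psign_add (a b e : ℤ) : psign (a + e) * psign (b + e) = psign (a + b) := by
  rw [← psign_add, show a + e + (b + e) = a + b + 2 * e by ring, psign_add (a + b),
    show psign (2 * e) = 1 from Int.negOnePow_two_mul e, mul_one]

lemma OrientedBallComplex.inc_eq_zero_or (K : OrientedBallComplex) (σ τ : K.Cell) :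
    K.inc σ τ = 0 ∨ K.dim σ = K.dim τ + 1 := by
  by_cases h : K.carrier τ ⊆ K.carrier σ ∧ K.dim σ = K.dim τ + 1
  · exact Or.inr h.2
  · exact Or.inl (K.inc_eq_zero _ _ h)

lemma inc_splitCell (e : ℤ) (c c' : ((K.prod L).prod (simplex ρ)).Cell) (h : 0 ∈ c.2.1)
    (h' : 0 ∈ c'.2.1) :
    ((splitSign K L ρ e c h * splitSign K L ρ e c' h' : ℤˣ) : ℤ) *
      ((K.prod (simplex (leftPart n m ρ))).prod (L.prod (simplex (rightPart n m ρ)))).inc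
        (splitCell K L ρ c h) (splitCell K L ρ c' h') =
      ((K.prod L).prod (simplex ρ)).inc c c' := by
  obtain ⟨⟨κ, l⟩, τ⟩ := c
  obtain ⟨⟨κ', l'⟩, τ'⟩ := c'
  dsimp only [splitSign]
  rw [psign_add_mul_psign_add]
  simp only [OrientedBallComplex.prod, splitCell]
  rw [inc_parts h h']
  have he := face_eq_iff h h'
  simp only [Prod.mk.injEq]
  generalize leftFace τ h = a, leftFace τ' h' = a', rightFace τ h = b, rightFace τ' h' = b' at he ⊢
  have hp : ∀ d t d' t' : ℕ, ((psign (d * t + d' * t') : ℤˣ) : ℤ) =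
      (-1) ^ (d * t) * (-1) ^ (d' * t') := fun d t d' t' => by
    rw [← pow_add, ← Int.coe_negOnePow_natCast]
    push_cast
    rfl
  have hs : ∀ k : ℕ, ((-1 : ℤ) ^ k) * (-1) ^ k = 1 := fun k => by rw [← mul_pow]; simp
  by_cases h1 : κ = κ' <;> by_cases h2 : l = l' <;> by_cases h3 : a = a' <;> by_cases h4 : b = b'
  all_goals simp [h1, h2, h3, h4, he, OrientedBallComplex.inc_self, hp, hs]
  · ring
  · rcases OrientedBallComplex.inc_eq_zero_or _ a a' with h5 | h5
    · rw [h5]; simp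
    · rw [h5, mul_add, pow_add, mul_one, pow_add]
      linear_combination (-1) ^ L.dim l' * (-1) ^ K.dim κ' *
        (simplex (leftPart n m ρ)).inc a a' * hs (L.dim l' * (simplex (leftPart n m ρ)).dim a')
  · rcases L.inc_eq_zero_or l l' with h5 | h5
    · rw [h5]; simp
    · rw [h5, add_mul, pow_add, one_mul, pow_add]
      linear_combination (-1) ^ K.dim κ' * L.inc l l' * hs ((simplex (leftPart n m ρ)).dim a') +
        (-1) ^ K.dim κ' * L.inc l l' * (-1) ^ (simplex (leftPart n m ρ)).dim a' *
        (-1) ^ (simplex (leftPart n m ρ)).dim a' *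
          hs (L.dim l' * (simplex (leftPart n m ρ)).dim a')

/-- The cells of `(K × L) × ρ` which do not contain the vertex `0` of the simplex. -/
def farCells : Subcomplex ((K.prod L).prod (simplex ρ)) where
  cells := {c | 0 ∉ c.2.1}
  mem_of_subset c c' h h' h0 := h' (simplex_carrier_subset.1
    ((OrientedBallComplex.prod_subset_iff (K.prod L) (simplex ρ) c c').1 h).2 h0)

/-- The cells of `(K × S) × (L × U)` which do not contain both vertices `0` of the simplices. -/
def farCellsProd (S : Finset (Fin (n + 1))) (U : Finset (Fin (m + 1))) :
    Subcomplex ((K.prod (simplex S)).prod (L.prod (simplex U))) where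
  cells := {c | ¬ (0 ∈ c.1.2.1 ∧ 0 ∈ c.2.2.1)}
  mem_of_subset c c' h h' h0 := by
    have h1 := (OrientedBallComplex.prod_subset_iff _ _ c c').1 h
    have h2 := ((OrientedBallComplex.prod_subset_iff K (simplex S) c.1 c'.1).1 h1.1).2
    have h3 := ((OrientedBallComplex.prod_subset_iff L (simplex U) c.2 c'.2).1 h1.2).2
    exact h' ⟨simplex_carrier_subset.1 h2 h0.1, simplex_carrier_subset.1 h3 h0.2⟩

lemma splitCell_notMem (c : ((K.prod L).prod (simplex ρ)).Cell) (h : 0 ∈ c.2.1) :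
    splitCell K L ρ c h ∉
      (farCellsProd K L (leftPart n m ρ) (rightPart n m ρ)).cells :=
  not_not.2 ⟨zero_mem_leftPart h, zero_mem_rightPart h⟩

/-- The cell `(κ × λ) × τ` for a cell `(κ × τ₀) × (λ × τ₁)`. -/
def joinCell
    (c : ((K.prod (simplex (leftPart n m ρ))).prod (L.prod (simplex (rightPart n m ρ)))).Cell)
    (h : 0 ∈ c.1.2.1 ∧ 0 ∈ c.2.2.1) : ((K.prod L).prod (simplex ρ)).Cell :=
  ((c.1.1, c.2.1), ⟨joinParts c.1.2.1 c.2.2.1,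
    ⟨0, mem_leftPart.1 ((leftPart_joinParts h.1).symm ▸ h.1)⟩, subset_iff_parts.2
      ⟨(leftPart_joinParts h.1).trans_subset c.1.2.2.2,
        (rightPart_joinParts h.2).trans_subset c.2.2.2.2⟩⟩)

lemma zero_mem_joinCell
    (c : ((K.prod (simplex (leftPart n m ρ))).prod (L.prod (simplex (rightPart n m ρ)))).Cell)
    (h : 0 ∈ c.1.2.1 ∧ 0 ∈ c.2.2.1) : 0 ∈ (joinCell K L ρ c h).2.1 :=
  mem_leftPart.1 ((leftPart_joinParts h.1).symm ▸ h.1)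

lemma splitCell_joinCell
    (c : ((K.prod (simplex (leftPart n m ρ))).prod (L.prod (simplex (rightPart n m ρ)))).Cell)
    (h : 0 ∈ c.1.2.1 ∧ 0 ∈ c.2.2.1) :
    splitCell K L ρ (joinCell K L ρ c h) (zero_mem_joinCell K L ρ c h) = c :=
  Prod.ext (Prod.ext rfl (Subtype.ext (leftPart_joinParts h.1)))
    (Prod.ext rfl (Subtype.ext (rightPart_joinParts h.2)))

lemma joinCell_splitCell (c : ((K.prod L).prod (simplex ρ)).Cell) (h : 0 ∈ c.2.1) :
    joinCell K L ρ (splitCell K L ρ c h) ⟨zero_mem_leftPart h, zero_mem_rightPart h⟩ = c :=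
  Prod.ext rfl (Subtype.ext (joinParts_parts h))

lemma splitCell_subset_iff (c c' : ((K.prod L).prod (simplex ρ)).Cell) (h : 0 ∈ c.2.1)
    (h' : 0 ∈ c'.2.1) :
    ((K.prod (simplex (leftPart n m ρ))).prod (L.prod (simplex (rightPart n m ρ)))).carrier
        (splitCell K L ρ c h) ⊆
      ((K.prod (simplex (leftPart n m ρ))).prod (L.prod (simplex (rightPart n m ρ)))).carrier
        (splitCell K L ρ c' h') ↔
    ((K.prod L).prod (simplex ρ)).carrier c ⊆ ((K.prod L).prod (simplex ρ)).carrier c' := by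
  have h1 : ((K.prod (simplex (leftPart n m ρ))).prod (L.prod (simplex (rightPart n m ρ)))).carrier
      (splitCell K L ρ c h) ⊆
      ((K.prod (simplex (leftPart n m ρ))).prod (L.prod (simplex (rightPart n m ρ)))).carrier
      (splitCell K L ρ c' h') ↔ _ := OrientedBallComplex.prod_subset_iff _ _ _ _
  have h2 : (K.prod (simplex (leftPart n m ρ))).carrier (c.1.1, leftFace c.2 h) ⊆
    (K.prod (simplex (leftPart n m ρ))).carrier (c'.1.1, leftFace c'.2 h') ↔ _ :=
      OrientedBallComplex.prod_subset_iff _ _ _ _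
  have h3 : (L.prod (simplex (rightPart n m ρ))).carrier (c.1.2, rightFace c.2 h) ⊆
    (L.prod (simplex (rightPart n m ρ))).carrier (c'.1.2, rightFace c'.2 h') ↔ _ :=
      OrientedBallComplex.prod_subset_iff _ _ _ _
  have h4 : ((K.prod L).prod (simplex ρ)).carrier c ⊆ ((K.prod L).prod (simplex ρ)).carrier c' ↔ _ :=
    OrientedBallComplex.prod_subset_iff _ _ _ _
  have h5 : (K.prod L).carrier c.1 ⊆ (K.prod L).carrier c'.1 ↔ _ :=
    OrientedBallComplex.prod_subset_iff _ _ _ _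
  refine h1.trans (((and_congr h2 h3)).trans (Iff.trans ?_ (h4.trans (and_congr_left' h5)).symm))
  have h6 : (simplex (leftPart n m ρ)).carrier (leftFace c.2 h) ⊆
      (simplex (leftPart n m ρ)).carrier (leftFace c'.2 h') ↔
      leftPart n m c.2.1 ⊆ leftPart n m c'.2.1 := simplex_carrier_subset
  have h7 : (simplex (rightPart n m ρ)).carrier (rightFace c.2 h) ⊆
      (simplex (rightPart n m ρ)).carrier (rightFace c'.2 h') ↔
      rightPart n m c.2.1 ⊆ rightPart n m c'.2.1 := simplex_carrier_subset
  have h8 : (simplex ρ).carrier c.2 ⊆ (simplex ρ).carrier c'.2 ↔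
      leftPart n m c.2.1 ⊆ leftPart n m c'.2.1 ∧ rightPart n m c.2.1 ⊆ rightPart n m c'.2.1 :=
    simplex_carrier_subset.trans subset_iff_parts
  refine (and_congr (and_congr_right' h6) (and_congr_right' h7)).trans (Iff.trans ?_
    (and_congr_right' h8).symm)
  exact and_and_and_comm

lemma splitCell_ssubset_iff (c c' : ((K.prod L).prod (simplex ρ)).Cell) (h : 0 ∈ c.2.1)
    (h' : 0 ∈ c'.2.1) :
    ((K.prod (simplex (leftPart n m ρ))).prod (L.prod (simplex (rightPart n m ρ)))).carrier
        (splitCell K L ρ c h) ⊂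
      ((K.prod (simplex (leftPart n m ρ))).prod (L.prod (simplex (rightPart n m ρ)))).carrier
        (splitCell K L ρ c' h') ↔
    ((K.prod L).prod (simplex ρ)).carrier c ⊂ ((K.prod L).prod (simplex ρ)).carrier c' :=
  and_congr (splitCell_subset_iff K L ρ c c' h h')
    (not_congr (splitCell_subset_iff K L ρ c' c h' h))

/-- The map of oriented cells underlying `splitHom`. -/
def splitFun (e : ℤ) : RelCell _ (farCells K L ρ) →
    RelCell _ (farCellsProd K L (leftPart n m ρ) (rightPart n m ρ))
  | .cell c h ε => .cell (splitCell K L ρ c (not_not.1 h)) (splitCell_notMem K L ρ c (not_not.1 h))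
      (ε * splitSign K L ρ e c (not_not.1 h))
  | .empty n => .empty n

/-- The isomorphism of categories of cells given by the interchange of factors. -/
def splitHom (e : ℤ) : GradedHom 0 (RelCell _ (farCells K L ρ))
    (RelCell _ (farCellsProd K L (leftPart n m ρ) (rightPart n m ρ))) :=
  RelCell.gradedHom 0 (splitFun K L ρ e)
    (by
      rintro (⟨c, h, ε⟩ | m) (⟨c', h', ε'⟩ | m') hle
      · rcases hle with ⟨rfl, rfl⟩ | hle
        · exact le_rfl
        · exact Or.inr ((splitCell_ssubset_iff K L ρ c c' _ _).2 hle)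
      · exact hle.elim
      · have h1 := dim_parts c'.2 (not_not.1 h')
        have h2 : m < ((K.prod L).dim c'.1 + (simplex ρ).dim c'.2 : ℕ) := hle
        change m < (((K.dim c'.1.1 + (simplex (leftPart n _ ρ)).dim _) +
          (L.dim c'.1.2 + (simplex (rightPart n _ ρ)).dim _) : ℕ) : ℤ)
        rw [h1] at h2
        change m < ((K.dim c'.1.1 + L.dim c'.1.2 + _ : ℕ) : ℤ) at h2
        dsimp only [splitCell]
        omega
      · exact hle)
    (by
      rintro (⟨c, h, ε⟩ | m)
      · have h1 := dim_parts c.2 (not_not.1 h)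
        change (((K.dim c.1.1 + (simplex (leftPart n _ ρ)).dim (leftFace c.2 (not_not.1 h))) +
          (L.dim c.1.2 + (simplex (rightPart n _ ρ)).dim (rightFace c.2 (not_not.1 h))) : ℕ) : ℤ) =
          ((K.dim c.1.1 + L.dim c.1.2 + (simplex ρ).dim c.2 : ℕ) : ℤ) - 0
        rw [h1]
        omega
      · exact (sub_zero _).symm)
    (by
      rintro (⟨c, h, ε⟩ | m)
      · exact congrArg (RelCell.cell _ _) (neg_mul _ _)
      · rfl)
    (fun n => congrArg RelCell.empty (sub_zero n).symm)

lemma splitHom_inc (e : ℤ) (x y : RelCell _ (farCells K L ρ)) :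
    ((splitHom K L ρ e).F.obj x).inc ((splitHom K L ρ e).F.obj y) = x.inc y := by
  rcases x with ⟨c, h, ε⟩ | m <;> rcases y with ⟨c', h', ε'⟩ | m'
  · have := inc_splitCell K L ρ e c c' (not_not.1 h) (not_not.1 h')
    change ((ε * splitSign K L ρ e c (not_not.1 h) : ℤˣ) : ℤ) *
      ((ε' * splitSign K L ρ e c' (not_not.1 h') : ℤˣ) : ℤ) * _ = ε * ε' * _
    rw [← this]
    push_cast
    ring
  all_goals rfl

/-- The inverse of `splitFun`. -/
def joinFun (e : ℤ) : RelCell _ (farCellsProd K L (leftPart n m ρ) (rightPart n m ρ)) →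
    RelCell _ (farCells K L ρ)
  | .cell c h ε => .cell (joinCell K L ρ c (not_not.1 h))
      (not_not.2 (zero_mem_joinCell K L ρ c (not_not.1 h)))
      (ε * splitSign K L ρ e (joinCell K L ρ c (not_not.1 h))
        (zero_mem_joinCell K L ρ c (not_not.1 h)))
  | .empty n => .empty n

lemma splitFun_joinFun (e : ℤ)
    (x : RelCell _ (farCellsProd K L (leftPart n m ρ) (rightPart n m ρ))) :
    splitFun K L ρ e (joinFun K L ρ e x) = x := by
  rcases x with ⟨c, h, ε⟩ | m
  · have h1 : ∀ {c c'} (_ : c = c') (h h') {ε ε' : ℤˣ} (_ : ε = ε'),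
      (RelCell.cell c h ε : RelCell _ (farCellsProd K L (leftPart n m ρ) (rightPart n m ρ))) =
        .cell c' h' ε' := by
      rintro c _ rfl h h' ε _ rfl
      rfl
    refine h1 (splitCell_joinCell K L ρ c (not_not.1 h)) _ _ ?_
    rw [mul_assoc, Int.units_mul_self, mul_one]
  · rfl

lemma joinFun_splitFun (e : ℤ) (x : RelCell _ (farCells K L ρ)) :
    joinFun K L ρ e (splitFun K L ρ e x) = x := by
  rcases x with ⟨c, h, ε⟩ | m
  · have h0 := joinCell_splitCell K L ρ c (not_not.1 h)
    have h1 : ∀ {c' : ((K.prod L).prod (simplex ρ)).Cell} (hc : c' = c) (h' h2),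
        (RelCell.cell c' h' (ε * splitSign K L ρ e c (not_not.1 h) * splitSign K L ρ e c' h2) :
          RelCell _ (farCells K L ρ)) = .cell c h ε := by
      rintro _ rfl h' h2
      rw [mul_assoc, Int.units_mul_self, mul_one]
    exact h1 h0 _ _
  · rfl

lemma joinFun_mono (e : ℤ) : Monotone (joinFun (n := n) (m := m) K L ρ e) := by
  intro x y h
  rw [← splitFun_joinFun K L ρ e x, ← splitFun_joinFun K L ρ e y] at h
  generalize joinFun K L ρ e x = x' at h ⊢
  generalize joinFun K L ρ e y = y' at h ⊢
  rcases x' with ⟨c, h', ε⟩ | m <;> rcases y' with ⟨c', h'', ε'⟩ | m'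
  · rcases h with ⟨h1, h2⟩ | h
    · have h3 : c = c' := by
        rw [← joinCell_splitCell K L ρ c (not_not.1 h'), ← joinCell_splitCell K L ρ c' (not_not.1 h'')]
        simp only [h1]
      subst h3
      exact Or.inl ⟨rfl, mul_right_cancel h2⟩
    · exact Or.inr ((splitCell_ssubset_iff K L ρ c c' _ _).1 h)
  · exact h.elim
  · have h1 := RelCell.dim_mono h
    have h2 : ((splitHom K L ρ e).F.obj (.cell c' h'' ε')).dim =
        (RelCell.cell c' h'' ε' : RelCell _ (farCells K L ρ)).dim - 0 :=
      (splitHom K L ρ e).gdim_obj (.cell c' h'' ε')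
    have h3 : m < (splitFun K L ρ e (.cell c' h'' ε')).dim := h
    have h4 : m < (RelCell.cell c' h'' ε' : RelCell _ (farCells K L ρ)).dim - 0 := h2 ▸ h3
    rw [sub_zero] at h4
    exact h4
  · exact h

lemma splitHom_isIso (e : ℤ) : ∃ θ' : RelCell _ (farCellsProd K L (leftPart n m ρ)
    (rightPart n m ρ)) ⥤ RelCell _ (farCells K L ρ),
    (splitHom K L ρ e).F ⋙ θ' = 𝟭 _ ∧ θ' ⋙ (splitHom K L ρ e).F = 𝟭 _ :=
  ⟨(joinFun_mono K L ρ e).functor, RelCell.functor_ext (joinFun_splitFun K L ρ e),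
    RelCell.functor_ext (splitFun_joinFun K L ρ e)⟩

end Rearrange

end

section

namespace RelCell

variable {A : Type u} [Category.{v} A] [BalancedCategory A]

/-- The inclusion of the oriented cells outside a subcomplex in all oriented cells. -/
def inclHom (K : OrientedBallComplex) (L : Subcomplex K) : GradedHom 0 (RelCell K L) (OrCell K) :=
  gradedHom 0
    (fun x => match x with
      | .cell σ _ ε => OrCell.mk σ ε
      | .empty n => .empty n)
    (by rintro (⟨σ, _, ε⟩ | m) (⟨τ, _, δ⟩ | n) h <;> exact h)
    (by rintro (⟨σ, _, ε⟩ | m) <;> exact (sub_zero _).symm)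
    (by rintro (⟨σ, _, ε⟩ | m) <;> rfl)
    (fun n => by rw [sub_zero])

lemma quotientHom_comp_inclHom_comp [EmptyInitial A] {K : OrientedBallComplex} (L : Subcomplex K)
    {k : ℤ} (W : Pre A K k) (h : ∀ c ∈ L.cells, ∀ ε,
      W.F.obj (OrCell.mk c ε) = (gempty A).obj (K.dim c - k)) :
    (quotientHom K L).comp ((inclHom K L).comp W (zero_add k).symm) (zero_add k).symm = W := by
  have e : ∀ x, W.F.obj ((inclHom K L).F.obj ((quotientHom K L).F.obj x)) = W.F.obj x := by
    rintro (⟨c, hc, ε⟩ | n)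
    · by_cases h1 : c ∈ L.cells
      · have h2 : (quotientHom K L).F.obj (.cell c hc ε) = .empty (K.dim c) := dif_pos h1
        rw [h2]
        exact (W.obj_empty _).trans (h c h1 ε).symm
      · have h2 : (quotientHom K L).F.obj (.cell c hc ε) = .cell c h1 ε := dif_neg h1
        rw [h2]
        rfl
    · rfl
  refine GradedHom.ext_F (_root_.CategoryTheory.Functor.hext e fun x y f => ?_)
  have e' := e x
  rcases x with ⟨c, hc, ε⟩ | n
  · by_cases h1 : c ∈ L.cells
    · exact heq_of_eq_empty (e'.trans (h c h1 ε)) (e _) (e _) _ _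
    · rcases y with ⟨c', hc', ε'⟩ | n
      · have h3 : c' ∉ L.cells := fun h' =>
          h1 (L.mem_of_subset _ _ (OrCell.carrier_subset (leOfHom f)) h')
        have h2 : (quotientHom K L).F.obj (.cell c hc ε) = .cell c h1 ε := dif_neg h1
        have h4 : (quotientHom K L).F.obj (.cell c' hc' ε') = .cell c' h3 ε' := dif_neg h3
        refine W.map_heq_map ?_ ?_ _ _
        · rw [h2]; rfl
        · rw [h4]; rfl
      · exact (leOfHom f : RelCell.le _ _).elim
  · exact heq_of_eq_empty (e'.trans (W.obj_empty n)) (e _) (e _) _ _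

end RelCell

lemma AdTheory.exists_mem_of_eq {A : Type u} [Category.{v} A] [BalancedCategory A]
    [EmptyInitial A] {T : AdTheory A} {K : OrientedBallComplex} {k k' : ℤ} (h : k = k')
    {M : Pre A K k} (hM : M ∈ T.ad K k) : ∃ N ∈ T.ad K k', N.F = M.F := by
  subst h
  exact ⟨M, hM, rfl⟩

open Unor

variable {A : Type u} [Category.{v} A] [BalancedCategory A] [EmptyInitial A] [MonoidalCategory A]
  [GradedSymmetricCategory A]

lemma Pre.gdim_obj_mk {K : OrientedBallComplex} {k : ℤ} (M : Pre A K k) (σ : K.Cell) (ε : ℤˣ) :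
    gdim (M.F.obj (OrCell.mk σ ε)) = K.dim σ - k := M.gdim_obj _

section

variable {K L : OrientedBallComplex} {k l : ℤ} {F : Pre A K k} {G : Pre A L l}
  {H : Pre A (K.prod L) (k + l)}

lemma IsProd.obj_eq (h : IsProd F G H) (σ : K.Cell) (τ : L.Cell) :
    (F.bar σ).as ⊗ (G.bar τ).as = (sgn A (psign (k * L.dim τ))).obj (H.bar (σ, τ)).as := by
  refine (h.obj σ τ 1 1).symm.trans ((H.obj_mk (σ, τ) _).trans ?_)
  rw [one_mul, one_mul]

lemma IsProd.barMap_eq (h : IsProd F G H) {σ σ' : K.Cell} {τ τ' : L.Cell}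
    (hσ : K.carrier σ ⊆ K.carrier σ') (hτ : L.carrier τ ⊆ L.carrier τ') :
    (F.barMap hσ ⊗ₘ G.barMap hτ) ≫ can _ (h.obj_eq σ' τ') =
      can _ (h.obj_eq σ τ) ≫ H.barMap (prod_carrier_subset hσ hτ) := by
  have hle : OrCell.mk (K := K.prod L) (σ, τ) (1 * 1 * psign (k * L.dim τ)) ≤
      OrCell.mk (K := K.prod L) (σ', τ') (1 * 1 * psign (k * L.dim τ')) := by
    rcases (K.prod L).carrier_eq_or_ssubset (prod_carrier_subset hσ hτ) with e | e
    · injection e with e1 e2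
      subst e1 e2
      exact le_rfl
    · exact Or.inr e
  have h1 := h.map σ σ' τ τ' 1 1 1 1 (homOfLE (OrCell.mk_le_mk hσ)) (homOfLE (OrCell.mk_le_mk hτ))
    (homOfLE hle)
  have h2 := of_heq (h.obj σ τ 1 1).symm (h.obj σ' τ' 1 1).symm h1.symm
  have h3 := H.of_map (homOfLE hle)
  have h4 : of (F.F.map (homOfLE (OrCell.mk_le_mk hσ)) ⊗ₘ
      G.F.map (homOfLE (OrCell.mk_le_mk hτ))) = F.barMap hσ ⊗ₘ G.barMap hτ := of_tensorHom _ _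
  rw [← h4]
  exact comp_eq_comp_of_squares h2 h3
    ((can_congr _ (by rw [one_mul, one_mul, one_mul])).trans (can_comp_can _ _).symm)
    ((can_congr _ (by rw [one_mul, one_mul, one_mul])).trans (can_comp_can _ _).symm)

lemma inv_comp_square {C : Type u} [Category.{v} C] {X Y X' Y' : C} {x : X ⟶ X'} {y : Y ⟶ Y'}
    (c : X ≅ Y) (c' : X' ≅ Y') (h : x ≫ c'.hom = c.hom ≫ y) : y ≫ c'.inv = c.inv ≫ x := by
  rw [Iso.comp_inv_eq, Category.assoc, h, Iso.inv_hom_id_assoc]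

lemma IsProd.barMap_comp_can (h : IsProd F G H) {σ σ' : K.Cell} {τ τ' : L.Cell}
    (hσ : K.carrier σ ⊆ K.carrier σ') (hτ : L.carrier τ ⊆ L.carrier τ') :
    H.barMap (prod_carrier_subset hσ hτ) ≫ can _ (eq_sgn_symm (h.obj_eq σ' τ')) =
      can _ (eq_sgn_symm (h.obj_eq σ τ)) ≫ (F.barMap hσ ⊗ₘ G.barMap hτ) :=
  inv_comp_square (canIso _ (h.obj_eq σ τ)) (canIso _ (h.obj_eq σ' τ')) (h.barMap_eq hσ hτ)

end

section Append

variable {T : AdTheory A} {n m : ℕ} (P : Fin n → StarAd T) (Q : Fin m → StarAd T)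

lemma miss_append (ρ : Finset (Fin (n + m + 1))) :
    miss (Fin.append P Q) ρ = miss P (leftPart n m ρ) + miss Q (rightPart n m ρ) := by
  simp only [miss, Finset.sum_filter, Fin.sum_univ_add, Fin.append_left, Fin.append_right,
    mem_leftPart, mem_rightPart]
  rfl

lemma orSign_append_left (ρ : Finset (Fin (n + m + 1))) (a : Fin n) :
    orSign (Fin.append P Q) ρ (Fin.castAdd m a) =
      orSign P (leftPart n m ρ) a * psign ((P a).dim * miss Q (rightPart n m ρ)) := by
  unfold orSign miss
  rw [← psign_add, ← mul_add]
  simp only [Finset.sum_filter, Fin.sum_univ_add, Fin.append_left, Fin.append_right,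
    mem_leftPart, mem_rightPart]
  congr 3
  refine Finset.sum_congr rfl fun b _ => if_congr ?_ rfl rfl
  exact and_iff_right (by rw [Fin.lt_def]; simp; omega)

lemma orSign_append_right (ρ : Finset (Fin (n + m + 1))) (b : Fin m) :
    orSign (Fin.append P Q) ρ (Fin.natAdd n b) = orSign Q (rightPart n m ρ) b := by
  unfold orSign
  simp only [Finset.sum_filter, Fin.sum_univ_add, Fin.append_left, Fin.append_right,
    mem_rightPart]
  rw [Finset.sum_eq_zero, zero_add]
  · congr 2
    refine Finset.sum_congr rfl fun c _ => if_congr ?_ rfl rfl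
    exact and_congr_left' (by rw [Fin.lt_def, Fin.lt_def]; simp)
  · intro c _
    refine if_neg fun h => ?_
    have := h.1
    rw [Fin.lt_def] at this
    simp at this
    omega

end Append

namespace AdSing

variable {T : AdTheory A} {n : ℕ} {P : Fin n → StarAd T} {K : OrientedBallComplex} {k : ℤ}
  (M : AdSing T P K k)

lemma adj_obj_eq_empty (κ : K.Cell) {σ : Finset (Fin (n + 1))} (τ : (simplex σ).Cell) (ε : ℤˣ)
    (h : 0 ∉ τ.1) : (M.adj σ).F.obj (OrCell.mk (K := K.prod (simplex σ)) (κ, τ) ε) =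
      (gempty A).obj ((K.prod (simplex σ)).dim (κ, τ) - (k + miss P σ)) := by
  have h1 := (M.isAdjoint σ).obj κ τ 1 ε
  rw [one_mul] at h1
  refine h1.trans (((M.1.F.obj (OrCell.mk κ 1)).pre_eq_empty σ τ ε h).trans ?_)
  congr 1
  have h2 : (M.1.F.obj (OrCell.mk κ 1)).dim = K.dim κ - k := M.1.gdim_obj (OrCell.mk κ 1)
  rw [h2]
  change _ = ((K.dim κ + (simplex σ).dim τ : ℕ) : ℤ) - _
  push_cast
  ring

lemma gdim_bar (σ : Finset (Fin (n + 1))) (κ : K.Cell) (τ : (simplex σ).Cell) :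
    gdim (M.bar σ κ τ).as = K.dim κ + (simplex σ).dim τ - (k + miss P σ) := by
  refine ((M.adj σ).gdim_obj_mk (κ, τ) 1).trans (congrArg (· - _) ?_)
  exact Int.natCast_add _ _

end AdSing

/-- The pread on `(K × L) × ρ` which underlies the external product. -/
lemma exists_prodPread {T : MultiplicativeAdTheory A} {n m : ℕ} {P : Fin n → StarAd T.toAdTheory}
    {Q : Fin m → StarAd T.toAdTheory} {K L : OrientedBallComplex} {k l : ℤ}
    (M : AdSing T.toAdTheory P K k) (N : AdSing T.toAdTheory Q L l)
    (ρ : Finset (Fin (n + m + 1))) :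
    ∃ H ∈ T.ad ((K.prod L).prod (simplex ρ)) (k + l + miss (Fin.append P Q) ρ),
      (∀ (c : (K.prod L).Cell) (τ : (simplex ρ).Cell) (ε : ℤˣ), 0 ∉ τ.1 →
        H.F.obj (OrCell.mk (K := (K.prod L).prod (simplex ρ)) (c, τ) ε) =
          (gempty A).obj (((K.prod L).prod (simplex ρ)).dim (c, τ) -
            (k + l + miss (Fin.append P Q) ρ))) ∧
      ∃ e : ∀ (κ : K.Cell) (κ' : L.Cell) (τ : (simplex ρ).Cell) (h : 0 ∈ τ.1),
        (H.bar ((κ, κ'), τ)).as = (sgn A (extSign P k l (leftPart n m ρ) (L.dim κ')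
          ((simplex _).dim (leftFace τ h)) ((simplex _).dim (rightFace τ h)))).obj
          ((M.bar (leftPart n m ρ) κ (leftFace τ h)).as ⊗
            (N.bar (rightPart n m ρ) κ' (rightFace τ h)).as),
        ∀ (κ ν : K.Cell) (κ' ν' : L.Cell) (τ υ : (simplex ρ).Cell) (h : 0 ∈ τ.1) (h' : 0 ∈ υ.1)
          (hκ : K.carrier κ ⊆ K.carrier ν) (hκ' : L.carrier κ' ⊆ L.carrier ν') (hτ : τ.1 ⊆ υ.1),
          H.barMap (prod_carrier_subset (prod_carrier_subset hκ hκ')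
              (simplex_carrier_subset.2 hτ)) ≫ can _ (e ν ν' υ h') =
            can _ (e κ κ' τ h) ≫
              (M.barMap (τ := leftFace τ h) (τ' := leftFace υ h') hκ (subset_iff_parts.1 hτ).1 ⊗ₘ
              N.barMap (τ := rightFace τ h) (τ' := rightFace υ h') hκ'
                (subset_iff_parts.1 hτ).2) := by
  obtain ⟨W, hW, hprod⟩ := T.prod_mem (M.adj_mem (leftPart n m ρ)) (N.adj_mem (rightPart n m ρ))
  have hempty : ∀ c ∈ (farCellsProd K L (leftPart n m ρ) (rightPart n m ρ)).cells, ∀ ε,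
      W.F.obj (OrCell.mk c ε) = (gempty A).obj
        (((K.prod (simplex (leftPart n m ρ))).prod (L.prod (simplex (rightPart n m ρ)))).dim c -
        (k + miss P (leftPart n m ρ) + (l + miss Q (rightPart n m ρ)))) := by
    rintro ⟨⟨κ, a⟩, ⟨κ', b⟩⟩ hc ε
    have h1 : W.F.obj (OrCell.mk ((κ, a), (κ', b)) ε) = _ := W.obj_mk ((κ, a), (κ', b)) ε
    rw [h1, show W.F.obj (OrCell.mk ((κ, a), (κ', b)) 1) = _ from
      eq_sgn_symm (hprod.obj_eq (κ, a) (κ', b))]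
    by_cases h0 : 0 ∈ a.1
    · have h2 := N.adj_obj_eq_empty κ' b 1 fun h => hc ⟨h0, h⟩
      have h3 := M.gdim_bar (leftPart n m ρ) κ a
      rw [show ((N.adj (rightPart n m ρ)).bar (κ', b)).as = _ from h2,
        GradedMonoidalCategory.tensor_empty, sgn_obj_empty, sgn_obj_empty]
      refine congrArg _ ((congrArg (fun x : ℤ => x + _) h3).trans ?_)
      change _ + (((_ + _ : ℕ) : ℤ) - _) = (((_ + _ : ℕ) + (_ + _ : ℕ) : ℕ) : ℤ) - _
      push_cast
      ring
    · have h2 := M.adj_obj_eq_empty κ a 1 h0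
      have h3 := N.gdim_bar (rightPart n m ρ) κ' b
      rw [show ((M.adj (leftPart n m ρ)).bar (κ, a)).as = _ from h2,
        GradedMonoidalCategory.empty_tensor, sgn_obj_empty, sgn_obj_empty]
      refine congrArg _ ((congrArg (fun x : ℤ => _ + x) h3).trans ?_)
      change (((_ + _ : ℕ) : ℤ) - _) + _ = (((_ + _ : ℕ) + (_ + _ : ℕ) : ℕ) : ℤ) - _
      push_cast
      ring
  have h1 := T.stable (splitHom K L ρ (l * miss P (leftPart n m ρ))) (splitHom_isIso K L ρ _)
    (splitHom_inc K L ρ _) ((RelCell.inclHom _ _).comp W (zero_add _).symm)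
    ((RelCell.quotientHom_comp_inclHom_comp _ W hempty).symm ▸ hW)
  obtain ⟨H, hH, hF⟩ := AdTheory.exists_mem_of_eq (k' := k + l + miss (Fin.append P Q) ρ)
    (by rw [miss_append]; ring) h1
  have hobj : ∀ x, H.F.obj x = W.F.obj ((RelCell.inclHom _ _).F.obj
      ((splitHom K L ρ (l * miss P (leftPart n m ρ))).F.obj
        ((quotientHom _ (farCells K L ρ)).F.obj x))) := fun x => Functor.congr_obj hF x
  have hnear : ∀ (κ : K.Cell) (κ' : L.Cell) (τ : (simplex ρ).Cell) (h : 0 ∈ τ.1) (ε : ℤˣ),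
      (RelCell.inclHom _ _).F.obj ((splitHom K L ρ (l * miss P (leftPart n m ρ))).F.obj
        ((quotientHom _ (farCells K L ρ)).F.obj
          (OrCell.mk (K := (K.prod L).prod (simplex ρ)) ((κ, κ'), τ) ε))) =
        OrCell.mk (splitCell K L ρ ((κ, κ'), τ) h)
          (ε * splitSign K L ρ (l * miss P (leftPart n m ρ)) ((κ, κ'), τ) h) := by
    intro κ κ' τ h ε
    have h2 : (quotientHom _ (farCells K L ρ)).F.obj
        (OrCell.mk (K := (K.prod L).prod (simplex ρ)) ((κ, κ'), τ) ε) =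
        .cell ((κ, κ'), τ) (not_not.2 h) ε := dif_neg (not_not.2 h)
    rw [h2]
    rfl
  refine ⟨H, hH, fun c τ ε h0 => ?_, ?_⟩
  · have h2 : (quotientHom _ (farCells K L ρ)).F.obj
        (OrCell.mk (K := (K.prod L).prod (simplex ρ)) (c, τ) ε) =
        .empty (((K.prod L).prod (simplex ρ)).dim (c, τ)) := dif_pos h0
    rw [hobj, h2]
    refine (W.obj_empty _).trans (congrArg _ ?_)
    rw [miss_append]
    ring
  have hs : ∀ (κ : K.Cell) (κ' : L.Cell) (τ : (simplex ρ).Cell) (h : 0 ∈ τ.1),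
      1 * splitSign K L ρ (l * miss P (leftPart n m ρ)) ((κ, κ'), τ) h *
        psign ((k + miss P (leftPart n m ρ)) *
          (L.prod (simplex (rightPart n m ρ))).dim (κ', rightFace τ h)) =
      extSign P k l (leftPart n m ρ) (L.dim κ')
          ((simplex _).dim (leftFace τ h)) ((simplex _).dim (rightFace τ h)) := by
    intro κ κ' τ h
    have h3 : (L.prod (simplex (rightPart n m ρ))).dim (κ', rightFace τ h) =
      L.dim κ' + (simplex _).dim (rightFace τ h) := rfl
    dsimp only [splitSign, extSign]
    rw [one_mul, h3, ← psign_add]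
    congr 1
    push_cast
    ring
  have hbar : ∀ (κ : K.Cell) (κ' : L.Cell) (τ : (simplex ρ).Cell) (h : 0 ∈ τ.1),
      (H.bar ((κ, κ'), τ)).as = W.F.obj (OrCell.mk (splitCell K L ρ ((κ, κ'), τ) h)
          (1 * splitSign K L ρ (l * miss P (leftPart n m ρ)) ((κ, κ'), τ) h)) :=
    fun κ κ' τ h => (hobj _).trans (congrArg _ (hnear κ κ' τ h 1))
  have e : ∀ (κ : K.Cell) (κ' : L.Cell) (τ : (simplex ρ).Cell) (h : 0 ∈ τ.1),
      (H.bar ((κ, κ'), τ)).as = (sgn A (extSign P k l (leftPart n m ρ) (L.dim κ')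
        ((simplex _).dim (leftFace τ h)) ((simplex _).dim (rightFace τ h)))).obj
        ((M.bar (leftPart n m ρ) κ (leftFace τ h)).as ⊗
          (N.bar (rightPart n m ρ) κ' (rightFace τ h)).as) := by
    intro κ κ' τ h
    rw [← hs κ κ' τ h]
    exact (hbar κ κ' τ h).trans (eq_sgn_trans (W.obj_mk _ _)
      (eq_sgn_symm (hprod.obj_eq (κ, leftFace τ h) (κ', rightFace τ h))))
  refine ⟨e, fun κ ν κ' ν' τ υ h h' hκ hκ' hτ => ?_⟩
  let f : OrCell.mk (K := (K.prod L).prod (simplex ρ)) ((κ, κ'), τ) 1 ⟶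
      OrCell.mk (K := (K.prod L).prod (simplex ρ)) ((ν, ν'), υ) 1 :=
    homOfLE (OrCell.mk_le_mk (prod_carrier_subset (prod_carrier_subset hκ hκ')
      (simplex_carrier_subset.2 hτ)))
  have hle := leOfHom ((quotientHom _ (farCells K L ρ) |>.comp
    ((splitHom K L ρ (l * miss P (leftPart n m ρ))).comp (RelCell.inclHom _ _) rfl) rfl).F.map f)
  have hle' : OrCell.mk (splitCell K L ρ ((κ, κ'), τ) h)
        (1 * splitSign K L ρ (l * miss P (leftPart n m ρ)) ((κ, κ'), τ) h) ≤
      OrCell.mk (splitCell K L ρ ((ν, ν'), υ) h')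
        (1 * splitSign K L ρ (l * miss P (leftPart n m ρ)) ((ν, ν'), υ) h') := by
    rw [← hnear κ κ' τ h 1, ← hnear ν ν' υ h' 1]
    exact hle
  have h3 : HEq (H.F.map f) (W.F.map (homOfLE hle')) := by
    refine (Functor.hcongr_hom hF f).trans ?_
    exact W.map_heq_map (hnear κ κ' τ h 1) (hnear ν ν' υ h' 1) _ _
  have h4 := of_heq (hbar κ κ' τ h) (hbar ν ν' υ h') h3
  have h5 := W.of_map (homOfLE hle')
  have h6 := hprod.barMap_comp_can (σ := (κ, leftFace τ h)) (σ' := (ν, leftFace υ h'))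
    (τ := (κ', rightFace τ h)) (τ' := (ν', rightFace υ h'))
    (prod_carrier_subset hκ (simplex_carrier_subset.2 (subset_iff_parts.1 hτ).1))
    (prod_carrier_subset hκ' (simplex_carrier_subset.2 (subset_iff_parts.1 hτ).2))
  have h7 := comp_eq_comp_of_squares h5 h6 (can_comp_can (W.obj_mk _ _)
      (eq_sgn_symm (hprod.obj_eq (κ, leftFace τ h) (κ', rightFace τ h)))).symm
    (can_comp_can (W.obj_mk _ _)
      (eq_sgn_symm (hprod.obj_eq (ν, leftFace υ h') (ν', rightFace υ h')))).symm
  exact comp_eq_comp_of_squares h4 h7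
    ((can_congr _ ((hs κ κ' τ h).symm.trans (one_mul _).symm)).trans (can_comp_can
      (eq_sgn_one (hbar κ κ' τ h)) (eq_sgn_trans (W.obj_mk _ _)
        (eq_sgn_symm (hprod.obj_eq (κ, leftFace τ h) (κ', rightFace τ h))))).symm)
    ((can_congr _ ((hs ν ν' υ h').symm.trans (one_mul _).symm)).trans (can_comp_can
      (eq_sgn_one (hbar ν ν' υ h')) (eq_sgn_trans (W.obj_mk _ _)
        (eq_sgn_symm (hprod.obj_eq (ν, leftFace υ h') (ν', rightFace υ h'))))).symm)

end

section

section Coherence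

variable {C : Type u} [Category.{v} C] [MonoidalCategory C]

/-- The map on `X ⊗ Y` induced by a map on `Y`. -/
def rightGlue (X : C) {Y' Y q : C} (g : Y' ⟶ Y ⊗ q) : X ⊗ Y' ⟶ (X ⊗ Y) ⊗ q :=
  X ◁ g ≫ (α_ X Y q).inv

lemma rightGlue_natural {X X₂ Y' Y₂' Y Y₂ q : C} {g : Y' ⟶ Y ⊗ q} {g₂ : Y₂' ⟶ Y₂ ⊗ q} (x : X ⟶ X₂)
    {y : Y ⟶ Y₂} {y' : Y' ⟶ Y₂'} (h : y' ≫ g₂ = g ≫ y ▷ q) :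
    (x ⊗ₘ y') ≫ rightGlue X₂ g₂ = rightGlue X g ≫ (x ⊗ₘ y) ▷ q := by
  unfold rightGlue
  rw [← Category.assoc, tensorHom_comp_whiskerLeft, h, ← tensorHom_id, ← tensorHom_id,
    ← whiskerLeft_comp_tensorHom, Category.assoc, Category.assoc, associator_inv_naturality]

lemma rightGlue_comp (X : C) {Y' Y q q' : C} (g : Y' ⟶ Y ⊗ q) (w : q ⟶ q') :
    rightGlue X (g ≫ Y ◁ w) = rightGlue X g ≫ (X ⊗ Y) ◁ w := by
  simp [rightGlue]

lemma rightGlue_rightGlue (X : C) {Y'' Y' Y p q : C} (g : Y'' ⟶ Y' ⊗ q) (g' : Y' ⟶ Y ⊗ p) :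
    rightGlue X g ≫ rightGlue X g' ▷ q ≫ (α_ (X ⊗ Y) p q).hom =
      rightGlue X (g ≫ g' ▷ q ≫ (α_ Y p q).hom) := by
  unfold rightGlue
  monoidal

variable [BraidedCategory C]

/-- The map on `X ⊗ Y` induced by a map on `X`. -/
def leftGlue {X' X p : C} (g : X' ⟶ X ⊗ p) (Y : C) : X' ⊗ Y ⟶ (X ⊗ Y) ⊗ p :=
  g ▷ Y ≫ (α_ X p Y).hom ≫ X ◁ (β_ p Y).hom ≫ (α_ X Y p).inv

lemma leftGlue_natural {X' X₂' X X₂ Y Y₂ p : C} {g : X' ⟶ X ⊗ p} {g₂ : X₂' ⟶ X₂ ⊗ p}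
    {x : X ⟶ X₂} {x' : X' ⟶ X₂'} (h : x' ≫ g₂ = g ≫ x ▷ p) (y : Y ⟶ Y₂) :
    (x' ⊗ₘ y) ≫ leftGlue g₂ Y₂ = leftGlue g Y ≫ (x ⊗ₘ y) ▷ p := by
  unfold leftGlue
  have h1 : (x ▷ p ⊗ₘ y) ≫ (α_ X₂ p Y₂).hom = (α_ X p Y).hom ≫ (x ⊗ₘ (𝟙 p ⊗ₘ y)) := by
    rw [← tensorHom_id, associator_naturality]
  have h2 : (x ⊗ₘ (𝟙 p ⊗ₘ y)) ≫ X₂ ◁ (β_ p Y₂).hom =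
      X ◁ (β_ p Y).hom ≫ (x ⊗ₘ (y ⊗ₘ 𝟙 p)) := by
    rw [tensorHom_comp_whiskerLeft, BraidedCategory.braiding_naturality,
      ← whiskerLeft_comp_tensorHom]
  rw [← Category.assoc, tensorHom_comp_whiskerRight, h, ← whiskerRight_comp_tensorHom,
    Category.assoc, reassoc_of% h1, reassoc_of% h2, associator_inv_naturality, tensorHom_id]
  simp only [Category.assoc]

lemma leftGlue_comp {X' X p p' : C} (g : X' ⟶ X ⊗ p) (w : p ⟶ p') (Y : C) :
    leftGlue (g ≫ X ◁ w) Y = leftGlue g Y ≫ (X ⊗ Y) ◁ w := by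
  have h : X ◁ w ▷ Y ≫ X ◁ (β_ p' Y).hom = X ◁ (β_ p Y).hom ≫ X ◁ Y ◁ w := by
    rw [← MonoidalCategory.whiskerLeft_comp, BraidedCategory.braiding_naturality_left,
      MonoidalCategory.whiskerLeft_comp]
  unfold leftGlue
  simp [reassoc_of% h]

lemma leftGlue_leftGlue {X'' X' X p q : C} (g : X'' ⟶ X' ⊗ q) (g' : X' ⟶ X ⊗ p) (Y : C) :
    leftGlue g Y ≫ leftGlue g' Y ▷ q ≫ (α_ (X ⊗ Y) p q).hom =
      leftGlue (g ≫ g' ▷ q ≫ (α_ X p q).hom) Y := by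
  unfold leftGlue
  have ex := whisker_exchange g' (β_ q Y).hom
  calc _ = g ▷ Y ≫ (α_ _ _ _).hom ≫ (X' ◁ (β_ q Y).hom ≫ g' ▷ (Y ⊗ q)) ≫ (α_ _ _ _).hom ≫
        X ◁ (α_ _ _ _).inv ≫ X ◁ (β_ p Y).hom ▷ q ≫ X ◁ (α_ _ _ _).hom ≫ (α_ _ _ _).inv := by
          monoidal
    _ = _ := by
      rw [ex, BraidedCategory.braiding_tensor_left_hom]
      monoidal

lemma rightGlue_leftGlue {X' X Y' Y p q : C} (g : X' ⟶ X ⊗ p) (g' : Y' ⟶ Y ⊗ q) :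
    rightGlue X' g' ≫ leftGlue g Y ▷ q ≫ (α_ (X ⊗ Y) p q).hom ≫ (X ⊗ Y) ◁ (β_ p q).hom =
      leftGlue g Y' ≫ rightGlue X g' ▷ p ≫ (α_ (X ⊗ Y) q p).hom := by
  unfold leftGlue rightGlue
  have ex := whisker_exchange g g'
  have h : X ◁ (β_ p Y').hom ≫ X ◁ g' ▷ p = X ◁ p ◁ g' ≫ X ◁ (β_ p (Y ⊗ q)).hom := by
    rw [← MonoidalCategory.whiskerLeft_comp, ← BraidedCategory.braiding_naturality_right,
      MonoidalCategory.whiskerLeft_comp]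
  calc _ = (X' ◁ g' ≫ g ▷ (Y ⊗ q)) ≫ (α_ _ _ _).hom ≫ X ◁ (α_ _ _ _).inv ≫
        X ◁ (β_ p Y).hom ▷ q ≫ X ◁ (α_ _ _ _).hom ≫ X ◁ Y ◁ (β_ p q).hom ≫ (α_ _ _ _).inv := by
          monoidal
    _ = g ▷ Y' ≫ (α_ _ _ _).hom ≫ (X ◁ p ◁ g' ≫ X ◁ (β_ p (Y ⊗ q)).hom) ≫
        X ◁ (α_ _ _ _).hom ≫ (α_ _ _ _).inv := by
      rw [ex, BraidedCategory.braiding_tensor_right_hom]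
      monoidal
    _ = _ := by
      rw [← h]
      monoidal

end Coherence

lemma leftGlue_rightGlue {C : Type u} [Category.{v} C] [MonoidalCategory C] [SymmetricCategory C]
    {X' X Y' Y p q : C} (g : X' ⟶ X ⊗ q) (g' : Y' ⟶ Y ⊗ p) :
    leftGlue g Y' ≫ rightGlue X g' ▷ q ≫ (α_ (X ⊗ Y) p q).hom ≫ (X ⊗ Y) ◁ (β_ p q).hom =
      rightGlue X' g' ≫ leftGlue g Y ▷ p ≫ (α_ (X ⊗ Y) q p).hom := by
  have h := congrArg (· ≫ (X ⊗ Y) ◁ (β_ p q).hom) (rightGlue_leftGlue g g')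
  simp only [Category.assoc] at h
  rw [← MonoidalCategory.whiskerLeft_comp, SymmetricCategory.symmetry,
    MonoidalCategory.whiskerLeft_id, Category.comp_id] at h
  exact h.symm

end

section

section Coherence

variable {C : Type u} [Category.{v} C] [MonoidalCategory C]

lemma square_right_right (X : C) {Y'' Y' Y₁ Y p q : C} [BraidedCategory C] {g : Y'' ⟶ Y' ⊗ q}
    {g' : Y' ⟶ Y ⊗ p} {g₂ : Y'' ⟶ Y₁ ⊗ p} {g₂' : Y₁ ⟶ Y ⊗ q}
    (h : g ≫ g' ▷ q ≫ (α_ Y p q).hom ≫ Y ◁ (β_ p q).hom = g₂ ≫ g₂' ▷ p ≫ (α_ Y q p).hom) :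
    (𝟙 X ▷ Y'' ≫ rightGlue X g) ≫ (𝟙 X ▷ Y' ≫ rightGlue X g') ▷ q ≫ (α_ (X ⊗ Y) p q).hom ≫
        (X ⊗ Y) ◁ (β_ p q).hom =
      (𝟙 X ▷ Y'' ≫ rightGlue X g₂) ≫ (𝟙 X ▷ Y₁ ≫ rightGlue X g₂') ▷ p ≫
        (α_ (X ⊗ Y) q p).hom := by
  simp only [id_whiskerRight, Category.id_comp]
  rw [rightGlue_rightGlue, ← h]
  simp only [← Category.assoc]
  rw [rightGlue_comp]
  simp only [Category.assoc]
  rw [← rightGlue_rightGlue]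
  simp only [Category.assoc]

lemma square_left_left [BraidedCategory C] {X'' X' X₁ X p q : C} {g : X'' ⟶ X' ⊗ q}
    {g' : X' ⟶ X ⊗ p} {g₂ : X'' ⟶ X₁ ⊗ p} {g₂' : X₁ ⟶ X ⊗ q}
    (h : g ≫ g' ▷ q ≫ (α_ X p q).hom ≫ X ◁ (β_ p q).hom = g₂ ≫ g₂' ▷ p ≫ (α_ X q p).hom) (Y : C) :
    (X'' ◁ 𝟙 Y ≫ leftGlue g Y) ≫ (X' ◁ 𝟙 Y ≫ leftGlue g' Y) ▷ q ≫ (α_ (X ⊗ Y) p q).hom ≫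
        (X ⊗ Y) ◁ (β_ p q).hom =
      (X'' ◁ 𝟙 Y ≫ leftGlue g₂ Y) ≫ (X₁ ◁ 𝟙 Y ≫ leftGlue g₂' Y) ▷ p ≫
        (α_ (X ⊗ Y) q p).hom := by
  simp only [MonoidalCategory.whiskerLeft_id, Category.id_comp]
  rw [leftGlue_leftGlue, ← h]
  simp only [← Category.assoc]
  rw [leftGlue_comp]
  simp only [Category.assoc]
  rw [← leftGlue_leftGlue]
  simp only [Category.assoc]

lemma square_left_right [SymmetricCategory C] {X' X Y' Y p q : C} (g : X' ⟶ X ⊗ p)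
    (g' : Y' ⟶ Y ⊗ q) :
    (𝟙 X' ▷ Y' ≫ rightGlue X' g') ≫ (X' ◁ 𝟙 Y ≫ leftGlue g Y) ▷ q ≫ (α_ (X ⊗ Y) p q).hom ≫
        (X ⊗ Y) ◁ (β_ p q).hom =
      (X' ◁ 𝟙 Y' ≫ leftGlue g Y') ≫ (𝟙 X ▷ Y' ≫ rightGlue X g') ▷ p ≫
        (α_ (X ⊗ Y) q p).hom := by
  simp only [MonoidalCategory.whiskerLeft_id, id_whiskerRight, Category.id_comp]
  exact rightGlue_leftGlue g g'

lemma square_right_left [SymmetricCategory C] {X' X Y' Y p q : C} (g : X' ⟶ X ⊗ q)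
    (g' : Y' ⟶ Y ⊗ p) :
    (X' ◁ 𝟙 Y' ≫ leftGlue g Y') ≫ (𝟙 X ▷ Y' ≫ rightGlue X g') ▷ q ≫ (α_ (X ⊗ Y) p q).hom ≫
        (X ⊗ Y) ◁ (β_ p q).hom =
      (𝟙 X' ▷ Y' ≫ rightGlue X' g') ≫ (X' ◁ 𝟙 Y ≫ leftGlue g Y) ▷ p ≫
        (α_ (X ⊗ Y) q p).hom := by
  simp only [MonoidalCategory.whiskerLeft_id, id_whiskerRight, Category.id_comp]
  exact leftGlue_rightGlue g g'

lemma whiskered_leftGlue_natural [BraidedCategory C] {X' X₂' X X₂ Y Y₂ p : C} {g : X' ⟶ X ⊗ p}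
    {g₂ : X₂' ⟶ X₂ ⊗ p} {x : X ⟶ X₂} {x' : X' ⟶ X₂'} (h : x' ≫ g₂ = g ≫ x ▷ p) (y : Y ⟶ Y₂) :
    (x' ⊗ₘ y) ≫ X₂' ◁ 𝟙 Y₂ ≫ leftGlue g₂ Y₂ =
      (X' ◁ 𝟙 Y ≫ leftGlue g Y) ≫ (x ⊗ₘ y) ▷ p := by
  rw [MonoidalCategory.whiskerLeft_id, MonoidalCategory.whiskerLeft_id, Category.id_comp,
    Category.id_comp]
  exact leftGlue_natural h y

lemma whiskered_rightGlue_natural {X X₂ Y' Y₂' Y Y₂ q : C} {g : Y' ⟶ Y ⊗ q} {g₂ : Y₂' ⟶ Y₂ ⊗ q}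
    (x : X ⟶ X₂) {y : Y ⟶ Y₂} {y' : Y' ⟶ Y₂'} (h : y' ≫ g₂ = g ≫ y ▷ q) :
    (x ⊗ₘ y') ≫ 𝟙 X₂ ▷ Y₂' ≫ rightGlue X₂ g₂ =
      (𝟙 X ▷ Y' ≫ rightGlue X g) ≫ (x ⊗ₘ y) ▷ q := by
  rw [id_whiskerRight, id_whiskerRight, Category.id_comp, Category.id_comp]
  exact rightGlue_natural x h

end Coherence

open Unor

variable {A : Type u} [Category.{v} A] [BalancedCategory A] [EmptyInitial A] [MonoidalCategory A]
  [GradedSymmetricCategory A] {n m : ℕ}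

namespace AdSing

section

variable {T : AdTheory A} {P : Fin n → StarAd T} {Q : Fin m → StarAd T}
  {K L : OrientedBallComplex} {k l : ℤ} (M : AdSing T P K k) (N : AdSing T Q L l)

lemma bar_eq_of_eq {σ σ' : Finset (Fin (n + 1))} (e : σ' = σ) (κ : K.Cell)
    {U : Finset (Fin (n + 1))} (hn : U.Nonempty) (h' : U ⊆ σ') (h : U ⊆ σ) :
    (M.bar σ' κ ⟨U, hn, h'⟩).as = (M.bar σ κ ⟨U, hn, h⟩).as := by
  subst e
  rfl

/-- The identification of the values on a cell of two equal faces. -/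
def barCast {σ σ' : Finset (Fin (n + 1))} (e : σ' = σ) (κ : K.Cell)
    {U : Finset (Fin (n + 1))} (hn : U.Nonempty) (h' : U ⊆ σ') (h : U ⊆ σ) :
    M.bar σ' κ ⟨U, hn, h'⟩ ⟶ M.bar σ κ ⟨U, hn, h⟩ :=
  can 1 (eq_sgn_one (M.bar_eq_of_eq e κ hn h' h))

/-- The isomorphism `f_{σ,i}` of a product for an index `i` of the first factor. -/
def prodGlueLeft {a : Fin n} {S S' : Finset (Fin (n + 1))} (h : IsFace a S S')
    {R R' : Finset (Fin (m + 1))} (e : R' = R) (κ : K.Cell) (κ' : L.Cell) (τ : (simplex S).Cell)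
    {U : Finset (Fin (m + 1))} (hn : U.Nonempty) (hU' : U ⊆ R') (hU : U ⊆ R) :
    M.bar S' κ (h.face τ) ⊗ N.bar R' κ' ⟨U, hn, hU'⟩ ⟶
      (M.bar S κ τ ⊗ N.bar R κ' ⟨U, hn, hU⟩) ⊗ (P a).bar :=
  M.bar S' κ (h.face τ) ◁ N.barCast e κ' hn hU' hU ≫ leftGlue (M.barGlue h κ τ).hom _

/-- The isomorphism `f_{σ,i}` of a product for an index `i` of the second factor. -/
def prodGlueRight {S S' : Finset (Fin (n + 1))} (e : S' = S) {b : Fin m}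
    {R R' : Finset (Fin (m + 1))} (h : IsFace b R R') (κ : K.Cell) (κ' : L.Cell)
    {U : Finset (Fin (n + 1))} (hn : U.Nonempty) (hU' : U ⊆ S') (hU : U ⊆ S)
    (τ : (simplex R).Cell) :
    M.bar S' κ ⟨U, hn, hU'⟩ ⊗ N.bar R' κ' (h.face τ) ⟶
      (M.bar S κ ⟨U, hn, hU⟩ ⊗ N.bar R κ' τ) ⊗ (Q b).bar :=
  M.barCast e κ hn hU' hU ▷ N.bar R' κ' (h.face τ) ≫ rightGlue _ (N.barGlue h κ' τ).hom

lemma prodGlueLeft_natural {a : Fin n} {S S' : Finset (Fin (n + 1))} (h : IsFace a S S')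
    {R R' : Finset (Fin (m + 1))} (e : R' = R) {κ ν : K.Cell} {κ' ν' : L.Cell}
    {τ υ : (simplex S).Cell} {U V : Finset (Fin (m + 1))} (hn : U.Nonempty) (hU' : U ⊆ R')
    (hU : U ⊆ R) (hn₂ : V.Nonempty) (hV' : V ⊆ R') (hV : V ⊆ R)
    (hκ : K.carrier κ ⊆ K.carrier ν) (hκ' : L.carrier κ' ⊆ L.carrier ν') (hτ : τ.1 ⊆ υ.1)
    (hUV : U ⊆ V) :
    (M.barMap (τ := h.face τ) (τ' := h.face υ) hκ hτ ⊗ₘ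
      N.barMap (σ := R') (τ := ⟨U, hn, hU'⟩) (τ' := ⟨V, hn₂, hV'⟩) hκ' hUV) ≫
        prodGlueLeft M N h e ν ν' υ hn₂ hV' hV =
      prodGlueLeft M N h e κ κ' τ hn hU' hU ≫
        (M.barMap hκ hτ ⊗ₘ
          N.barMap (σ := R) (τ := ⟨U, hn, hU⟩) (τ' := ⟨V, hn₂, hV⟩) hκ' hUV) ▷ (P a).bar := by
  subst e
  exact whiskered_leftGlue_natural (M.barMap_comp_barGlue h hκ hτ)
    (N.barMap (σ := R') (τ := ⟨U, hn, hU'⟩) (τ' := ⟨V, hn₂, hV'⟩) hκ' hUV)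

lemma prodGlueRight_natural {S S' : Finset (Fin (n + 1))} (e : S' = S) {b : Fin m}
    {R R' : Finset (Fin (m + 1))} (h : IsFace b R R') {κ ν : K.Cell} {κ' ν' : L.Cell}
    {U V : Finset (Fin (n + 1))} (hn : U.Nonempty) (hU' : U ⊆ S') (hU : U ⊆ S)
    (hn₂ : V.Nonempty) (hV' : V ⊆ S') (hV : V ⊆ S) {τ υ : (simplex R).Cell}
    (hκ : K.carrier κ ⊆ K.carrier ν) (hκ' : L.carrier κ' ⊆ L.carrier ν') (hUV : U ⊆ V)
    (hτ : τ.1 ⊆ υ.1) :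
    (M.barMap (σ := S') (τ := ⟨U, hn, hU'⟩) (τ' := ⟨V, hn₂, hV'⟩) hκ hUV ⊗ₘ
      N.barMap (τ := h.face τ) (τ' := h.face υ) hκ' hτ) ≫
        prodGlueRight M N e h ν ν' hn₂ hV' hV υ =
      prodGlueRight M N e h κ κ' hn hU' hU τ ≫
        (M.barMap (σ := S) (τ := ⟨U, hn, hU⟩) (τ' := ⟨V, hn₂, hV⟩) hκ hUV ⊗ₘ
          N.barMap hκ' hτ) ▷ (Q b).bar := by
  subst e
  exact whiskered_rightGlue_natural
    (M.barMap (σ := S') (τ := ⟨U, hn, hU'⟩) (τ' := ⟨V, hn₂, hV'⟩) hκ hUV)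
    (N.barMap_comp_barGlue h hκ' hτ)

lemma isSigned_barCast {σ σ' : Finset (Fin (n + 1))} (e : σ' = σ) (κ : K.Cell)
    {U : Finset (Fin (n + 1))} (hn : U.Nonempty) (h' : U ⊆ σ') (h : U ⊆ σ) :
    IsSigned 1 (M.barCast e κ hn h' h) :=
  isSigned_can _

lemma isSigned_barGlue {a : Fin n} {S S' : Finset (Fin (n + 1))} (h : IsFace a S S') (κ : K.Cell)
    (τ : (simplex S).Cell) : IsSigned (orSign P S a) (M.barGlue h κ τ).hom :=
  (((isSigned_can (eq_sgn_symm (M.val_eq κ 1 S' (h.face τ) 1))).comp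
    ((isSigned_of (M.valGlue κ 1 h τ 1)).comp (isSigned_can
      (eq_sgn_tensor (M.val_eq κ 1 S τ 1) ((P a).obj_eq (orSign P S a)))))).congr (by simp))

lemma isSigned_prodGlueLeft {a : Fin n} {S S' : Finset (Fin (n + 1))} (h : IsFace a S S')
    {R R' : Finset (Fin (m + 1))} (e : R' = R) (κ : K.Cell) (κ' : L.Cell) (τ : (simplex S).Cell)
    {U : Finset (Fin (m + 1))} (hn : U.Nonempty) (hU' : U ⊆ R') (hU : U ⊆ R) :
    IsSigned (orSign P S a *
        psign ((P a).dim * (L.dim κ' + (simplex R).dim ⟨U, hn, hU⟩ - (l + miss Q R))))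
      (prodGlueLeft M N h e κ κ' τ hn hU' hU) := by
  refine ((((N.isSigned_barCast e κ' hn hU' hU).whiskerLeft _).comp
    (((M.isSigned_barGlue h κ τ).whiskerRight _).comp ((isSigned_associator _ _ _).comp
      (((isSigned_braiding _ _).whiskerLeft _).comp (isSigned_associator_inv _ _ _)))))).congr ?_
  rw [one_mul, one_mul, mul_one]
  exact congrArg (fun x => orSign P S a * psign x)
    (congrArg₂ (· * ·) ((P a).gdim_obj 1) (N.gdim_bar R κ' ⟨U, hn, hU⟩))

lemma isSigned_prodGlueRight {S S' : Finset (Fin (n + 1))} (e : S' = S) {b : Fin m}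
    {R R' : Finset (Fin (m + 1))} (h : IsFace b R R') (κ : K.Cell) (κ' : L.Cell)
    {U : Finset (Fin (n + 1))} (hn : U.Nonempty) (hU' : U ⊆ S') (hU : U ⊆ S)
    (τ : (simplex R).Cell) :
    IsSigned (orSign Q R b) (prodGlueRight M N e h κ κ' hn hU' hU τ) :=
  (((M.isSigned_barCast e κ hn hU' hU).whiskerRight _).comp
    (((N.isSigned_barGlue h κ' τ).whiskerLeft _).comp (isSigned_associator_inv _ _ _))).congr
      (by rw [one_mul, mul_one])

lemma prodGlue_square_left_left {a b : Fin n} {S Sa Sb S' : Finset (Fin (n + 1))}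
    (ha : IsFace a S Sa) (hb : IsFace b S Sb) (hab : IsFace b Sa S') (hba : IsFace a Sb S')
    {R Ra Rb R' : Finset (Fin (m + 1))} (ea : Ra = R) (eb : Rb = R) (eab : R' = Ra)
    (eba : R' = Rb) (κ : K.Cell) (κ' : L.Cell) (τ : (simplex S).Cell)
    {U : Finset (Fin (m + 1))} (hn : U.Nonempty) (hU' : U ⊆ R') (hUa : U ⊆ Ra) (hUb : U ⊆ Rb)
    (hU : U ⊆ R) :
    prodGlueLeft M N hab eab κ κ' (ha.face τ) hn hU' hUa ≫
      prodGlueLeft M N ha ea κ κ' τ hn hUa hU ▷ (P b).bar ≫ (α_ _ _ _).hom ≫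
        _ ◁ (β_ (P a).bar (P b).bar).hom =
    prodGlueLeft M N hba eba κ κ' (hb.face τ) hn hU' hUb ≫
      prodGlueLeft M N hb eb κ κ' τ hn hUb hU ▷ (P a).bar ≫ (α_ _ _ _).hom := by
  subst ea
  subst eb
  subst eab
  exact square_left_left (M.barGlue_square ha hb hab hba κ τ) _

lemma prodGlue_square_right_right {S Sa Sb S' : Finset (Fin (n + 1))} (ea : Sa = S) (eb : Sb = S)
    (eab : S' = Sa) (eba : S' = Sb) {a b : Fin m} {R Ra Rb R' : Finset (Fin (m + 1))}
    (ha : IsFace a R Ra) (hb : IsFace b R Rb) (hab : IsFace b Ra R') (hba : IsFace a Rb R')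
    (κ : K.Cell) (κ' : L.Cell) {U : Finset (Fin (n + 1))} (hn : U.Nonempty) (hU' : U ⊆ S')
    (hUa : U ⊆ Sa) (hUb : U ⊆ Sb) (hU : U ⊆ S) (τ : (simplex R).Cell) :
    prodGlueRight M N eab hab κ κ' hn hU' hUa (ha.face τ) ≫
      prodGlueRight M N ea ha κ κ' hn hUa hU τ ▷ (Q b).bar ≫ (α_ _ _ _).hom ≫
        _ ◁ (β_ (Q a).bar (Q b).bar).hom =
    prodGlueRight M N eba hba κ κ' hn hU' hUb (hb.face τ) ≫
      prodGlueRight M N eb hb κ κ' hn hUb hU τ ▷ (Q a).bar ≫ (α_ _ _ _).hom := by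
  subst ea
  subst eb
  subst eab
  exact square_right_right _ (N.barGlue_square ha hb hab hba κ' τ)

lemma prodGlue_square_left_right {a : Fin n} {S Sa Sb S' : Finset (Fin (n + 1))}
    (ha : IsFace a S Sa) (eb : Sb = S) (eab : S' = Sa) (hba : IsFace a Sb S')
    {b : Fin m} {R Ra Rb R' : Finset (Fin (m + 1))} (ea : Ra = R) (hb : IsFace b R Rb)
    (hab : IsFace b Ra R') (eba : R' = Rb) (κ : K.Cell) (κ' : L.Cell)
    {U : Finset (Fin (n + 1))} (hn : U.Nonempty) (hU : U ⊆ S) (hUa : U ⊆ Sa) (hUb : U ⊆ Sb)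
    (hU' : U ⊆ S') {V : Finset (Fin (m + 1))} (hn₂ : V.Nonempty) (hV : V ⊆ R) (hVa : V ⊆ Ra)
    (hVb : V ⊆ Rb) (hV' : V ⊆ R') :
    prodGlueRight M N eab hab κ κ' hn hU' hUa ⟨V, hn₂, hVa⟩ ≫
      prodGlueLeft M N ha ea κ κ' ⟨U, hn, hU⟩ hn₂ hVa hV ▷ (Q b).bar ≫ (α_ _ _ _).hom ≫
        _ ◁ (β_ (P a).bar (Q b).bar).hom =
    prodGlueLeft M N hba eba κ κ' ⟨U, hn, hUb⟩ hn₂ hV' hVb ≫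
      prodGlueRight M N eb hb κ κ' hn hUb hU ⟨V, hn₂, hV⟩ ▷ (P a).bar ≫ (α_ _ _ _).hom := by
  subst ea
  subst eb
  subst eab
  subst eba
  exact square_left_right (M.barGlue ha κ ⟨U, hn, hU⟩).hom (N.barGlue hb κ' ⟨V, hn₂, hV⟩).hom

lemma prodGlue_square_right_left {b : Fin n} {S Sa Sb S' : Finset (Fin (n + 1))}
    (hb : IsFace b S Sb) (ea : Sa = S) (eba : S' = Sb) (hab : IsFace b Sa S')
    {a : Fin m} {R Ra Rb R' : Finset (Fin (m + 1))} (eb : Rb = R) (ha : IsFace a R Ra)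
    (hba : IsFace a Rb R') (eab : R' = Ra) (κ : K.Cell) (κ' : L.Cell)
    {U : Finset (Fin (n + 1))} (hn : U.Nonempty) (hU : U ⊆ S) (hUa : U ⊆ Sa) (hUb : U ⊆ Sb)
    (hU' : U ⊆ S') {V : Finset (Fin (m + 1))} (hn₂ : V.Nonempty) (hV : V ⊆ R) (hVa : V ⊆ Ra)
    (hVb : V ⊆ Rb) (hV' : V ⊆ R') :
    prodGlueLeft M N hab eab κ κ' ⟨U, hn, hUa⟩ hn₂ hV' hVa ≫
      prodGlueRight M N ea ha κ κ' hn hUa hU ⟨V, hn₂, hV⟩ ▷ (P b).bar ≫ (α_ _ _ _).hom ≫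
        _ ◁ (β_ (Q a).bar (P b).bar).hom =
    prodGlueRight M N eba hba κ κ' hn hU' hUb ⟨V, hn₂, hVb⟩ ≫
      prodGlueLeft M N hb eb κ κ' ⟨U, hn, hU⟩ hn₂ hVb hV ▷ (Q a).bar ≫ (α_ _ _ _).hom := by
  subst ea
  subst eb
  subst eab
  subst eba
  exact square_right_left (M.barGlue hb κ ⟨U, hn, hU⟩).hom (N.barGlue ha κ' ⟨V, hn₂, hV⟩).hom

end

end AdSing

end

section

open Unor

lemma IsFace.rightPart_eq {n m : ℕ} {a : Fin n} {ρ ρ' : Finset (Fin (n + m + 1))}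
    (h : IsFace (Fin.castAdd m a) ρ ρ') : rightPart n m ρ' = rightPart n m ρ := by
  rw [h.eq]
  ext j
  rw [mem_rightPart, mem_rightPart, Finset.mem_insert, or_iff_right]
  intro h'
  have h1 : leftVertex n m a.succ = rightVertex n m j := h'.symm
  exact Fin.succ_ne_zero a (leftVertex_eq_rightVertex h1).1

lemma IsFace.leftPart_eq {n m : ℕ} {b : Fin m} {ρ ρ' : Finset (Fin (n + m + 1))}
    (h : IsFace (Fin.natAdd n b) ρ ρ') : leftPart n m ρ' = leftPart n m ρ := by
  rw [h.eq]
  ext j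
  rw [mem_leftPart, mem_leftPart, Finset.mem_insert, or_iff_right]
  intro h'
  have h1 : leftVertex n m j = rightVertex n m b.succ := h'
  exact Fin.succ_ne_zero b (leftVertex_eq_rightVertex h1).2

variable {A : Type u} [Category.{v} A] [BalancedCategory A] [EmptyInitial A] [MonoidalCategory A]
  [GradedSymmetricCategory A] {n m : ℕ}

section Append

variable {T : AdTheory A} (P : Fin n → StarAd T) (Q : Fin m → StarAd T)

/-- The identification of the ads of the first sequence with ads of the joined sequence. -/
def appendLeft (a : Fin n) : (Fin.append P Q (Fin.castAdd m a)).bar ≅ (P a).bar :=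
  canIso 1 (eq_sgn_one (congrArg (fun p => p.obj 1) (Fin.append_left P Q a)))

/-- The identification of the ads of the second sequence with ads of the joined sequence. -/
def appendRight (b : Fin m) : (Fin.append P Q (Fin.natAdd n b)).bar ≅ (Q b).bar :=
  canIso 1 (eq_sgn_one (congrArg (fun p => p.obj 1) (Fin.append_right P Q b)))

/-- The sign of the isomorphism `f_{ρ,i}` of a product. -/
lemma extSign_mul_extSign_of_isFace {a : Fin n} {ρ ρ' : Finset (Fin (n + m + 1))}
    (h : IsFace (Fin.castAdd m a) ρ ρ') (k l : ℤ) (d t₀ t₁ : ℕ) :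
    extSign P k l (leftPart n m ρ') d t₀ t₁ * (orSign P (leftPart n m ρ) a *
        psign ((P a).dim * (d + t₁ - (l + miss Q (rightPart n m ρ)))) *
          extSign P k l (leftPart n m ρ) d t₀ t₁) =
      orSign (Fin.append P Q) ρ (Fin.castAdd m a) := by
  have h1 := h.left.miss_eq (P := P)
  rw [orSign_append_left]
  unfold extSign
  rw [h1, mul_right_comm, mul_left_comm, mul_assoc, mul_comm (psign _) (psign _)]
  refine congrArg _ ?_
  rw [← psign_add, ← psign_add]
  refine (Int.negOnePow_eq_iff _ _).2 ?_
  refine ⟨(k + miss P (leftPart n m ρ')) * (d + t₁) + d * t₀ + l * miss P (leftPart n m ρ') +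
    (P a).dim * (d + t₁) - (P a).dim * miss Q (rightPart n m ρ), ?_⟩
  ring

end Append

namespace AdSing

variable {T : MultiplicativeAdTheory A} {P : Fin n → StarAd T.toAdTheory}
  {Q : Fin m → StarAd T.toAdTheory} {K L : OrientedBallComplex} {k l : ℤ}
  (M : AdSing T.toAdTheory P K k) (N : AdSing T.toAdTheory Q L l)

/-- The pread on `(K × L) × ρ` which underlies the external product. -/
def prodPread (ρ : Finset (Fin (n + m + 1))) :
    Pre A ((K.prod L).prod (simplex ρ)) (k + l + miss (Fin.append P Q) ρ) :=
  (exists_prodPread M N ρ).choose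

lemma prodPread_eq (ρ : Finset (Fin (n + m + 1))) (κ : K.Cell) (κ' : L.Cell)
    (τ : (simplex ρ).Cell) (h : 0 ∈ τ.1) :
    ((prodPread M N ρ).bar ((κ, κ'), τ)).as = (sgn A (extSign P k l (leftPart n m ρ) (L.dim κ')
      ((simplex _).dim (leftFace τ h)) ((simplex _).dim (rightFace τ h)))).obj
      ((M.bar (leftPart n m ρ) κ (leftFace τ h)).as ⊗
        (N.bar (rightPart n m ρ) κ' (rightFace τ h)).as) :=
  (exists_prodPread M N ρ).choose_spec.2.2.choose κ κ' τ h

/-- The value of the product is the product of the values, without orientations. -/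
def prodPreadIso (ρ : Finset (Fin (n + m + 1))) (κ : K.Cell) (κ' : L.Cell)
    (τ : (simplex ρ).Cell) (h : 0 ∈ τ.1) : (prodPread M N ρ).bar ((κ, κ'), τ) ≅
      M.bar (leftPart n m ρ) κ (leftFace τ h) ⊗ N.bar (rightPart n m ρ) κ' (rightFace τ h) :=
  canIso _ (prodPread_eq M N ρ κ κ' τ h)

lemma prodPread_barMap (ρ : Finset (Fin (n + m + 1))) (κ ν : K.Cell) (κ' ν' : L.Cell)
    (τ υ : (simplex ρ).Cell) (h : 0 ∈ τ.1) (h' : 0 ∈ υ.1) (hκ : K.carrier κ ⊆ K.carrier ν)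
    (hκ' : L.carrier κ' ⊆ L.carrier ν') (hτ : τ.1 ⊆ υ.1) :
    (prodPread M N ρ).barMap (prod_carrier_subset (prod_carrier_subset hκ hκ')
      (simplex_carrier_subset.2 hτ)) ≫ (prodPreadIso M N ρ ν ν' υ h').hom =
    (prodPreadIso M N ρ κ κ' τ h).hom ≫
      (M.barMap (τ := leftFace τ h) (τ' := leftFace υ h') hκ (subset_iff_parts.1 hτ).1 ⊗ₘ
      N.barMap (τ := rightFace τ h) (τ' := rightFace υ h') hκ' (subset_iff_parts.1 hτ).2) :=
  (exists_prodPread M N ρ).choose_spec.2.2.choose_spec κ ν κ' ν' τ υ h h' hκ hκ' hτ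

/-- The isomorphisms `f_{ρ,i}` of the product, without orientations. -/
def prodGlue : ∀ (c : Fin (n + m)) {ρ ρ' : Finset (Fin (n + m + 1))} (h : IsFace c ρ ρ')
    (κ : K.Cell) (κ' : L.Cell) (τ : (simplex ρ).Cell), 0 ∈ τ.1 →
      ((prodPread M N ρ').bar ((κ, κ'), h.face τ) ⟶
        (prodPread M N ρ).bar ((κ, κ'), τ) ⊗ (Fin.append P Q c).bar) :=
  Fin.addCases
    (fun a ρ ρ' h κ κ' τ h0 => (prodPreadIso M N ρ' κ κ' (h.face τ) h0).hom ≫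
      prodGlueLeft M N h.left h.rightPart_eq κ κ' (leftFace τ h0) (rightFace τ h0).2.1
        (rightFace (h.face τ) h0).2.2 (rightFace τ h0).2.2 ≫
      ((prodPreadIso M N ρ κ κ' τ h0).inv ⊗ₘ (appendLeft P Q a).inv))
    (fun b ρ ρ' h κ κ' τ h0 => (prodPreadIso M N ρ' κ κ' (h.face τ) h0).hom ≫
      prodGlueRight M N h.leftPart_eq h.right κ κ' (leftFace τ h0).2.1
        (leftFace (h.face τ) h0).2.2 (leftFace τ h0).2.2 (rightFace τ h0) ≫
      ((prodPreadIso M N ρ κ κ' τ h0).inv ⊗ₘ (appendRight P Q b).inv))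

lemma prodGlue_castAdd {a : Fin n} {ρ ρ' : Finset (Fin (n + m + 1))}
    (h : IsFace (Fin.castAdd m a) ρ ρ') (κ : K.Cell) (κ' : L.Cell) (τ : (simplex ρ).Cell)
    (h0 : 0 ∈ τ.1) : prodGlue M N (Fin.castAdd m a) h κ κ' τ h0 =
      (prodPreadIso M N ρ' κ κ' (h.face τ) h0).hom ≫
      prodGlueLeft M N h.left h.rightPart_eq κ κ' (leftFace τ h0) (rightFace τ h0).2.1
        (rightFace (h.face τ) h0).2.2 (rightFace τ h0).2.2 ≫
      ((prodPreadIso M N ρ κ κ' τ h0).inv ⊗ₘ (appendLeft P Q a).inv) := by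
  unfold prodGlue
  rw [Fin.addCases_left]

lemma prodGlue_natAdd {b : Fin m} {ρ ρ' : Finset (Fin (n + m + 1))}
    (h : IsFace (Fin.natAdd n b) ρ ρ') (κ : K.Cell) (κ' : L.Cell) (τ : (simplex ρ).Cell)
    (h0 : 0 ∈ τ.1) : prodGlue M N (Fin.natAdd n b) h κ κ' τ h0 =
      (prodPreadIso M N ρ' κ κ' (h.face τ) h0).hom ≫
      prodGlueRight M N h.leftPart_eq h.right κ κ' (leftFace τ h0).2.1
        (leftFace (h.face τ) h0).2.2 (leftFace τ h0).2.2 (rightFace τ h0) ≫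
      ((prodPreadIso M N ρ κ κ' τ h0).inv ⊗ₘ (appendRight P Q b).inv) := by
  unfold prodGlue
  rw [Fin.addCases_right]

lemma square_of_inv {C : Type u} [Category.{v} C] [MonoidalCategory C] {X F p X₀ F₀ p₀ : C}
    {g : X ⟶ F ⊗ p} {G : X₀ ⟶ F₀ ⊗ p₀} {a : X ⟶ X₀} {b : F ≅ F₀} {d : p ≅ p₀}
    (h : g = a ≫ G ≫ (b.inv ⊗ₘ d.inv)) : g ≫ (b.hom ⊗ₘ d.hom) = a ≫ G := by
  rw [h, Category.assoc, Category.assoc, tensorHom_comp_tensorHom, Iso.inv_hom_id,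
    Iso.inv_hom_id, id_tensorHom_id, Category.comp_id]

lemma prodGlue_castAdd_comp {a : Fin n} {ρ ρ' : Finset (Fin (n + m + 1))}
    (h : IsFace (Fin.castAdd m a) ρ ρ') (κ : K.Cell) (κ' : L.Cell) (τ : (simplex ρ).Cell)
    (h0 : 0 ∈ τ.1) : prodGlue M N (Fin.castAdd m a) h κ κ' τ h0 ≫
        ((prodPreadIso M N ρ κ κ' τ h0).hom ⊗ₘ (appendLeft P Q a).hom) =
      (prodPreadIso M N ρ' κ κ' (h.face τ) h0).hom ≫
      prodGlueLeft M N h.left h.rightPart_eq κ κ' (leftFace τ h0) (rightFace τ h0).2.1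
        (rightFace (h.face τ) h0).2.2 (rightFace τ h0).2.2 :=
  square_of_inv (prodGlue_castAdd M N h κ κ' τ h0)

lemma prodGlue_natAdd_comp {b : Fin m} {ρ ρ' : Finset (Fin (n + m + 1))}
    (h : IsFace (Fin.natAdd n b) ρ ρ') (κ : K.Cell) (κ' : L.Cell) (τ : (simplex ρ).Cell)
    (h0 : 0 ∈ τ.1) : prodGlue M N (Fin.natAdd n b) h κ κ' τ h0 ≫
        ((prodPreadIso M N ρ κ κ' τ h0).hom ⊗ₘ (appendRight P Q b).hom) =
      (prodPreadIso M N ρ' κ κ' (h.face τ) h0).hom ≫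
      prodGlueRight M N h.leftPart_eq h.right κ κ' (leftFace τ h0).2.1
        (leftFace (h.face τ) h0).2.2 (leftFace τ h0).2.2 (rightFace τ h0) :=
  square_of_inv (prodGlue_natAdd M N h κ κ' τ h0)

lemma isSigned_canIso_inv_tensor {X X' Y Y' : A} {s t : ℤˣ} (h : X' = (sgn A s).obj X)
    (h' : Y' = (sgn A t).obj Y) : IsSigned (s * t) ((canIso s h).inv ⊗ₘ (canIso t h').inv) :=
  (can_tensorHom_can (eq_sgn_symm h) (eq_sgn_symm h')) ▸ isSigned_can _

lemma isSigned_prodGlue (c : Fin (n + m)) {ρ ρ' : Finset (Fin (n + m + 1))} (h : IsFace c ρ ρ')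
    (κ : K.Cell) (κ' : L.Cell) (τ : (simplex ρ).Cell) (h0 : 0 ∈ τ.1) :
    IsSigned (orSign (Fin.append P Q) ρ c) (prodGlue M N c h κ κ' τ h0) := by
  induction c using Fin.addCases with
  | left a =>
    rw [prodGlue_castAdd]
    refine ((isSigned_can (prodPread_eq M N ρ' κ κ' (h.face τ) h0)).comp
      ((isSigned_prodGlueLeft M N h.left h.rightPart_eq κ κ' (leftFace τ h0) (rightFace τ h0).2.1
        (rightFace (h.face τ) h0).2.2 (rightFace τ h0).2.2).comp
        (isSigned_canIso_inv_tensor (prodPread_eq M N ρ κ κ' τ h0) _))).congr ?_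
    rw [mul_one]
    exact extSign_mul_extSign_of_isFace P Q h k l (L.dim κ') _ _
  | right b =>
    rw [prodGlue_natAdd]
    refine ((isSigned_can (prodPread_eq M N ρ' κ κ' (h.face τ) h0)).comp
      ((isSigned_prodGlueRight M N h.leftPart_eq h.right κ κ' (leftFace τ h0).2.1
        (leftFace (h.face τ) h0).2.2 (leftFace τ h0).2.2 (rightFace τ h0)).comp
        (isSigned_canIso_inv_tensor (prodPread_eq M N ρ κ κ' τ h0) _))).congr ?_
    rw [mul_one, orSign_append_right, mul_left_comm]
    exact (congrArg (_ * ·) ((congrArg (fun S => extSign P k l S (L.dim κ') _ _ * _)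
      h.leftPart_eq).trans (Int.units_mul_self _))).trans (mul_one _)

lemma prodGlue_natural (c : Fin (n + m)) {ρ ρ' : Finset (Fin (n + m + 1))} (h : IsFace c ρ ρ')
    {κ ν : K.Cell} {κ' ν' : L.Cell} {τ υ : (simplex ρ).Cell} (h0 : 0 ∈ τ.1)
    (hκ : K.carrier κ ⊆ K.carrier ν) (hκ' : L.carrier κ' ⊆ L.carrier ν') (hτ : τ.1 ⊆ υ.1) :
    (prodPread M N ρ').barMap (prod_carrier_subset (prod_carrier_subset hκ hκ')
        (simplex_carrier_subset (τ := h.face τ) (τ' := h.face υ).2 hτ)) ≫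
          prodGlue M N c h ν ν' υ (hτ h0) =
      prodGlue M N c h κ κ' τ h0 ≫
        (prodPread M N ρ).barMap (prod_carrier_subset (prod_carrier_subset hκ hκ')
          (simplex_carrier_subset.2 hτ)) ▷ (Fin.append P Q c).bar := by
  have h1 := prodPread_barMap M N ρ' κ ν κ' ν' (h.face τ) (h.face υ) h0 (hτ h0) hκ hκ' hτ
  have h2 := prodPread_barMap M N ρ κ ν κ' ν' τ υ h0 (hτ h0) hκ hκ' hτ
  induction c using Fin.addCases with
  | left a =>
    exact natural_of_squares_symm (prodPreadIso M N ρ ν ν' υ (hτ h0) ⊗ᵢ appendLeft P Q a).isIso_hom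
      (prodGlueLeft_natural M N h.left h.rightPart_eq (τ := leftFace τ h0)
        (υ := leftFace υ (hτ h0)) (rightFace τ h0).2.1
        (rightFace (h.face τ) h0).2.2 (rightFace τ h0).2.2 (rightFace υ (hτ h0)).2.1
        (rightFace (h.face υ) (hτ h0)).2.2 (rightFace υ (hτ h0)).2.2 hκ hκ'
        (subset_iff_parts.1 hτ).1 (subset_iff_parts.1 hτ).2) h1 h2
      (prodGlue_castAdd_comp M N h κ κ' τ h0) (prodGlue_castAdd_comp M N h ν ν' υ (hτ h0))
  | right b =>
    exact natural_of_squares_symm (prodPreadIso M N ρ ν ν' υ (hτ h0) ⊗ᵢ appendRight P Q b).isIso_hom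
      (prodGlueRight_natural M N h.leftPart_eq h.right (leftFace τ h0).2.1
        (leftFace (h.face τ) h0).2.2 (leftFace τ h0).2.2 (leftFace υ (hτ h0)).2.1
        (leftFace (h.face υ) (hτ h0)).2.2 (leftFace υ (hτ h0)).2.2 (τ := rightFace τ h0)
        (υ := rightFace υ (hτ h0)) hκ hκ' (subset_iff_parts.1 hτ).1
        (subset_iff_parts.1 hτ).2) h1 h2
      (prodGlue_natAdd_comp M N h κ κ' τ h0) (prodGlue_natAdd_comp M N h ν ν' υ (hτ h0))

lemma square_of_squares {C : Type u} [Category.{v} C] [MonoidalCategory C] [BraidedCategory C]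
    {X Fa Fb F p q X₀ F₀a F₀b F₀ p₀ q₀ : C} {f : X ⟶ Fa ⊗ q} {f' : Fa ⟶ F ⊗ p} {h : X ⟶ Fb ⊗ p}
    {h' : Fb ⟶ F ⊗ q} {f₀ : X₀ ⟶ F₀a ⊗ q₀} {f₀' : F₀a ⟶ F₀ ⊗ p₀} {h₀ : X₀ ⟶ F₀b ⊗ p₀}
    {h₀' : F₀b ⟶ F₀ ⊗ q₀} {x : X ⟶ X₀} {b : Fb ⟶ F₀b} {a : Fa ⟶ F₀a} {c : F ≅ F₀} {d : p ≅ p₀}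
    {e : q ≅ q₀}
    (hs : f₀ ≫ f₀' ▷ q₀ ≫ (α_ F₀ p₀ q₀).hom ≫ F₀ ◁ (β_ p₀ q₀).hom =
      h₀ ≫ h₀' ▷ p₀ ≫ (α_ F₀ q₀ p₀).hom)
    (h1 : f ≫ (a ⊗ₘ e.hom) = x ≫ f₀) (h2 : f' ≫ (c.hom ⊗ₘ d.hom) = a ≫ f₀')
    (h3 : h ≫ (b ⊗ₘ d.hom) = x ≫ h₀) (h4 : h' ≫ (c.hom ⊗ₘ e.hom) = b ≫ h₀') :
    f ≫ f' ▷ q ≫ (α_ F p q).hom ≫ F ◁ (β_ p q).hom = h ≫ h' ▷ p ≫ (α_ F q p).hom := by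
  have e1 := square_left_of_squares h1 h2
  have e2 := square_right_of_squares h3 h4
  rw [hs, ← e2] at e1
  rw [← cancel_mono (c.hom ⊗ₘ e.hom ⊗ₘ d.hom)]
  simpa only [Category.assoc] using e1

lemma prodGlue_square {a b : Fin (n + m)} {σ σa σb ρ : Finset (Fin (n + m + 1))}
    (ha : IsFace a σ σa) (hb : IsFace b σ σb) (hab : IsFace b σa ρ) (hba : IsFace a σb ρ)
    (κ : K.Cell) (κ' : L.Cell) (τ : (simplex σ).Cell) (h0 : 0 ∈ τ.1) :
    prodGlue M N b hab κ κ' (ha.face τ) h0 ≫ prodGlue M N a ha κ κ' τ h0 ▷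
        (Fin.append P Q b).bar ≫ (α_ _ _ _).hom ≫ (prodPread M N σ).bar ((κ, κ'), τ) ◁
          (β_ (Fin.append P Q a).bar (Fin.append P Q b).bar).hom =
      prodGlue M N a hba κ κ' (hb.face τ) h0 ≫ prodGlue M N b hb κ κ' τ h0 ▷
        (Fin.append P Q a).bar ≫ (α_ _ _ _).hom := by
  induction a using Fin.addCases with
  | left a =>
    induction b using Fin.addCases with
    | left b =>
      exact square_of_squares
        (prodGlue_square_left_left M N ha.left hb.left hab.left hba.left ha.rightPart_eq
          hb.rightPart_eq hab.rightPart_eq hba.rightPart_eq κ κ' (leftFace τ h0)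
          (rightFace τ h0).2.1 (rightFace (hab.face (ha.face τ)) h0).2.2
          (rightFace (ha.face τ) h0).2.2 (rightFace (hb.face τ) h0).2.2 (rightFace τ h0).2.2)
        (prodGlue_castAdd_comp M N hab κ κ' (ha.face τ) h0)
        (prodGlue_castAdd_comp M N ha κ κ' τ h0)
        (prodGlue_castAdd_comp M N hba κ κ' (hb.face τ) h0)
        (prodGlue_castAdd_comp M N hb κ κ' τ h0)
    | right b =>
      exact square_of_squares
        (prodGlue_square_left_right M N ha.left hb.leftPart_eq hab.leftPart_eq hba.left
          ha.rightPart_eq hb.right hab.right hba.rightPart_eq κ κ' (leftFace τ h0).2.1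
          (leftFace τ h0).2.2 (leftFace (ha.face τ) h0).2.2 (leftFace (hb.face τ) h0).2.2
          (leftFace (hab.face (ha.face τ)) h0).2.2 (rightFace τ h0).2.1
          (rightFace τ h0).2.2 (rightFace (ha.face τ) h0).2.2 (rightFace (hb.face τ) h0).2.2
          (rightFace (hab.face (ha.face τ)) h0).2.2)
        (prodGlue_natAdd_comp M N hab κ κ' (ha.face τ) h0)
        (prodGlue_castAdd_comp M N ha κ κ' τ h0)
        (prodGlue_castAdd_comp M N hba κ κ' (hb.face τ) h0)
        (prodGlue_natAdd_comp M N hb κ κ' τ h0)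
  | right a =>
    induction b using Fin.addCases with
    | left b =>
      exact square_of_squares
        (prodGlue_square_right_left M N hb.left ha.leftPart_eq hba.leftPart_eq hab.left
          hb.rightPart_eq ha.right hba.right hab.rightPart_eq κ κ' (leftFace τ h0).2.1
          (leftFace τ h0).2.2 (leftFace (ha.face τ) h0).2.2 (leftFace (hb.face τ) h0).2.2
          (leftFace (hab.face (ha.face τ)) h0).2.2 (rightFace τ h0).2.1
          (rightFace τ h0).2.2 (rightFace (ha.face τ) h0).2.2 (rightFace (hb.face τ) h0).2.2
          (rightFace (hab.face (ha.face τ)) h0).2.2)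
        (prodGlue_castAdd_comp M N hab κ κ' (ha.face τ) h0)
        (prodGlue_natAdd_comp M N ha κ κ' τ h0)
        (prodGlue_natAdd_comp M N hba κ κ' (hb.face τ) h0)
        (prodGlue_castAdd_comp M N hb κ κ' τ h0)
    | right b =>
      exact square_of_squares
        (prodGlue_square_right_right M N ha.leftPart_eq hb.leftPart_eq hab.leftPart_eq
          hba.leftPart_eq ha.right hb.right hab.right hba.right κ κ' (leftFace τ h0).2.1
          (leftFace (hab.face (ha.face τ)) h0).2.2 (leftFace (ha.face τ) h0).2.2
          (leftFace (hb.face τ) h0).2.2 (leftFace τ h0).2.2 (rightFace τ h0))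
        (prodGlue_natAdd_comp M N hab κ κ' (ha.face τ) h0)
        (prodGlue_natAdd_comp M N ha κ κ' τ h0)
        (prodGlue_natAdd_comp M N hba κ κ' (hb.face τ) h0)
        (prodGlue_natAdd_comp M N hb κ κ' τ h0)

/-- The preads and isomorphisms which make up the external product. -/
def prodFamily : AdjointFamily (Fin.append P Q) (K.prod L) (k + l) where
  pread := prodPread M N
  mem ρ := (exists_prodPread M N ρ).choose_spec.1
  obj_eq_empty ρ c τ ε h := (exists_prodPread M N ρ).choose_spec.2.1 c τ ε h
  glue {c _ _} h κ τ h0 := prodGlue M N c h κ.1 κ.2 τ h0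
  isSigned_glue {c _ _} h κ τ h0 := isSigned_prodGlue M N c h κ.1 κ.2 τ h0
  glue_natural {c _ _} h κ ν τ υ h0 hκ hτ := by
    have hs := (OrientedBallComplex.prod_subset_iff K L κ ν).1 hκ
    exact prodGlue_natural M N c h h0 hs.1 hs.2 hτ
  glue_square ha hb hab hba κ τ h0 := prodGlue_square M N ha hb hab hba κ.1 κ.2 τ h0

/-- The external product. -/
def extProd : AdSing T.toAdTheory (Fin.append P Q) (K.prod L) (k + l) :=
  (prodFamily M N).toAdSing

end AdSing

end

section

open Unor

variable {A : Type u} [Category.{v} A] [BalancedCategory A] [EmptyInitial A] [MonoidalCategory A]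
  [GradedSymmetricCategory A] {n m : ℕ}

lemma square_of_common {C : Type u} [Category.{v} C] {V V' X X' Y Y' : C} {f : V ⟶ V'}
    {a : V ⟶ X} {b : V' ⟶ X'} {g : X ⟶ X'} {a' : V ⟶ Y} {b' : V' ⟶ Y'} {g' : Y ⟶ Y'}
    {c : X ⟶ Y} {d : X' ⟶ Y'} [Epi a] (h : f ≫ b = a ≫ g) (h' : f ≫ b' = a' ≫ g')
    (ha : a ≫ c = a') (hb : b ≫ d = b') : g ≫ d = c ≫ g' := by
  rw [← cancel_epi a, ← Category.assoc, ← h, Category.assoc, hb, h', ← ha, Category.assoc]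

namespace AdjointFamily

variable {T : AdTheory A} {P : Fin n → StarAd T} {K : OrientedBallComplex} {k : ℤ}
  (D : AdjointFamily P K k)

lemma bar_eq (σ : Finset (Fin (n + 1))) (κ : K.Cell) (τ : (simplex σ).Cell) :
    (D.toAdSing.bar σ κ τ).as = ((D.pread σ).bar (κ, τ)).as :=
  (eq_sgn_symm (D.toAdSing.val_eq κ 1 σ τ 1)).trans
    (eq_sgn_symm (eq_sgn_symm ((D.pread σ).obj_mk (κ, τ) (1 * 1))))

/-- The values of the ad belonging to a family. -/
def barIso (σ : Finset (Fin (n + 1))) (κ : K.Cell) (τ : (simplex σ).Cell) :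
    D.toAdSing.bar σ κ τ ≅ (D.pread σ).bar (κ, τ) :=
  canIso 1 (eq_sgn_one (D.bar_eq σ κ τ))

lemma toAdSing_barMap {σ : Finset (Fin (n + 1))} {κ κ' : K.Cell} {τ τ' : (simplex σ).Cell}
    (hκ : K.carrier κ ⊆ K.carrier κ') (hτ : τ.1 ⊆ τ'.1) :
    D.toAdSing.barMap hκ hτ ≫ (D.barIso σ κ' τ').hom = (D.barIso σ κ τ).hom ≫
      (D.pread σ).barMap (prod_carrier_subset hκ (simplex_carrier_subset.2 hτ)) := by
  let f : OrCell.mk κ 1 ⟶ OrCell.mk κ' 1 := homOfLE (OrCell.mk_le_mk hκ)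
  let g : OrCell.mk τ 1 ⟶ OrCell.mk τ' 1 :=
    homOfLE (OrCell.mk_le_mk (simplex_carrier_subset.2 hτ))
  have h1 := D.toAdSing.of_valMap f g
  have h2 := (D.pread σ).of_map (homOfLE (OrCell.prod_le (leOfHom f) (leOfHom g)))
  have h3 : (D.pread σ).F.map (homOfLE (OrCell.prod_le (leOfHom f) (leOfHom g))) =
      D.toAdSing.valMap f g :=
    (congrArg _ (Subsingleton.elim _ _)).trans ((D.pread σ).F.map_comp _ _)
  rw [h3] at h2
  exact square_of_common h1 h2
    ((can_comp_can (D.toAdSing.val_eq κ 1 σ τ 1) _).trans (can_congr _ (mul_one _)))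
    ((can_comp_can (D.toAdSing.val_eq κ' 1 σ τ' 1) _).trans (can_congr _ (mul_one _)))

lemma toAdSing_barGlue {a : Fin n} {σ σ' : Finset (Fin (n + 1))} (h : IsFace a σ σ') (κ : K.Cell)
    (τ : (simplex σ).Cell) (h0 : 0 ∈ τ.1) :
    (D.toAdSing.barGlue h κ τ).hom ≫ (D.barIso σ κ τ).hom ▷ (P a).bar =
      (D.barIso σ' κ (h.face τ)).hom ≫ D.glue h κ τ h0 := by
  refine square_of_common (D.toAdSing.of_valGlue h κ τ 1 1) (D.of_valGlue h κ τ 1 1 h0)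
    ((can_comp_can (D.toAdSing.val_eq κ 1 σ' (h.face τ) 1) _).trans (can_congr _ (mul_one _))) ?_
  refine (congrArg (_ ≫ ·) (can_whiskerRight (eq_sgn_one (D.bar_eq σ κ τ)) (P a).bar.as)).trans ?_
  exact (can_comp_can (eq_sgn_tensor (D.toAdSing.val_eq κ 1 σ τ 1)
    ((P a).obj_eq (orSign P σ a))) _).trans (can_congr _ (mul_one _))

end AdjointFamily

section

variable {T : AdTheory A} {P : Fin n → StarAd T} {Q : Fin m → StarAd T}
  {K L : OrientedBallComplex} {k l : ℤ}

open AdSing in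
/-- The unoriented values of `Z` are the products of the unoriented values of `M` and `N`. -/
structure IsBarProd (M : AdSing T P K k) (N : AdSing T Q L l)
    (Z : AdSing T (Fin.append P Q) (K.prod L) (k + l)) : Prop where
  eq : ∀ (ρ : Finset (Fin (n + m + 1))) (κ : K.Cell) (κ' : L.Cell) (τ : (simplex ρ).Cell)
    (h : 0 ∈ τ.1), (Z.bar ρ (κ, κ') τ).as = (sgn A (extSign P k l (leftPart n m ρ) (L.dim κ')
      ((simplex _).dim (leftFace τ h)) ((simplex _).dim (rightFace τ h)))).obj
      ((M.bar (leftPart n m ρ) κ (leftFace τ h)).as ⊗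
        (N.bar (rightPart n m ρ) κ' (rightFace τ h)).as)
  barMap : ∀ (ρ : Finset (Fin (n + m + 1))) (κ ν : K.Cell) (κ' ν' : L.Cell)
    (τ υ : (simplex ρ).Cell) (h : 0 ∈ τ.1) (h' : 0 ∈ υ.1) (hκ : K.carrier κ ⊆ K.carrier ν)
    (hκ' : L.carrier κ' ⊆ L.carrier ν') (hτ : τ.1 ⊆ υ.1),
    Z.barMap (prod_carrier_subset hκ hκ') hτ ≫ (canIso _ (eq ρ ν ν' υ h')).hom =
    (canIso _ (eq ρ κ κ' τ h)).hom ≫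
      (M.barMap (τ := leftFace τ h) (τ' := leftFace υ h') hκ (subset_iff_parts.1 hτ).1 ⊗ₘ
      N.barMap (τ := rightFace τ h) (τ' := rightFace υ h') hκ' (subset_iff_parts.1 hτ).2)
  barGlue_left : ∀ {a : Fin n} {ρ ρ' : Finset (Fin (n + m + 1))}
    (h : IsFace (Fin.castAdd m a) ρ ρ') (κ : K.Cell) (κ' : L.Cell) (τ : (simplex ρ).Cell)
    (h0 : 0 ∈ τ.1), (Z.barGlue h (κ, κ') τ).hom ≫
        ((canIso _ (eq ρ κ κ' τ h0)).hom ⊗ₘ (appendLeft P Q a).hom) =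
      (canIso _ (eq ρ' κ κ' (h.face τ) h0)).hom ≫
      prodGlueLeft M N h.left h.rightPart_eq κ κ' (leftFace τ h0) (rightFace τ h0).2.1
        (rightFace (h.face τ) h0).2.2 (rightFace τ h0).2.2
  barGlue_right : ∀ {b : Fin m} {ρ ρ' : Finset (Fin (n + m + 1))}
    (h : IsFace (Fin.natAdd n b) ρ ρ') (κ : K.Cell) (κ' : L.Cell) (τ : (simplex ρ).Cell)
    (h0 : 0 ∈ τ.1), (Z.barGlue h (κ, κ') τ).hom ≫
        ((canIso _ (eq ρ κ κ' τ h0)).hom ⊗ₘ (appendRight P Q b).hom) =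
      (canIso _ (eq ρ' κ κ' (h.face τ) h0)).hom ≫
      prodGlueRight M N h.leftPart_eq h.right κ κ' (leftFace τ h0).2.1
        (leftFace (h.face τ) h0).2.2 (leftFace τ h0).2.2 (rightFace τ h0)

end

lemma comp_square_whiskerRight {C : Type u} [Category.{v} C] [MonoidalCategory C]
    {X X₁ X₂ F F₁ F₂ p p₂ : C} {g : X ⟶ F ⊗ p} {g₁ : X₁ ⟶ F₁ ⊗ p} {g₂ : X₂ ⟶ F₂ ⊗ p₂}
    {a : X ⟶ X₁} {b : F ⟶ F₁} {a' : X₁ ⟶ X₂} {b' : F₁ ⟶ F₂} {d : p ⟶ p₂} {a'' : X ⟶ X₂}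
    {b'' : F ⟶ F₂} (h : g ≫ b ▷ p = a ≫ g₁) (h' : g₁ ≫ (b' ⊗ₘ d) = a' ≫ g₂) (ha : a ≫ a' = a'')
    (hb : b ≫ b' = b'') : g ≫ (b'' ⊗ₘ d) = a'' ≫ g₂ := by
  rw [← ha, ← hb, Category.assoc, ← h', ← Category.assoc a, ← h, Category.assoc,
    whiskerRight_comp_tensorHom]

section

variable {T : MultiplicativeAdTheory A} {P : Fin n → StarAd T.toAdTheory}
  {Q : Fin m → StarAd T.toAdTheory} {K L : OrientedBallComplex} {k l : ℤ}
  (M : AdSing T.toAdTheory P K k) (N : AdSing T.toAdTheory Q L l)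

open AdSing

lemma isBarProd_extProd : IsBarProd M N (extProd M N) := by
  have e : ∀ (ρ : Finset (Fin (n + m + 1))) (κ : K.Cell) (κ' : L.Cell) (τ : (simplex ρ).Cell)
    (h : 0 ∈ τ.1), ((extProd M N).bar ρ (κ, κ') τ).as =
      (sgn A (extSign P k l (leftPart n m ρ) (L.dim κ')
        ((simplex _).dim (leftFace τ h)) ((simplex _).dim (rightFace τ h)))).obj
      ((M.bar (leftPart n m ρ) κ (leftFace τ h)).as ⊗
        (N.bar (rightPart n m ρ) κ' (rightFace τ h)).as) := fun ρ κ κ' τ h =>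
    ((prodFamily M N).bar_eq ρ (κ, κ') τ).trans (prodPread_eq M N ρ κ κ' τ h)
  have e' : ∀ (ρ : Finset (Fin (n + m + 1))) (κ : K.Cell) (κ' : L.Cell) (τ : (simplex ρ).Cell)
      (h : 0 ∈ τ.1), ((prodFamily M N).barIso ρ (κ, κ') τ).hom ≫
      (prodPreadIso M N ρ κ κ' τ h).hom = (canIso _ (e ρ κ κ' τ h)).hom := fun ρ κ κ' τ h =>
    (can_comp_can _ (prodPread_eq M N ρ κ κ' τ h)).trans (can_congr _ (one_mul _))
  refine ⟨e, fun ρ κ ν κ' ν' τ υ h h' hκ hκ' hτ => ?_, fun {a ρ ρ'} h κ κ' τ h0 => ?_,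
    fun {b ρ ρ'} h κ κ' τ h0 => ?_⟩
  · exact comp_eq_comp_of_squares
      ((prodFamily M N).toAdSing_barMap (prod_carrier_subset hκ hκ') hτ)
      (prodPread_barMap M N ρ κ ν κ' ν' τ υ h h' hκ hκ' hτ) (e' ρ κ κ' τ h).symm
      (e' ρ ν ν' υ h').symm
  · exact comp_square_whiskerRight ((prodFamily M N).toAdSing_barGlue h (κ, κ') τ h0)
      (prodGlue_castAdd_comp M N h κ κ' τ h0) (e' ρ' κ κ' (h.face τ) h0) (e' ρ κ κ' τ h0)
  · exact comp_square_whiskerRight ((prodFamily M N).toAdSing_barGlue h (κ, κ') τ h0)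
      (prodGlue_natAdd_comp M N h κ κ' τ h0) (e' ρ' κ κ' (h.face τ) h0) (e' ρ κ κ' τ h0)

end

end

section

open Unor

variable {A : Type u} [Category.{v} A] [BalancedCategory A] [EmptyInitial A] [MonoidalCategory A]
  [GradedSymmetricCategory A] {n m : ℕ}

lemma sign_mul_extSign {ε δ ε₁ ε₂ δ₁ δ₂ E : ℤˣ} (h : ε * δ = ε₁ * ε₂ * (δ₁ * δ₂) * E) :
    ε * δ * E = ε₁ * δ₁ * (ε₂ * δ₂) := by
  rw [h, mul_assoc _ E E, Int.units_mul_self, mul_one, mul_mul_mul_comm]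

lemma sign_glue_left {ε δ ε₁ ε₂ δ₁ δ₂ δ₂' E E' : ℤˣ} (h : ε * δ = ε₁ * ε₂ * (δ₁ * δ₂) * E')
    (h' : ε * δ = ε₁ * ε₂ * (δ₁ * δ₂') * E) (s t : ℤˣ) :
    ε₁ * δ₁ * (ε₂ * δ₂' * (E' * (s * t * E))) = ε₁ * δ₁ * (t * (ε₂ * δ₂ * s)) := by
  have h1 : δ₂ * E' = δ₂' * E := by
    rw [h, mul_assoc, mul_assoc (ε₁ * ε₂), mul_right_inj, mul_assoc, mul_assoc, mul_right_inj] at h'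
    exact h'
  have h2 : δ₂' * E' * E = δ₂ := by
    rw [mul_right_comm, ← h1, mul_assoc, Int.units_mul_self, mul_one]
  calc _ = ε₁ * δ₁ * (t * (ε₂ * (δ₂' * E' * E) * s)) := by
        simp only [mul_comm, mul_left_comm]
    _ = _ := by rw [h2]

namespace Unor

lemma of_tensorHom_comp_can {X X' Y Y' X₀ X₀' Y₀ Y₀' : A} {f : X ⟶ X'} {g : Y ⟶ Y'} {r r' s s' : ℤˣ}
    {hX : X = (sgn A r).obj X₀} {hX' : X' = (sgn A r').obj X₀'} {hY : Y = (sgn A s).obj Y₀}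
    {hY' : Y' = (sgn A s').obj Y₀'} {F : mk X₀ ⟶ mk X₀'} {G : mk Y₀ ⟶ mk Y₀'}
    (e : of f ≫ can r' hX' = can r hX ≫ F) (e' : of g ≫ can s' hY' = can s hY ≫ G) :
    of (f ⊗ₘ g) ≫ can (r' * s') (eq_sgn_tensor hX' hY') =
      can (r * s) (eq_sgn_tensor hX hY) ≫ (F ⊗ₘ G) := by
  rw [← can_tensorHom_can hX hY, ← can_tensorHom_can hX' hY']
  refine (congrArg (· ≫ _) (of_tensorHom f g)).trans ?_
  refine (tensorHom_comp_tensorHom _ _ _ _).trans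
    (Eq.trans ?_ (tensorHom_comp_tensorHom _ _ _ _).symm)
  exact congrArg₂ (· ⊗ₘ ·) e e'

lemma of_whiskerLeft_comp_can {X Y Y' X₀ Y₀ Y₀' : A} {g : Y ⟶ Y'} {r s s' : ℤˣ}
    (hX : X = (sgn A r).obj X₀) {hY : Y = (sgn A s).obj Y₀}
    {hY' : Y' = (sgn A s').obj Y₀'} {G : mk Y₀ ⟶ mk Y₀'}
    (e' : of g ≫ can s' hY' = can s hY ≫ G) :
    of (X ◁ g) ≫ can (r * s') (eq_sgn_tensor hX hY') =
      can (r * s) (eq_sgn_tensor hX hY) ≫ mk X₀ ◁ G := by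
  have e : of (𝟙 X) ≫ can r hX = can r hX ≫ 𝟙 (mk X₀) := by
    rw [of_id, Category.comp_id]
    exact Category.id_comp _
  have h := of_tensorHom_comp_can e e'
  rw [id_tensorHom] at h
  exact h.trans (congrArg (_ ≫ ·) (id_tensorHom _ _))

lemma of_comp_eqToHom_associator {Z' Z X Y p : A} {f : Z' ⟶ Z ⊗ p} (hZ : Z = X ⊗ Y)
    {Z₀' Z₀ X₀ Y₀ p₁ p₀ W : A} {r s t t' x y : ℤˣ} {hZ' : Z' = (sgn A r).obj Z₀'}
    {hZ₀ : Z = (sgn A r).obj Z₀} {hp : p = (sgn A s).obj p₁} (hX : X = (sgn A x).obj X₀)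
    (hY : Y = (sgn A y).obj Y₀) {hE : Z₀ = (sgn A t).obj (X₀ ⊗ Y₀)} {hw : p₁ = (sgn A 1).obj p₀}
    {hE' : Z₀' = (sgn A t').obj W} {G : mk Z₀' ⟶ mk Z₀ ⊗ mk p₁}
    {G' : mk W ⟶ (mk X₀ ⊗ mk Y₀) ⊗ mk p₀} (hp' : p = (sgn A s).obj p₀)
    (e : of f ≫ can (r * s) (eq_sgn_tensor hZ₀ hp) = can r hZ' ≫ G)
    (e' : G ≫ ((canIso t hE).hom ⊗ₘ (canIso 1 hw).hom) = (canIso t' hE').hom ≫ G')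
    (hs : r * t = x * y) :
    of (f ≫ eqToHom (congrArg (· ⊗ p) hZ) ≫ (α_ X Y p).hom) ≫
        can (x * (y * s)) (eq_sgn_tensor hX (eq_sgn_tensor hY hp')) =
      can (r * t') (eq_sgn_trans hZ' hE') ≫ G' ≫ (α_ (mk X₀) (mk Y₀) (mk p₀)).hom := by
  subst hZ
  have h1 : of (f ≫ eqToHom (congrArg (· ⊗ p) (rfl : X ⊗ Y = X ⊗ Y)) ≫ (α_ X Y p).hom) =
      of f ≫ (α_ (mk X) (mk Y) (mk p)).hom := by
    rw [eqToHom_refl, Category.id_comp, of_comp]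
    rfl
  have h2 : (α_ (mk X) (mk Y) (mk p)).hom ≫
      can (x * (y * s)) (eq_sgn_tensor hX (eq_sgn_tensor hY hp')) =
      can (r * s) (eq_sgn_tensor hZ₀ hp) ≫ ((canIso t hE).hom ⊗ₘ (canIso 1 hw).hom) ≫
        (α_ (mk X₀) (mk Y₀) (mk p₀)).hom := by
    have h3 : can (x * (y * s)) (eq_sgn_tensor hX (eq_sgn_tensor hY hp')) =
        can x hX ⊗ₘ can y hY ⊗ₘ can s hp' :=
      (can_tensorHom_can hX (eq_sgn_tensor hY hp')).symm.trans
        (congrArg (_ ⊗ₘ ·) (can_tensorHom_can hY hp').symm)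
    have h4 : can (r * s) (eq_sgn_tensor hZ₀ hp) ≫ ((canIso t hE).hom ⊗ₘ (canIso 1 hw).hom) =
        (can x hX ⊗ₘ can y hY) ⊗ₘ can s hp' := by
      refine (congrArg (_ ≫ ·) (can_tensorHom_can hE hw)).trans ((can_comp_can _ _).trans ?_)
      refine Eq.trans ?_ ((congrArg (· ⊗ₘ _) (can_tensorHom_can hX hY)).trans
        (can_tensorHom_can (eq_sgn_tensor hX hY) hp')).symm
      exact can_congr _ (by rw [mul_mul_mul_comm, hs, mul_one])
    rw [h3, ← Category.assoc, h4]
    exact (associator_naturality _ _ _).symm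
  rw [h1, Category.assoc, h2, ← Category.assoc, e, Category.assoc, ← Category.assoc G, e',
    ← can_comp_can hZ' hE', Category.assoc, Category.assoc]
  rfl

end Unor

lemma rightGlue_comp_associator {C : Type u} [Category.{v} C] [MonoidalCategory C] (X : C)
    {Y' Y q : C} (g : Y' ⟶ Y ⊗ q) : rightGlue X g ≫ (α_ X Y q).hom = X ◁ g := by
  simp [rightGlue]

lemma leftGlue_comp_associator {C : Type u} [Category.{v} C] [MonoidalCategory C]
    [BraidedCategory C] {X' X p : C} (g : X' ⟶ X ⊗ p) (Y : C) :
    leftGlue g Y ≫ (α_ X Y p).hom = g ▷ Y ≫ (α_ X p Y).hom ≫ X ◁ (β_ p Y).hom := by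
  simp [leftGlue]

variable {T : AdTheory A} {P : Fin n → StarAd T} {Q : Fin m → StarAd T}
  {K L : OrientedBallComplex} {k l : ℤ} {M : AdSing T P K k} {N : AdSing T Q L l}
  {Z : AdSing T (Fin.append P Q) (K.prod L) (k + l)}

lemma append_left_obj_eq (P : Fin n → StarAd T) (Q : Fin m → StarAd T) (a : Fin n) (s : ℤˣ) :
    (Fin.append P Q (Fin.castAdd m a)).obj s = (sgn A s).obj ((P a).obj 1) := by
  rw [Fin.append_left]
  exact (P a).obj_eq s

lemma append_right_obj_eq (P : Fin n → StarAd T) (Q : Fin m → StarAd T) (b : Fin m) (s : ℤˣ) :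
    (Fin.append P Q (Fin.natAdd n b)).obj s = (sgn A s).obj ((Q b).obj 1) := by
  rw [Fin.append_right]
  exact (Q b).obj_eq s

namespace IsBarProd

variable (H : IsBarProd M N Z)
include H

lemma val_eq (ρ : Finset (Fin (n + m + 1))) (κ : K.Cell) (κ' : L.Cell) (τ : (simplex ρ).Cell)
    (h : 0 ∈ τ.1) (ε ε₁ ε₂ δ δ₁ δ₂ : ℤˣ)
    (hs : ε * δ = ε₁ * ε₂ * (δ₁ * δ₂) * extSign P k l (leftPart n m ρ) (L.dim κ')
      ((simplex _).dim (leftFace τ h)) ((simplex _).dim (rightFace τ h))) :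
    Z.val (κ, κ') ε ρ τ δ = M.val κ ε₁ (leftPart n m ρ) (leftFace τ h) δ₁ ⊗
      N.val κ' ε₂ (rightPart n m ρ) (rightFace τ h) δ₂ := by
  have h1 := eq_sgn_trans (Z.val_eq (κ, κ') ε ρ τ δ) (H.eq ρ κ κ' τ h)
  rw [sign_mul_extSign hs] at h1
  exact h1.trans (eq_sgn_tensor (M.val_eq κ ε₁ _ (leftFace τ h) δ₁)
    (N.val_eq κ' ε₂ _ (rightFace τ h) δ₂)).symm

lemma isExtProd : IsExtProd M N Z where
  obj := H.val_eq
  map ρ κ ν κ' ν' τ υ h h' ε ε₁ ε₂ δ δ₁ δ₂ ζ ζ₁ ζ₂ θ θ₁ θ₂ hs ht f f₁ f₂ g g₁ g₂ := by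
    have e1 := Z.of_valMap f g
    have hκ := OrCell.carrier_subset (leOfHom f₁)
    have hκ' := OrCell.carrier_subset (leOfHom f₂)
    have hτ := simplex_carrier_subset.1 (OrCell.carrier_subset (leOfHom g))
    exact heq_of_can _ (sign_mul_extSign hs) (sign_mul_extSign ht)
      (eq_sgn_trans (Z.val_eq (κ, κ') ε ρ τ δ) (H.eq ρ κ κ' τ h))
      (eq_sgn_tensor (M.val_eq κ ε₁ _ (leftFace τ h) δ₁) (N.val_eq κ' ε₂ _ (rightFace τ h) δ₂))
      (eq_sgn_trans (Z.val_eq (ν, ν') ζ ρ υ θ) (H.eq ρ ν ν' υ h'))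
      (eq_sgn_tensor (M.val_eq ν ζ₁ _ (leftFace υ h') θ₁) (N.val_eq ν' ζ₂ _ (rightFace υ h') θ₂))
      (comp_eq_comp_of_squares e1 (H.barMap ρ κ ν κ' ν' τ υ h h' hκ hκ' hτ)
        (can_comp_can _ _).symm (can_comp_can _ _).symm)
      (of_tensorHom_comp_can (M.of_valMap f₁ g₁) (N.of_valMap f₂ g₂))
  glue_left a ρ ρ' hρ κ κ' τ h ε ε₁ ε₂ δ δ₁ δ₂ δ₂' hs hδ := by
    have e0 : (Z.bar ρ' (κ, κ') (hρ.face τ)).as = (sgn A (extSign P k l (leftPart n m ρ')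
        (L.dim κ') ((simplex _).dim (leftFace τ h)) ((simplex _).dim (rightFace τ h)))).obj
        ((M.bar (leftPart n m ρ') κ (hρ.left.face (leftFace τ h))).as ⊗
          (N.bar (rightPart n m ρ) κ' (rightFace τ h)).as) :=
      (H.eq ρ' κ κ' (hρ.face τ) h).trans (congrArg (fun X => (sgn A _).obj (_ ⊗ X))
        (N.bar_eq_of_eq hρ.rightPart_eq κ' (rightFace τ h).2.1 (rightFace (hρ.face τ) h).2.2
          (rightFace τ h).2.2))
    have e2 : (Z.barGlue hρ (κ, κ') τ).hom ≫
        ((canIso _ (H.eq ρ κ κ' τ h)).hom ⊗ₘ (appendLeft P Q a).hom) = (canIso _ e0).hom ≫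
          leftGlue (M.barGlue hρ.left κ (leftFace τ h)).hom _ := by
      refine (H.barGlue_left hρ κ κ' τ h).trans ?_
      refine (Category.assoc _ _ _).symm.trans (congrArg (· ≫ _) ?_)
      refine (congrArg (_ ≫ ·) (whiskerLeft_can _ _)).trans ?_
      exact (can_comp_can _ _).trans (can_congr _ (mul_one _))
    have e3 := of_comp_eqToHom_associator (H.val_eq ρ κ κ' τ h ε ε₁ ε₂ δ δ₁ δ₂' hδ)
      (M.val_eq κ ε₁ _ (leftFace τ h) δ₁) (N.val_eq κ' ε₂ _ (rightFace τ h) δ₂')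
      (append_left_obj_eq P Q a _) (hZ₀ := Z.val_eq (κ, κ') ε ρ τ δ)
      (hp := (Fin.append P Q (Fin.castAdd m a)).obj_eq _) (Z.of_valGlue hρ (κ, κ') τ ε δ) e2 (sign_mul_extSign hδ)
    have e4 := of_square_left
      (eq_sgn_tensor (M.val_eq κ ε₁ _ (hρ.left.face (leftFace τ h)) δ₁)
        (N.val_eq κ' ε₂ _ (rightFace τ h) δ₂))
      (M.val_eq κ ε₁ _ (hρ.left.face (leftFace τ h)) δ₁) (M.val_eq κ ε₁ _ (leftFace τ h) δ₁)
      ((P a).obj_eq (orSign P (leftPart n m ρ) a)) (N.val_eq κ' ε₂ _ (rightFace τ h) δ₂)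
      (f := 𝟙 _) (g := 𝟙 _)
      ((congrArg (· ≫ _) (of_id _)).trans ((Category.id_comp _).trans (Category.comp_id _).symm))
      (M.of_valGlue hρ.left κ (leftFace τ h) ε₁ δ₁)
    have e5 := e3.trans (congrArg (_ ≫ ·) (leftGlue_comp_associator
      (M.barGlue hρ.left κ (leftFace τ h)).hom _))
    rw [Category.id_comp] at e4
    refine heq_of_can _ (sign_mul_extSign hs) ?_ _ _ _ _ e5
      (e4.trans (congrArg (_ ≫ ·) (Category.id_comp _)))
    have e6 := extSign_mul_extSign_of_isFace P Q hρ k l (L.dim κ')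
      ((simplex _).dim (leftFace τ h)) ((simplex _).dim (rightFace τ h))
    have e7 : gdim (N.val κ' ε₂ (rightPart n m ρ) (rightFace τ h) δ₂) =
        L.dim κ' + (simplex _).dim (rightFace τ h) - (l + miss Q (rightPart n m ρ)) := by
      rw [N.val_eq, gdim_sgn]
      exact N.gdim_bar _ κ' (rightFace τ h)
    rw [e7, StarAd.gdim_obj, ← e6]
    exact sign_glue_left hs hδ _ _
  glue_right b ρ ρ' hρ κ κ' τ h ε ε₁ ε₂ δ δ₁ δ₂ hs := by
    have e0 : (Z.bar ρ' (κ, κ') (hρ.face τ)).as = (sgn A (extSign P k l (leftPart n m ρ)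
        (L.dim κ') ((simplex _).dim (leftFace τ h)) ((simplex _).dim (rightFace τ h)))).obj
        ((M.bar (leftPart n m ρ) κ (leftFace τ h)).as ⊗
          (N.bar (rightPart n m ρ') κ' (hρ.right.face (rightFace τ h))).as) :=
      (H.eq ρ' κ κ' (hρ.face τ) h).trans (congrArg₂ (fun S X => (sgn A
        (extSign P k l S (L.dim κ') _ _)).obj (X ⊗ _)) hρ.leftPart_eq
        (M.bar_eq_of_eq hρ.leftPart_eq κ (leftFace τ h).2.1 (leftFace (hρ.face τ) h).2.2
          (leftFace τ h).2.2))
    have e2 : (Z.barGlue hρ (κ, κ') τ).hom ≫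
        ((canIso _ (H.eq ρ κ κ' τ h)).hom ⊗ₘ (appendRight P Q b).hom) = (canIso _ e0).hom ≫
          rightGlue _ (N.barGlue hρ.right κ' (rightFace τ h)).hom := by
      refine (H.barGlue_right hρ κ κ' τ h).trans ?_
      refine (Category.assoc _ _ _).symm.trans (congrArg (· ≫ _) ?_)
      refine (congrArg (_ ≫ ·) (can_whiskerRight _ _)).trans ?_
      refine (can_comp_can _ _).trans (can_congr _ ((mul_one _).trans ?_))
      exact congrArg (fun S => extSign P k l S (L.dim κ') _ _) hρ.leftPart_eq
    have e3 := of_comp_eqToHom_associator (H.val_eq ρ κ κ' τ h ε ε₁ ε₂ δ δ₁ δ₂ hs)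
      (M.val_eq κ ε₁ _ (leftFace τ h) δ₁) (N.val_eq κ' ε₂ _ (rightFace τ h) δ₂)
      (append_right_obj_eq P Q b _) (hZ₀ := Z.val_eq (κ, κ') ε ρ τ δ)
      (hp := (Fin.append P Q (Fin.natAdd n b)).obj_eq _) (Z.of_valGlue hρ (κ, κ') τ ε δ) e2
      (sign_mul_extSign hs)
    have e4 := of_whiskerLeft_comp_can (M.val_eq κ ε₁ _ (leftFace τ h) δ₁)
      (N.of_valGlue hρ.right κ' (rightFace τ h) ε₂ δ₂)
    have e5 := e3.trans (congrArg (_ ≫ ·) (rightGlue_comp_associator _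
      (N.barGlue hρ.right κ' (rightFace τ h)).hom))
    refine heq_of_can _ (sign_mul_extSign hs) ?_ _ _ _ _ e5 e4
    rw [orSign_append_right]

end IsBarProd

end

section

open Unor

variable {A : Type u} [Category.{v} A] [BalancedCategory A] [EmptyInitial A] [MonoidalCategory A]
  [GradedSymmetricCategory A] {n m : ℕ}

namespace AdSing

variable {T : AdTheory A} {P : Fin n → StarAd T} {K : OrientedBallComplex} {k : ℤ}

/-- The pairs of cells on which all ads with singularities are empty. -/
def IsFar (x : OrCell K) {σ : Finset (Fin (n + 1))} (z : OrCell (simplex σ)) : Prop :=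
  match x, z with
  | .cell _ _ _, .cell τ _ _ => (0 : Fin (n + 1)) ∉ τ.1
  | .cell _ _ _, .empty _ => True
  | .empty _, _ => True

lemma exists_eq_of_not_isFar {x : OrCell K} {σ : Finset (Fin (n + 1))} {z : OrCell (simplex σ)}
    (h : ¬ IsFar x z) : ∃ (κ : K.Cell) (ε : ℤˣ) (τ : (simplex σ).Cell) (δ : ℤˣ),
      0 ∈ τ.1 ∧ x = OrCell.mk κ ε ∧ z = OrCell.mk τ δ := by
  rcases x with ⟨κ, _, ε⟩ | _
  · rcases z with ⟨τ, _, δ⟩ | _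
    · exact ⟨κ, ε, τ, δ, not_not.1 h, rfl, rfl⟩
    · exact absurd trivial h
  · exact absurd trivial h

lemma obj_of_isFar (Z : AdSing T P K k) {x : OrCell K} {σ : Finset (Fin (n + 1))}
    {z : OrCell (simplex σ)} (h : IsFar x z) : ((Z.1.F.obj x).pre σ).F.obj z =
      (gempty A).obj (z.dim - (miss P σ - (x.dim - k))) := by
  rcases x with ⟨κ, h0, ε⟩ | j
  · have h1 : (Z.1.F.obj (OrCell.mk κ ε)).dim = K.dim κ - k := Z.1.gdim_obj (OrCell.mk κ ε)
    rcases z with ⟨τ, _, δ⟩ | i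
    · refine ((Z.1.F.obj (OrCell.mk κ ε)).pre_eq_empty σ τ δ h).trans ?_
      rw [h1]
      rfl
    · refine (((Z.1.F.obj (OrCell.mk κ ε)).pre σ).obj_empty i).trans ?_
      rw [h1]
      rfl
  · have h1 : Z.1.F.obj (.empty j) = SingObj.emptyObj P (j - k) := Z.1.obj_empty j
    rw [h1]
    rfl

lemma exists_eq_of_le_of_not_isFar {x x' : OrCell K} {σ : Finset (Fin (n + 1))}
    {z z' : OrCell (simplex σ)} (f : x ⟶ x') (g : z ⟶ z') (h : ¬ IsFar x z) :
    ∃ (κ κ' : K.Cell) (ε ε' : ℤˣ) (τ τ' : (simplex σ).Cell) (δ δ' : ℤˣ),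
      0 ∈ τ.1 ∧ 0 ∈ τ'.1 ∧ x = OrCell.mk κ ε ∧ x' = OrCell.mk κ' ε' ∧ z = OrCell.mk τ δ ∧
        z' = OrCell.mk τ' δ' := by
  obtain ⟨κ, ε, τ, δ, h0, rfl, rfl⟩ := exists_eq_of_not_isFar h
  rcases x' with ⟨κ', _, ε'⟩ | _
  · rcases z' with ⟨τ', _, δ'⟩ | _
    · exact ⟨κ, κ', ε, ε', τ, τ', δ, δ', h0,
        simplex_carrier_subset.1 (OrCell.carrier_subset (leOfHom g)) h0, rfl, rfl, rfl, rfl⟩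
    · exact (leOfHom g : RelCell.le _ _).elim
  · exact (leOfHom f : RelCell.le _ _).elim

lemma ext_of_val {Z Z' : AdSing T P K k}
    (h1 : ∀ (κ : K.Cell) (ε : ℤˣ) (σ : Finset (Fin (n + 1))) (τ : (simplex σ).Cell) (δ : ℤˣ),
      0 ∈ τ.1 → Z.val κ ε σ τ δ = Z'.val κ ε σ τ δ)
    (h2 : ∀ {κ κ' : K.Cell} {ε ε' : ℤˣ} (f : OrCell.mk κ ε ⟶ OrCell.mk κ' ε')
      {σ : Finset (Fin (n + 1))} {τ τ' : (simplex σ).Cell} {δ δ' : ℤˣ}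
      (g : OrCell.mk τ δ ⟶ OrCell.mk τ' δ'), 0 ∈ τ.1 → 0 ∈ τ'.1 →
      HEq (Z.valMap f g) (Z'.valMap f g))
    (h3 : ∀ (κ : K.Cell) (ε : ℤˣ) {a : Fin n} {σ σ' : Finset (Fin (n + 1))} (h : IsFace a σ σ')
      (τ : (simplex σ).Cell) (δ : ℤˣ), 0 ∈ τ.1 →
      HEq (Z.valGlue κ ε h τ δ).hom (Z'.valGlue κ ε h τ δ).hom) : Z = Z' := by
  have e1 : ∀ (x : OrCell K) (σ : Finset (Fin (n + 1))) (z : OrCell (simplex σ)),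
      ((Z.1.F.obj x).pre σ).F.obj z = ((Z'.1.F.obj x).pre σ).F.obj z := by
    intro x σ z
    by_cases h : IsFar x z
    · rw [Z.obj_of_isFar h, Z'.obj_of_isFar h]
    · obtain ⟨κ, ε, τ, δ, h0, rfl, rfl⟩ := exists_eq_of_not_isFar h
      exact h1 κ ε σ τ δ h0
  have e2 : ∀ (x : OrCell K), Z.1.F.obj x = Z'.1.F.obj x := by
    intro x
    refine SingObj.ext_heq ((Z.1.gdim_obj x).trans (Z'.1.gdim_obj x).symm) (e1 x)
      (fun σ z z' g => ?_) fun {a σ σ'} h z => ?_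
    · by_cases h : IsFar x z
      · exact heq_of_eq_empty (Z.obj_of_isFar h) (e1 x σ z) (e1 x σ z') _ _
      · obtain ⟨κ, -, ε, -, τ, τ', δ, δ', h0, h0', rfl, -, rfl, rfl⟩ :=
          exists_eq_of_le_of_not_isFar (𝟙 x) g h
        have e := h2 (𝟙 (OrCell.mk κ ε)) g h0 h0'
        have e' : ∀ Z : AdSing T P K k, Z.valMap (𝟙 (OrCell.mk κ ε)) g =
            ((Z.1.F.obj (OrCell.mk κ ε)).pre σ).F.map g := fun Z =>
          (congrArg (fun f : Z.1.F.obj (OrCell.mk κ ε) ⟶ Z.1.F.obj (OrCell.mk κ ε) =>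
            f.app σ (OrCell.mk τ δ) ≫ ((Z.1.F.obj (OrCell.mk κ ε)).pre σ).F.map g)
              (Z.1.F.map_id _)).trans (Category.id_comp _)
        rwa [e', e'] at e
    · by_cases h' : IsFar x z
      · have h4 : IsFar x (h.cell z) := by
          rcases x with _ | _
          · rcases z with _ | _
            · exact h'
            · trivial
          · trivial
        exact heq_of_eq_empty (Z.obj_of_isFar h4) (e1 _ _ _) (congrArg (· ⊗ _) (e1 _ _ _)) _ _
      · obtain ⟨κ, ε, τ, δ, h0, rfl, rfl⟩ := exists_eq_of_not_isFar h'
        exact h3 κ ε h τ δ h0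
  refine Subtype.ext (GradedHom.ext_F (_root_.CategoryTheory.Functor.hext e2 fun x x' f =>
    SingObj.hom_heq (e2 x) (e2 x') _ _ fun σ z => ?_))
  by_cases h : IsFar x z
  · exact heq_of_eq_empty (Z.obj_of_isFar h) (e1 x σ z) (e1 x' σ z) _ _
  · obtain ⟨κ, κ', ε, ε', τ, -, δ, -, h0, -, rfl, rfl, rfl, -⟩ :=
      exists_eq_of_le_of_not_isFar f (𝟙 z) h
    have e := h2 f (𝟙 (OrCell.mk τ δ)) h0 h0
    have e' : ∀ Z : AdSing T P K k, Z.valMap f (𝟙 (OrCell.mk τ δ)) =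
        (Z.1.F.map f).app σ (OrCell.mk τ δ) := fun Z =>
      (congrArg (_ ≫ ·) (((Z.1.F.obj (OrCell.mk κ' ε')).pre σ).F.map_id _)).trans
        (Category.comp_id _)
    rwa [e', e'] at e

end AdSing

section

variable {T : AdTheory A} {P : Fin n → StarAd T} {Q : Fin m → StarAd T}
  {K L : OrientedBallComplex} {k l : ℤ} {M : AdSing T P K k} {N : AdSing T Q L l}

/-- Orientations of the factors which induce given orientations of cells of a product. -/
lemma exists_orientations {ρ : Finset (Fin (n + m + 1))} {κ ν : K.Cell} {κ' ν' : L.Cell}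
    {τ υ : (simplex ρ).Cell} (h : 0 ∈ τ.1) (h' : 0 ∈ υ.1) {ε ζ δ θ : ℤˣ} (s : L.Cell → ℕ → ℕ → ℤˣ)
    (f : OrCell.mk (K := K.prod L) (κ, κ') ε ⟶ OrCell.mk (K := K.prod L) (ν, ν') ζ)
    (g : OrCell.mk τ δ ⟶ OrCell.mk υ θ) : ∃ ε₁ ε₂ δ₁ δ₂ ζ₁ ζ₂ θ₁ θ₂ : ℤˣ,
    ε * δ = ε₁ * ε₂ * (δ₁ * δ₂) * s κ' ((simplex _).dim (leftFace τ h))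
      ((simplex _).dim (rightFace τ h)) ∧
    ζ * θ = ζ₁ * ζ₂ * (θ₁ * θ₂) * s ν' ((simplex _).dim (leftFace υ h'))
      ((simplex _).dim (rightFace υ h')) ∧
    OrCell.mk κ ε₁ ≤ OrCell.mk ν ζ₁ ∧ OrCell.mk κ' ε₂ ≤ OrCell.mk ν' ζ₂ ∧
    OrCell.mk (leftFace τ h) δ₁ ≤ OrCell.mk (leftFace υ h') θ₁ ∧
    OrCell.mk (rightFace τ h) δ₂ ≤ OrCell.mk (rightFace υ h') θ₂ := by
  have hκ := (OrientedBallComplex.prod_subset_iff K L (κ, κ') (ν, ν')).1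
    (OrCell.carrier_subset (leOfHom f))
  have hτ := subset_iff_parts.1 (simplex_carrier_subset.1 (OrCell.carrier_subset (leOfHom g)))
  have h1 := OrCell.mk_le_mk hκ.1
  have h2 := OrCell.mk_le_mk hκ.2
  have h3 := OrCell.mk_le_mk (σ := leftFace τ h) (τ := leftFace υ h')
    (simplex_carrier_subset.2 hτ.1)
  have h4 := OrCell.mk_le_mk (σ := rightFace τ h) (τ := rightFace υ h')
    (simplex_carrier_subset.2 hτ.2)
  have hu : ∀ a b : ℤˣ, a = a * b * b := fun a b => by
    rw [mul_assoc, Int.units_mul_self, mul_one]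
  set S := s κ' ((simplex _).dim (leftFace τ h)) ((simplex _).dim (rightFace τ h)) with hS
  set S' := s ν' ((simplex _).dim (leftFace υ h')) ((simplex _).dim (rightFace υ h')) with hS'
  rcases K.carrier_eq_or_ssubset hκ.1 with e1 | e1
  swap
  · exact ⟨ε * δ * S, 1, 1, 1, ζ * θ * S', 1, 1, 1, by simp [← hu], by simp [← hu], Or.inr e1, h2,
      h3, h4⟩
  rcases L.carrier_eq_or_ssubset hκ.2 with e2 | e2
  swap
  · exact ⟨1, ε * δ * S, 1, 1, 1, ζ * θ * S', 1, 1, by simp [← hu], by simp [← hu], h1, Or.inr e2,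
      h3, h4⟩
  rcases (simplex _).carrier_eq_or_ssubset (σ := leftFace τ h) (τ := leftFace υ h')
    (simplex_carrier_subset.2 hτ.1) with e3 | e3
  swap
  · exact ⟨1, 1, ε * δ * S, 1, 1, 1, ζ * θ * S', 1, by simp [← hu], by simp [← hu], h1, h2,
      Or.inr e3, h4⟩
  rcases (simplex _).carrier_eq_or_ssubset (σ := rightFace τ h) (τ := rightFace υ h')
    (simplex_carrier_subset.2 hτ.2) with e4 | e4
  swap
  · exact ⟨1, 1, 1, ε * δ * S, 1, 1, 1, ζ * θ * S', by simp [← hu], by simp [← hu], h1, h2, h3,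
      Or.inr e4⟩
  have e5 : τ = υ := Subtype.ext (eq_iff_parts.2
    ⟨congrArg Subtype.val e3, congrArg Subtype.val e4⟩)
  subst e1
  subst e2
  subst e5
  have e6 : ε = ζ := by
    rcases (leOfHom f : RelCell.le _ _) with e | e
    · exact e.2
    · exact absurd e (ssubset_irrefl _)
  have e7 : δ = θ := by
    rcases (leOfHom g : RelCell.le _ _) with e | e
    · exact e.2
    · exact absurd e (ssubset_irrefl _)
  subst e6
  subst e7
  exact ⟨ε * δ * S, 1, 1, 1, ε * δ * S, 1, 1, 1, by simp [← hu], by simp [← hu, hS, hS'], le_rfl,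
    le_rfl, le_rfl, le_rfl⟩

lemma IsExtProd.eq {Z Z' : AdSing T (Fin.append P Q) (K.prod L) (k + l)} (h : IsExtProd M N Z)
    (h' : IsExtProd M N Z') : Z = Z' := by
  have hu : ∀ a b : ℤˣ, a = a * b * 1 * (1 * 1) * b := fun a b => by
    rw [mul_one, mul_one, mul_one, mul_assoc, Int.units_mul_self, mul_one]
  have hcancel : ∀ {X X' Y Y' W W' : A} (g : X ⟶ Y) (g' : X' ⟶ Y') (e : Y = W) (e' : Y' = W)
      (hX : X = X') (i : W ⟶ W') [Mono i],
      HEq (g ≫ eqToHom e ≫ i) (g' ≫ eqToHom e' ≫ i) → HEq g g' := by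
    intro X X' Y Y' W W' g g' e e' hX i _ hh
    subst hX
    subst e
    subst e'
    rw [eqToHom_refl, Category.id_comp] at hh
    exact heq_of_eq ((cancel_mono i).1 (eq_of_heq hh))
  refine AdSing.ext_of_val ?_ ?_ ?_
  · rintro ⟨κ, κ'⟩ ε ρ τ δ h0
    exact (h.obj ρ κ κ' τ h0 ε (ε * δ * _) 1 δ 1 1 (hu _ _)).trans
      (h'.obj ρ κ κ' τ h0 ε (ε * δ * _) 1 δ 1 1 (hu _ _)).symm
  · rintro ⟨κ, κ'⟩ ⟨ν, ν'⟩ ε ζ f ρ τ υ δ θ g h0 h0'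
    obtain ⟨ε₁, ε₂, δ₁, δ₂, ζ₁, ζ₂, θ₁, θ₂, e, e', f₁, f₂, g₁, g₂⟩ :=
      exists_orientations h0 h0' (fun c => extSign P k l (leftPart n m ρ) (L.dim c)) f g
    exact (h.map ρ κ ν κ' ν' τ υ h0 h0' ε ε₁ ε₂ δ δ₁ δ₂ ζ ζ₁ ζ₂ θ θ₁ θ₂ e e' f (homOfLE f₁)
      (homOfLE f₂) g (homOfLE g₁) (homOfLE g₂)).trans
      (h'.map ρ κ ν κ' ν' τ υ h0 h0' ε ε₁ ε₂ δ δ₁ δ₂ ζ ζ₁ ζ₂ θ θ₁ θ₂ e e' f (homOfLE f₁)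
      (homOfLE f₂) g (homOfLE g₁) (homOfLE g₂)).symm
  · rintro ⟨κ, κ'⟩ ε c ρ ρ' hρ τ δ h0
    have e0 : Z.val (κ, κ') ε ρ' (hρ.face τ) δ = Z'.val (κ, κ') ε ρ' (hρ.face τ) δ :=
      (h.obj ρ' κ κ' (hρ.face τ) h0 ε (ε * δ * _) 1 δ 1 1 (hu _ _)).trans
      (h'.obj ρ' κ κ' (hρ.face τ) h0 ε (ε * δ * _) 1 δ 1 1 (hu _ _)).symm
    have hu' : ∀ a b c : ℤˣ, a = a * b * 1 * (1 * (b * c)) * c := fun a b c => by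
      rw [mul_one, one_mul, ← mul_assoc, mul_assoc a, Int.units_mul_self, mul_one, mul_assoc,
        Int.units_mul_self, mul_one]
    induction c using Fin.addCases with
    | left a =>
      refine hcancel _ _ _ _ e0 _ ((h.glue_left a ρ ρ' hρ κ κ' τ h0 ε (ε * δ * _) 1 δ 1 1 _
        (hu _ _) (hu' _ _ _)).trans (h'.glue_left a ρ ρ' hρ κ κ' τ h0 ε (ε * δ * _) 1 δ 1 1 _
        (hu _ _) (hu' _ _ _)).symm)
    | right b =>
      exact hcancel _ _ _ _ e0 _ ((h.glue_right b ρ ρ' hρ κ κ' τ h0 ε (ε * δ * _) 1 δ 1 1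
        (hu _ _)).trans (h'.glue_right b ρ ρ' hρ κ κ' τ h0 ε (ε * δ * _) 1 δ 1 1 (hu _ _)).symm)

end

section

variable {T : AdTheory A} {P : Fin n → StarAd T} {Q : Fin m → StarAd T}
  {K K' L L' : OrientedBallComplex} {k l : ℤ} {M : AdSing T P K' k} {N : AdSing T Q L' l}
  {Z : AdSing T (Fin.append P Q) (K'.prod L') (k + l)}

lemma IsExtProd.pull (h : IsExtProd M N Z) (f : K.Hom K') (g : L.Hom L') :
    IsExtProd (M.pull f) (N.pull g) (Z.pull (f.prod g)) where
  obj ρ κ κ' τ h0 ε ε₁ ε₂ δ δ₁ δ₂ hs := h.obj ρ (f.toFun κ) (g.toFun κ') τ h0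
    (f.sign κ * g.sign κ' * ε) (f.sign κ * ε₁) (g.sign κ' * ε₂) δ δ₁ δ₂ (by
      rw [g.dim_toFun, mul_assoc, hs]
      simp only [mul_assoc, mul_left_comm])
  map ρ κ ν κ' ν' τ υ h0 h0' ε ε₁ ε₂ δ δ₁ δ₂ ζ ζ₁ ζ₂ θ θ₁ θ₂ hs ht φ φ₁ φ₂ ψ ψ₁ ψ₂ :=
    h.map ρ (f.toFun κ) (f.toFun ν) (g.toFun κ') (g.toFun ν') τ υ h0 h0'
      (f.sign κ * g.sign κ' * ε) (f.sign κ * ε₁) (g.sign κ' * ε₂) δ δ₁ δ₂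
      (f.sign ν * g.sign ν' * ζ) (f.sign ν * ζ₁) (g.sign ν' * ζ₂) θ θ₁ θ₂
      (by
        rw [g.dim_toFun, mul_assoc, hs]
        simp only [mul_assoc, mul_left_comm])
      (by
        rw [g.dim_toFun, mul_assoc, ht]
        simp only [mul_assoc, mul_left_comm])
      ((f.prod g).cellHom.F.map φ) (f.cellHom.F.map φ₁) (g.cellHom.F.map φ₂) ψ ψ₁ ψ₂
  glue_left a ρ ρ' hρ κ κ' τ h0 ε ε₁ ε₂ δ δ₁ δ₂ δ₂' hs hδ :=
    h.glue_left a ρ ρ' hρ (f.toFun κ) (g.toFun κ') τ h0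
      (f.sign κ * g.sign κ' * ε) (f.sign κ * ε₁) (g.sign κ' * ε₂) δ δ₁ δ₂ δ₂'
      (by
        rw [g.dim_toFun, mul_assoc, hs]
        simp only [mul_assoc, mul_left_comm])
      (by
        rw [g.dim_toFun, mul_assoc, hδ]
        simp only [mul_assoc, mul_left_comm])
  glue_right b ρ ρ' hρ κ κ' τ h0 ε ε₁ ε₂ δ δ₁ δ₂ hs :=
    h.glue_right b ρ ρ' hρ (f.toFun κ) (g.toFun κ') τ h0
      (f.sign κ * g.sign κ' * ε) (f.sign κ * ε₁) (g.sign κ' * ε₂) δ δ₁ δ₂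
      (by
        rw [g.dim_toFun, mul_assoc, hs]
        simp only [mul_assoc, mul_left_comm])

end

lemma AdSing.extProd_pull {T : MultiplicativeAdTheory A} {P : Fin n → StarAd T.toAdTheory}
    {Q : Fin m → StarAd T.toAdTheory} {K K' L L' : OrientedBallComplex} {k l : ℤ}
    (M : AdSing T.toAdTheory P K' k) (N : AdSing T.toAdTheory Q L' l) (f : K.Hom K')
    (g : L.Hom L') : extProd (M.pull f) (N.pull g) = (extProd M N).pull (f.prod g) :=
  (isBarProd_extProd _ _).isExtProd.eq ((isBarProd_extProd M N).isExtProd.pull f g)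

end

section

open Unor

variable {A : Type u} [Category.{v} A] [BalancedCategory A] [EmptyInitial A] [MonoidalCategory A]
  [GradedSymmetricCategory A] {n : ℕ}

lemma Unor.IsSigned.exists_iso {X Y X₀ Y₀ : A} {s : ℤˣ} {φ : mk X₀ ⟶ mk Y₀} (h : IsSigned 1 φ)
    (hX : X = (sgn A s).obj X₀) (hY : Y = (sgn A s).obj Y₀) :
    ∃ f : X ≅ Y, of f.hom ≫ can s hY = can s hX ≫ φ := by
  obtain ⟨Y', h1, f, h2⟩ := (isSigned_can hX).comp h
  rw [mul_one] at h1
  subst hY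
  subst h1
  refine ⟨f, Eq.trans ?_ h2⟩
  exact congrArg (_ ≫ ·) (can_congr _ (mul_one s).symm)

namespace AdSing

variable {T : AdTheory A} {P : Fin n → StarAd T} {K : OrientedBallComplex} {k : ℤ}

/-- The data of a natural map of ads with singularities, without orientations. -/
structure BarHom (Z Z' : AdSing T P K k) where
  app : ∀ {σ : Finset (Fin (n + 1))} (κ : K.Cell) (τ : (simplex σ).Cell), 0 ∈ τ.1 →
    (Z.bar σ κ τ ⟶ Z'.bar σ κ τ)
  isSigned : ∀ {σ : Finset (Fin (n + 1))} (κ : K.Cell) (τ : (simplex σ).Cell) (h : 0 ∈ τ.1),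
    IsSigned 1 (app κ τ h)
  natural : ∀ {σ : Finset (Fin (n + 1))} {κ κ' : K.Cell} {τ τ' : (simplex σ).Cell} (h : 0 ∈ τ.1)
    (hκ : K.carrier κ ⊆ K.carrier κ') (hτ : τ.1 ⊆ τ'.1),
    Z.barMap hκ hτ ≫ app κ' τ' (hτ h) = app κ τ h ≫ Z'.barMap hκ hτ
  comm : ∀ {a : Fin n} {σ σ' : Finset (Fin (n + 1))} (h : IsFace a σ σ') (κ : K.Cell)
    (τ : (simplex σ).Cell) (h0 : 0 ∈ τ.1),
    (Z.barGlue h κ τ).hom ≫ app κ τ h0 ▷ (P a).bar =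
      app κ (h.face τ) h0 ≫ (Z'.barGlue h κ τ).hom

namespace BarHom

variable {Z Z' : AdSing T P K k} (B : BarHom Z Z')

lemma exists_val (x : OrCell K) (σ : Finset (Fin (n + 1))) (z : OrCell (simplex σ)) :
    ∃ f : ((Z.1.F.obj x).pre σ).F.obj z ⟶ ((Z'.1.F.obj x).pre σ).F.obj z,
      ∀ (κ : K.Cell) (ε : ℤˣ) (τ : (simplex σ).Cell) (δ : ℤˣ) (hx : OrCell.mk κ ε = x)
        (hz : OrCell.mk τ δ = z) (h0 : 0 ∈ τ.1),
        of f ≫ can (ε * δ) (hx ▸ hz ▸ Z'.val_eq κ ε σ τ δ) =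
          can (ε * δ) (hx ▸ hz ▸ Z.val_eq κ ε σ τ δ) ≫ B.app κ τ h0 := by
  by_cases h : IsFar x z
  · refine ⟨eqToHom ((Z.obj_of_isFar h).trans (Z'.obj_of_isFar h).symm), ?_⟩
    rintro κ ε τ δ rfl rfl h0
    exact absurd h0 h
  · obtain ⟨κ, ε, τ, δ, h0, rfl, rfl⟩ := exists_eq_of_not_isFar h
    obtain ⟨f, hf⟩ := (B.isSigned κ τ h0).exists_iso (Z.val_eq κ ε σ τ δ) (Z'.val_eq κ ε σ τ δ)
    refine ⟨f.hom, fun κ₁ ε₁ τ₁ δ₁ hx hz h0' => ?_⟩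
    injection hx with e1 e2
    injection hz with e3 e4
    subst e1 e2 e3 e4
    exact hf

/-- The map of oriented values. -/
def val (x : OrCell K) (σ : Finset (Fin (n + 1))) (z : OrCell (simplex σ)) :
    ((Z.1.F.obj x).pre σ).F.obj z ⟶ ((Z'.1.F.obj x).pre σ).F.obj z :=
  (B.exists_val x σ z).choose

lemma of_val (κ : K.Cell) (ε : ℤˣ) {σ : Finset (Fin (n + 1))} (τ : (simplex σ).Cell) (δ : ℤˣ)
    (h0 : 0 ∈ τ.1) : of (B.val (OrCell.mk κ ε) σ (OrCell.mk τ δ)) ≫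
        can (ε * δ) (Z'.val_eq κ ε σ τ δ) =
      can (ε * δ) (Z.val_eq κ ε σ τ δ) ≫ B.app κ τ h0 :=
  (B.exists_val _ σ _).choose_spec κ ε τ δ rfl rfl h0

lemma val_natural {x x' : OrCell K} (f : x ⟶ x') {σ : Finset (Fin (n + 1))}
    {z z' : OrCell (simplex σ)} (g : z ⟶ z') :
    ((Z.1.F.map f).app σ z ≫ ((Z.1.F.obj x').pre σ).F.map g) ≫ B.val x' σ z' =
      B.val x σ z ≫ (Z'.1.F.map f).app σ z ≫ ((Z'.1.F.obj x').pre σ).F.map g := by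
  by_cases h : IsFar x z
  · exact eq_of_heq (heq_of_eq_empty (Z.obj_of_isFar h) rfl rfl _ _)
  obtain ⟨κ, κ', ε, ε', τ, τ', δ, δ', h0, h0', rfl, rfl, rfl, rfl⟩ :=
    exists_eq_of_le_of_not_isFar f g h
  have h1 := Z.of_valMap f g
  have h2 := Z'.of_valMap f g
  have h3 := B.natural h0 (OrCell.carrier_subset (leOfHom f))
    (simplex_carrier_subset.1 (OrCell.carrier_subset (leOfHom g)))
  refine of_injective ((of_comp _ _).trans (Eq.trans ?_ (of_comp _ _).symm))
  rw [← cancel_mono (can (ε' * δ') (Z'.val_eq κ' ε' σ τ' δ'))]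
  refine (Category.assoc _ _ _).trans ((congrArg (_ ≫ ·) (B.of_val κ' ε' τ' δ' h0')).trans ?_)
  refine (Category.assoc _ _ _).symm.trans ((congrArg (· ≫ _) h1).trans ?_)
  refine (Category.assoc _ _ _).trans ((congrArg (_ ≫ ·) h3).trans ?_)
  refine (Category.assoc _ _ _).symm.trans ((congrArg (· ≫ _)
    (B.of_val κ ε τ δ h0).symm).trans ?_)
  refine (Category.assoc _ _ _).trans (Eq.trans ?_ (Category.assoc _ _ _).symm)
  exact congrArg (_ ≫ ·) h2.symm

lemma val_neg (x : OrCell K) {σ : Finset (Fin (n + 1))} (z : OrCell (simplex σ)) :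
    HEq (B.val x σ z.neg) ((ginv A).map (B.val x σ z)) := by
  have e : ∀ Z : AdSing T P K k, ((Z.1.F.obj x).pre σ).F.obj z.neg =
      (ginv A).obj (((Z.1.F.obj x).pre σ).F.obj z) := fun Z => (Z.1.F.obj x).pre_obj_neg σ z
  by_cases h : IsFar x z
  · refine heq_of_eq_empty ?_ (e Z) (e Z') _ _ (m := z.dim - (miss P σ - (x.dim - k)))
    rw [e, Z.obj_of_isFar h, inv_obj_empty]
  obtain ⟨κ, ε, τ, δ, h0, rfl, rfl⟩ := exists_eq_of_not_isFar h
  exact heq_ginv_map_of_can _ (mul_neg ε δ) (mul_neg ε δ) _ _ _ _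
    (B.of_val κ ε τ δ h0) (B.of_val κ ε τ (-δ) h0)

lemma neg_val (x : OrCell K) {σ : Finset (Fin (n + 1))} (z : OrCell (simplex σ)) :
    HEq (B.val x.neg σ z) (B.val x σ z.neg) := by
  have e : ∀ Z : AdSing T P K k, ((Z.1.F.obj x.neg).pre σ).F.obj z =
      ((Z.1.F.obj x).pre σ).F.obj z.neg := fun Z =>
    congrArg (fun X : SingObj P => (X.pre σ).F.obj z) (Z.1.obj_inv x)
  by_cases h : IsFar x z
  · have h' : IsFar x z.neg := by
      rcases x with _ | _
      · rcases z with _ | _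
        · exact h
        · trivial
      · trivial
    exact heq_of_eq_empty ((e Z).trans (Z.obj_of_isFar h')) (e Z) (e Z') _ _
  obtain ⟨κ, ε, τ, δ, h0, rfl, rfl⟩ := exists_eq_of_not_isFar h
  exact heq_of_can _ (neg_mul_comm ε δ) (neg_mul_comm ε δ) _ _ _ _ (B.of_val κ (-ε) τ δ h0)
    (B.of_val κ ε τ (-δ) h0)

lemma val_comm (x : OrCell K) {a : Fin n} {σ σ' : Finset (Fin (n + 1))} (h : IsFace a σ σ')
    (z : OrCell (simplex σ)) :
    ((Z.1.F.obj x).glue h z).hom ≫ B.val x σ z ▷ (P a).obj (orSign P σ a) =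
      B.val x σ' (h.cell z) ≫ ((Z'.1.F.obj x).glue h z).hom := by
  by_cases hf : IsFar x z
  · have h' : IsFar x (h.cell z) := by
      rcases x with _ | _
      · rcases z with _ | _
        · exact hf
        · trivial
      · trivial
    exact eq_of_heq (heq_of_eq_empty (Z.obj_of_isFar h') rfl rfl _ _)
  obtain ⟨κ, ε, τ, δ, h0, rfl, rfl⟩ := exists_eq_of_not_isFar hf
  have h1 := Z.of_valGlue h κ τ ε δ
  have h2 := Z'.of_valGlue h κ τ ε δ
  have h3 := B.comm h κ τ h0
  have h4 := B.of_val κ ε (h.face τ) δ h0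
  have h5 : of (B.val (OrCell.mk κ ε) σ (OrCell.mk τ δ) ▷ (P a).obj (orSign P σ a)) ≫
      can (ε * δ * orSign P σ a) (eq_sgn_tensor (Z'.val_eq κ ε σ τ δ)
        ((P a).obj_eq (orSign P σ a))) =
      can (ε * δ * orSign P σ a) (eq_sgn_tensor (Z.val_eq κ ε σ τ δ)
        ((P a).obj_eq (orSign P σ a))) ≫ B.app κ τ h0 ▷ (P a).bar := by
    have h6 := of_tensorHom_comp_can (B.of_val κ ε τ δ h0) (g := 𝟙 _) (G := 𝟙 _)
      (hY := (P a).obj_eq (orSign P σ a)) (hY' := (P a).obj_eq (orSign P σ a))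
      ((congrArg (· ≫ _) (of_id _)).trans ((Category.id_comp _).trans (Category.comp_id _).symm))
    rw [tensorHom_id] at h6
    exact h6.trans (congrArg (_ ≫ ·) (tensorHom_id _ _))
  refine of_injective ((of_comp _ _).trans (Eq.trans ?_ (of_comp _ _).symm))
  rw [← cancel_mono (can (ε * δ * orSign P σ a) (eq_sgn_tensor (Z'.val_eq κ ε σ τ δ)
        ((P a).obj_eq (orSign P σ a))))]
  refine (Category.assoc _ _ _).trans ((congrArg (_ ≫ ·) h5).trans ?_)
  refine (Category.assoc _ _ _).symm.trans ((congrArg (· ≫ _) h1).trans ?_)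
  refine (Category.assoc _ _ _).trans ((congrArg (_ ≫ ·) h3).trans ?_)
  refine (Category.assoc _ _ _).symm.trans ((congrArg (· ≫ _) h4.symm).trans ?_)
  refine (Category.assoc _ _ _).trans (Eq.trans ?_ (Category.assoc _ _ _).symm)
  exact congrArg (_ ≫ ·) h2.symm

/-- The natural transformation of functors. -/
def natTrans : Z.1.F ⟶ Z'.1.F where
  app x :=
    { app := B.val x
      natural := fun σ z z' g => by
        have h := B.val_natural (𝟙 x) g
        have e : ∀ Z : AdSing T P K k, (Z.1.F.map (𝟙 x)).app σ z ≫
            ((Z.1.F.obj x).pre σ).F.map g = ((Z.1.F.obj x).pre σ).F.map g := fun Z =>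
          (congrArg (fun f : Z.1.F.obj x ⟶ Z.1.F.obj x => f.app σ z ≫ _)
            (Z.1.F.map_id x)).trans (Category.id_comp _)
        rwa [e, e] at h
      app_neg := fun σ z => B.val_neg x z
      comm := fun h z => B.val_comm x h z }
  naturality x x' f := SingObj.Hom.ext (funext₂ fun σ z => by
    have h := B.val_natural f (𝟙 z)
    have e : ∀ Z : AdSing T P K k, (Z.1.F.map f).app σ z ≫
        ((Z.1.F.obj x').pre σ).F.map (𝟙 z) = (Z.1.F.map f).app σ z := fun Z =>
      (congrArg (_ ≫ ·) (((Z.1.F.obj x').pre σ).F.map_id z)).trans (Category.comp_id _)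
    rwa [e, e] at h)

lemma natTrans_app_neg (x : OrCell K) : HEq (B.natTrans.app ((ginv (OrCell K)).obj x))
    ((ginv (SingObj P)).map (B.natTrans.app x)) :=
  SingObj.hom_heq (Z.1.obj_inv x) (Z'.1.obj_inv x) _ _ fun _ z => B.neg_val x z

lemma val_comp_val (B' : BarHom Z' Z) (h : ∀ {σ : Finset (Fin (n + 1))} (κ : K.Cell)
    (τ : (simplex σ).Cell) (h0 : 0 ∈ τ.1), B.app κ τ h0 ≫ B'.app κ τ h0 = 𝟙 _)
    (x : OrCell K) (σ : Finset (Fin (n + 1))) (z : OrCell (simplex σ)) :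
    B.val x σ z ≫ B'.val x σ z = 𝟙 _ := by
  by_cases hf : IsFar x z
  · exact eq_of_heq (heq_of_eq_empty (Z.obj_of_isFar hf) rfl rfl _ _)
  obtain ⟨κ, ε, τ, δ, h0, rfl, rfl⟩ := exists_eq_of_not_isFar hf
  refine of_injective ((of_comp _ _).trans (Eq.trans ?_ (of_id _).symm))
  rw [← cancel_mono (can (ε * δ) (Z.val_eq κ ε σ τ δ))]
  refine (Category.assoc _ _ _).trans ((congrArg (_ ≫ ·) (B'.of_val κ ε τ δ h0)).trans ?_)
  refine (Category.assoc _ _ _).symm.trans ((congrArg (· ≫ _) (B.of_val κ ε τ δ h0)).trans ?_)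
  refine (Category.assoc _ _ _).trans ((congrArg (_ ≫ ·) (h κ τ h0)).trans ?_)
  exact (Category.comp_id _).trans (Category.id_comp _).symm

/-- The isomorphism of functors given by mutually inverse data. -/
def natIso (B' : BarHom Z' Z) (h : ∀ {σ : Finset (Fin (n + 1))} (κ : K.Cell)
    (τ : (simplex σ).Cell) (h0 : 0 ∈ τ.1), B.app κ τ h0 ≫ B'.app κ τ h0 = 𝟙 _)
    (h' : ∀ {σ : Finset (Fin (n + 1))} (κ : K.Cell)
    (τ : (simplex σ).Cell) (h0 : 0 ∈ τ.1), B'.app κ τ h0 ≫ B.app κ τ h0 = 𝟙 _) :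
    Z.1.F ≅ Z'.1.F where
  hom := B.natTrans
  inv := B'.natTrans
  hom_inv_id := NatTrans.ext (funext fun x => SingObj.Hom.ext (funext₂ fun σ z =>
    B.val_comp_val B' h x σ z))
  inv_hom_id := NatTrans.ext (funext fun x => SingObj.Hom.ext (funext₂ fun σ z =>
    B'.val_comp_val B h' x σ z))

end BarHom

end AdSing

end

section

open Unor

variable {A : Type u} [Category.{v} A] [BalancedCategory A] [EmptyInitial A] [MonoidalCategory A]
  [GradedSymmetricCategory A] {n m : ℕ}

/-- The cells `τ₀` of `S₀` and `τ₁` of `S₁` are the two parts of the cell `τ` of `ρ`. -/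
structure Parts {ρ : Finset (Fin (n + m + 1))} (τ : (simplex ρ).Cell) {S₀ : Finset (Fin (n + 1))}
    (τ₀ : (simplex S₀).Cell) {S₁ : Finset (Fin (m + 1))} (τ₁ : (simplex S₁).Cell) : Prop where
  zero_mem : 0 ∈ τ.1
  left : leftPart n m ρ = S₀
  right : rightPart n m ρ = S₁
  left_val : leftPart n m τ.1 = τ₀.1
  right_val : rightPart n m τ.1 = τ₁.1

lemma parts_faces {ρ : Finset (Fin (n + m + 1))} (τ : (simplex ρ).Cell) (h : 0 ∈ τ.1) :
    Parts τ (leftFace τ h) (rightFace τ h) :=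
  ⟨h, rfl, rfl, rfl, rfl⟩

namespace Parts

variable {ρ : Finset (Fin (n + m + 1))} {τ : (simplex ρ).Cell} {S₀ : Finset (Fin (n + 1))}
  {τ₀ : (simplex S₀).Cell} {S₁ : Finset (Fin (m + 1))} {τ₁ : (simplex S₁).Cell}

lemma dim_eq (h : Parts τ τ₀ τ₁) : (simplex ρ).dim τ = (simplex S₀).dim τ₀ + (simplex S₁).dim τ₁ := by
  obtain ⟨h, rfl, rfl, e, e'⟩ := h
  obtain rfl : leftFace τ h = τ₀ := Subtype.ext e
  obtain rfl : rightFace τ h = τ₁ := Subtype.ext e'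
  exact dim_parts τ h

lemma face_left {a : Fin n} {ρ' : Finset (Fin (n + m + 1))} {S₀' : Finset (Fin (n + 1))}
    (hp : Parts τ τ₀ τ₁) (h : IsFace (Fin.castAdd m a) ρ ρ') (h' : IsFace a S₀ S₀') :
    Parts (h.face τ) (h'.face τ₀) τ₁ where
  zero_mem := hp.zero_mem
  left := by rw [h.left.eq, h'.eq, hp.left]
  right := h.rightPart_eq.trans hp.right
  left_val := hp.left_val
  right_val := hp.right_val

lemma face_right {b : Fin m} {ρ' : Finset (Fin (n + m + 1))} {S₁' : Finset (Fin (m + 1))}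
    (hp : Parts τ τ₀ τ₁) (h : IsFace (Fin.natAdd n b) ρ ρ') (h' : IsFace b S₁ S₁') :
    Parts (h.face τ) τ₀ (h'.face τ₁) where
  zero_mem := hp.zero_mem
  left := h.leftPart_eq.trans hp.left
  right := by rw [h.right.eq, h'.eq, hp.right]
  left_val := hp.left_val
  right_val := hp.right_val

lemma isFace_left {a : Fin n} {ρ' : Finset (Fin (n + m + 1))} (hp : Parts τ τ₀ τ₁)
    (h : IsFace (Fin.castAdd m a) ρ ρ') : IsFace a S₀ (leftPart n m ρ') :=
  hp.left ▸ h.left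

lemma isFace_right {b : Fin m} {ρ' : Finset (Fin (n + m + 1))} (hp : Parts τ τ₀ τ₁)
    (h : IsFace (Fin.natAdd n b) ρ ρ') : IsFace b S₁ (rightPart n m ρ') :=
  hp.right ▸ h.right

lemma mono {υ : (simplex ρ).Cell} {υ₀ : (simplex S₀).Cell} {υ₁ : (simplex S₁).Cell}
    (h : Parts τ τ₀ τ₁) (h' : Parts υ υ₀ υ₁) (hτ : τ.1 ⊆ υ.1) : τ₀.1 ⊆ υ₀.1 ∧ τ₁.1 ⊆ υ₁.1 := by
  rw [← h.left_val, ← h'.left_val, ← h.right_val, ← h'.right_val]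
  exact subset_iff_parts.1 hτ

end Parts

namespace IsBarProd

variable {T : AdTheory A} {P : Fin n → StarAd T} {Q : Fin m → StarAd T}
  {K L : OrientedBallComplex} {k l : ℤ} {M : AdSing T P K k} {N : AdSing T Q L l}
  {Z : AdSing T (Fin.append P Q) (K.prod L) (k + l)} (H : IsBarProd M N Z)
include H

variable {ρ ρ' : Finset (Fin (n + m + 1))} {τ υ : (simplex ρ).Cell}
  {S₀ S₀' : Finset (Fin (n + 1))} {τ₀ υ₀ : (simplex S₀).Cell} {S₁ S₁' : Finset (Fin (m + 1))}
  {τ₁ υ₁ : (simplex S₁).Cell}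

lemma bar_eq (κ : K.Cell) (κ' : L.Cell) (h : Parts τ τ₀ τ₁) :
    (Z.bar ρ (κ, κ') τ).as = (sgn A (extSign P k l S₀ (L.dim κ') ((simplex _).dim τ₀)
      ((simplex _).dim τ₁))).obj ((M.bar S₀ κ τ₀).as ⊗ (N.bar S₁ κ' τ₁).as) := by
  obtain ⟨h, rfl, rfl, e, e'⟩ := h
  obtain rfl : leftFace τ h = τ₀ := Subtype.ext e
  obtain rfl : rightFace τ h = τ₁ := Subtype.ext e'
  exact H.eq ρ κ κ' τ h

/-- The values of a product. -/
def iso (κ : K.Cell) (κ' : L.Cell) (h : Parts τ τ₀ τ₁) :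
    Z.bar ρ (κ, κ') τ ≅ M.bar S₀ κ τ₀ ⊗ N.bar S₁ κ' τ₁ :=
  canIso _ (H.bar_eq κ κ' h)

lemma barMap_iso {κ ν : K.Cell} {κ' ν' : L.Cell} (h : Parts τ τ₀ τ₁) (h' : Parts υ υ₀ υ₁)
    (hκ : K.carrier κ ⊆ K.carrier ν) (hκ' : L.carrier κ' ⊆ L.carrier ν') (hτ : τ.1 ⊆ υ.1)
    (hκ₂ : (K.prod L).carrier (κ, κ') ⊆ (K.prod L).carrier (ν, ν')) :
    Z.barMap hκ₂ hτ ≫ (H.iso ν ν' h').hom =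
      (H.iso κ κ' h).hom ≫ (M.barMap hκ (h.mono h' hτ).1 ⊗ₘ N.barMap hκ' (h.mono h' hτ).2) := by
  obtain ⟨h, rfl, rfl, e, e'⟩ := h
  obtain rfl : leftFace τ h = τ₀ := Subtype.ext e
  obtain rfl : rightFace τ h = τ₁ := Subtype.ext e'
  obtain ⟨h', -, -, e, e'⟩ := h'
  obtain rfl : leftFace υ h' = υ₀ := Subtype.ext e
  obtain rfl : rightFace υ h' = υ₁ := Subtype.ext e'
  exact H.barMap ρ κ ν κ' ν' τ υ h h' hκ hκ' hτ

lemma barGlue_iso_left {a : Fin n} (h : IsFace (Fin.castAdd m a) ρ ρ') (h₀ : IsFace a S₀ S₀')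
    (κ : K.Cell) (κ' : L.Cell) (hp : Parts τ τ₀ τ₁) (hp' : Parts (h.face τ) (h₀.face τ₀) τ₁) :
    (Z.barGlue h (κ, κ') τ).hom ≫ ((H.iso κ κ' hp).hom ⊗ₘ (appendLeft P Q a).hom) =
      (H.iso κ κ' hp').hom ≫ leftGlue (M.barGlue h₀ κ τ₀).hom (N.bar S₁ κ' τ₁) := by
  obtain ⟨h0, rfl, rfl, e, e'⟩ := hp
  obtain rfl : leftFace τ h0 = τ₀ := Subtype.ext e
  obtain rfl : rightFace τ h0 = τ₁ := Subtype.ext e'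
  obtain rfl : leftPart n m ρ' = S₀' := hp'.left
  refine (H.barGlue_left h κ κ' τ h0).trans ?_
  refine (Category.assoc _ _ _).symm.trans (congrArg (· ≫ _) ?_)
  refine (congrArg (_ ≫ ·) (whiskerLeft_can _ _)).trans ?_
  exact (can_comp_can _ _).trans (can_congr _ (mul_one _))

lemma barGlue_iso_right {b : Fin m} (h : IsFace (Fin.natAdd n b) ρ ρ') (h₁ : IsFace b S₁ S₁')
    (κ : K.Cell) (κ' : L.Cell) (hp : Parts τ τ₀ τ₁) (hp' : Parts (h.face τ) τ₀ (h₁.face τ₁)) :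
    (Z.barGlue h (κ, κ') τ).hom ≫ ((H.iso κ κ' hp).hom ⊗ₘ (appendRight P Q b).hom) =
      (H.iso κ κ' hp').hom ≫ rightGlue (M.bar S₀ κ τ₀) (N.barGlue h₁ κ' τ₁).hom := by
  obtain ⟨h0, rfl, rfl, e, e'⟩ := hp
  obtain rfl : leftFace τ h0 = τ₀ := Subtype.ext e
  obtain rfl : rightFace τ h0 = τ₁ := Subtype.ext e'
  obtain rfl : rightPart n m ρ' = S₁' := hp'.right
  refine (H.barGlue_right h κ κ' τ h0).trans ?_
  refine (Category.assoc _ _ _).symm.trans (congrArg (· ≫ _) ?_)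
  refine (congrArg (_ ≫ ·) (can_whiskerRight _ _)).trans ?_
  refine (can_comp_can _ _).trans (can_congr _ ((mul_one _).trans ?_))
  exact congrArg (fun S => extSign P k l S (L.dim κ') _ _) h.leftPart_eq

end IsBarProd

namespace AdSing

variable {T : AdTheory A} {P : Fin n → StarAd T} {P' : Fin m → StarAd T} {K K' : OrientedBallComplex}
  {k l : ℤ}

section Pull

variable (Z : AdSing T P K' k) (f : K.Hom K')

lemma pull_bar_eq (σ : Finset (Fin (n + 1))) (κ : K.Cell) (τ : (simplex σ).Cell) :
    ((Z.pull f).bar σ κ τ).as = (sgn A (f.sign κ)).obj (Z.bar σ (f.toFun κ) τ).as := by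
  have h := eq_sgn_trans (eq_sgn_symm ((Z.pull f).val_eq κ 1 σ τ 1))
    (Z.val_eq (f.toFun κ) (f.sign κ * 1) σ τ 1)
  simpa using h

/-- The values of a restriction. -/
def pullIso (σ : Finset (Fin (n + 1))) (κ : K.Cell) (τ : (simplex σ).Cell) :
    (Z.pull f).bar σ κ τ ≅ Z.bar σ (f.toFun κ) τ :=
  canIso _ (Z.pull_bar_eq f σ κ τ)

lemma can_comp_pullIso (σ : Finset (Fin (n + 1))) (κ : K.Cell) (τ : (simplex σ).Cell) :
    can (1 * 1) ((Z.pull f).val_eq κ 1 σ τ 1) ≫ (Z.pullIso f σ κ τ).hom =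
      can (f.sign κ * 1 * 1) (Z.val_eq (f.toFun κ) (f.sign κ * 1) σ τ 1) :=
  (can_comp_can _ _).trans (can_congr _ (by simp))

lemma barMap_pullIso {σ : Finset (Fin (n + 1))} {κ ν : K.Cell} {τ υ : (simplex σ).Cell}
    (hκ : K.carrier κ ⊆ K.carrier ν) (hτ : τ.1 ⊆ υ.1) :
    (Z.pull f).barMap hκ hτ ≫ (Z.pullIso f σ ν υ).hom =
      (Z.pullIso f σ κ τ).hom ≫ Z.barMap ((f.carrier_subset_iff κ ν).2 hκ) hτ := by
  let φ : OrCell.mk κ 1 ⟶ OrCell.mk ν 1 := homOfLE (OrCell.mk_le_mk hκ)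
  let g : OrCell.mk τ 1 ⟶ OrCell.mk υ 1 :=
    homOfLE (OrCell.mk_le_mk (simplex_carrier_subset.2 hτ))
  have h1 := (Z.pull f).of_valMap φ g
  have h2 := Z.of_valMap (f.cellHom.F.map φ) g
  exact square_of_common h1 h2 (Z.can_comp_pullIso f σ κ τ) (Z.can_comp_pullIso f σ ν υ)

lemma barGlue_pullIso {a : Fin n} {σ σ' : Finset (Fin (n + 1))} (h : IsFace a σ σ') (κ : K.Cell)
    (τ : (simplex σ).Cell) :
    ((Z.pull f).barGlue h κ τ).hom ≫ ((Z.pullIso f σ κ τ).hom ⊗ₘ 𝟙 (P a).bar) =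
      (Z.pullIso f σ' κ (h.face τ)).hom ≫ (Z.barGlue h (f.toFun κ) τ).hom := by
  rw [tensorHom_id]
  have h1 := (Z.pull f).of_valGlue h κ τ 1 1
  have h2 := Z.of_valGlue h (f.toFun κ) τ (f.sign κ * 1) 1
  refine square_of_common h1 h2 (Z.can_comp_pullIso f σ' κ (h.face τ)) ?_
  refine (congrArg (_ ≫ ·) (can_whiskerRight _ _)).trans ((can_comp_can _ _).trans
    (can_congr _ ?_))
  rw [mul_right_comm, mul_one (f.sign κ), mul_one (1 : ℤˣ), one_mul, mul_one, mul_comm]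

end Pull

section Relabel

variable (h : n = m) (h' : P = P' ∘ Fin.cast h) (h'' : k = l) (Z : AdSing T P K k)

lemma relabel_bar_eq {ρ : Finset (Fin (m + 1))} {ρ' : Finset (Fin (n + 1))}
    (hρ : ∀ i, i ∈ ρ' ↔ Fin.cast (congrArg (· + 1) h) i ∈ ρ) (κ : K.Cell) {τ : (simplex ρ).Cell}
    {τ' : (simplex ρ').Cell} (hτ : ∀ i, i ∈ τ'.1 ↔ Fin.cast (congrArg (· + 1) h) i ∈ τ.1) :
    ((Z.relabel h h' h'').bar ρ κ τ).as = (Z.bar ρ' κ τ').as := by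
  subst h h''
  obtain rfl : P = P' := h'
  obtain rfl : ρ' = ρ := Finset.ext hρ
  obtain rfl : τ' = τ := Subtype.ext (Finset.ext hτ)
  rfl

/-- The values of a relabelling. -/
def relabelIso {ρ : Finset (Fin (m + 1))} {ρ' : Finset (Fin (n + 1))}
    (hρ : ∀ i, i ∈ ρ' ↔ Fin.cast (congrArg (· + 1) h) i ∈ ρ) (κ : K.Cell) {τ : (simplex ρ).Cell}
    {τ' : (simplex ρ').Cell} (hτ : ∀ i, i ∈ τ'.1 ↔ Fin.cast (congrArg (· + 1) h) i ∈ τ.1) :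
    (Z.relabel h h' h'').bar ρ κ τ ≅ Z.bar ρ' κ τ' :=
  canIso 1 (eq_sgn_one (Z.relabel_bar_eq h h' h'' hρ κ hτ))

lemma barMap_relabelIso {ρ : Finset (Fin (m + 1))} {ρ' : Finset (Fin (n + 1))}
    (hρ : ∀ i, i ∈ ρ' ↔ Fin.cast (congrArg (· + 1) h) i ∈ ρ) {κ ν : K.Cell}
    {τ υ : (simplex ρ).Cell} {τ' υ' : (simplex ρ').Cell}
    (hτ : ∀ i, i ∈ τ'.1 ↔ Fin.cast (congrArg (· + 1) h) i ∈ τ.1)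
    (hυ : ∀ i, i ∈ υ'.1 ↔ Fin.cast (congrArg (· + 1) h) i ∈ υ.1)
    (hκ : K.carrier κ ⊆ K.carrier ν) (h1 : τ.1 ⊆ υ.1) :
    (Z.relabel h h' h'').barMap hκ h1 ≫ (Z.relabelIso h h' h'' hρ ν hυ).hom =
      (Z.relabelIso h h' h'' hρ κ hτ).hom ≫
        Z.barMap (τ := τ') (τ' := υ') hκ (fun i hi => (hυ i).2 (h1 ((hτ i).1 hi))) := by
  subst h h''
  obtain rfl : P = P' := h'
  obtain rfl : ρ' = ρ := Finset.ext hρ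
  obtain rfl : τ' = τ := Subtype.ext (Finset.ext hτ)
  obtain rfl : υ' = υ := Subtype.ext (Finset.ext hυ)
  exact (Category.comp_id _).trans (Category.id_comp _).symm

lemma barGlue_relabelIso {c : Fin m} {a : Fin n} (ha : Fin.cast h a = c)
    {ρ σ : Finset (Fin (m + 1))} {ρ' σ' : Finset (Fin (n + 1))}
    (hρ : ∀ i, i ∈ ρ' ↔ Fin.cast (congrArg (· + 1) h) i ∈ ρ)
    (hσ : ∀ i, i ∈ σ' ↔ Fin.cast (congrArg (· + 1) h) i ∈ σ) (hf : IsFace c ρ σ)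
    (hf' : IsFace a ρ' σ') (κ : K.Cell) {τ : (simplex ρ).Cell} {τ' : (simplex ρ').Cell}
    (hτ : ∀ i, i ∈ τ'.1 ↔ Fin.cast (congrArg (· + 1) h) i ∈ τ.1)
    (hp : (P' c).obj 1 = (sgn A 1).obj ((P a).obj 1)) :
    ((Z.relabel h h' h'').barGlue hf κ τ).hom ≫
        ((Z.relabelIso h h' h'' hρ κ hτ).hom ⊗ₘ can 1 hp) =
      (Z.relabelIso h h' h'' hσ κ (τ := hf.face τ) (τ' := hf'.face τ') hτ).hom ≫
        (Z.barGlue hf' κ τ').hom := by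
  subst h h''
  obtain rfl : P = P' := h'
  obtain rfl : ρ' = ρ := Finset.ext hρ
  obtain rfl : σ' = σ := Finset.ext hσ
  obtain rfl : τ' = τ := Subtype.ext (Finset.ext hτ)
  obtain rfl : a = c := ha
  refine Eq.trans (congrArg (_ ≫ ·) (id_tensorHom_id _ _)) ?_
  exact (Category.comp_id _).trans (Category.id_comp _).symm

end Relabel

end AdSing

end

section

open Unor

section Coherence

variable {C : Type u} [Category.{v} C] [MonoidalCategory C]

lemma glue_trans {X X₂ X₃ Y Y₂ Y₃ p p₂ p₃ : C} {g : X ⟶ Y ⊗ p} {g₂ : X₂ ⟶ Y₂ ⊗ p₂}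
    {g₃ : X₃ ⟶ Y₃ ⊗ p₃} {a : X ⟶ X₂} {b : Y ⟶ Y₂} {w : p ⟶ p₂} {a' : X₂ ⟶ X₃} {b' : Y₂ ⟶ Y₃}
    {w' : p₂ ⟶ p₃} (h : g ≫ (b ⊗ₘ w) = a ≫ g₂) (h' : g₂ ≫ (b' ⊗ₘ w') = a' ≫ g₃) :
    g ≫ ((b ≫ b') ⊗ₘ (w ≫ w')) = (a ≫ a') ≫ g₃ := by
  rw [← tensorHom_comp_tensorHom, ← Category.assoc, h, Category.assoc, h', Category.assoc]

lemma map_trans {X X₂ X₃ Y Y₂ Y₃ : C} {f : X ⟶ Y} {f₂ : X₂ ⟶ Y₂} {f₃ : X₃ ⟶ Y₃} {a : X ⟶ X₂}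
    {b : Y ⟶ Y₂} {a' : X₂ ⟶ X₃} {b' : Y₂ ⟶ Y₃} (h : f ≫ b = a ≫ f₂) (h' : f₂ ≫ b' = a' ≫ f₃) :
    f ≫ b ≫ b' = (a ≫ a') ≫ f₃ := by
  rw [← Category.assoc, h, Category.assoc, h', Category.assoc]

lemma glue_comp_inv {X X₁ X₂ Y Y₁ Y₂ p p₀ : C} {g₁ : X₁ ⟶ Y₁ ⊗ p} {g₂ : X₂ ⟶ Y₂ ⊗ p}
    {g : X ⟶ Y ⊗ p₀} {a₁ : X₁ ≅ X} {b₁ : Y₁ ≅ Y} {a₂ : X₂ ≅ X} {b₂ : Y₂ ≅ Y} {w : p ⟶ p₀} [IsIso w]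
    (h₁ : g₁ ≫ (b₁.hom ⊗ₘ w) = a₁.hom ≫ g) (h₂ : g₂ ≫ (b₂.hom ⊗ₘ w) = a₂.hom ≫ g) :
    g₁ ≫ (b₁.hom ≫ b₂.inv) ▷ p = (a₁.hom ≫ a₂.inv) ≫ g₂ := by
  rw [← cancel_mono (b₂.hom ⊗ₘ w), Category.assoc, Category.assoc, Category.assoc, h₂,
    Iso.inv_hom_id_assoc, ← h₁, whiskerRight_comp_tensorHom, Category.assoc, Iso.inv_hom_id,
    Category.comp_id]

lemma map_comp_inv {X X₁ X₂ Y Y₁ Y₂ : C} {f₁ : X₁ ⟶ Y₁} {f₂ : X₂ ⟶ Y₂} {f : X ⟶ Y} {a₁ : X₁ ≅ X}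
    {b₁ : Y₁ ≅ Y} {a₂ : X₂ ≅ X} {b₂ : Y₂ ≅ Y} (h₁ : f₁ ≫ b₁.hom = a₁.hom ≫ f)
    (h₂ : f₂ ≫ b₂.hom = a₂.hom ≫ f) :
    f₁ ≫ b₁.hom ≫ b₂.inv = (a₁.hom ≫ a₂.inv) ≫ f₂ := by
  rw [← cancel_mono b₂.hom]
  simp [h₂, reassoc_of% h₁]

lemma rightGlue_comp_tensorHom (X : C) {Y' Y Y₂' Y₂ q q₂ : C} {g : Y' ⟶ Y ⊗ q} {g₂ : Y₂' ⟶ Y₂ ⊗ q₂}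
    {y' : Y' ⟶ Y₂'} {y : Y ⟶ Y₂} {w : q ⟶ q₂} (h : g ≫ (y ⊗ₘ w) = y' ≫ g₂) :
    rightGlue X g ≫ (X ◁ y ⊗ₘ w) = X ◁ y' ≫ rightGlue X g₂ := by
  unfold rightGlue
  rw [Category.assoc, ← Category.assoc (X ◁ y'), ← MonoidalCategory.whiskerLeft_comp, ← h,
    ← id_tensorHom X y, ← associator_inv_naturality, id_tensorHom,
    MonoidalCategory.whiskerLeft_comp, Category.assoc]

lemma rightGlue_whiskerRight {X X₂ : C} (x : X ⟶ X₂) {Y' Y q : C} (g : Y' ⟶ Y ⊗ q) :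
    rightGlue X g ≫ (x ▷ Y ⊗ₘ 𝟙 q) = x ▷ Y' ≫ rightGlue X₂ g := by
  have h := rightGlue_natural x (g := g) (g₂ := g) (y := 𝟙 _) (y' := 𝟙 _) (by simp)
  rw [tensorHom_id, tensorHom_id] at h
  rw [tensorHom_id]
  exact h.symm

lemma associator_comp_rightGlue_rightGlue (X Y : C) {Z' Z q : C} (g : Z' ⟶ Z ⊗ q) :
    (α_ X Y Z').hom ≫ rightGlue X (rightGlue Y g) = rightGlue (X ⊗ Y) g ≫ (α_ X Y Z).hom ▷ q := by
  unfold rightGlue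
  monoidal

variable [BraidedCategory C]

lemma leftGlue_comp_tensorHom {X' X X₂' X₂ p p₂ : C} {g : X' ⟶ X ⊗ p} {g₂ : X₂' ⟶ X₂ ⊗ p₂}
    {x' : X' ⟶ X₂'} {x : X ⟶ X₂} {w : p ⟶ p₂} (h : g ≫ (x ⊗ₘ w) = x' ≫ g₂) (Y : C) :
    leftGlue g Y ≫ (x ▷ Y ⊗ₘ w) = x' ▷ Y ≫ leftGlue g₂ Y := by
  have h1 := leftGlue_natural (g := g ≫ X ◁ w) (g₂ := g₂) (x := x) (x' := x') (by
    rw [← h, Category.assoc, tensorHom_def' x w]) (𝟙 Y)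
  rw [tensorHom_id, tensorHom_id, leftGlue_comp, Category.assoc] at h1
  rw [h1, tensorHom_def' (x ▷ Y) w]

lemma leftGlue_whiskerLeft {X' X p : C} (g : X' ⟶ X ⊗ p) {Y Y₂ : C} (y : Y ⟶ Y₂) :
    leftGlue g Y ≫ (X ◁ y ⊗ₘ 𝟙 p) = X' ◁ y ≫ leftGlue g Y₂ := by
  have h := leftGlue_natural (g := g) (g₂ := g) (x := 𝟙 _) (x' := 𝟙 _) (by simp) y
  rw [id_tensorHom, id_tensorHom] at h
  rw [tensorHom_id]
  exact h.symm

lemma associator_comp_leftGlue {X' X p : C} (g : X' ⟶ X ⊗ p) (Y Z : C) :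
    (α_ X' Y Z).hom ≫ leftGlue g (Y ⊗ Z) = leftGlue (leftGlue g Y) Z ≫ (α_ X Y Z).hom ▷ p := by
  unfold leftGlue
  rw [BraidedCategory.braiding_tensor_right_hom]
  monoidal

lemma associator_comp_rightGlue_leftGlue (X : C) {Y' Y p : C} (g : Y' ⟶ Y ⊗ p) (Z : C) :
    (α_ X Y' Z).hom ≫ rightGlue X (leftGlue g Z) =
      leftGlue (rightGlue X g) Z ≫ (α_ X Y Z).hom ▷ p := by
  unfold leftGlue rightGlue
  monoidal

lemma inv_comp_of_comp {X X₂ Y Y₂ p : C} {g : X ⟶ Y ⊗ p} {g₂ : X₂ ⟶ Y₂ ⊗ p} {a : X ≅ X₂}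
    {b : Y ≅ Y₂} (h : a.hom ≫ g₂ = g ≫ b.hom ▷ p) : g₂ ≫ (b.inv ⊗ₘ 𝟙 p) = a.inv ≫ g := by
  rw [tensorHom_id, Iso.eq_inv_comp, ← Category.assoc, h, Category.assoc, hom_inv_whiskerRight,
    Category.comp_id]

end Coherence

section Combinatorics

variable {n m r : ℕ}

lemma cast_leftVertex_leftVertex (i : Fin (n + 1)) :
    Fin.cast (congrArg (· + 1) (Nat.add_assoc n m r)) (leftVertex (n + m) r (leftVertex n m i)) =
      leftVertex n (m + r) i := by
  apply Fin.ext
  rw [Fin.val_cast, val_leftVertex, val_leftVertex, val_leftVertex]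

lemma cast_leftVertex_rightVertex (i : Fin (m + 1)) :
    Fin.cast (congrArg (· + 1) (Nat.add_assoc n m r)) (leftVertex (n + m) r (rightVertex n m i)) =
      rightVertex n (m + r) (leftVertex m r i) := by
  cases i using Fin.cases with
  | zero => rfl
  | succ i => rfl

lemma cast_rightVertex (i : Fin (r + 1)) :
    Fin.cast (congrArg (· + 1) (Nat.add_assoc n m r)) (rightVertex (n + m) r i) =
      rightVertex n (m + r) (rightVertex m r i) := by
  cases i using Fin.cases with
  | zero => rfl
  | succ i =>
    apply Fin.ext
    change n + m + (i : ℕ) + 1 = n + (m + i) + 1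
    omega

/-- The subset of `{0, …, (n + m) + r}` which corresponds to a subset of `{0, …, n + (m + r)}`. -/
def assocPart (ρ : Finset (Fin (n + (m + r) + 1))) : Finset (Fin (n + m + r + 1)) :=
  Finset.univ.filter fun i => Fin.cast (congrArg (· + 1) (Nat.add_assoc n m r)) i ∈ ρ

lemma mem_assocPart {ρ : Finset (Fin (n + (m + r) + 1))} (i : Fin (n + m + r + 1)) :
    i ∈ assocPart ρ ↔ Fin.cast (congrArg (· + 1) (Nat.add_assoc n m r)) i ∈ ρ :=
  Finset.mem_filter.trans (and_iff_right (Finset.mem_univ _))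

lemma leftPart_leftPart_assocPart (ρ : Finset (Fin (n + (m + r) + 1))) :
    leftPart n m (leftPart (n + m) r (assocPart ρ)) = leftPart n (m + r) ρ := by
  ext i
  rw [mem_leftPart, mem_leftPart, mem_assocPart, mem_leftPart, cast_leftVertex_leftVertex]

lemma rightPart_leftPart_assocPart (ρ : Finset (Fin (n + (m + r) + 1))) :
    rightPart n m (leftPart (n + m) r (assocPart ρ)) = leftPart m r (rightPart n (m + r) ρ) := by
  ext i
  rw [mem_rightPart, mem_leftPart, mem_assocPart, mem_leftPart, mem_rightPart,
    cast_leftVertex_rightVertex]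

lemma rightPart_assocPart (ρ : Finset (Fin (n + (m + r) + 1))) :
    rightPart (n + m) r (assocPart ρ) = rightPart m r (rightPart n (m + r) ρ) := by
  ext i
  rw [mem_rightPart, mem_assocPart, mem_rightPart, mem_rightPart, cast_rightVertex]

/-- The cell of `assocPart ρ` which corresponds to a cell of `ρ` with the vertex `0`. -/
def assocCell {ρ : Finset (Fin (n + (m + r) + 1))} (τ : (simplex ρ).Cell) (h : 0 ∈ τ.1) :
    (simplex (assocPart ρ)).Cell :=
  ⟨assocPart τ.1, ⟨0, (mem_assocPart 0).2 h⟩, fun i hi =>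
    (mem_assocPart i).2 (τ.2.2 ((mem_assocPart i).1 hi))⟩

lemma IsFace.assoc {c : Fin (n + m + r)} {ρ ρ' : Finset (Fin (n + (m + r) + 1))}
    (h : IsFace (Fin.cast (Nat.add_assoc n m r) c) ρ ρ') :
    IsFace c (assocPart ρ) (assocPart ρ') where
  notMem h' := h.notMem ((mem_assocPart _).1 h')
  eq := by
    ext i
    rw [mem_assocPart, h.eq, Finset.mem_insert, Finset.mem_insert, mem_assocPart]
    refine or_congr_left ?_
    rw [Fin.ext_iff, Fin.ext_iff]
    rfl

/-- The cells `τ₀`, `τ₁` and `τ₂` are the three parts of the cell `τ`. -/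
def TripleParts {ρ : Finset (Fin (n + (m + r) + 1))} (τ : (simplex ρ).Cell)
    {S₀ : Finset (Fin (n + 1))} (τ₀ : (simplex S₀).Cell) {S₁ : Finset (Fin (m + 1))}
    (τ₁ : (simplex S₁).Cell) {S₂ : Finset (Fin (r + 1))} (τ₂ : (simplex S₂).Cell) : Prop :=
  ∃ h : 0 ∈ τ.1, Parts τ τ₀ (rightFace τ h) ∧ Parts (rightFace τ h) τ₁ τ₂

lemma tripleParts_faces {ρ : Finset (Fin (n + (m + r) + 1))} (τ : (simplex ρ).Cell) (h : 0 ∈ τ.1) :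
    TripleParts τ (leftFace τ h) (leftFace (rightFace τ h) (zero_mem_rightPart h))
      (rightFace (rightFace τ h) (zero_mem_rightPart h)) :=
  ⟨h, parts_faces τ h, parts_faces _ _⟩

namespace TripleParts

variable {ρ ρ' : Finset (Fin (n + (m + r) + 1))} {τ υ : (simplex ρ).Cell}
  {S₀ S₀' : Finset (Fin (n + 1))} {τ₀ υ₀ : (simplex S₀).Cell} {S₁ S₁' : Finset (Fin (m + 1))}
  {τ₁ υ₁ : (simplex S₁).Cell} {S₂ S₂' : Finset (Fin (r + 1))} {τ₂ υ₂ : (simplex S₂).Cell}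

lemma zero_mem (h : TripleParts τ τ₀ τ₁ τ₂) : 0 ∈ τ.1 := h.choose

lemma parts (h : TripleParts τ τ₀ τ₁ τ₂) : Parts τ τ₀ (rightFace τ h.zero_mem) :=
  h.choose_spec.1

lemma parts_right (h : TripleParts τ τ₀ τ₁ τ₂) : Parts (rightFace τ h.zero_mem) τ₁ τ₂ :=
  h.choose_spec.2

lemma of_parts {S : Finset (Fin (m + r + 1))} {σ : (simplex S).Cell} (h : Parts τ τ₀ σ)
    (h' : Parts σ τ₁ τ₂) : TripleParts τ τ₀ τ₁ τ₂ := by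
  obtain ⟨h0, e1, rfl, e2, e3⟩ := h
  obtain rfl : rightFace τ h0 = σ := Subtype.ext e3
  exact ⟨h0, ⟨h0, e1, rfl, e2, rfl⟩, h'⟩

lemma parts_assoc (h : TripleParts τ τ₀ τ₁ τ₂) :
    Parts (assocCell τ h.zero_mem) (leftFace (assocCell τ h.zero_mem)
      ((mem_assocPart 0).2 h.zero_mem)) τ₂ where
  zero_mem := (mem_assocPart 0).2 h.zero_mem
  left := rfl
  right := (rightPart_assocPart ρ).trans h.parts_right.right
  left_val := rfl
  right_val := (rightPart_assocPart τ.1).trans h.parts_right.right_val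

lemma parts_assoc_left (h : TripleParts τ τ₀ τ₁ τ₂) :
    Parts (leftFace (assocCell τ h.zero_mem) ((mem_assocPart 0).2 h.zero_mem)) τ₀ τ₁ where
  zero_mem := zero_mem_leftPart ((mem_assocPart 0).2 h.zero_mem)
  left := (leftPart_leftPart_assocPart ρ).trans h.parts.left
  right := (rightPart_leftPart_assocPart ρ).trans h.parts_right.left
  left_val := (leftPart_leftPart_assocPart τ.1).trans h.parts.left_val
  right_val := (rightPart_leftPart_assocPart τ.1).trans h.parts_right.left_val

lemma face₀ {a : Fin n} (hp : TripleParts τ τ₀ τ₁ τ₂) (h : IsFace (Fin.castAdd (m + r) a) ρ ρ')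
    (h' : IsFace a S₀ S₀') : TripleParts (h.face τ) (h'.face τ₀) τ₁ τ₂ :=
  of_parts (hp.parts.face_left h h') hp.parts_right

lemma face₁ {b : Fin m} (hp : TripleParts τ τ₀ τ₁ τ₂)
    (h : IsFace (Fin.natAdd n (Fin.castAdd r b)) ρ ρ') (h' : IsFace b S₁ S₁') :
    TripleParts (h.face τ) τ₀ (h'.face τ₁) τ₂ :=
  of_parts (hp.parts.face_right h h.right) (hp.parts_right.face_left h.right h')

lemma face₂ {c : Fin r} (hp : TripleParts τ τ₀ τ₁ τ₂)
    (h : IsFace (Fin.natAdd n (Fin.natAdd m c)) ρ ρ') (h' : IsFace c S₂ S₂') :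
    TripleParts (h.face τ) τ₀ τ₁ (h'.face τ₂) :=
  of_parts (hp.parts.face_right h h.right) (hp.parts_right.face_right h.right h')

lemma mono (h : TripleParts τ τ₀ τ₁ τ₂) (h' : TripleParts υ υ₀ υ₁ υ₂) (hτ : τ.1 ⊆ υ.1) :
    τ₀.1 ⊆ υ₀.1 ∧ τ₁.1 ⊆ υ₁.1 ∧ τ₂.1 ⊆ υ₂.1 := by
  obtain ⟨h1, h2⟩ := h.parts.mono h'.parts hτ
  exact ⟨h1, h.parts_right.mono h'.parts_right h2⟩

end TripleParts

end Combinatorics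

end

section

open Unor

variable {A : Type u} [Category.{v} A] [BalancedCategory A] [EmptyInitial A] [MonoidalCategory A]
  [GradedSymmetricCategory A] {n m r : ℕ}

variable {T : AdTheory A} {P : Fin n → StarAd T} {Q : Fin m → StarAd T} {R : Fin r → StarAd T}
  {K L J : OrientedBallComplex} {k l j : ℤ}

/-- The sign which relates the orientation of a cell of a triple product to the orientations of
its parts. -/
def tripleSign (P : Fin n → StarAd T) (Q : Fin m → StarAd T) (k l j : ℤ) (S₀ : Finset (Fin (n + 1)))
    (S₁ : Finset (Fin (m + 1))) (d d' t₀ t₁ t₂ : ℕ) : ℤˣ :=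
  extSign Q l j S₁ d' t₁ t₂ * extSign P k (l + j) S₀ (d + d') t₀ (t₁ + t₂)

lemma tripleSign_eq (P : Fin n → StarAd T) (Q : Fin m → StarAd T) (k l j : ℤ)
    {S : Finset (Fin (n + m + 1))} {S₀ : Finset (Fin (n + 1))} {S₁ : Finset (Fin (m + 1))}
    (h₀ : leftPart n m S = S₀) (h₁ : rightPart n m S = S₁) (d d' t₀ t₁ t₂ : ℕ) :
    extSign (Fin.append P Q) (k + l) j S d' (t₀ + t₁) t₂ * extSign P k l S₀ d t₀ t₁ =
      tripleSign P Q k l j S₀ S₁ d d' t₀ t₁ t₂ := by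
  unfold tripleSign extSign
  rw [miss_append, h₀, h₁, ← psign_add, ← psign_add]
  congr 1
  push_cast
  ring

/-- The values of `Z` are the values of the triple product `(M × N) × O`. -/
structure TripleIso (M : AdSing T P K k) (N : AdSing T Q L l) (O : AdSing T R J j) {d : ℤ}
    (Z : AdSing T (Fin.append P (Fin.append Q R)) ((K.prod L).prod J) d) where
  iso : ∀ (κ : K.Cell) (κ' : L.Cell) (κ'' : J.Cell) {ρ : Finset (Fin (n + (m + r) + 1))}
    {τ : (simplex ρ).Cell} {S₀ : Finset (Fin (n + 1))} {τ₀ : (simplex S₀).Cell}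
    {S₁ : Finset (Fin (m + 1))} {τ₁ : (simplex S₁).Cell} {S₂ : Finset (Fin (r + 1))}
    {τ₂ : (simplex S₂).Cell}, TripleParts τ τ₀ τ₁ τ₂ →
      (Z.bar ρ ((κ, κ'), κ'') τ ≅ (M.bar S₀ κ τ₀ ⊗ N.bar S₁ κ' τ₁) ⊗ O.bar S₂ κ'' τ₂)
  isSigned : ∀ (κ : K.Cell) (κ' : L.Cell) (κ'' : J.Cell) {ρ : Finset (Fin (n + (m + r) + 1))}
    {τ : (simplex ρ).Cell} {S₀ : Finset (Fin (n + 1))} {τ₀ : (simplex S₀).Cell}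
    {S₁ : Finset (Fin (m + 1))} {τ₁ : (simplex S₁).Cell} {S₂ : Finset (Fin (r + 1))}
    {τ₂ : (simplex S₂).Cell} (h : TripleParts τ τ₀ τ₁ τ₂),
    IsSigned (tripleSign P Q k l j S₀ S₁ (L.dim κ') (J.dim κ'') ((simplex _).dim τ₀)
      ((simplex _).dim τ₁) ((simplex _).dim τ₂)) (iso κ κ' κ'' h).hom ∧
    IsSigned (tripleSign P Q k l j S₀ S₁ (L.dim κ') (J.dim κ'') ((simplex _).dim τ₀)
      ((simplex _).dim τ₁) ((simplex _).dim τ₂)) (iso κ κ' κ'' h).inv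
  barMap : ∀ {κ ν : K.Cell} {κ' ν' : L.Cell} {κ'' ν'' : J.Cell}
    {ρ : Finset (Fin (n + (m + r) + 1))} {τ υ : (simplex ρ).Cell} {S₀ : Finset (Fin (n + 1))}
    {τ₀ υ₀ : (simplex S₀).Cell} {S₁ : Finset (Fin (m + 1))} {τ₁ υ₁ : (simplex S₁).Cell}
    {S₂ : Finset (Fin (r + 1))} {τ₂ υ₂ : (simplex S₂).Cell} (h : TripleParts τ τ₀ τ₁ τ₂)
    (h' : TripleParts υ υ₀ υ₁ υ₂) (hκ : K.carrier κ ⊆ K.carrier ν)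
    (hκ' : L.carrier κ' ⊆ L.carrier ν') (hκ'' : J.carrier κ'' ⊆ J.carrier ν'') (hτ : τ.1 ⊆ υ.1),
    Z.barMap (prod_carrier_subset (prod_carrier_subset hκ hκ') hκ'') hτ ≫
        (iso ν ν' ν'' h').hom =
      (iso κ κ' κ'' h).hom ≫ ((M.barMap hκ (h.mono h' hτ).1 ⊗ₘ N.barMap hκ' (h.mono h' hτ).2.1) ⊗ₘ
        O.barMap hκ'' (h.mono h' hτ).2.2)
  barGlue₀ : ∀ {a : Fin n} {ρ ρ' : Finset (Fin (n + (m + r) + 1))}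
    (h : IsFace (Fin.castAdd (m + r) a) ρ ρ') {S₀ S₀' : Finset (Fin (n + 1))}
    (h₀ : IsFace a S₀ S₀') (κ : K.Cell) (κ' : L.Cell) (κ'' : J.Cell) {τ : (simplex ρ).Cell}
    {τ₀ : (simplex S₀).Cell} {S₁ : Finset (Fin (m + 1))} {τ₁ : (simplex S₁).Cell}
    {S₂ : Finset (Fin (r + 1))} {τ₂ : (simplex S₂).Cell} (hp : TripleParts τ τ₀ τ₁ τ₂)
    (hw : (Fin.append P (Fin.append Q R) (Fin.castAdd (m + r) a)).obj 1 =
      (sgn A 1).obj ((P a).obj 1)),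
    (Z.barGlue h ((κ, κ'), κ'') τ).hom ≫ ((iso κ κ' κ'' hp).hom ⊗ₘ can 1 hw) =
      (iso κ κ' κ'' (hp.face₀ h h₀)).hom ≫
        leftGlue (leftGlue (M.barGlue h₀ κ τ₀).hom (N.bar S₁ κ' τ₁)) (O.bar S₂ κ'' τ₂)
  barGlue₁ : ∀ {b : Fin m} {ρ ρ' : Finset (Fin (n + (m + r) + 1))}
    (h : IsFace (Fin.natAdd n (Fin.castAdd r b)) ρ ρ') {S₁ S₁' : Finset (Fin (m + 1))}
    (h₁ : IsFace b S₁ S₁') (κ : K.Cell) (κ' : L.Cell) (κ'' : J.Cell) {τ : (simplex ρ).Cell}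
    {S₀ : Finset (Fin (n + 1))} {τ₀ : (simplex S₀).Cell} {τ₁ : (simplex S₁).Cell}
    {S₂ : Finset (Fin (r + 1))} {τ₂ : (simplex S₂).Cell} (hp : TripleParts τ τ₀ τ₁ τ₂)
    (hw : (Fin.append P (Fin.append Q R) (Fin.natAdd n (Fin.castAdd r b))).obj 1 =
      (sgn A 1).obj ((Q b).obj 1)),
    (Z.barGlue h ((κ, κ'), κ'') τ).hom ≫ ((iso κ κ' κ'' hp).hom ⊗ₘ can 1 hw) =
      (iso κ κ' κ'' (hp.face₁ h h₁)).hom ≫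
        leftGlue (rightGlue (M.bar S₀ κ τ₀) (N.barGlue h₁ κ' τ₁).hom) (O.bar S₂ κ'' τ₂)
  barGlue₂ : ∀ {c : Fin r} {ρ ρ' : Finset (Fin (n + (m + r) + 1))}
    (h : IsFace (Fin.natAdd n (Fin.natAdd m c)) ρ ρ') {S₂ S₂' : Finset (Fin (r + 1))}
    (h₂ : IsFace c S₂ S₂') (κ : K.Cell) (κ' : L.Cell) (κ'' : J.Cell) {τ : (simplex ρ).Cell}
    {S₀ : Finset (Fin (n + 1))} {τ₀ : (simplex S₀).Cell} {S₁ : Finset (Fin (m + 1))}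
    {τ₁ : (simplex S₁).Cell} {τ₂ : (simplex S₂).Cell} (hp : TripleParts τ τ₀ τ₁ τ₂)
    (hw : (Fin.append P (Fin.append Q R) (Fin.natAdd n (Fin.natAdd m c))).obj 1 =
      (sgn A 1).obj ((R c).obj 1)),
    (Z.barGlue h ((κ, κ'), κ'') τ).hom ≫ ((iso κ κ' κ'' hp).hom ⊗ₘ can 1 hw) =
      (iso κ κ' κ'' (hp.face₂ h h₂)).hom ≫
        rightGlue (M.bar S₀ κ τ₀ ⊗ N.bar S₁ κ' τ₁) (O.barGlue h₂ κ'' τ₂).hom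

lemma append_append_obj₀ (P : Fin n → StarAd T) (Q : Fin m → StarAd T) (R : Fin r → StarAd T)
    (a : Fin n) : (Fin.append P (Fin.append Q R) (Fin.castAdd (m + r) a)).obj 1 =
      (sgn A 1).obj ((P a).obj 1) :=
  append_left_obj_eq P _ a 1

lemma append_append_obj₁ (P : Fin n → StarAd T) (Q : Fin m → StarAd T) (R : Fin r → StarAd T)
    (b : Fin m) : (Fin.append P (Fin.append Q R) (Fin.natAdd n (Fin.castAdd r b))).obj 1 =
      (sgn A 1).obj ((Q b).obj 1) := by
  rw [Fin.append_right]
  exact append_left_obj_eq Q R b 1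

lemma append_append_obj₂ (P : Fin n → StarAd T) (Q : Fin m → StarAd T) (R : Fin r → StarAd T)
    (c : Fin r) : (Fin.append P (Fin.append Q R) (Fin.natAdd n (Fin.natAdd m c))).obj 1 =
      (sgn A 1).obj ((R c).obj 1) := by
  rw [Fin.append_right]
  exact append_right_obj_eq Q R c 1

lemma trans_symm_hom_comp {C : Type u} [Category.{v} C] {X Y Z : C} (a : X ≅ Z) (b : Y ≅ Z) :
    (a ≪≫ b.symm).hom ≫ (b ≪≫ a.symm).hom = 𝟙 X := by
  simp

namespace TripleIso

variable {M : AdSing T P K k} {N : AdSing T Q L l} {O : AdSing T R J j} {d : ℤ}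
  {Z Z' : AdSing T (Fin.append P (Fin.append Q R)) ((K.prod L).prod J) d}
  (B : TripleIso M N O Z) (B' : TripleIso M N O Z')

/-- The values on the parts of a cell determine an isomorphism of values. -/
def compare {ρ : Finset (Fin (n + (m + r) + 1))} (κ : ((K.prod L).prod J).Cell)
    (τ : (simplex ρ).Cell) (h : 0 ∈ τ.1) : Z.bar ρ κ τ ≅ Z'.bar ρ κ τ :=
  B.iso κ.1.1 κ.1.2 κ.2 (tripleParts_faces τ h) ≪≫
    (B'.iso κ.1.1 κ.1.2 κ.2 (tripleParts_faces τ h)).symm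

lemma compare_eq {ρ : Finset (Fin (n + (m + r) + 1))} {κ : K.Cell} {κ' : L.Cell} {κ'' : J.Cell}
    {τ : (simplex ρ).Cell} (h : 0 ∈ τ.1) {S₀ : Finset (Fin (n + 1))} {τ₀ : (simplex S₀).Cell}
    {S₁ : Finset (Fin (m + 1))} {τ₁ : (simplex S₁).Cell} {S₂ : Finset (Fin (r + 1))}
    {τ₂ : (simplex S₂).Cell} (hp : TripleParts τ τ₀ τ₁ τ₂) :
    (compare B B' ((κ, κ'), κ'') τ h).hom =
      (B.iso κ κ' κ'' hp).hom ≫ (B'.iso κ κ' κ'' hp).inv := by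
  obtain ⟨h0, ⟨-, rfl, -, e0, -⟩, ⟨-, rfl, rfl, e1, e2⟩⟩ := hp
  obtain rfl : leftFace τ h = τ₀ := Subtype.ext e0
  obtain rfl : leftFace (rightFace τ h) (zero_mem_rightPart h) = τ₁ := Subtype.ext e1
  obtain rfl : rightFace (rightFace τ h) (zero_mem_rightPart h) = τ₂ := Subtype.ext e2
  rfl

/-- Two ads with the values of the triple product are isomorphic. -/
def barHom : AdSing.BarHom Z Z' where
  app κ τ h := (compare B B' κ τ h).hom
  isSigned κ τ h := ((B.isSigned κ.1.1 κ.1.2 κ.2 (tripleParts_faces τ h)).1.comp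
    (B'.isSigned κ.1.1 κ.1.2 κ.2 (tripleParts_faces τ h)).2).congr (Int.units_mul_self _)
  natural {σ κ ν τ υ} h hκ hτ := by
    obtain ⟨h1, h2⟩ := (OrientedBallComplex.prod_subset_iff (K.prod L) J κ ν).1 hκ
    obtain ⟨h3, h4⟩ := (OrientedBallComplex.prod_subset_iff K L κ.1 ν.1).1 h1
    exact map_comp_inv
      (B.barMap (tripleParts_faces τ h) (tripleParts_faces υ (hτ h)) h3 h4 h2 hτ)
      (B'.barMap (tripleParts_faces τ h) (tripleParts_faces υ (hτ h)) h3 h4 h2 hτ)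
  comm {c σ σ'} h κ τ h0 := by
    obtain ⟨⟨κ, κ'⟩, κ''⟩ := κ
    have hp := tripleParts_faces τ h0
    induction c using Fin.addCases with
    | left a =>
      have h' := hp.parts.isFace_left h
      rw [compare_eq B B' h0 hp, compare_eq B B' (τ := h.face τ) h0 (hp.face₀ h h')]
      have hw := append_append_obj₀ P Q R a
      exact glue_comp_inv (w := can 1 hw) (B.barGlue₀ h h' κ κ' κ'' hp hw)
        (B'.barGlue₀ h h' κ κ' κ'' hp hw)
    | right c =>
      induction c using Fin.addCases with
      | left b =>
        have h' := hp.parts_right.isFace_left h.right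
        rw [compare_eq B B' h0 hp, compare_eq B B' (τ := h.face τ) h0 (hp.face₁ h h')]
        have hw := append_append_obj₁ P Q R b
        exact glue_comp_inv (w := can 1 hw) (B.barGlue₁ h h' κ κ' κ'' hp hw)
          (B'.barGlue₁ h h' κ κ' κ'' hp hw)
      | right c =>
        have h' := hp.parts_right.isFace_right h.right
        rw [compare_eq B B' h0 hp, compare_eq B B' (τ := h.face τ) h0 (hp.face₂ h h')]
        have hw := append_append_obj₂ P Q R c
        exact glue_comp_inv (w := can 1 hw) (B.barGlue₂ h h' κ κ' κ'' hp hw)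
          (B'.barGlue₂ h h' κ κ' κ'' hp hw)

lemma compare_comp_compare {ρ : Finset (Fin (n + (m + r) + 1))} (κ : ((K.prod L).prod J).Cell)
    (τ : (simplex ρ).Cell) (h : 0 ∈ τ.1) :
    (compare B B' κ τ h).hom ≫ (compare B' B κ τ h).hom = 𝟙 _ :=
  trans_symm_hom_comp _ _

/-- Two ads with the values of the triple product are isomorphic. -/
def natIso : Z.1.F ≅ Z'.1.F :=
  (barHom B B').natIso (barHom B' B) (fun κ τ h => compare_comp_compare B B' κ τ h)
    (fun κ τ h => compare_comp_compare B' B κ τ h)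

end TripleIso

end

section

open Unor

variable {A : Type u} [Category.{v} A] [BalancedCategory A] [EmptyInitial A] [MonoidalCategory A]
  [GradedSymmetricCategory A] {n m r : ℕ}

variable {T : AdTheory A} {P : Fin n → StarAd T} {Q : Fin m → StarAd T} {R : Fin r → StarAd T}
  {K L J : OrientedBallComplex} {k l j : ℤ}

lemma can_comp_can_one {X X' X'' : A} (h : X'' = (sgn A 1).obj X') (h' : X' = (sgn A 1).obj X)
    (h'' : X'' = (sgn A 1).obj X) : can 1 h ≫ can 1 h' = can 1 h'' :=
  (can_comp_can h h').trans (can_congr _ (mul_one 1))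

section Right

variable {M : AdSing T P K k} {N : AdSing T Q L l} {O : AdSing T R J j}
  {N' : AdSing T (Fin.append Q R) (L.prod J) (l + j)}
  {Z : AdSing T (Fin.append P (Fin.append Q R)) (K.prod (L.prod J)) (k + (l + j))}
  (H : IsBarProd M N' Z) (H' : IsBarProd N O N')

/-- The values of a product `M × (N × O)`. -/
def rightIso (κ : K.Cell) (κ' : L.Cell) (κ'' : J.Cell) {ρ : Finset (Fin (n + (m + r) + 1))}
    {τ : (simplex ρ).Cell} {S₀ : Finset (Fin (n + 1))} {τ₀ : (simplex S₀).Cell}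
    {S : Finset (Fin (m + r + 1))} {σ : (simplex S).Cell}
    {S₁ : Finset (Fin (m + 1))} {τ₁ : (simplex S₁).Cell} {S₂ : Finset (Fin (r + 1))}
    {τ₂ : (simplex S₂).Cell} (h : Parts τ τ₀ σ) (h' : Parts σ τ₁ τ₂) :
    (Z.pull (K.prodAssoc L J)).bar ρ ((κ, κ'), κ'') τ ≅
      (M.bar S₀ κ τ₀ ⊗ N.bar S₁ κ' τ₁) ⊗ O.bar S₂ κ'' τ₂ :=
  Z.pullIso (K.prodAssoc L J) ρ ((κ, κ'), κ'') τ ≪≫ H.iso κ (κ', κ'') h ≪≫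
    whiskerLeftIso (M.bar S₀ κ τ₀) (H'.iso κ' κ'' h') ≪≫ (α_ _ _ _).symm

lemma rightIso_eq {κ : K.Cell} {κ' : L.Cell} {κ'' : J.Cell} {ρ : Finset (Fin (n + (m + r) + 1))}
    {τ : (simplex ρ).Cell} {S₀ : Finset (Fin (n + 1))} {τ₀ : (simplex S₀).Cell}
    {S : Finset (Fin (m + r + 1))} {σ : (simplex S).Cell}
    {S₁ : Finset (Fin (m + 1))} {τ₁ : (simplex S₁).Cell} {S₂ : Finset (Fin (r + 1))}
    {τ₂ : (simplex S₂).Cell} (h : TripleParts τ τ₀ τ₁ τ₂) (hp : Parts τ τ₀ σ)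
    (hq : Parts σ τ₁ τ₂) : rightIso H H' κ κ' κ'' h.parts h.parts_right =
      rightIso H H' κ κ' κ'' hp hq := by
  obtain ⟨h0, e1, rfl, e2, e3⟩ := hp
  obtain rfl : rightFace τ h0 = σ := Subtype.ext e3
  rfl

/-- A product `M × (N × O)` has the values of the triple product. -/
def rightTripleIso : TripleIso M N O (Z.pull (K.prodAssoc L J)) where
  iso κ κ' κ'' {ρ τ S₀ τ₀ S₁ τ₁ S₂ τ₂} h := rightIso H H' κ κ' κ'' h.parts h.parts_right
  isSigned κ κ' κ'' {ρ τ S₀ τ₀ S₁ τ₁ S₂ τ₂} h := by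
    have e : (1 : ℤˣ) * (extSign P k (l + j) S₀ (L.dim κ' + J.dim κ'') ((simplex _).dim τ₀)
        ((simplex _).dim (rightFace τ h.zero_mem)) * (extSign Q l j S₁ (J.dim κ'')
        ((simplex _).dim τ₁) ((simplex _).dim τ₂) * 1)) =
        tripleSign P Q k l j S₀ S₁ (L.dim κ') (J.dim κ'') ((simplex _).dim τ₀)
          ((simplex _).dim τ₁) ((simplex _).dim τ₂) := by
      rw [h.parts_right.dim_eq, one_mul, mul_one, mul_comm, tripleSign]
    constructor
    · exact ((isSigned_can _).comp ((isSigned_can _).comp (((isSigned_can _).whiskerLeft _).comp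
        (isSigned_associator_inv _ _ _)))).congr e
    · refine (((((isSigned_associator _ _ _).comp (((isSigned_can _).whiskerLeft _))).comp
        (isSigned_can _)).comp (isSigned_can _)).congr (Eq.trans ?_ e))
      rw [mul_comm (1 : ℤˣ), mul_comm _ (extSign P k _ _ _ _ _), mul_comm]
      rfl
  barMap {κ ν κ' ν' κ'' ν'' ρ τ υ S₀ τ₀ υ₀ S₁ τ₁ υ₁ S₂ τ₂ υ₂} h h' hκ hκ' hκ'' hτ := by
    refine map_trans (Z.barMap_pullIso (K.prodAssoc L J) (prod_carrier_subset
      (prod_carrier_subset hκ hκ') hκ'') hτ) ?_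
    refine map_trans (H.barMap_iso h.parts h'.parts hκ (prod_carrier_subset hκ' hκ'') hτ _) ?_
    refine map_trans (f₂ := M.barMap hκ (h.mono h' hτ).1 ⊗ₘ
      (N.barMap hκ' (h.mono h' hτ).2.1 ⊗ₘ O.barMap hκ'' (h.mono h' hτ).2.2)) ?_ ?_
    · refine (tensorHom_comp_whiskerLeft _ _ _).trans (Eq.trans ?_
        (whiskerLeft_comp_tensorHom _ _ _).symm)
      exact congrArg (_ ⊗ₘ ·) (H'.barMap_iso h.parts_right h'.parts_right hκ' hκ'' _ _)
    · exact associator_inv_naturality _ _ _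
  barGlue₀ {a ρ ρ'} h {S₀ S₀'} h₀ κ κ' κ'' {τ τ₀ S₁ τ₁ S₂ τ₂} hp hw := by
    rw [rightIso_eq H H' (hp.face₀ h h₀) (hp.parts.face_left h h₀) hp.parts_right]
    refine Eq.trans (congrArg (fun x => _ ≫ (_ ⊗ₘ x)) ?_)
      (glue_trans (Z.barGlue_pullIso (K.prodAssoc L J) h ((κ, κ'), κ'') τ)
      (glue_trans (H.barGlue_iso_left h h₀ κ (κ', κ'') hp.parts (hp.parts.face_left h h₀))
      (glue_trans (leftGlue_whiskerLeft _ (H'.iso κ' κ'' hp.parts_right).hom)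
      (inv_comp_of_comp (associator_comp_leftGlue _ _ _)))))
    rw [Category.id_comp, Category.comp_id, Category.comp_id]
    rfl
  barGlue₁ {b ρ ρ'} h {S₁ S₁'} h₁ κ κ' κ'' {τ S₀ τ₀ τ₁ S₂ τ₂} hp hw := by
    rw [rightIso_eq H H' (hp.face₁ h h₁) (hp.parts.face_right h h.right)
      (hp.parts_right.face_left h.right h₁)]
    refine Eq.trans (congrArg (fun x => _ ≫ (_ ⊗ₘ x)) ?_)
      (glue_trans (Z.barGlue_pullIso (K.prodAssoc L J) h ((κ, κ'), κ'') τ)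
      (glue_trans (H.barGlue_iso_right h h.right κ (κ', κ'') hp.parts
        (hp.parts.face_right h h.right))
      (glue_trans (rightGlue_comp_tensorHom _ (H'.barGlue_iso_left h.right h₁ κ' κ''
        hp.parts_right (hp.parts_right.face_left h.right h₁)))
      (inv_comp_of_comp (associator_comp_rightGlue_leftGlue _ _ _)))))
    rw [Category.id_comp, Category.comp_id]
    exact (can_comp_can_one _ _ hw).symm
  barGlue₂ {c ρ ρ'} h {S₂ S₂'} h₂ κ κ' κ'' {τ S₀ τ₀ S₁ τ₁ τ₂} hp hw := by
    rw [rightIso_eq H H' (hp.face₂ h h₂) (hp.parts.face_right h h.right)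
      (hp.parts_right.face_right h.right h₂)]
    refine Eq.trans (congrArg (fun x => _ ≫ (_ ⊗ₘ x)) ?_)
      (glue_trans (Z.barGlue_pullIso (K.prodAssoc L J) h ((κ, κ'), κ'') τ)
      (glue_trans (H.barGlue_iso_right h h.right κ (κ', κ'') hp.parts
        (hp.parts.face_right h h.right))
      (glue_trans (rightGlue_comp_tensorHom _ (H'.barGlue_iso_right h.right h₂ κ' κ''
        hp.parts_right (hp.parts_right.face_right h.right h₂)))
      (inv_comp_of_comp (associator_comp_rightGlue_rightGlue _ _ _)))))
    rw [Category.id_comp, Category.comp_id]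
    exact (can_comp_can_one _ _ hw).symm

end Right

section Left

variable {M : AdSing T P K k} {N : AdSing T Q L l} {O : AdSing T R J j}
  {M' : AdSing T (Fin.append P Q) (K.prod L) (k + l)}
  {Z : AdSing T (Fin.append (Fin.append P Q) R) ((K.prod L).prod J) (k + l + j)}
  (H : IsBarProd M' O Z) (H' : IsBarProd M N M')

/-- The values of a product `(M × N) × O`. -/
def leftIso (κ : K.Cell) (κ' : L.Cell) (κ'' : J.Cell) {ρ : Finset (Fin (n + (m + r) + 1))}
    {τ : (simplex ρ).Cell} {ρ' : Finset (Fin (n + m + r + 1))} {τ' : (simplex ρ').Cell}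
    {S : Finset (Fin (n + m + 1))} {σ : (simplex S).Cell}
    {S₀ : Finset (Fin (n + 1))} {τ₀ : (simplex S₀).Cell}
    {S₁ : Finset (Fin (m + 1))} {τ₁ : (simplex S₁).Cell} {S₂ : Finset (Fin (r + 1))}
    {τ₂ : (simplex S₂).Cell}
    (hρ : ∀ i, i ∈ ρ' ↔ Fin.cast (congrArg (· + 1) (Nat.add_assoc n m r)) i ∈ ρ)
    (hτ : ∀ i, i ∈ τ'.1 ↔ Fin.cast (congrArg (· + 1) (Nat.add_assoc n m r)) i ∈ τ.1)
    (h : Parts τ' σ τ₂) (h' : Parts σ τ₀ τ₁) :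
    (Z.relabel (Nat.add_assoc n m r) (Fin.append_assoc P Q R) (Int.add_assoc k l j)).bar ρ
        ((κ, κ'), κ'') τ ≅ (M.bar S₀ κ τ₀ ⊗ N.bar S₁ κ' τ₁) ⊗ O.bar S₂ κ'' τ₂ :=
  Z.relabelIso (Nat.add_assoc n m r) (Fin.append_assoc P Q R) (Int.add_assoc k l j) hρ
      ((κ, κ'), κ'') hτ ≪≫ H.iso (κ, κ') κ'' h ≪≫
    whiskerRightIso (H'.iso κ κ' h') (O.bar S₂ κ'' τ₂)

lemma leftIso_eq {κ : K.Cell} {κ' : L.Cell} {κ'' : J.Cell} {ρ : Finset (Fin (n + (m + r) + 1))}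
    {τ : (simplex ρ).Cell} {ρ' : Finset (Fin (n + m + r + 1))} {τ' : (simplex ρ').Cell}
    {S S' : Finset (Fin (n + m + 1))} {σ : (simplex S).Cell} {σ' : (simplex S').Cell}
    {S₀ : Finset (Fin (n + 1))} {τ₀ : (simplex S₀).Cell}
    {S₁ : Finset (Fin (m + 1))} {τ₁ : (simplex S₁).Cell} {S₂ : Finset (Fin (r + 1))}
    {τ₂ : (simplex S₂).Cell}
    (hρ : ∀ i, i ∈ ρ' ↔ Fin.cast (congrArg (· + 1) (Nat.add_assoc n m r)) i ∈ ρ)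
    (hτ : ∀ i, i ∈ τ'.1 ↔ Fin.cast (congrArg (· + 1) (Nat.add_assoc n m r)) i ∈ τ.1)
    (h : Parts τ' σ τ₂) (h' : Parts σ τ₀ τ₁) (hp : Parts τ' σ' τ₂) (hq : Parts σ' τ₀ τ₁) :
    leftIso H H' κ κ' κ'' hρ hτ h h' = leftIso H H' κ κ' κ'' hρ hτ hp hq := by
  obtain ⟨h0, rfl, e1, e2, e3⟩ := h
  obtain rfl : leftFace τ' h0 = σ := Subtype.ext e2
  obtain ⟨-, rfl, e1, e2, e3⟩ := hp
  obtain rfl : leftFace τ' h0 = σ' := Subtype.ext e2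
  rfl

/-- A product `(M × N) × O` has the values of the triple product. -/
def leftTripleIso : TripleIso M N O
    (Z.relabel (Nat.add_assoc n m r) (Fin.append_assoc P Q R) (Int.add_assoc k l j)) where
  iso κ κ' κ'' {ρ τ S₀ τ₀ S₁ τ₁ S₂ τ₂} h :=
    leftIso H H' κ κ' κ'' mem_assocPart mem_assocPart h.parts_assoc h.parts_assoc_left
  isSigned κ κ' κ'' {ρ τ S₀ τ₀ S₁ τ₁ S₂ τ₂} h := by
    have e := tripleSign_eq P Q k l j h.parts_assoc_left.left h.parts_assoc_left.right (L.dim κ')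
      (J.dim κ'') ((simplex _).dim τ₀) ((simplex _).dim τ₁) ((simplex _).dim τ₂)
    rw [← h.parts_assoc_left.dim_eq] at e
    constructor
    · exact ((isSigned_can _).comp ((isSigned_can _).comp ((isSigned_can _).whiskerRight _))).congr
        ((one_mul _).trans e)
    · exact (((((isSigned_can _).whiskerRight _)).comp (isSigned_can _)).comp
        (isSigned_can _)).congr ((mul_one _).trans ((mul_comm _ _).trans e))
  barMap {κ ν κ' ν' κ'' ν'' ρ τ υ S₀ τ₀ υ₀ S₁ τ₁ υ₁ S₂ τ₂ υ₂} h h' hκ hκ' hκ'' hτ := by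
    have h1 := h.parts_assoc_left.mono h'.parts_assoc_left
    refine map_trans (Z.barMap_relabelIso _ _ _ mem_assocPart mem_assocPart mem_assocPart
      (prod_carrier_subset (prod_carrier_subset hκ hκ') hκ'') hτ) ?_
    refine map_trans (H.barMap_iso h.parts_assoc h'.parts_assoc (prod_carrier_subset hκ hκ') hκ''
      (fun i hi => (mem_assocPart i).2 (hτ ((mem_assocPart i).1 hi))) _) ?_
    refine (tensorHom_comp_whiskerRight _ _ _).trans (Eq.trans ?_
      (whiskerRight_comp_tensorHom _ _ _).symm)
    exact congrArg (· ⊗ₘ _) (H'.barMap_iso h.parts_assoc_left h'.parts_assoc_left hκ hκ' _ _)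
  barGlue₀ {a ρ ρ'} h {S₀ S₀'} h₀ κ κ' κ'' {τ τ₀ S₁ τ₁ S₂ τ₂} hp hw := by
    have hc : Fin.cast (Nat.add_assoc n m r) (Fin.castAdd r (Fin.castAdd m a)) =
        Fin.castAdd (m + r) a := rfl
    have h1 : IsFace (Fin.castAdd r (Fin.castAdd m a)) (assocPart ρ) (assocPart ρ') :=
      IsFace.assoc h
    have hq := hp.parts_assoc.face_left h1 h1.left
    have hq' := hp.parts_assoc_left.face_left h1.left h₀
    refine Eq.trans ?_ (congrArg (fun e => Iso.hom e ≫ _) (leftIso_eq H H' mem_assocPart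
      mem_assocPart (hp.face₀ h h₀).parts_assoc (hp.face₀ h h₀).parts_assoc_left hq hq').symm)
    have hv := (append_left_obj_eq P Q a 1)
    have hu := (append_left_obj_eq (Fin.append P Q) R (Fin.castAdd m a) 1)
    have ht := eq_sgn_trans hw (eq_sgn_symm (eq_sgn_trans hu hv))
    refine Eq.trans (congrArg (fun x => _ ≫ (_ ⊗ₘ x)) ?_)
      (glue_trans (Z.barGlue_relabelIso _ _ _ hc mem_assocPart mem_assocPart h h1
        ((κ, κ'), κ'') mem_assocPart ht)
      (glue_trans (H.barGlue_iso_left h1 h1.left (κ, κ') κ'' hp.parts_assoc hq)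
      (leftGlue_comp_tensorHom (H'.barGlue_iso_left h1.left h₀ κ κ' hp.parts_assoc_left hq') _)))
    exact ((congrArg (_ ≫ ·) (can_comp_can_one hu hv (eq_sgn_trans hu hv))).trans
      (can_comp_can_one ht _ hw)).symm
  barGlue₁ {b ρ ρ'} h {S₁ S₁'} h₁ κ κ' κ'' {τ S₀ τ₀ τ₁ S₂ τ₂} hp hw := by
    have hc : Fin.cast (Nat.add_assoc n m r) (Fin.castAdd r (Fin.natAdd n b)) =
        Fin.natAdd n (Fin.castAdd r b) := rfl
    have h1 : IsFace (Fin.castAdd r (Fin.natAdd n b)) (assocPart ρ) (assocPart ρ') :=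
      IsFace.assoc h
    have hq := hp.parts_assoc.face_left h1 h1.left
    have hq' := hp.parts_assoc_left.face_right h1.left h₁
    refine Eq.trans ?_ (congrArg (fun e => Iso.hom e ≫ _) (leftIso_eq H H' mem_assocPart
      mem_assocPart (hp.face₁ h h₁).parts_assoc (hp.face₁ h h₁).parts_assoc_left hq hq').symm)
    have hv := (append_right_obj_eq P Q b 1)
    have hu := (append_left_obj_eq (Fin.append P Q) R (Fin.natAdd n b) 1)
    have ht := eq_sgn_trans hw (eq_sgn_symm (eq_sgn_trans hu hv))
    refine Eq.trans (congrArg (fun x => _ ≫ (_ ⊗ₘ x)) ?_)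
      (glue_trans (Z.barGlue_relabelIso _ _ _ hc mem_assocPart mem_assocPart h h1
        ((κ, κ'), κ'') mem_assocPart ht)
      (glue_trans (H.barGlue_iso_left h1 h1.left (κ, κ') κ'' hp.parts_assoc hq)
      (leftGlue_comp_tensorHom (H'.barGlue_iso_right h1.left h₁ κ κ' hp.parts_assoc_left hq') _)))
    exact ((congrArg (_ ≫ ·) (can_comp_can_one hu hv (eq_sgn_trans hu hv))).trans
      (can_comp_can_one ht _ hw)).symm
  barGlue₂ {c ρ ρ'} h {S₂ S₂'} h₂ κ κ' κ'' {τ S₀ τ₀ S₁ τ₁ τ₂} hp hw := by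
    have hc : Fin.cast (Nat.add_assoc n m r) (Fin.natAdd (n + m) c) =
        Fin.natAdd n (Fin.natAdd m c) := Fin.ext (Nat.add_assoc n m c)
    have h1 : IsFace (Fin.natAdd (n + m) c) (assocPart ρ) (assocPart ρ') :=
      IsFace.assoc (hc.symm ▸ h)
    have hq := hp.parts_assoc.face_right h1 h₂
    refine Eq.trans ?_ (congrArg (fun e => Iso.hom e ≫ _) (leftIso_eq H H' mem_assocPart
      mem_assocPart (hp.face₂ h h₂).parts_assoc (hp.face₂ h h₂).parts_assoc_left hq
      hp.parts_assoc_left).symm)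
    have hu := (append_right_obj_eq (Fin.append P Q) R c 1)
    have ht := eq_sgn_trans hw (eq_sgn_symm hu)
    refine Eq.trans (congrArg (fun x => _ ≫ (_ ⊗ₘ x)) ?_)
      (glue_trans (Z.barGlue_relabelIso _ _ _ hc mem_assocPart mem_assocPart h h1
        ((κ, κ'), κ'') mem_assocPart ht)
      (glue_trans (H.barGlue_iso_right h1 h₂ (κ, κ') κ'' hp.parts_assoc hq)
      (rightGlue_whiskerRight (H'.iso κ κ' hp.parts_assoc_left).hom _)))
    rw [Category.comp_id]
    exact (can_comp_can_one ht hu hw).symm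

end Left

end

section

open Unor

variable {A : Type u} [Category.{v} A] [BalancedCategory A] [EmptyInitial A] [MonoidalCategory A]
  [GradedSymmetricCategory A] {n m r : ℕ}

lemma Unor.of_associator_comp_can {X Y Z X₀ Y₀ Z₀ : A} {x y z : ℤˣ} (hX : X = (sgn A x).obj X₀)
    (hY : Y = (sgn A y).obj Y₀) (hZ : Z = (sgn A z).obj Z₀) :
    of (α_ X Y Z).hom ≫ can (x * (y * z)) (eq_sgn_tensor hX (eq_sgn_tensor hY hZ)) =
      can (x * y * z) (eq_sgn_tensor (eq_sgn_tensor hX hY) hZ) ≫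
        (α_ (mk X₀) (mk Y₀) (mk Z₀)).hom := by
  have h3 : can (x * (y * z)) (eq_sgn_tensor hX (eq_sgn_tensor hY hZ)) =
      can x hX ⊗ₘ can y hY ⊗ₘ can z hZ :=
    (can_tensorHom_can hX (eq_sgn_tensor hY hZ)).symm.trans
      (congrArg (_ ⊗ₘ ·) (can_tensorHom_can hY hZ).symm)
  have h4 : can (x * y * z) (eq_sgn_tensor (eq_sgn_tensor hX hY) hZ) =
      (can x hX ⊗ₘ can y hY) ⊗ₘ can z hZ :=
    (can_tensorHom_can (eq_sgn_tensor hX hY) hZ).symm.trans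
      (congrArg (· ⊗ₘ _) (can_tensorHom_can hX hY).symm)
  refine (congrArg (_ ≫ ·) h3).trans (Eq.trans ?_ (congrArg (· ≫ _) h4.symm))
  exact (associator_naturality _ _ _).symm

variable {T : AdTheory A} {P : Fin n → StarAd T} {Q : Fin m → StarAd T} {R : Fin r → StarAd T}
  {K L J : OrientedBallComplex} {k l j : ℤ} {M : AdSing T P K k} {N : AdSing T Q L l}
  {O : AdSing T R J j}

lemma comp_inv_comp_hom {C : Type u} [Category.{v} C] {V W X Y Y' : C} (a : V ⟶ W) (b : W ⟶ X)
    (c : X ⟶ Y) (d : Y' ≅ Y) : (a ≫ b ≫ c ≫ d.inv) ≫ d.hom = a ≫ b ≫ c := by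
  simp

section Right

variable {N' : AdSing T (Fin.append Q R) (L.prod J) (l + j)}
  {Z : AdSing T (Fin.append P (Fin.append Q R)) (K.prod (L.prod J)) (k + (l + j))}
  (H : IsBarProd M N' Z) (H' : IsBarProd N O N')

lemma rightTripleIso_hom {κ : K.Cell} {κ' : L.Cell} {κ'' : J.Cell}
    {ρ : Finset (Fin (n + (m + r) + 1))} {τ : (simplex ρ).Cell} {S₀ : Finset (Fin (n + 1))}
    {τ₀ : (simplex S₀).Cell} {S₁ : Finset (Fin (m + 1))} {τ₁ : (simplex S₁).Cell}
    {S₂ : Finset (Fin (r + 1))} {τ₂ : (simplex S₂).Cell} (h : TripleParts τ τ₀ τ₁ τ₂) :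
    ∃ e : ((Z.pull (K.prodAssoc L J)).bar ρ ((κ, κ'), κ'') τ).as =
      (sgn A (tripleSign P Q k l j S₀ S₁ (L.dim κ') (J.dim κ'') ((simplex _).dim τ₀)
        ((simplex _).dim τ₁) ((simplex _).dim τ₂))).obj
        ((M.bar S₀ κ τ₀).as ⊗ ((N.bar S₁ κ' τ₁).as ⊗ (O.bar S₂ κ'' τ₂).as)),
      ((rightTripleIso H H').iso κ κ' κ'' h).hom ≫ (α_ _ _ _).hom = can _ e := by
  have e : (1 : ℤˣ) * (extSign P k (l + j) S₀ (L.dim κ' + J.dim κ'') ((simplex _).dim τ₀)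
      ((simplex _).dim (rightFace τ h.zero_mem)) * (extSign Q l j S₁ (J.dim κ'')
      ((simplex _).dim τ₁) ((simplex _).dim τ₂))) =
      tripleSign P Q k l j S₀ S₁ (L.dim κ') (J.dim κ'') ((simplex _).dim τ₀)
        ((simplex _).dim τ₁) ((simplex _).dim τ₂) := by
    rw [h.parts_right.dim_eq, one_mul, mul_comm, tripleSign]
  have h1 := Z.pull_bar_eq (K.prodAssoc L J) ρ ((κ, κ'), κ'') τ
  have h2 := H.bar_eq κ (κ', κ'') h.parts
  have h3 := eq_sgn_tensor_left (H'.bar_eq κ' κ'' h.parts_right) (M.bar S₀ κ τ₀).as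
  have h4 := eq_sgn_trans h1 (eq_sgn_trans h2 h3)
  refine ⟨h4.trans (congrArg (fun s => (sgn A s).obj _) e), ?_⟩
  refine (comp_inv_comp_hom (Z.pullIso (K.prodAssoc L J) ρ ((κ, κ'), κ'') τ).hom _ _ (α_ _ _ _)).trans ?_
  refine (congrArg (fun x => _ ≫ _ ≫ x) (whiskerLeft_can _ _)).trans ?_
  refine (congrArg (fun x => _ ≫ x) (can_comp_can h2 h3)).trans ?_
  exact (can_comp_can h1 _).trans (can_congr _ e)

end Right

section Left

variable {M' : AdSing T (Fin.append P Q) (K.prod L) (k + l)}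
  {Z : AdSing T (Fin.append (Fin.append P Q) R) ((K.prod L).prod J) (k + l + j)}
  (H : IsBarProd M' O Z) (H' : IsBarProd M N M')

lemma leftTripleIso_hom {κ : K.Cell} {κ' : L.Cell} {κ'' : J.Cell}
    {ρ : Finset (Fin (n + (m + r) + 1))} {τ : (simplex ρ).Cell} {S₀ : Finset (Fin (n + 1))}
    {τ₀ : (simplex S₀).Cell} {S₁ : Finset (Fin (m + 1))} {τ₁ : (simplex S₁).Cell}
    {S₂ : Finset (Fin (r + 1))} {τ₂ : (simplex S₂).Cell} (h : TripleParts τ τ₀ τ₁ τ₂) :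
    ∃ e : ((Z.relabel (Nat.add_assoc n m r) (Fin.append_assoc P Q R) (Int.add_assoc k l j)).bar ρ
        ((κ, κ'), κ'') τ).as =
      (sgn A (tripleSign P Q k l j S₀ S₁ (L.dim κ') (J.dim κ'') ((simplex _).dim τ₀)
        ((simplex _).dim τ₁) ((simplex _).dim τ₂))).obj
        (((M.bar S₀ κ τ₀).as ⊗ (N.bar S₁ κ' τ₁).as) ⊗ (O.bar S₂ κ'' τ₂).as),
      ((leftTripleIso H H').iso κ κ' κ'' h).hom = can _ e := by
  have e := tripleSign_eq P Q k l j h.parts_assoc_left.left h.parts_assoc_left.right (L.dim κ')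
    (J.dim κ'') ((simplex _).dim τ₀) ((simplex _).dim τ₁) ((simplex _).dim τ₂)
  rw [← h.parts_assoc_left.dim_eq] at e
  have h1 := eq_sgn_one (Z.relabel_bar_eq (Nat.add_assoc n m r) (Fin.append_assoc P Q R)
    (Int.add_assoc k l j) mem_assocPart ((κ, κ'), κ'') (τ := τ) (τ' := assocCell τ h.zero_mem)
    mem_assocPart)
  have h2 := H.bar_eq (κ, κ') κ'' h.parts_assoc
  have h3 := eq_sgn_tensor_right (H'.bar_eq κ κ' h.parts_assoc_left) (O.bar S₂ κ'' τ₂).as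
  have h4 := eq_sgn_trans h1 (eq_sgn_trans h2 h3)
  have e' := (one_mul _).trans e
  refine ⟨h4.trans (congrArg (fun s => (sgn A s).obj _) e'), ?_⟩
  refine (congrArg (fun x => _ ≫ _ ≫ x) (can_whiskerRight _ _)).trans ?_
  refine (congrArg (fun x => _ ≫ x) (can_comp_can h2 h3)).trans ?_
  exact (can_comp_can h1 _).trans (can_congr _ e')

end Left

lemma comp_square_of_comp_eq {C : Type u} [Category.{v} C] {X X' Y Y' V W : C} {f : X ⟶ X'}
    {a : X ⟶ Y} {b : X' ⟶ Y'} {c : Y ≅ V} {c' : Y' ≅ V} {α : V ⟶ W} {d : Y' ⟶ W}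
    (h : f ≫ b = a ≫ c.hom ≫ c'.inv) (h' : c'.hom ≫ α = d) :
    f ≫ b ≫ d = (a ≫ c.hom) ≫ α := by
  rw [← Category.assoc, h, ← h']
  simp

theorem isInducedByAssociators_natIso {N' : AdSing T (Fin.append Q R) (L.prod J) (l + j)}
    {Z' : AdSing T (Fin.append P (Fin.append Q R)) (K.prod (L.prod J)) (k + (l + j))}
    (H : IsBarProd M N' Z') (H' : IsBarProd N O N')
    {M' : AdSing T (Fin.append P Q) (K.prod L) (k + l)}
    {Z : AdSing T (Fin.append (Fin.append P Q) R) ((K.prod L).prod J) (k + l + j)}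
    (G : IsBarProd M' O Z) (G' : IsBarProd M N M') :
    IsInducedByAssociators M N O
      (TripleIso.natIso (leftTripleIso G G') (rightTripleIso H H')) := by
  intro ρ κ κ' κ'' τ h ε ε₁ ε₂ ε₃ δ δ₁ δ₂ δ₃ hs
  have hp := tripleParts_faces τ h
  obtain ⟨e1, h1⟩ := leftTripleIso_hom G G' (κ := κ) (κ' := κ') (κ'' := κ'') hp
  obtain ⟨e2, h2⟩ := rightTripleIso_hom H H' (κ := κ) (κ' := κ') (κ'' := κ'') hp
  have h3 := (TripleIso.barHom (leftTripleIso G G') (rightTripleIso H H')).of_val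
    ((κ, κ'), κ'') ε τ δ h
  have h4 := comp_square_of_comp_eq h3 h2
  have hd : tripleSign P Q k l j (leftPart n (m + r) ρ) (leftPart m r (rightPart n (m + r) ρ))
      (L.dim κ') (J.dim κ'') ((simplex _).dim (leftFace τ h))
      ((simplex _).dim (leftFace (rightFace τ h) (zero_mem_rightPart h)))
      ((simplex _).dim (rightFace (rightFace τ h) (zero_mem_rightPart h))) =
      extSign Q l j (leftPart m r (rightPart n (m + r) ρ)) (J.dim κ'')
        ((simplex _).dim (leftFace (rightFace τ h) (zero_mem_rightPart h)))
        ((simplex _).dim (rightFace (rightFace τ h) (zero_mem_rightPart h))) *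
      extSign P k (l + j) (leftPart n (m + r) ρ) (L.dim κ' + J.dim κ'')
        ((simplex _).dim (leftFace τ h)) ((simplex _).dim (rightFace τ h)) := by
    rw [tripleSign, ← dim_parts (rightFace τ h) (zero_mem_rightPart h)]
  have hs' : ε * δ * tripleSign P Q k l j (leftPart n (m + r) ρ)
      (leftPart m r (rightPart n (m + r) ρ)) (L.dim κ') (J.dim κ'')
      ((simplex _).dim (leftFace τ h))
      ((simplex _).dim (leftFace (rightFace τ h) (zero_mem_rightPart h)))
      ((simplex _).dim (rightFace (rightFace τ h) (zero_mem_rightPart h))) =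
      ε₁ * δ₁ * (ε₂ * δ₂) * (ε₃ * δ₃) := by
    rw [hd, hs, mul_assoc _ (extSign Q _ _ _ _ _ _), mul_assoc, Int.units_mul_self, mul_one]
    simp only [mul_assoc, mul_left_comm]
  refine heq_of_can _ hs' (hs'.trans (mul_assoc _ _ _)) ?_ _ ?_ _ ?_
    (Unor.of_associator_comp_can (M.val_eq κ ε₁ _ (leftFace τ h) δ₁)
      (N.val_eq κ' ε₂ _ (leftFace (rightFace τ h) (zero_mem_rightPart h)) δ₂)
      (O.val_eq κ'' ε₃ _ (rightFace (rightFace τ h) (zero_mem_rightPart h)) δ₃))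
  · exact eq_sgn_trans ((Z.relabel (Nat.add_assoc n m r) (Fin.append_assoc P Q R)
      (Int.add_assoc k l j)).val_eq ((κ, κ'), κ'') ε ρ τ δ) e1
  · exact eq_sgn_trans ((Z'.pull (K.prodAssoc L J)).val_eq ((κ, κ'), κ'') ε ρ τ δ) e2
  · refine (congrArg (_ ≫ ·) (can_comp_can _ e2).symm).trans (h4.trans ?_)
    refine congrArg (· ≫ _) ?_
    exact (congrArg (_ ≫ ·) h1).trans (can_comp_can _ e1)

theorem exists_iso_isInducedByAssociators {T : MultiplicativeAdTheory A}
    {P : Fin n → StarAd T.toAdTheory} {Q : Fin m → StarAd T.toAdTheory}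
    {R : Fin r → StarAd T.toAdTheory} {K L J : OrientedBallComplex} {k l j : ℤ}
    (M : AdSing T.toAdTheory P K k) (N : AdSing T.toAdTheory Q L l)
    (O : AdSing T.toAdTheory R J j) :
    ∃ Φ : ((AdSing.extProd (AdSing.extProd M N) O).relabel
          (Nat.add_assoc n m r) (Fin.append_assoc P Q R) (Int.add_assoc k l j)).1.F ≅
        ((AdSing.extProd M (AdSing.extProd N O)).pull (K.prodAssoc L J)).1.F,
      (∀ x, HEq (Φ.hom.app ((ginv (OrCell ((K.prod L).prod J))).obj x))
        ((ginv (SingObj (Fin.append P (Fin.append Q R)))).map (Φ.hom.app x))) ∧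
      IsInducedByAssociators M N O Φ :=
  ⟨_, fun x => AdSing.BarHom.natTrans_app_neg _ x,
    isInducedByAssociators_natIso (isBarProd_extProd M (AdSing.extProd N O))
      (isBarProd_extProd N O) (isBarProd_extProd (AdSing.extProd M N) O) (isBarProd_extProd M N)⟩

end

end QuinnAd

end

theorem mainTheorem7 {A : Type u} [Category.{v} A] [BalancedCategory A] [EmptyInitial A]
    [MonoidalCategory A] [GradedSymmetricCategory A] (T : MultiplicativeAdTheory A) :
    ∃ ext : ∀ {n m : ℕ} (P : Fin n → StarAd T.toAdTheory) (Q : Fin m → StarAd T.toAdTheory)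
        (K L : OrientedBallComplex) (k l : ℤ),
        AdSing T.toAdTheory P K k → AdSing T.toAdTheory Q L l →
          AdSing T.toAdTheory (Fin.append P Q) (K.prod L) (k + l),
      (∀ {n m : ℕ} (P : Fin n → StarAd T.toAdTheory) (Q : Fin m → StarAd T.toAdTheory)
        (K L : OrientedBallComplex) (k l : ℤ) (M : AdSing T.toAdTheory P K k)
        (N : AdSing T.toAdTheory Q L l), IsExtProd M N (ext P Q K L k l M N)) ∧
      (∀ {n m : ℕ} (P : Fin n → StarAd T.toAdTheory) (Q : Fin m → StarAd T.toAdTheory)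
        {K K' L L' : OrientedBallComplex} (f : K.Hom K') (g : L.Hom L') (k l : ℤ)
        (M : AdSing T.toAdTheory P K' k) (N : AdSing T.toAdTheory Q L' l),
        ext P Q K L k l (M.pull f) (N.pull g) = (ext P Q K' L' k l M N).pull (f.prod g)) ∧
      (∀ {n m r : ℕ} (P : Fin n → StarAd T.toAdTheory) (Q : Fin m → StarAd T.toAdTheory)
        (R : Fin r → StarAd T.toAdTheory) (K L J : OrientedBallComplex) (k l j : ℤ)
        (M : AdSing T.toAdTheory P K k) (N : AdSing T.toAdTheory Q L l)
        (O : AdSing T.toAdTheory R J j),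
        ∃ Φ : ((ext (Fin.append P Q) R (K.prod L) J (k + l) j (ext P Q K L k l M N) O).relabel
              (Nat.add_assoc n m r) (Fin.append_assoc P Q R) (Int.add_assoc k l j)).1.F ≅
            ((ext P (Fin.append Q R) K (L.prod J) k (l + j) M (ext Q R L J l j N O)).pull
              (K.prodAssoc L J)).1.F,
          (∀ x, HEq (Φ.hom.app ((ginv (OrCell ((K.prod L).prod J))).obj x))
            ((ginv (SingObj (Fin.append P (Fin.append Q R)))).map (Φ.hom.app x))) ∧
          IsInducedByAssociators M N O Φ) := by
  exact ⟨fun P Q K L k l M N => AdSing.extProd M N,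
    fun P Q K L k l M N => (isBarProd_extProd M N).isExtProd,
    fun P Q _ _ _ _ f g k l M N => AdSing.extProd_pull M N f g,
    fun P Q R K L J k l j M N O => exists_iso_isInducedByAssociators M N O⟩
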